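/- Let $k$ be a field of characteristic $0$, $\mathcal H$ a Hopf algebra over $k$ with invertible antipode, and $\mathcal L\neq 0$ an $\mathcal H$-base algebra: a left $\mathcal H$-module algebra (action $\rhd$) and left $\mathcal H$-comodule algebra (coaction $\delta(\lambda)=\lambda^{(1)}\otimes\lambda^{[\infty]}\in\mathcal H\otimes\mathcal L$) with $(h^{(1)}\rhd\lambda)^{(1)}h^{(2)}\otimes(h^{(1)}\rhd\lambda)^{[\infty]}=h^{(1)}\lambda^{(1)}\otimes h^{(2)}\rhd\lambda^{[\infty]}$ and $\lambda\mu=(\lambda^{(1)}\rhd\mu)\lambda^{[\infty]}$. Let $\mathcal U\supset\mathcal H$ be a Hopf algebra containing $\mathcal H$, with coproduct $\Delta$, counit $\varepsilon$, antipode $\gamma$, $\bar\gamma=\gamma^{-1}$, and with a universal R-matrix $\mathcal R\in\mathcal U\otimes\mathcal U$ (invertible, $(\Delta\otimes\mathrm{id})\mathcal R=\mathcal R_{13}\mathcal R_{23}$, $(\mathrm{id}\otimes\Delta)\mathcal R=\mathcal R_{13}\mathcal R_{12}$, $\mathcal R\Delta=\Delta^{op}\mathcal R$). Let $\mathcal F\in\mathcal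 U\otimes\mathcal U\otimes\mathcal L$ be a dynamical twist: $\mathcal F$ is invertible with inverse $\bar{\mathcal F}$, $h^{(1)}\mathcal F_1\otimes h^{(2)}\mathcal F_2\otimes h^{(3)}\rhd\mathcal F_{\mathcal L}=\mathcal F(\Delta(h)\otimes1)$ for $h\in\mathcal H$, $\mathcal F_{(12)3}\mathcal F_{12|3}=\mathcal F_{1(23)}\mathcal F_{23}$ (brackets denote application of $\Delta$ and $\mathcal F_{12|3}=\mathcal F_1\otimes\mathcal F_2\otimes\delta(\mathcal F_{\mathcal L})$), and $\varepsilon$ applied to the first or to the second leg of $\mathcal F$ gives $1$. Let $\rho$ be a representation of $\mathcal U$ on $k^n$, and $P$ the flip of $k^n\otimes k^n$. **The algebras.** The RE algebra $\mathcal K$ is generated by the entries of an $n\times n$ matrix $K$ with relations $SK_2SK_2=K_2SK_2S$, $S=P(\rho\otimes\rho)(\mathcal R)$. The twisted tensor square $B$ is the algebra $\mathcal U\otimes\mathcal U$ with coproduct $\mathcal R_{23}^{-1}\Delta_{\mathcal U\otimes\mathcal U}(\cdot)\mathcal R_{23}$; $\mathcal K$ is a $B$-module algebra via $(x\otimes y)\blacktriangleright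 K=\rho(\gamma(x))K\rho(y)$. Put $y\rightharpoonup a=(1\otimes y)\blacktriangleright a$, and let $\mathcal K^{\mathcal U}=\{a\in\mathcal K:\ \Delta(x)\blacktriangleright a=\varepsilon(x)a\ \ \forall x\in\mathcal U\}$. The dynamical RE algebra $\tilde{\mathcal K}$ is generated by $\mathcal L$ (as a subalgebra) and the entries of a matrix $K$ with relations $\lambda K=\rho(\gamma(\lambda^{(1)}))K\rho(\lambda^{(2)})\lambda^{[\infty]}$ (with $\lambda^{(1)}\otimes\lambda^{(2)}\otimes\lambda^{[\infty]}=(\Delta\otimes\mathrm{id})\delta(\lambda)$) and $\tilde SK_2\tilde SK_2=K_2\tilde SK_2\tilde S$, $\tilde S=P(\rho\otimes\rho\otimes\mathrm{id})(\bar{\mathcal F}_{21}\mathcal R\mathcal F)$. **The elements.** Put $\zeta=\bar{\mathcal F}_2\bar\gamma(\bar{\mathcal F}_1)\otimes\bar{\mathcal F}_{\mathcal L}\in\mathcal U\otimes\mathcal L$, $\bar\zeta=\zeta^{-1}$, $\zeta_{1|2}=\zeta_1\otimes\delta(\zeta_{\mathcal L})$, $\bar\Gamma(x\otimes\lambda)=\lambda^{(1)}\bar\gamma(x)\otimes\lambda^{[\infty]}$.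 Put $\xi=\mathcal F\zeta_{1|2}\in B\otimes\mathcal L$, let $\Psi=\mathcal F_{(12)(34)}\in B\otimes B\otimes\mathcal L$ be obtained from $\mathcal F$ by applying $\Delta$ to both legs in $\mathcal U$, and let $\Upsilon=(\Delta_B\otimes\mathrm{id})(\xi^{-1})\,\Psi\,\xi_{1|2}\,\xi_2$, where $\xi_2=1\otimes\xi$ and $\xi_{1|2}$ is formed with $\delta$ and $\Delta:\mathcal H\to B$. **Claim.** (i) $\mathcal K^{\mathcal U}$ lies in the center of $\mathcal K$. (ii) There is a linear isomorphism $\tilde{\mathcal K}\simeq\mathcal K\otimes\mathcal L$ which sends $K_{ij}$ to $K_{ij}\otimes1$ and $\lambda\in\mathcal L$ to $1\otimes\lambda$, and under which the multiplication of $\tilde{\mathcal K}$ becomes $$(a\otimes\lambda)*(b\otimes\mu)=(\Upsilon_1\blacktriangleright a)\bigl(\Upsilon_2\Delta(\lambda^{(1)})\blacktriangleright b\bigr)\otimes\Upsilon_{\mathcal L}\lambda^{[\infty]}\mu .$$ (iii) With this identification, for every $a\in\mathcal K^{\mathcal U}$ the element $$z(a)=\Bigl(\bigl(\zeta\bar\Gamma(\bar\zeta)\bigr)_1\rightharpoonup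 a\Bigr)\otimes\bigl(\zeta\bar\Gamma(\bar\zeta)\bigr)_{\mathcal L}$$ is central in $\tilde{\mathcal K}$. (iv) The map $z$ is injective on $\mathcal K^{\mathcal U}$, with $z(1)=1$ and $z(ab)=z(a)z(b)$ for $a,b\in\mathcal K^{\mathcal U}$. Thus the center of $\tilde{\mathcal K}$ contains a copy of the algebra $\mathcal K^{\mathcal U}$ of $\mathcal U$-invariant central elements of $\mathcal K$. -/

import Mathlib

open TensorProduct
open scoped Kronecker

noncomputable section
namespace DynRE

section Conj
variable {k C : Type*} [Field k] [Ring C] [Bialgebra k C]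

/-- The conjugation `c ↦ J⁻¹ c J` by a unit `J`. -/
def conjHom {A : Type*} [Ring A] [Algebra k A] (J : Aˣ) : A →ₐ[k] A where
  toFun c := ↑J⁻¹ * c * ↑J
  map_one' := by simp
  map_mul' x y := by simp [mul_assoc]
  map_zero' := by simp
  map_add' x y := by simp [mul_add, add_mul]
  commutes' r := by
    rw [← Algebra.commutes, mul_assoc]; simp

theorem conjHom_apply {A : Type*} [Ring A] [Algebra k A] (J : Aˣ) (c : A) :
    conjHom (k := k) J c = ↑J⁻¹ * c * ↑J := rfl

variable (k C) in
/-- `Δ ⊗ id` with values in `C ⊗ (C ⊗ C)`. -/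
def cL : C ⊗[k] C →ₐ[k] C ⊗[k] (C ⊗[k] C) :=
  (Algebra.TensorProduct.assoc k k k C C C).toAlgHom.comp
    (Algebra.TensorProduct.map (Bialgebra.comulAlgHom k C) (.id k C))

variable (k C) in
/-- `id ⊗ Δ` -/
def cR : C ⊗[k] C →ₐ[k] C ⊗[k] (C ⊗[k] C) :=
  Algebra.TensorProduct.map (.id k C) (Bialgebra.comulAlgHom k C)

variable (k C) in
/-- `z ↦ z ⊗ 1` -/
def jL : C ⊗[k] C →ₐ[k] C ⊗[k] (C ⊗[k] C) :=
  (Algebra.TensorProduct.assoc k k k C C C).toAlgHom.comp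
    (Algebra.TensorProduct.includeLeft)

variable (k C) in
/-- `z ↦ 1 ⊗ z` -/
def jR : C ⊗[k] C →ₐ[k] C ⊗[k] (C ⊗[k] C) :=
  Algebra.TensorProduct.includeRight

/-- `J⁻¹ Δ(c) J` -/
def conjComul (J : (C ⊗[k] C)ˣ) : C →ₐ[k] C ⊗[k] C :=
  (conjHom J).comp (Bialgebra.comulAlgHom k C)

theorem conjComul_assocL (J : (C ⊗[k] C)ˣ) (z : C ⊗[k] C) :
    Algebra.TensorProduct.assoc k k k C C C
      (Algebra.TensorProduct.map (conjComul J) (.id k C) z) =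
    jL k C (↑J⁻¹ : C ⊗[k] C) * cL k C z * jL k C (J : C ⊗[k] C) := by
  induction z with
  | zero => simp
  | add x y hx hy => simp only [map_add, mul_add, add_mul, hx, hy]
  | tmul x y =>
    simp only [jL, cL, AlgHom.comp_apply, ← map_mul]
    simp [conjComul, conjHom_apply]

theorem conjComul_assocR (J : (C ⊗[k] C)ˣ) (z : C ⊗[k] C) :
    Algebra.TensorProduct.map (.id k C) (conjComul J) z =
    jR k C (↑J⁻¹ : C ⊗[k] C) * cR k C z * jR k C (J : C ⊗[k] C) := by
  induction z with
  | zero => simp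
  | add x y hx hy => simp only [map_add, mul_add, add_mul, hx, hy]
  | tmul x y => simp [jR, cR, conjComul, conjHom_apply]

theorem conjComul_coassoc (J : (C ⊗[k] C)ˣ)
    (hJ : cL k C J * jL k C J = cR k C J * jR k C J) :
    (Algebra.TensorProduct.assoc k k k C C C).toAlgHom.comp
      ((Algebra.TensorProduct.map (conjComul J) (.id k C)).comp (conjComul J))
      = (Algebra.TensorProduct.map (.id k C) (conjComul J)).comp (conjComul J) := by
  have hu : Units.map (cL k C : C ⊗[k] C →* C ⊗[k] (C ⊗[k] C)) J * Units.map (jL k C : C ⊗[k] C →* C ⊗[k] (C ⊗[k] C)) J =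
      Units.map (cR k C : C ⊗[k] C →* C ⊗[k] (C ⊗[k] C)) J * Units.map (jR k C : C ⊗[k] C →* C ⊗[k] (C ⊗[k] C)) J := by
    ext
    exact hJ
  have hu' := congrArg Units.val (congrArg (fun u => u⁻¹) hu)
  simp only [mul_inv_rev, Units.val_mul, ← map_inv] at hu'
  have hu'' : jL k C (↑J⁻¹ : C ⊗[k] C) * cL k C (↑J⁻¹ : C ⊗[k] C) =
    jR k C (↑J⁻¹ : C ⊗[k] C) * cR k C (↑J⁻¹ : C ⊗[k] C) := hu'
  apply AlgHom.ext
  intro z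
  have hc : cL k C (Bialgebra.comulAlgHom k C z) = cR k C (Bialgebra.comulAlgHom k C z) :=
    Coalgebra.coassoc_apply z
  have hz : conjComul J z = (↑J⁻¹ : C ⊗[k] C) * Bialgebra.comulAlgHom k C z * J.val := rfl
  refine (conjComul_assocL J (conjComul J z)).trans
    (Eq.trans ?_ (conjComul_assocR J (conjComul J z)).symm)
  rw [hz, map_mul, map_mul, map_mul, map_mul, hc]
  calc _ = (jL k C (↑J⁻¹ : C ⊗[k] C) * cL k C (↑J⁻¹ : C ⊗[k] C)) *
        cR k C (Bialgebra.comulAlgHom k C z) * (cL k C J * jL k C J) := by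
        simp only [mul_assoc]
    _ = _ := by rw [hu'', hJ]; simp only [mul_assoc]

theorem map_units_inv_eq_one {A B : Type*} [Ring A] [Ring B] [Algebra k A] [Algebra k B]
    (f : A →ₐ[k] B) (u : Aˣ) (h : f u = 1) : f (↑u⁻¹ : A) = 1 := by
  have : f (u : A) * f (↑u⁻¹ : A) = 1 := by rw [← map_mul, Units.mul_inv, map_one]
  rwa [h, one_mul] at this

theorem conjComul_rTensor (J : (C ⊗[k] C)ˣ)
    (hJ : Algebra.TensorProduct.map (Bialgebra.counitAlgHom k C) (.id k C) (J : C ⊗[k] C) = 1) :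
    (Algebra.TensorProduct.map (Bialgebra.counitAlgHom k C) (.id k C)).comp (conjComul J) =
      (Algebra.TensorProduct.lid k C).symm := by
  have h2 := map_units_inv_eq_one _ J hJ
  apply AlgHom.ext
  intro z
  have hz : conjComul J z = (↑J⁻¹ : C ⊗[k] C) * Bialgebra.comulAlgHom k C z * J.val := rfl
  rw [AlgHom.comp_apply, hz, map_mul, map_mul, hJ, h2, one_mul, mul_one]
  exact Coalgebra.rTensor_counit_comul z

theorem conjComul_lTensor (J : (C ⊗[k] C)ˣ)
    (hJ : Algebra.TensorProduct.map (.id k C) (Bialgebra.counitAlgHom k C) (J : C ⊗[k] C) = 1) :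
    (Algebra.TensorProduct.map (.id k C) (Bialgebra.counitAlgHom k C)).comp (conjComul J) =
      (Algebra.TensorProduct.rid k k C).symm := by
  have h2 := map_units_inv_eq_one _ J hJ
  apply AlgHom.ext
  intro z
  have hz : conjComul J z = (↑J⁻¹ : C ⊗[k] C) * Bialgebra.comulAlgHom k C z * J.val := rfl
  rw [AlgHom.comp_apply, hz, map_mul, map_mul, hJ, h2, one_mul, mul_one]
  exact Coalgebra.lTensor_counit_comul z

end Conj

/-- A universal R-matrix of a Hopf algebra: an invertible `R ∈ U ⊗ U` with
`(Δ ⊗ id)(R) = R₁₃ R₂₃`, `(id ⊗ Δ)(R) = R₁₃ R₁₂` and `R Δ(x) = Δᵒᵖ(x) R`. -/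
structure UniversalRMatrix (k U : Type*) [Field k] [Ring U] [HopfAlgebra k U] where
  val : (U ⊗[k] U)ˣ
  comul_left : Algebra.TensorProduct.assoc k k k U U U
      (Algebra.TensorProduct.map (Bialgebra.comulAlgHom k U) (AlgHom.id k U) (val : U ⊗[k] U)) =
    Algebra.TensorProduct.map (AlgHom.id k U) Algebra.TensorProduct.includeRight (val : U ⊗[k] U) *
      Algebra.TensorProduct.includeRight (val : U ⊗[k] U)
  comul_right : Algebra.TensorProduct.map (AlgHom.id k U) (Bialgebra.comulAlgHom k U)
      (val : U ⊗[k] U) =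
    Algebra.TensorProduct.map (AlgHom.id k U) Algebra.TensorProduct.includeRight (val : U ⊗[k] U) *
      Algebra.TensorProduct.map (AlgHom.id k U) Algebra.TensorProduct.includeLeft (val : U ⊗[k] U)
  comm : ∀ x : U, (val : U ⊗[k] U) * Coalgebra.comul (R := k) x =
    TensorProduct.comm k U U (Coalgebra.comul (R := k) x) * (val : U ⊗[k] U)

section RMatrix
variable {k U : Type*} [Field k] [Ring U] [HopfAlgebra k U]

theorem UniversalRMatrix.counit_left (R : UniversalRMatrix k U) :
    Algebra.TensorProduct.map (Bialgebra.counitAlgHom k U) (AlgHom.id k U) (R.val : U ⊗[k] U) = 1 := by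
  have h := congrArg (Algebra.TensorProduct.lid k (U ⊗[k] U) ∘
    Algebra.TensorProduct.map (Bialgebra.counitAlgHom k U) (AlgHom.id k (U ⊗[k] U))) R.comul_left
  have e1 : ∀ z : U ⊗[k] U, (Algebra.TensorProduct.lid k (U ⊗[k] U))
      (Algebra.TensorProduct.map (Bialgebra.counitAlgHom k U) (AlgHom.id k (U ⊗[k] U))
      (Algebra.TensorProduct.assoc k k k U U U
      (Algebra.TensorProduct.map (Bialgebra.comulAlgHom k U) (AlgHom.id k U) z))) = z := by
    intro z
    induction z with
    | zero => simp
    | add x y hx hy => simp only [map_add, hx, hy]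
    | tmul x y =>
      have : ∀ w : U ⊗[k] U, (Algebra.TensorProduct.lid k (U ⊗[k] U))
        (Algebra.TensorProduct.map (Bialgebra.counitAlgHom k U) (AlgHom.id k (U ⊗[k] U))
        (Algebra.TensorProduct.assoc k k k U U U (w ⊗ₜ y))) =
        (TensorProduct.lid k U ((Coalgebra.counit (R := k)).rTensor U w)) ⊗ₜ y := by
        intro w
        induction w with
        | zero => simp
        | add a b ha hb => simp only [map_add, TensorProduct.add_tmul, ha, hb]
        | tmul a b => simp [TensorProduct.smul_tmul']
      simp only [Algebra.TensorProduct.map_tmul, Bialgebra.comulAlgHom_apply, AlgHom.id_apply, this]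
      simp
  have e2 : ∀ z : U ⊗[k] U, (Algebra.TensorProduct.lid k (U ⊗[k] U))
      (Algebra.TensorProduct.map (Bialgebra.counitAlgHom k U) (AlgHom.id k (U ⊗[k] U))
      (Algebra.TensorProduct.includeRight z)) = z := by
    intro z; simp
  simp only [Function.comp, e1, map_mul, e2] at h
  have h2 := (Units.mul_left_inj R.val).1 ((one_mul _).trans h)
  have e3 : ∀ z : U ⊗[k] U, (Algebra.TensorProduct.lid k (U ⊗[k] U))
      (Algebra.TensorProduct.map (Bialgebra.counitAlgHom k U) (AlgHom.id k (U ⊗[k] U))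
      (Algebra.TensorProduct.map (AlgHom.id k U) Algebra.TensorProduct.includeRight z)) =
      Algebra.TensorProduct.includeRight (TensorProduct.lid k U
      (Algebra.TensorProduct.map (Bialgebra.counitAlgHom k U) (AlgHom.id k U) z)) := by
    intro z
    induction z with
    | zero => simp
    | add x y hx hy => simp only [map_add, hx, hy]
    | tmul x y => simp
  rw [e3] at h2
  have h3 := congrArg (TensorProduct.lid k U ∘
    Algebra.TensorProduct.map (Bialgebra.counitAlgHom k U) (AlgHom.id k U)) h2
  simp at h3
  apply (TensorProduct.lid k U).injective
  rw [← h3]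

theorem UniversalRMatrix.counit_right (R : UniversalRMatrix k U) :
    Algebra.TensorProduct.map (AlgHom.id k U) (Bialgebra.counitAlgHom k U) (R.val : U ⊗[k] U) = 1 := by
  let g : U ⊗[k] (U ⊗[k] U) →ₐ[k] U ⊗[k] U := Algebra.TensorProduct.map (AlgHom.id k U)
    ((Algebra.TensorProduct.rid k k U).toAlgHom.comp
      (Algebra.TensorProduct.map (AlgHom.id k U) (Bialgebra.counitAlgHom k U)))
  have h := congrArg g R.comul_right
  have e1 : ∀ z : U ⊗[k] U, g (Algebra.TensorProduct.map (AlgHom.id k U)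
      (Bialgebra.comulAlgHom k U) z) = z := by
    intro z
    induction z with
    | zero => simp
    | add x y hx hy => simp only [map_add, hx, hy]
    | tmul x y =>
      have : ∀ w : U ⊗[k] U, g (x ⊗ₜ w) =
        x ⊗ₜ (TensorProduct.rid k U ((Coalgebra.counit (R := k)).lTensor U w)) := by
        intro w
        induction w with
        | zero => simp
        | add a b ha hb => simp only [map_add, TensorProduct.tmul_add, ha, hb]
        | tmul a b => simp [g]
      simp only [Algebra.TensorProduct.map_tmul, Bialgebra.comulAlgHom_apply, AlgHom.id_apply, this]
      simp
  have e2 : ∀ z : U ⊗[k] U, g (Algebra.TensorProduct.map (AlgHom.id k U)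
      Algebra.TensorProduct.includeLeft z) = z := by
    intro z
    induction z with
    | zero => simp
    | add x y hx hy => simp only [map_add, hx, hy]
    | tmul x y => simp [g]
  have e3 : ∀ z : U ⊗[k] U, g (Algebra.TensorProduct.map (AlgHom.id k U)
      Algebra.TensorProduct.includeRight z) =
      (TensorProduct.rid k U
      (Algebra.TensorProduct.map (AlgHom.id k U) (Bialgebra.counitAlgHom k U) z)) ⊗ₜ[k] (1 : U) := by
    intro z
    induction z with
    | zero => simp
    | add x y hx hy => simp only [map_add, TensorProduct.add_tmul, hx, hy]
    | tmul x y => simp [g, TensorProduct.smul_tmul']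
  simp only [map_mul, e1, e2, e3] at h
  have h2 := (Units.mul_left_inj R.val).1 ((one_mul _).trans h)
  have h3 := congrArg (TensorProduct.rid k U ∘
    Algebra.TensorProduct.map (AlgHom.id k U) (Bialgebra.counitAlgHom k U)) h2
  simp at h3
  apply (TensorProduct.rid k U).injective
  rw [← h3]

theorem UniversalRMatrix.comul_right_inv (R : UniversalRMatrix k U) :
    Algebra.TensorProduct.map (AlgHom.id k U) (Bialgebra.comulAlgHom k U)
      (↑R.val⁻¹ : U ⊗[k] U) =
    Algebra.TensorProduct.map (AlgHom.id k U) Algebra.TensorProduct.includeLeft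
      (↑R.val⁻¹ : U ⊗[k] U) *
    Algebra.TensorProduct.map (AlgHom.id k U) Algebra.TensorProduct.includeRight
      (↑R.val⁻¹ : U ⊗[k] U) := by
  have h := R.comul_right
  have h1 := Units.coe_map_inv (Algebra.TensorProduct.map (AlgHom.id k U)
    (Bialgebra.comulAlgHom k U) : U ⊗[k] U →* U ⊗[k] (U ⊗[k] U)) R.val
  have h2 := Units.coe_map_inv (Algebra.TensorProduct.map (AlgHom.id k U)
    (Algebra.TensorProduct.includeLeft (S := k) (R := k) (A := U) (B := U)) :
      U ⊗[k] U →* U ⊗[k] (U ⊗[k] U)) R.val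
  have h3 := Units.coe_map_inv (Algebra.TensorProduct.map (AlgHom.id k U)
    (Algebra.TensorProduct.includeRight (R := k) (A := U) (B := U)) :
      U ⊗[k] U →* U ⊗[k] (U ⊗[k] U)) R.val
  simp only [MonoidHom.coe_coe] at h1 h2 h3
  rw [← h1, ← h2, ← h3, ← Units.val_mul, ← mul_inv_rev]
  congr 2
  ext
  simpa using h

theorem UniversalRMatrix.lTensor_antipode_inv (R : UniversalRMatrix k U) :
    (HopfAlgebra.antipode k (A := U)).lTensor U (↑R.val⁻¹ : U ⊗[k] U) = R.val := by
  let g : U ⊗[k] (U ⊗[k] U) →ₗ[k] U ⊗[k] U :=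
    (LinearMap.mul' k U ∘ₗ (HopfAlgebra.antipode k (A := U)).rTensor U).lTensor U
  have h := congrArg g R.comul_right_inv
  have e1 : ∀ z : U ⊗[k] U, g (Algebra.TensorProduct.map (AlgHom.id k U)
      (Bialgebra.comulAlgHom k U) z) = (Algebra.TensorProduct.map (AlgHom.id k U)
      ((Algebra.ofId k U).comp (Bialgebra.counitAlgHom k U)) z) := by
    intro z
    induction z with
    | zero => simp
    | add x y hx hy => simp only [map_add, hx, hy]
    | tmul x y => simp [g, Algebra.ofId_apply]
  have e2 : ∀ a b : U ⊗[k] U, g (Algebra.TensorProduct.map (AlgHom.id k U)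
      Algebra.TensorProduct.includeLeft a * Algebra.TensorProduct.map (AlgHom.id k U)
      Algebra.TensorProduct.includeRight b) =
      (HopfAlgebra.antipode k (A := U)).lTensor U a * b := by
    intro a b
    induction a with
    | zero => simp
    | add x y hx hy => simp only [map_add, add_mul, hx, hy]
    | tmul x y =>
      induction b with
      | zero => simp
      | add x y hx hy => simp only [map_add, mul_add, hx, hy]
      | tmul z w => simp [g]
  have e3 : (Algebra.TensorProduct.map (AlgHom.id k U)
      ((Algebra.ofId k U).comp (Bialgebra.counitAlgHom k U)) (↑R.val⁻¹ : U ⊗[k] U)) = 1 := by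
    apply map_units_inv_eq_one
    have := congrArg (Algebra.TensorProduct.map (AlgHom.id k U) (Algebra.ofId k U)) R.counit_right
    rw [← AlgHom.comp_apply, ← Algebra.TensorProduct.map_comp] at this
    simpa using this
  rw [e1, e2, e3] at h
  rw [eq_comm, Units.mul_inv_eq_one] at h
  exact h

theorem UniversalRMatrix.rTensor_antipode (R : UniversalRMatrix k U) :
    (HopfAlgebra.antipode k (A := U)).rTensor U (R.val : U ⊗[k] U) = (↑R.val⁻¹ : U ⊗[k] U) := by
  let g : U ⊗[k] (U ⊗[k] U) →ₗ[k] U ⊗[k] U :=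
    (LinearMap.mul' k U ∘ₗ (HopfAlgebra.antipode k (A := U)).rTensor U).rTensor U ∘ₗ
      (TensorProduct.assoc k U U U).symm.toLinearMap
  have h := congrArg g R.comul_left
  have e1 : ∀ z : U ⊗[k] U, g (Algebra.TensorProduct.assoc k k k U U U
      (Algebra.TensorProduct.map (Bialgebra.comulAlgHom k U) (AlgHom.id k U) z)) =
      (Algebra.TensorProduct.map ((Algebra.ofId k U).comp (Bialgebra.counitAlgHom k U))
        (AlgHom.id k U) z) := by
    intro z
    induction z with
    | zero => simp
    | add x y hx hy => simp only [map_add, hx, hy]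
    | tmul x y =>
      have : ∀ w : U ⊗[k] U, g (Algebra.TensorProduct.assoc k k k U U U (w ⊗ₜ y)) =
        (LinearMap.mul' k U ((HopfAlgebra.antipode k (A := U)).rTensor U w)) ⊗ₜ y := by
        intro w
        induction w with
        | zero => simp
        | add a b ha hb => simp only [map_add, TensorProduct.add_tmul, ha, hb]
        | tmul a b => simp [g]
      simp only [Algebra.TensorProduct.map_tmul, Bialgebra.comulAlgHom_apply, AlgHom.id_apply, this]
      simp [Algebra.ofId_apply]
  have e2 : ∀ a b : U ⊗[k] U, g (Algebra.TensorProduct.map (AlgHom.id k U)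
      Algebra.TensorProduct.includeRight a * Algebra.TensorProduct.includeRight b) =
      (HopfAlgebra.antipode k (A := U)).rTensor U a * b := by
    intro a b
    induction a with
    | zero => simp
    | add x y hx hy => simp only [map_add, add_mul, hx, hy]
    | tmul x y =>
      induction b with
      | zero => simp
      | add x y hx hy => simp only [map_add, mul_add, hx, hy]
      | tmul z w => simp [g]
  have e3 : (Algebra.TensorProduct.map ((Algebra.ofId k U).comp (Bialgebra.counitAlgHom k U))
      (AlgHom.id k U) (R.val : U ⊗[k] U)) = 1 := by
    have := congrArg (Algebra.TensorProduct.map (Algebra.ofId k U) (AlgHom.id k U)) R.counit_left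
    rw [← AlgHom.comp_apply, ← Algebra.TensorProduct.map_comp] at this
    simpa using this
  rw [e1, e2, e3] at h
  exact (Units.eq_inv_of_mul_eq_one_right h.symm)

theorem UniversalRMatrix.map_antipode (R : UniversalRMatrix k U) :
    TensorProduct.map (HopfAlgebra.antipode k (A := U)) (HopfAlgebra.antipode k (A := U))
      (R.val : U ⊗[k] U) = R.val := by
  rw [← LinearMap.lTensor_comp_rTensor, LinearMap.comp_apply, R.rTensor_antipode,
    R.lTensor_antipode_inv]

/-- `w ⊗ w' ↦ (w ⊗ 1) R (1 ⊗ γ(w'))` -/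
def UniversalRMatrix.sandwich (R : UniversalRMatrix k U) : U ⊗[k] U →ₗ[k] U ⊗[k] U :=
  TensorProduct.lift (((LinearMap.mul k (U ⊗[k] U)).compl₁₂
    (LinearMap.mulRight k (R.val : U ⊗[k] U) ∘ₗ
      (Algebra.TensorProduct.includeLeft (R := k) (S := k) (A := U) (B := U)).toLinearMap)
    ((Algebra.TensorProduct.includeRight (R := k) (A := U) (B := U)).toLinearMap ∘ₗ
      HopfAlgebra.antipode k (A := U))))

theorem UniversalRMatrix.sandwich_tmul (R : UniversalRMatrix k U) (a b : U) :
    R.sandwich (a ⊗ₜ b) =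
      (a ⊗ₜ 1) * (R.val : U ⊗[k] U) * (1 ⊗ₜ HopfAlgebra.antipode k b) := by
  simp [sandwich]

theorem UniversalRMatrix.sandwich_self (R : UniversalRMatrix k U) :
    R.sandwich (R.val : U ⊗[k] U) = 1 := by
  let g : U ⊗[k] (U ⊗[k] U) →ₗ[k] U ⊗[k] U :=
    (LinearMap.mul' k U ∘ₗ (HopfAlgebra.antipode k (A := U)).lTensor U).lTensor U
  have h := congrArg g R.comul_right
  have e1 : ∀ z : U ⊗[k] U, g (Algebra.TensorProduct.map (AlgHom.id k U)
      (Bialgebra.comulAlgHom k U) z) = (Algebra.TensorProduct.map (AlgHom.id k U)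
      ((Algebra.ofId k U).comp (Bialgebra.counitAlgHom k U)) z) := by
    intro z
    induction z with
    | zero => simp
    | add x y hx hy => simp only [map_add, hx, hy]
    | tmul x y => simp [g, Algebra.ofId_apply]
  have e2 : ∀ a b : U ⊗[k] U, g (Algebra.TensorProduct.map (AlgHom.id k U)
      Algebra.TensorProduct.includeRight a * Algebra.TensorProduct.map (AlgHom.id k U)
      Algebra.TensorProduct.includeLeft b) =
      TensorProduct.lift (((LinearMap.mul k (U ⊗[k] U)).compl₁₂
        (LinearMap.mulRight k b ∘ₗ
        (Algebra.TensorProduct.includeLeft (R := k) (S := k) (A := U) (B := U)).toLinearMap)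
        ((Algebra.TensorProduct.includeRight (R := k) (A := U) (B := U)).toLinearMap ∘ₗ
        HopfAlgebra.antipode k (A := U)))) a := by
    intro a b
    induction a with
    | zero => simp
    | add x y hx hy => simp only [map_add, add_mul, hx, hy]
    | tmul x y =>
      induction b with
      | zero => simp
      | add z w hx hy =>
        simp only [map_add, mul_add, hx, hy]
        simp [mul_add]
      | tmul z w => simp [g]
  have e3 : (Algebra.TensorProduct.map (AlgHom.id k U)
      ((Algebra.ofId k U).comp (Bialgebra.counitAlgHom k U)) (R.val : U ⊗[k] U)) = 1 := by
    have := congrArg (Algebra.TensorProduct.map (AlgHom.id k U) (Algebra.ofId k U)) R.counit_right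
    rw [← AlgHom.comp_apply, ← Algebra.TensorProduct.map_comp] at this
    simpa using this
  rw [e1, e2, e3] at h
  exact h.symm

/-- The antipode image of the intertwining property of `R`. -/
theorem UniversalRMatrix.antipode_comm (R : UniversalRMatrix k U) (x : U) :
    TensorProduct.map (HopfAlgebra.antipode k (A := U)) (HopfAlgebra.antipode k (A := U))
      (Coalgebra.comul (R := k) x) * (R.val : U ⊗[k] U) =
    (R.val : U ⊗[k] U) * TensorProduct.comm k U U
      (TensorProduct.map (HopfAlgebra.antipode k (A := U)) (HopfAlgebra.antipode k (A := U))
      (Coalgebra.comul (R := k) x)) := by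
  have e : ∀ a b : U ⊗[k] U,
      TensorProduct.map (HopfAlgebra.antipode k (A := U)) (HopfAlgebra.antipode k (A := U)) (a * b)
      = TensorProduct.map (HopfAlgebra.antipode k (A := U)) (HopfAlgebra.antipode k (A := U)) b *
        TensorProduct.map (HopfAlgebra.antipode k (A := U)) (HopfAlgebra.antipode k (A := U)) a := by
    intro a b
    induction a with
    | zero => simp
    | add x y hx hy => simp only [map_add, add_mul, mul_add, hx, hy]
    | tmul x y =>
      induction b with
      | zero => simp
      | add x y hx hy => simp only [map_add, mul_add, add_mul, hx, hy]
      | tmul z w => simp [HopfAlgebra.antipode_mul_antidistrib]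
  have h := congrArg (TensorProduct.map (HopfAlgebra.antipode k (A := U))
    (HopfAlgebra.antipode k (A := U))) (R.comm x)
  rw [e, e, R.map_antipode] at h
  rw [h]
  congr 1
  induction Coalgebra.comul (R := k) x with
  | zero => simp
  | add x y hx hy => simp only [map_add, hx, hy]
  | tmul z w => simp

end RMatrix

section TwistedSquare
variable {k U : Type*} [Field k] [Ring U] [HopfAlgebra k U]

/-- The underlying algebra `U ⊗ U` of the twisted tensor square `U ⊗_R U`. -/
def TwistedSquare (_R : UniversalRMatrix k U) : Type _ := U ⊗[k] U

variable (R : UniversalRMatrix k U)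

instance : Ring (TwistedSquare R) := inferInstanceAs (Ring (U ⊗[k] U))

variable (k U) in
/-- `x ⊗ y ↦ (1 ⊗ x) ⊗ (y ⊗ 1)` -/
abbrev embed23 : U ⊗[k] U →ₐ[k] (U ⊗[k] U) ⊗[k] (U ⊗[k] U) :=
  Algebra.TensorProduct.map Algebra.TensorProduct.includeRight Algebra.TensorProduct.includeLeft

/-- `R₂₃` as a unit of `(U ⊗ U) ⊗ (U ⊗ U)`. -/
def UniversalRMatrix.unit23 : ((U ⊗[k] U) ⊗[k] (U ⊗[k] U))ˣ :=
  Units.map (embed23 k U : U ⊗[k] U →* (U ⊗[k] U) ⊗[k] (U ⊗[k] U)) R.val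

theorem comul_one_tmul (x : U) : Coalgebra.comul (R := k) ((1 : U) ⊗ₜ[k] x) =
    Algebra.TensorProduct.map (Algebra.TensorProduct.includeRight)
      (Algebra.TensorProduct.includeRight) (Coalgebra.comul (R := k) x) := by
  rw [TensorProduct.comul_tmul]
  induction Coalgebra.comul (R := k) x with
  | zero => simp
  | add x y hx hy => simp only [map_add, TensorProduct.tmul_add, hx, hy]
  | tmul z w => simp [Algebra.TensorProduct.one_def]

theorem comul_tmul_left (x : U) : Coalgebra.comul (R := k) (x ⊗ₜ[k] (1 : U)) =
    Algebra.TensorProduct.map (Algebra.TensorProduct.includeLeft (R := k) (S := k) (A := U) (B := U))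
      (Algebra.TensorProduct.includeLeft (R := k) (S := k) (A := U) (B := U))
      (Coalgebra.comul (R := k) x) := by
  rw [TensorProduct.comul_tmul]
  induction Coalgebra.comul (R := k) x with
  | zero => simp
  | add x y hx hy => simp only [map_add, TensorProduct.add_tmul, hx, hy]
  | tmul z w => simp [Algebra.TensorProduct.one_def]

theorem commute_of_tmul {A B C D E : Type*} [Ring A] [Ring B] [Ring C] [Ring D] [Ring E]
    [Algebra k A] [Algebra k B] [Algebra k C] [Algebra k D] [Algebra k E]
    (f : A ⊗[k] B →ₐ[k] E) (g : C ⊗[k] D →ₐ[k] E)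
    (h : ∀ a b c d, f (a ⊗ₜ b) * g (c ⊗ₜ d) = g (c ⊗ₜ d) * f (a ⊗ₜ b)) (z : A ⊗[k] B)
    (w : C ⊗[k] D) : f z * g w = g w * f z := by
  induction z with
  | zero => simp
  | add x y hx hy => simp only [map_add, add_mul, mul_add, hx, hy]
  | tmul x y =>
    induction w with
    | zero => simp
    | add x y hx hy => simp only [map_add, mul_add, add_mul, hx, hy]
    | tmul z w => exact h _ _ _ _

theorem unit23_cocycle :
    cL k (U ⊗[k] U) R.unit23 * jL k (U ⊗[k] U) R.unit23 =
    cR k (U ⊗[k] U) R.unit23 * jR k (U ⊗[k] U) R.unit23 := by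
  let α : U ⊗[k] (U ⊗[k] U) →ₐ[k] (U ⊗[k] U) ⊗[k] ((U ⊗[k] U) ⊗[k] (U ⊗[k] U)) :=
    Algebra.TensorProduct.map Algebra.TensorProduct.includeRight (embed23 k U)
  let β : U ⊗[k] (U ⊗[k] U) →ₐ[k] (U ⊗[k] U) ⊗[k] ((U ⊗[k] U) ⊗[k] (U ⊗[k] U)) :=
    Algebra.TensorProduct.map Algebra.TensorProduct.includeRight
      (Algebra.TensorProduct.map Algebra.TensorProduct.includeLeft
        Algebra.TensorProduct.includeLeft)
  have e1 : ∀ z : U ⊗[k] U, Algebra.TensorProduct.assoc k k k (U ⊗[k] U) (U ⊗[k] U) (U ⊗[k] U)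
      (Algebra.TensorProduct.map (Bialgebra.comulAlgHom k (U ⊗[k] U)) (AlgHom.id k (U ⊗[k] U))
        (embed23 k U z)) = α (Algebra.TensorProduct.assoc k k k U U U
      (Algebra.TensorProduct.map (Bialgebra.comulAlgHom k U) (AlgHom.id k U) z)) := by
    intro z
    induction z with
    | zero => simp
    | add x y hx hy => simp only [map_add, hx, hy]
    | tmul x y =>
      simp only [embed23, Algebra.TensorProduct.map_tmul, Bialgebra.comulAlgHom_apply,
        AlgHom.id_apply, Algebra.TensorProduct.includeRight_apply,
        Algebra.TensorProduct.includeLeft_apply, comul_one_tmul]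
      induction Coalgebra.comul (R := k) x with
      | zero => simp
      | add x y hx hy => simp only [map_add, TensorProduct.add_tmul, hx, hy]
      | tmul z w => simp [α]
  have e2 : ∀ z : U ⊗[k] U,
      (Algebra.TensorProduct.map (AlgHom.id k (U ⊗[k] U)) (Bialgebra.comulAlgHom k (U ⊗[k] U))
        (embed23 k U z)) = β
      (Algebra.TensorProduct.map (AlgHom.id k U) (Bialgebra.comulAlgHom k U) z) := by
    intro z
    induction z with
    | zero => simp
    | add x y hx hy => simp only [map_add, hx, hy]
    | tmul x y =>
      simp only [embed23, Algebra.TensorProduct.map_tmul, Bialgebra.comulAlgHom_apply,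
        AlgHom.id_apply, Algebra.TensorProduct.includeRight_apply,
        Algebra.TensorProduct.includeLeft_apply, comul_tmul_left]
      simp [β]
  have e3 : ∀ z : U ⊗[k] U, α (Algebra.TensorProduct.map (AlgHom.id k U)
      Algebra.TensorProduct.includeRight z) = β (Algebra.TensorProduct.map (AlgHom.id k U)
      Algebra.TensorProduct.includeRight z) := by
    intro z
    induction z with
    | zero => simp
    | add x y hx hy => simp only [map_add, hx, hy]
    | tmul x y => simp [α, β]
  have e4 : ∀ z : U ⊗[k] U, Algebra.TensorProduct.assoc k k k (U ⊗[k] U) (U ⊗[k] U) (U ⊗[k] U)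
      (embed23 k U z ⊗ₜ 1) = β (Algebra.TensorProduct.map (AlgHom.id k U)
      Algebra.TensorProduct.includeLeft z) := by
    intro z
    induction z with
    | zero => simp
    | add x y hx hy => simp only [map_add, TensorProduct.add_tmul, hx, hy]
    | tmul x y => simp [β, Algebra.TensorProduct.one_def]
  have e5 : ∀ z : U ⊗[k] U, (1 : U ⊗[k] U) ⊗ₜ[k] (embed23 k U z) =
      α (Algebra.TensorProduct.includeRight z) := by
    intro z
    simp [α]
    rfl
  have e6 : ∀ z w : U ⊗[k] U, α (Algebra.TensorProduct.includeRight z) *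
      β (Algebra.TensorProduct.map (AlgHom.id k U) Algebra.TensorProduct.includeLeft w) =
      β (Algebra.TensorProduct.map (AlgHom.id k U) Algebra.TensorProduct.includeLeft w) *
      α (Algebra.TensorProduct.includeRight z) := by
    intro z w
    refine commute_of_tmul (E := (U ⊗[k] U) ⊗[k] ((U ⊗[k] U) ⊗[k] (U ⊗[k] U)))
      (α.comp (Algebra.TensorProduct.includeRight (R := k) (A := U) (B := U ⊗[k] U)))
      (β.comp (Algebra.TensorProduct.map (AlgHom.id k U)
        (Algebra.TensorProduct.includeLeft (R := k) (S := k) (A := U) (B := U)))) ?_ z w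
    intro a b c d
    simp [α, β]
  have hu : (R.unit23 : (U ⊗[k] U) ⊗[k] (U ⊗[k] U)) = embed23 k U (R.val : U ⊗[k] U) := rfl
  have e1' : cL k (U ⊗[k] U) (embed23 k U R.val) = _ := e1 _
  have e2' : cR k (U ⊗[k] U) (embed23 k U R.val) = _ := e2 _
  have e4' : jL k (U ⊗[k] U) (embed23 k U R.val) = _ := e4 _
  have e5' : jR k (U ⊗[k] U) (embed23 k U R.val) = _ := e5 _
  rw [hu, e1', e2', e4', e5', R.comul_left, R.comul_right, map_mul, map_mul, mul_assoc, e6,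
    e3, mul_assoc]

theorem unit23_counit_left :
    Algebra.TensorProduct.map (Bialgebra.counitAlgHom k (U ⊗[k] U)) (.id k (U ⊗[k] U))
      (R.unit23 : (U ⊗[k] U) ⊗[k] (U ⊗[k] U)) = 1 := by
  have e : ∀ z : U ⊗[k] U, Algebra.TensorProduct.map (Bialgebra.counitAlgHom k (U ⊗[k] U))
      (.id k (U ⊗[k] U)) (embed23 k U z) = Algebra.TensorProduct.map (AlgHom.id k k)
      Algebra.TensorProduct.includeLeft (Algebra.TensorProduct.map (Bialgebra.counitAlgHom k U)
        (AlgHom.id k U) z) := by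
    intro z
    induction z with
    | zero => simp
    | add x y hx hy => simp only [map_add, hx, hy]
    | tmul x y => simp
  refine (e _).trans ?_
  rw [R.counit_left, map_one]

theorem unit23_counit_right :
    Algebra.TensorProduct.map (.id k (U ⊗[k] U)) (Bialgebra.counitAlgHom k (U ⊗[k] U))
      (R.unit23 : (U ⊗[k] U) ⊗[k] (U ⊗[k] U)) = 1 := by
  have e : ∀ z : U ⊗[k] U, Algebra.TensorProduct.map (.id k (U ⊗[k] U))
      (Bialgebra.counitAlgHom k (U ⊗[k] U)) (embed23 k U z) = Algebra.TensorProduct.map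
      Algebra.TensorProduct.includeRight (AlgHom.id k k)
      (Algebra.TensorProduct.map (AlgHom.id k U) (Bialgebra.counitAlgHom k U) z) := by
    intro z
    induction z with
    | zero => simp
    | add x y hx hy => simp only [map_add, hx, hy]
    | tmul x y => simp
  refine (e _).trans ?_
  rw [R.counit_right, map_one]

/-- The twisted tensor square: the algebra `U ⊗ U` with the coproduct
`b ↦ R₂₃⁻¹ Δ(b) R₂₃` and the counit of `U ⊗ U`. -/
instance : Bialgebra k (TwistedSquare R) :=
  Bialgebra.ofAlgHom (A := U ⊗[k] U) (conjComul R.unit23)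
    (Bialgebra.counitAlgHom k (U ⊗[k] U))
    (conjComul_coassoc R.unit23 (unit23_cocycle R))
    (conjComul_rTensor R.unit23 (unit23_counit_left R))
    (conjComul_lTensor R.unit23 (unit23_counit_right R))

end TwistedSquare
section REAlgebra
variable {n : Type*} [Fintype n] [DecidableEq n]

/-- `X₁ = X ⊗ 1`. -/
def leg1 {A : Type*} [MulZeroOneClass A] (X : Matrix n n A) : Matrix (n × n) (n × n) A :=
  X ⊗ₖ (1 : Matrix n n A)

/-- `X₂ = 1 ⊗ X`. -/
def leg2 {A : Type*} [MulZeroOneClass A] (X : Matrix n n A) : Matrix (n × n) (n × n) A :=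
  (1 : Matrix n n A) ⊗ₖ X

/-- `P M`, where `P` is the flip of the two tensor factors. -/
def flipMul {A : Type*} (M : Matrix (n × n) (n × n) A) : Matrix (n × n) (n × n) A :=
  M.submatrix Prod.swap id

theorem leg1_apply {A : Type*} [MulZeroOneClass A] (X : Matrix n n A) (p q : n × n) :
    leg1 X p q = if p.2 = q.2 then X p.1 q.1 else 0 := by
  simp [leg1, Matrix.kroneckerMap_apply, Matrix.one_apply]

theorem leg2_apply {A : Type*} [MulZeroOneClass A] (X : Matrix n n A) (p q : n × n) :
    leg2 X p q = if p.1 = q.1 then X p.2 q.2 else 0 := by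
  simp [leg2, Matrix.kroneckerMap_apply, Matrix.one_apply]

section Legs
variable {k A : Type*} [CommRing k] [Ring A] [Algebra k A]

variable (k) in
/-- `leg1` as an algebra homomorphism. -/
def leg1Hom : Matrix n n A →ₐ[k] Matrix (n × n) (n × n) A where
  toFun := leg1
  map_one' := by simp [leg1]
  map_mul' X Y := by
    ext p q
    simp only [leg1_apply, Matrix.mul_apply, Fintype.sum_prod_type]
    by_cases h : p.2 = q.2 <;> simp [h]
  map_zero' := by ext p q; simp [leg1]
  map_add' X Y := by simp [leg1, Matrix.add_kronecker]
  commutes' r := by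
    ext p q
    simp only [leg1_apply, Matrix.algebraMap_matrix_apply, Prod.ext_iff]
    by_cases h : p.2 = q.2 <;> simp [h]

variable (k) in
/-- `leg2` as an algebra homomorphism. -/
def leg2Hom : Matrix n n A →ₐ[k] Matrix (n × n) (n × n) A where
  toFun := leg2
  map_one' := by simp [leg2]
  map_mul' X Y := by
    ext p q
    simp only [leg2_apply, Matrix.mul_apply, Fintype.sum_prod_type]
    by_cases h : p.1 = q.1 <;> simp [h]
  map_zero' := by ext p q; simp [leg2]
  map_add' X Y := by simp [leg2, Matrix.kronecker_add]
  commutes' r := by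
    ext p q
    simp only [leg2_apply, Matrix.algebraMap_matrix_apply, Prod.ext_iff]
    by_cases h : p.1 = q.1 <;> simp [h]

theorem leg_mul_apply (X Y : Matrix n n A) (p q : n × n) :
    (leg1 X * leg2 Y) p q = X p.1 q.1 * Y p.2 q.2 := by
  simp [Matrix.mul_apply, Fintype.sum_prod_type, leg1_apply, leg2_apply]

theorem leg_mul_apply' (X Y : Matrix n n A) (p q : n × n) :
    (leg2 Y * leg1 X) p q = Y p.2 q.2 * X p.1 q.1 := by
  simp [Matrix.mul_apply, Fintype.sum_prod_type, leg1_apply, leg2_apply]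

theorem flipMul_mul (M N : Matrix (n × n) (n × n) A) : flipMul M * N = flipMul (M * N) := by
  ext p q; simp [flipMul, Matrix.mul_apply]

theorem flipMul_leg2 (X : Matrix n n A) (M : Matrix (n × n) (n × n) A) :
    flipMul (leg2 X * M) = leg1 X * flipMul M := by
  ext p q
  simp [flipMul, Matrix.mul_apply, Fintype.sum_prod_type, leg1_apply, leg2_apply]

theorem flipMul_leg1 (X : Matrix n n A) (M : Matrix (n × n) (n × n) A) :
    flipMul (leg1 X * M) = leg2 X * flipMul M := by
  ext p q
  simp [flipMul, Matrix.mul_apply, Fintype.sum_prod_type, leg1_apply, leg2_apply]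

end Legs

section Rep
variable {k U A : Type*} [Field k] [Ring U] [Algebra k U] [Ring A] [Algebra k A]

/-- `(ρ ⊗ ρ)(z)`, a matrix on the tensor square of the representation space. -/
def rep2 (ρ : U →ₐ[k] Matrix n n k) : U ⊗[k] U →ₐ[k] Matrix (n × n) (n × n) k :=
  Algebra.TensorProduct.lift ((leg1Hom k).comp ρ) ((leg2Hom k).comp ρ) (fun x y => by
    change leg1 _ * leg2 _ = leg2 _ * leg1 _
    ext p q
    rw [leg_mul_apply, leg_mul_apply', mul_comm])

variable (A) in
/-- `ρ` with matrices over `A`. -/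
def repA (ρ : U →ₐ[k] Matrix n n k) : U →ₐ[k] Matrix n n A :=
  (Algebra.ofId k A).mapMatrix.comp ρ

variable (A) in
/-- `ρ ⊗ ρ` with matrices over `A`. -/
def rep2A (ρ : U →ₐ[k] Matrix n n k) : U ⊗[k] U →ₐ[k] Matrix (n × n) (n × n) A :=
  (Algebra.ofId k A).mapMatrix.comp (rep2 ρ)

theorem rep2A_tmul (ρ : U →ₐ[k] Matrix n n k) (x y : U) :
    rep2A A ρ (x ⊗ₜ y) = leg1 (repA A ρ x) * leg2 (repA A ρ y) := by
  ext p q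
  rw [leg_mul_apply]
  have : rep2 ρ (x ⊗ₜ y) = leg1 (ρ x) * leg2 (ρ y) := rfl
  simp [rep2A, repA, this, leg_mul_apply, Algebra.ofId_apply]

theorem leg1_comm (ρ : U →ₐ[k] Matrix n n k) (X : Matrix n n A) (y : U) :
    leg1 X * leg2 (repA A ρ y) = leg2 (repA A ρ y) * leg1 X := by
  ext p q
  rw [leg_mul_apply, leg_mul_apply']
  exact (Algebra.commutes _ _).symm

theorem leg2_comm (ρ : U →ₐ[k] Matrix n n k) (X : Matrix n n A) (y : U) :
    leg2 X * leg1 (repA A ρ y) = leg1 (repA A ρ y) * leg2 X := by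
  ext p q
  rw [leg_mul_apply, leg_mul_apply']
  exact (Algebra.commutes _ _).symm

theorem flipMul_rep2A (ρ : U →ₐ[k] Matrix n n k) (z : U ⊗[k] U)
    (M : Matrix (n × n) (n × n) A) :
    flipMul (rep2A A ρ z * M) = rep2A A ρ (TensorProduct.comm k U U z) * flipMul M := by
  induction z with
  | zero => simp [flipMul]
  | add x y hx hy =>
    simp only [map_add, add_mul, ← hx, ← hy]
    ext p q; simp [flipMul]
  | tmul x y =>
    rw [TensorProduct.comm_tmul, rep2A_tmul, rep2A_tmul, mul_assoc, flipMul_leg1, flipMul_leg2,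
      ← mul_assoc, leg2_comm]

end Rep


/-- The reflection equation `S X₂ S X₂ = X₂ S X₂ S`: its left-hand side. -/
def reLeft {A : Type*} [Ring A] (S : Matrix (n × n) (n × n) A) (X : Matrix n n A) :
    Matrix (n × n) (n × n) A := S * leg2 X * S * leg2 X

/-- The right-hand side of the reflection equation. -/
def reRight {A : Type*} [Ring A] (S : Matrix (n × n) (n × n) A) (X : Matrix n n A) :
    Matrix (n × n) (n × n) A := leg2 X * S * leg2 X * S

section Def
variable {k U : Type*} [Field k] [Ring U] [HopfAlgebra k U]

/-- The braid matrix `S = P (ρ ⊗ ρ)(R)` with entries in `A`. -/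
def braid (A : Type*) [Ring A] [Algebra k A] (R : UniversalRMatrix k U)
    (ρ : U →ₐ[k] Matrix n n k) : Matrix (n × n) (n × n) A :=
  flipMul (rep2A A ρ (R.val : U ⊗[k] U))

/-- The defining relations of the RE algebra. -/
inductive RERel (R : UniversalRMatrix k U) (ρ : U →ₐ[k] Matrix n n k) :
    FreeAlgebra k (n × n) → FreeAlgebra k (n × n) → Prop
  | re (p q : n × n) : RERel R ρ
      (reLeft (braid (FreeAlgebra k (n × n)) R ρ)
        (Matrix.of fun i j => FreeAlgebra.ι k (i, j)) p q)
      (reRight (braid (FreeAlgebra k (n × n)) R ρ)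
        (Matrix.of fun i j => FreeAlgebra.ι k (i, j)) p q)

/-- The reflection equation algebra. -/
def REAlgebra (R : UniversalRMatrix k U) (ρ : U →ₐ[k] Matrix n n k) : Type _ :=
  RingQuot (RERel R ρ)

variable (R : UniversalRMatrix k U) (ρ : U →ₐ[k] Matrix n n k)

instance : Ring (REAlgebra R ρ) := inferInstanceAs (Ring (RingQuot (RERel R ρ)))
instance : Algebra k (REAlgebra R ρ) := inferInstanceAs (Algebra k (RingQuot (RERel R ρ)))

/-- The quotient map. -/
def REAlgebra.mk : FreeAlgebra k (n × n) →ₐ[k] REAlgebra R ρ :=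
  RingQuot.mkAlgHom k (RERel R ρ)

/-- The matrix `K` of generators of the RE algebra. -/
def REAlgebra.gen : Matrix n n (REAlgebra R ρ) :=
  Matrix.of fun i j => REAlgebra.mk R ρ (FreeAlgebra.ι k (i, j))

section Map
variable {A B : Type*} [Ring A] [Ring B] [Algebra k A] [Algebra k B]

theorem map_leg2 (f : A →ₐ[k] B) (X : Matrix n n A) :
    f.mapMatrix (leg2 X) = leg2 (f.mapMatrix X) := by
  ext p q
  simp only [AlgHom.mapMatrix_apply, Matrix.map_apply, leg2_apply]
  split_ifs <;> simp

theorem map_braid (f : A →ₐ[k] B) : f.mapMatrix (braid A R ρ) = braid B R ρ := by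
  ext p q
  simp [braid, flipMul, rep2A, Algebra.ofId_apply]

theorem map_reLeft (f : A →ₐ[k] B) (S : Matrix (n × n) (n × n) A) (X : Matrix n n A) :
    f.mapMatrix (reLeft S X) = reLeft (f.mapMatrix S) (f.mapMatrix X) := by
  simp only [reLeft, map_mul, map_leg2]

theorem map_reRight (f : A →ₐ[k] B) (S : Matrix (n × n) (n × n) A) (X : Matrix n n A) :
    f.mapMatrix (reRight S X) = reRight (f.mapMatrix S) (f.mapMatrix X) := by
  simp only [reRight, map_mul, map_leg2]

end Map

theorem REAlgebra.relation : reLeft (braid (REAlgebra R ρ) R ρ) (REAlgebra.gen R ρ) =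
    reRight (braid (REAlgebra R ρ) R ρ) (REAlgebra.gen R ρ) := by
  have h : (REAlgebra.mk R ρ).mapMatrix (reLeft (braid (FreeAlgebra k (n × n)) R ρ)
        (Matrix.of fun i j => FreeAlgebra.ι k (i, j))) =
      (REAlgebra.mk R ρ).mapMatrix (reRight (braid (FreeAlgebra k (n × n)) R ρ)
        (Matrix.of fun i j => FreeAlgebra.ι k (i, j))) := by
    ext p q
    exact RingQuot.mkAlgHom_rel k (RERel.re p q)
  rw [map_reLeft, map_reRight, map_braid] at h
  exact h

/-- The algebra homomorphism out of the RE algebra given by a matrix that satisfies the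
reflection equation. -/
def REAlgebra.lift {A : Type*} [Ring A] [Algebra k A] (X : Matrix n n A)
    (h : reLeft (braid A R ρ) X = reRight (braid A R ρ) X) : REAlgebra R ρ →ₐ[k] A :=
  RingQuot.liftAlgHom k ⟨FreeAlgebra.lift k fun p => X p.1 p.2, by
    rintro _ _ ⟨p, q⟩
    have e : (FreeAlgebra.lift k fun p : n × n => X p.1 p.2).mapMatrix
        (Matrix.of fun i j => FreeAlgebra.ι k (i, j)) = X := by
      ext i j; simp
    have h1 := congrFun (congrFun (map_reLeft (FreeAlgebra.lift k fun p : n × n => X p.1 p.2)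
      (braid (FreeAlgebra k (n × n)) R ρ) (Matrix.of fun i j => FreeAlgebra.ι k (i, j))) p) q
    have h2 := congrFun (congrFun (map_reRight (FreeAlgebra.lift k fun p : n × n => X p.1 p.2)
      (braid (FreeAlgebra k (n × n)) R ρ) (Matrix.of fun i j => FreeAlgebra.ι k (i, j))) p) q
    rw [map_braid, e] at h1 h2
    rw [h, ← h2] at h1
    exact h1⟩

/-- The linear map `x ⊗ y ↦ ρ(γ(x)) X ρ(y)`. -/
def sandwichK {A : Type*} [Ring A] [Algebra k A] (X : Matrix n n A) :
    U ⊗[k] U →ₗ[k] Matrix n n A :=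
  TensorProduct.lift ((LinearMap.mul k (Matrix n n A)).compl₁₂
    (LinearMap.mulRight k X ∘ₗ (repA A ρ).toLinearMap ∘ₗ HopfAlgebra.antipode k)
    (repA A ρ).toLinearMap)

theorem sandwichK_tmul {A : Type*} [Ring A] [Algebra k A] (X : Matrix n n A) (x y : U) :
    sandwichK ρ X (x ⊗ₜ y) = repA A ρ (HopfAlgebra.antipode k x) * X * repA A ρ y := by
  simp [sandwichK]

/-- `b₁ ⊗ b₂ ↦ (b₁ ▶ K)₁ (ρ ⊗ ρ)(R) (b₂ ▶ K)₂`. -/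
def theta {A : Type*} [Ring A] [Algebra k A] (X : Matrix n n A) :
    (U ⊗[k] U) ⊗[k] (U ⊗[k] U) →ₗ[k] Matrix (n × n) (n × n) A :=
  TensorProduct.lift ((LinearMap.mul k (Matrix (n × n) (n × n) A)).compl₁₂
    (LinearMap.mulRight k (rep2A A ρ (R.val : U ⊗[k] U)) ∘ₗ (leg1Hom k).toLinearMap ∘ₗ
      sandwichK ρ X)
    ((leg2Hom k).toLinearMap ∘ₗ sandwichK ρ X))

theorem theta_tmul {A : Type*} [Ring A] [Algebra k A] (X : Matrix n n A) (b c : U ⊗[k] U) :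
    theta R ρ X (b ⊗ₜ c) = leg1 (sandwichK ρ X b) * rep2A A ρ (R.val : U ⊗[k] U) *
      leg2 (sandwichK ρ X c) := by
  simp only [theta, TensorProduct.lift.tmul, LinearMap.compl₁₂_apply]
  rfl

section Theta
variable {A : Type*} [Ring A] [Algebra k A] (X : Matrix n n A)

theorem leg1_mul (X Y : Matrix n n A) : leg1 (X * Y) = leg1 X * leg1 Y :=
  map_mul (leg1Hom ℤ) X Y

theorem leg2_mul (X Y : Matrix n n A) : leg2 (X * Y) = leg2 X * leg2 Y :=
  map_mul (leg2Hom ℤ) X Y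

theorem rep2A_one_tmul (y : U) : rep2A A ρ (1 ⊗ₜ y) = leg2 (repA A ρ y) := by
  rw [rep2A_tmul, map_one]
  change leg1Hom k 1 * _ = _
  rw [map_one, one_mul]

theorem rep2A_tmul_one (y : U) : rep2A A ρ (y ⊗ₜ 1) = leg1 (repA A ρ y) := by
  rw [rep2A_tmul, map_one]
  change _ * leg2Hom k 1 = _
  rw [map_one, mul_one]

theorem theta_step (a a' b b' z z' : U) (W : U ⊗[k] U) :
    theta R ρ X (embed23 k U (z ⊗ₜ z') * ((a ⊗ₜ b) ⊗ₜ (a' ⊗ₜ b')) * embed23 k U W) =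
    leg1 (repA A ρ (HopfAlgebra.antipode k a)) * leg1 X * leg1 (repA A ρ z) *
      leg1 (repA A ρ b) * rep2A A ρ (R.sandwich W) *
      leg2 (repA A ρ (HopfAlgebra.antipode k a')) *
      leg2 (repA A ρ (HopfAlgebra.antipode k z')) * leg2 X * leg2 (repA A ρ b') := by
  induction W with
  | zero => simp
  | add x y hx hy => simp only [map_add, add_mul, mul_add, hx, hy]
  | tmul w w' =>
    simp only [Algebra.TensorProduct.map_tmul, Algebra.TensorProduct.includeRight_apply,
      Algebra.TensorProduct.includeLeft_apply, Algebra.TensorProduct.tmul_mul_tmul, one_mul,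
      mul_one, theta_tmul, sandwichK_tmul, R.sandwich_tmul,
      HopfAlgebra.antipode_mul_antidistrib, map_mul, leg1_mul, leg2_mul, rep2A_one_tmul,
      rep2A_tmul_one, mul_assoc]

theorem theta_pure (X' Y Z : U ⊗[k] U) :
    theta R ρ X (embed23 k U Z * TensorProduct.tensorTensorTensorComm k U U U U (X' ⊗ₜ Y) *
      embed23 k U R.val) =
    rep2A A ρ (TensorProduct.map (HopfAlgebra.antipode k) (HopfAlgebra.antipode k) X') *
      (leg1 X * rep2A A ρ ((HopfAlgebra.antipode k (A := U)).lTensor U Z) * leg2 X) *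
      rep2A A ρ Y := by
  induction X' with
  | zero => simp
  | add x y hx hy => simp only [map_add, TensorProduct.add_tmul, mul_add, add_mul, hx, hy]
  | tmul a a' =>
  induction Y with
  | zero => simp
  | add x y hx hy => simp only [map_add, TensorProduct.tmul_add, mul_add, add_mul, hx, hy]
  | tmul b b' =>
  induction Z with
  | zero => simp
  | add x y hx hy => simp only [map_add, mul_add, add_mul, hx, hy]
  | tmul z z' =>
    rw [TensorProduct.tensorTensorTensorComm_tmul, theta_step, R.sandwich_self, map_one, mul_one]
    simp only [TensorProduct.map_tmul, LinearMap.lTensor_tmul, rep2A_tmul, mul_assoc]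
    have h1 : ∀ (M : Matrix n n A) (y : U), Commute (leg1 M) (leg2 (repA A ρ y)) :=
      fun M y => leg1_comm ρ M y
    have h2 : Commute (leg1 (repA A ρ b)) (leg2 X) := (leg2_comm ρ X b).symm
    rw [(h1 (repA A ρ b) _).left_comm, (h1 (repA A ρ z) _).left_comm, (h1 X _).left_comm,
      (h1 (repA A ρ b) _).left_comm, h2.left_comm]


/-- `∑ (b₁ ▶ K)₂ S (b₂ ▶ K)₂` for the twisted coproduct of `b = x ⊗ y`. -/
theorem theta_coproduct (x y : U) :
    theta R ρ X (conjComul R.unit23 (x ⊗ₜ[k] y)) =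
    rep2A A ρ (TensorProduct.map (HopfAlgebra.antipode k) (HopfAlgebra.antipode k)
      (Coalgebra.comul (R := k) x)) *
      (leg1 X * rep2A A ρ (R.val : U ⊗[k] U) * leg2 X) *
      rep2A A ρ (Coalgebra.comul (R := k) y) := by
  have h := theta_pure R ρ X (Coalgebra.comul (R := k) x) (Coalgebra.comul (R := k) y)
    (↑R.val⁻¹ : U ⊗[k] U)
  rw [R.lTensor_antipode_inv] at h
  rw [← h]
  rfl

theorem comm_comm_apply (D : U ⊗[k] U) :
    TensorProduct.comm k U U (TensorProduct.comm k U U D) = D := by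
  induction D with
  | zero => simp
  | add x y hx hy => simp only [map_add, hx, hy]
  | tmul x y => simp

theorem flipMul_scalar_mul (z : U ⊗[k] U) (M : Matrix (n × n) (n × n) A) :
    flipMul (rep2A A ρ z) * M = flipMul (rep2A A ρ z * M) := flipMul_mul _ _

theorem theta_reflection (hX : reLeft (braid A R ρ) X = reRight (braid A R ρ) X)
    (b : U ⊗[k] U) :
    braid A R ρ * flipMul (theta R ρ X (conjComul R.unit23 b)) =
      flipMul (theta R ρ X (conjComul R.unit23 b)) * braid A R ρ := by
  induction b with
  | zero => simp [flipMul]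
  | add x y hx hy =>
    have e : ∀ M N : Matrix (n × n) (n × n) A, flipMul (M + N) = flipMul M + flipMul N :=
      fun M N => rfl
    simp only [map_add, e, mul_add, add_mul, hx, hy]
  | tmul x y =>
    rw [theta_coproduct]
    set G := TensorProduct.map (HopfAlgebra.antipode k (A := U)) (HopfAlgebra.antipode k (A := U))
      (Coalgebra.comul (R := k) x) with hG
    set D := Coalgebra.comul (R := k) y with hD
    set N := leg2 X * braid A R ρ * leg2 X with hN
    have hN' : flipMul (leg1 X * rep2A A ρ (R.val : U ⊗[k] U) * leg2 X) = N := by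
      rw [hN, mul_assoc, flipMul_leg1, ← flipMul_mul, mul_assoc]; rfl
    have hNS : braid A R ρ * N = N * braid A R ρ := by
      rw [reLeft, reRight] at hX
      simp only [hN, ← mul_assoc]
      exact hX
    have hSG : braid A R ρ * rep2A A ρ (TensorProduct.comm k U U G) =
        rep2A A ρ (TensorProduct.comm k U U G) * braid A R ρ := by
      have h := R.antipode_comm x
      rw [braid, flipMul_mul, ← map_mul, ← h, map_mul, flipMul_rep2A]
    have hSD : braid A R ρ * rep2A A ρ D = rep2A A ρ D * braid A R ρ := by
      have h := R.comm y
      rw [braid, flipMul_mul, ← map_mul, h, map_mul, flipMul_rep2A]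
      congr 2
      exact comm_comm_apply _
    have e : flipMul (rep2A A ρ G * (leg1 X * rep2A A ρ (R.val : U ⊗[k] U) * leg2 X) *
        rep2A A ρ D) = rep2A A ρ (TensorProduct.comm k U U G) * N * rep2A A ρ D := by
      rw [← flipMul_mul, flipMul_rep2A, hN']
    rw [e]
    calc _ = (braid A R ρ * rep2A A ρ (TensorProduct.comm k U U G)) * N * rep2A A ρ D := by
          simp only [mul_assoc]
      _ = rep2A A ρ (TensorProduct.comm k U U G) * (braid A R ρ * N) * rep2A A ρ D := by
          rw [hSG]; simp only [mul_assoc]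
      _ = rep2A A ρ (TensorProduct.comm k U U G) * N * (braid A R ρ * rep2A A ρ D) := by
          rw [hNS]; simp only [mul_assoc]
      _ = _ := by rw [hSD]; simp only [mul_assoc]

end Theta

section Action

/-- The generating matrix of the action, with entries in the convolution algebra: its `(i, j)`
entry is the functional `x ⊗ y ↦ (ρ(γ(x)) K ρ(y))ᵢⱼ`. -/
def actGen : Matrix n n (WithConv (TwistedSquare R →ₗ[k] REAlgebra R ρ)) :=
  Matrix.of fun i j => WithConv.toConv
    (LinearMap.proj (R := k) (φ := fun _ => REAlgebra R ρ) j ∘ₗ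
      LinearMap.proj (R := k) (φ := fun _ => n → REAlgebra R ρ) i ∘ₗ
      sandwichK ρ (REAlgebra.gen R ρ))

/-- Evaluation of a matrix over the convolution algebra. -/
def evMat (b : TwistedSquare R)
    (M : Matrix (n × n) (n × n) (WithConv (TwistedSquare R →ₗ[k] REAlgebra R ρ))) :
    Matrix (n × n) (n × n) (REAlgebra R ρ) := M.map fun f => f b

variable (k) in
/-- Evaluation on the convolution algebra. -/
def evLin {C A : Type*} [AddCommMonoid C] [Module k C] [Ring A] [Algebra k A] (b : C) :
    WithConv (C →ₗ[k] A) →+ A where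
  toFun f := f b
  map_zero' := rfl
  map_add' _ _ := rfl

theorem braid_apply (A : Type*) [Ring A] [Algebra k A] (p q : n × n) :
    braid A R ρ p q = algebraMap k A (flipMul (rep2 ρ (R.val : U ⊗[k] U)) p q) := rfl

theorem ev_algebraMap_mul (b : TwistedSquare R) (c : k)
    (f : WithConv (TwistedSquare R →ₗ[k] REAlgebra R ρ)) :
    evLin k b (algebraMap k _ c * f) = algebraMap k _ c * evLin k b f := by
  rw [← Algebra.smul_def, ← Algebra.smul_def]; rfl

theorem ev_mul_algebraMap (b : TwistedSquare R) (c : k)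
    (f : WithConv (TwistedSquare R →ₗ[k] REAlgebra R ρ)) :
    evLin k b (f * algebraMap k _ c) = evLin k b f * algebraMap k _ c := by
  rw [← Algebra.commutes, ← Algebra.commutes, ev_algebraMap_mul]

theorem evMat_apply (b : TwistedSquare R)
    (M : Matrix (n × n) (n × n) (WithConv (TwistedSquare R →ₗ[k] REAlgebra R ρ))) (p q : n × n) :
    evMat R ρ b M p q = evLin k b (M p q) := rfl

theorem evMat_braid_mul (b : TwistedSquare R)
    (M : Matrix (n × n) (n × n) (WithConv (TwistedSquare R →ₗ[k] REAlgebra R ρ))) :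
    evMat R ρ b (braid _ R ρ * M) = braid _ R ρ * evMat R ρ b M := by
  ext p q
  simp only [evMat_apply, Matrix.mul_apply, map_sum, braid_apply, ev_algebraMap_mul]

theorem evMat_mul_braid (b : TwistedSquare R)
    (M : Matrix (n × n) (n × n) (WithConv (TwistedSquare R →ₗ[k] REAlgebra R ρ))) :
    evMat R ρ b (M * braid _ R ρ) = evMat R ρ b M * braid _ R ρ := by
  ext p q
  simp only [evMat_apply, Matrix.mul_apply, map_sum, braid_apply, ev_mul_algebraMap]

theorem evMat_mul
    (T : TwistedSquare R ⊗[k] TwistedSquare R →ₗ[k] Matrix (n × n) (n × n) (REAlgebra R ρ))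
    (M N : Matrix (n × n) (n × n) (WithConv (TwistedSquare R →ₗ[k] REAlgebra R ρ)))
    (hT : ∀ b c, T (b ⊗ₜ c) = evMat R ρ b M * evMat R ρ c N) (b : TwistedSquare R) :
    evMat R ρ b (M * N) = T (Coalgebra.comul (R := k) b) := by
  have key : ∀ (D : TwistedSquare R ⊗[k] TwistedSquare R) (p q : n × n),
      ∑ r, LinearMap.mul' k (REAlgebra R ρ) (TensorProduct.map (M p r).ofConv (N r q).ofConv D) =
        T D p q := by
    intro D p q
    induction D with
    | zero => simp
    | add x y hx hy => simp only [map_add, Finset.sum_add_distrib, hx, hy, Matrix.add_apply]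
    | tmul x y =>
      rw [hT, Matrix.mul_apply]
      rfl
  ext p q
  rw [← key, evMat_apply, Matrix.mul_apply, map_sum]
  rfl

theorem evMat_leg2_actGen (b : TwistedSquare R) :
    evMat R ρ b (leg2 (actGen R ρ)) = leg2 (sandwichK ρ (REAlgebra.gen R ρ) b) := by
  ext p q
  rw [evMat_apply, leg2_apply, leg2_apply]
  split_ifs
  · rfl
  · simp

theorem evMat_middle (b : TwistedSquare R) :
    evMat R ρ b (leg2 (actGen R ρ) * braid _ R ρ * leg2 (actGen R ρ)) =
      flipMul (theta R ρ (REAlgebra.gen R ρ) (conjComul R.unit23 b)) := by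
  let fl : Matrix (n × n) (n × n) (REAlgebra R ρ) →ₗ[k] Matrix (n × n) (n × n) (REAlgebra R ρ) :=
    { toFun := flipMul
      map_add' := fun _ _ => rfl
      map_smul' := fun _ _ => rfl }
  refine evMat_mul R ρ (fl ∘ₗ theta R ρ (REAlgebra.gen R ρ)) _ _ ?_ b
  intro b c
  rw [evMat_mul_braid, evMat_leg2_actGen, evMat_leg2_actGen]
  refine (congrArg flipMul (theta_tmul R ρ _ b c)).trans ?_
  rw [mul_assoc, flipMul_leg1, ← flipMul_mul, mul_assoc]
  rfl

theorem actGen_relation : reLeft (braid _ R ρ) (actGen R ρ) =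
    reRight (braid _ R ρ) (actGen R ρ) := by
  have key : ∀ b, evMat R ρ b (reLeft (braid _ R ρ) (actGen R ρ)) =
      evMat R ρ b (reRight (braid _ R ρ) (actGen R ρ)) := by
    intro b
    have e1 : reLeft (braid _ R ρ) (actGen R ρ) =
      braid _ R ρ * (leg2 (actGen R ρ) * braid _ R ρ * leg2 (actGen R ρ)) := by
      simp only [reLeft, mul_assoc]
    have e2 : reRight (braid _ R ρ) (actGen R ρ) =
      (leg2 (actGen R ρ) * braid _ R ρ * leg2 (actGen R ρ)) * braid _ R ρ := rfl
    rw [e1, e2, evMat_braid_mul, evMat_mul_braid, evMat_middle]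
    exact theta_reflection R ρ _ (REAlgebra.relation R ρ) b
  ext p q b
  exact congrFun (congrFun (key b) p) q

/-- The action of the twisted tensor square on the RE algebra, `b ↦ (a ↦ b ▶ a)`, written as
the algebra homomorphism `a ↦ (b ↦ b ▶ a)` to the convolution algebra; it is determined by
`(x ⊗ y) ▶ K = ρ(γ(x)) K ρ(y)`, and the multiplicativity says that the RE algebra is a module
algebra. -/
def actHom : REAlgebra R ρ →ₐ[k] WithConv (TwistedSquare R →ₗ[k] REAlgebra R ρ) :=
  REAlgebra.lift R ρ (actGen R ρ) (actGen_relation R ρ)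

end Action
end Def
end REAlgebra

section ActionMap
variable {k U n : Type*} [Field k] [Ring U] [HopfAlgebra k U] [Fintype n] [DecidableEq n]
variable (R : UniversalRMatrix k U) (ρ : U →ₐ[k] Matrix n n k)

/-- The action `b ▶ a` of the twisted tensor square on the RE algebra, linear in `a` and `b`. -/
def blackAct : REAlgebra R ρ →ₗ[k] TwistedSquare R →ₗ[k] REAlgebra R ρ :=
  (WithConv.linearEquiv k (TwistedSquare R →ₗ[k] REAlgebra R ρ)).toLinearMap ∘ₗ
    (actHom R ρ).toLinearMap

/-- The identity map `U ⊗ U → U ⊗_R U`; it is an isomorphism of algebras. -/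
def toTwisted : U ⊗[k] U ≃ₐ[k] TwistedSquare R :=
  { Equiv.refl (U ⊗[k] U) with
    map_mul' := fun _ _ => rfl
    map_add' := fun _ _ => rfl
    commutes' := fun _ => rfl }

/-- The coproduct of `U` as a homomorphism from `U` to the twisted tensor square. -/
def diag : U →ₐ[k] TwistedSquare R :=
  (toTwisted R).toAlgHom.comp (Bialgebra.comulAlgHom k U)

/-- `a` is `U`-invariant: `Δ(x) ▶ a = ε(x) a` for all `x`. -/
def IsUInvariant (a : REAlgebra R ρ) : Prop :=
  ∀ x : U, blackAct R ρ a (diag R x) = Coalgebra.counit (R := k) x • a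

/-- `y ⇀ a = (1 ⊗ y) ▶ a`. -/
def harpoon (a : REAlgebra R ρ) : U →ₗ[k] REAlgebra R ρ :=
  blackAct R ρ a ∘ₗ (toTwisted R).toLinearMap ∘ₗ
    (Algebra.TensorProduct.includeRight (R := k) (A := U) (B := U)).toLinearMap

end ActionMap

/-- An `H`-base algebra: an `H`-module algebra (action `act`, written `h ▷ l`) which is also a
left `H`-comodule algebra (coaction `coact`, written `δ(l) = l⁽¹⁾ ⊗ l⁽∞⁾`), subject to the
Yetter-Drinfeld condition and to quasi-commutativity. -/
structure BaseAlgebra (k H L : Type*) [Field k] [Ring H] [HopfAlgebra k H] [Ring L]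
    [Algebra k L] where
  act : H →ₐ[k] Module.End k L
  coact : L →ₐ[k] H ⊗[k] L
  act_one : ∀ h : H, act h 1 = Coalgebra.counit (R := k) h • (1 : L)
  /-- `h ▷ (l m) = (h⁽¹⁾ ▷ l) (h⁽²⁾ ▷ m)` -/
  act_mul : ∀ (h : H) (l m : L), act h (l * m) =
    LinearMap.mul' k L (TensorProduct.map (act.toLinearMap.flip l) (act.toLinearMap.flip m)
      (Coalgebra.comul (R := k) h))
  coassoc : ∀ l : L, TensorProduct.assoc k H H L
      ((Coalgebra.comul (R := k) (A := H)).rTensor L (coact l)) =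
    coact.toLinearMap.lTensor H (coact l)
  counit_coact : ∀ l : L, TensorProduct.lid k L
    ((Coalgebra.counit (R := k) (A := H)).rTensor L (coact l)) = l
  /-- `(h⁽¹⁾ ▷ l)⁽¹⁾ h⁽²⁾ ⊗ (h⁽¹⁾ ▷ l)⁽∞⁾ = h⁽¹⁾ l⁽¹⁾ ⊗ h⁽²⁾ ▷ l⁽∞⁾` -/
  yetter_drinfeld : ∀ (h : H) (l : L),
    TensorProduct.lift ((LinearMap.mul k (H ⊗[k] L)).compl₁₂
        (coact.toLinearMap ∘ₗ act.toLinearMap.flip l)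
        (Algebra.TensorProduct.includeLeft (R := k) (S := k) (A := H) (B := L)).toLinearMap)
      (Coalgebra.comul (R := k) h) =
    TensorProduct.homTensorHomMap (RingHom.id k) H L H L
      (TensorProduct.map (LinearMap.mul k H) act.toLinearMap (Coalgebra.comul (R := k) h))
      (coact l)
  /-- `l m = (l⁽¹⁾ ▷ m) l⁽∞⁾` -/
  quasi_comm : ∀ l m : L,
    l * m = LinearMap.mul' k L ((act.toLinearMap.flip m).rTensor L (coact l))

section Twist
variable {k H U L : Type*} [Field k] [Ring H] [HopfAlgebra k H] [Ring U] [HopfAlgebra k U]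
  [Ring L] [Algebra k L] (𝓛 : BaseAlgebra k H L) (ι : H →ₐc[k] U)

section Bialg
variable {B M : Type*} [Ring B] [Bialgebra k B] [Ring M] [Algebra k M]

/-- `Δ ⊗ id` on `B ⊗ M`. -/
def dDelta : B ⊗[k] M →ₐ[k] B ⊗[k] (B ⊗[k] M) :=
  (Algebra.TensorProduct.assoc k k k B B M).toAlgHom.comp
    (Algebra.TensorProduct.map (Bialgebra.comulAlgHom k B) (.id k M))

/-- The coaction of `H` on `L`, pushed forward along an algebra map `f : H → B`. -/
def dCoact (f : H →ₐ[k] B) : L →ₐ[k] B ⊗[k] L :=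
  (Algebra.TensorProduct.map f (.id k L)).comp 𝓛.coact

/-- The gauge transformation of `F` by an invertible `ξ ∈ B ⊗ L`:
`Δ(ξ⁻¹) F ξ_{1|2} ξ_2`, with `ξ_{1|2} = (id ⊗ δ)(ξ)` and `ξ_2 = 1 ⊗ ξ`. -/
def gauge (f : H →ₐ[k] B) (F : B ⊗[k] (B ⊗[k] L)) (ξ : B ⊗[k] L) : B ⊗[k] (B ⊗[k] L) :=
  dDelta (Ring.inverse ξ) * F *
    (Algebra.TensorProduct.map (.id k B) (dCoact 𝓛 f) ξ *
      Algebra.TensorProduct.includeRight ξ)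

end Bialg

/-- `x ⊗ (y ⊗ l) ↦ h⁽¹⁾x ⊗ (h⁽²⁾y ⊗ h⁽³⁾ ▷ l)` -/
def diagAct : H →ₗ[k] Module.End k (U ⊗[k] (U ⊗[k] L)) :=
  TensorProduct.homTensorHomMap (RingHom.id k) U (U ⊗[k] L) U (U ⊗[k] L) ∘ₗ
    TensorProduct.map (LinearMap.mul k U ∘ₗ (ι : H →ₐ[k] U).toLinearMap)
      (TensorProduct.homTensorHomMap (RingHom.id k) U L U L ∘ₗ
        TensorProduct.map (LinearMap.mul k U ∘ₗ (ι : H →ₐ[k] U).toLinearMap)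
          𝓛.act.toLinearMap ∘ₗ Coalgebra.comul) ∘ₗ Coalgebra.comul

/-- A dynamical twist over the base algebra `L` in `U ⊗ U ⊗ L`. -/
structure DynamicalTwist where
  val : (U ⊗[k] (U ⊗[k] L))ˣ
  /-- `h⁽¹⁾F₁ ⊗ h⁽²⁾F₂ ⊗ h⁽³⁾ ▷ F_L = F₁h⁽¹⁾ ⊗ F₂h⁽²⁾ ⊗ F_L` -/
  invariant : ∀ h : H, diagAct 𝓛 ι h (val : U ⊗[k] (U ⊗[k] L)) =
    (val : U ⊗[k] (U ⊗[k] L)) * dDelta (ι h ⊗ₜ[k] (1 : L))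
  /-- `F_{(12)3} F_{12|3} = F_{1(23)} F_{23}` -/
  cocycle : dDelta (val : U ⊗[k] (U ⊗[k] L)) *
      Algebra.TensorProduct.map (.id k U) (Algebra.TensorProduct.map (.id k U)
        (dCoact 𝓛 (ι : H →ₐ[k] U))) (val : U ⊗[k] (U ⊗[k] L)) =
    Algebra.TensorProduct.map (.id k U) dDelta (val : U ⊗[k] (U ⊗[k] L)) *
      Algebra.TensorProduct.includeRight (val : U ⊗[k] (U ⊗[k] L))
  counit_left : Algebra.TensorProduct.lid k (U ⊗[k] L)
    (Algebra.TensorProduct.map (Bialgebra.counitAlgHom k U) (.id k (U ⊗[k] L))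
      (val : U ⊗[k] (U ⊗[k] L))) = 1
  counit_right : Algebra.TensorProduct.map (.id k U)
    ((Algebra.TensorProduct.lid k L).toAlgHom.comp
      (Algebra.TensorProduct.map (Bialgebra.counitAlgHom k U) (.id k L)))
      (val : U ⊗[k] (U ⊗[k] L)) = 1

/-- The inverse `γ̄` of the antipode. -/
def antipodeInv (k U : Type*) [Field k] [Ring U] [HopfAlgebra k U] : U →ₗ[k] U :=
  Ring.inverse (HopfAlgebra.antipode k (A := U) : Module.End k U)

variable {𝓛 ι} (F : DynamicalTwist 𝓛 ι)

/-- `ζ = F̄₂ γ̄(F̄₁) ⊗ F̄_L`, where `F̄` is the inverse of `F`. -/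
def zeta : U ⊗[k] L :=
  (LinearMap.mul' k U ∘ₗ (TensorProduct.comm k U U).toLinearMap ∘ₗ
    (antipodeInv k U).rTensor U).rTensor L
    ((TensorProduct.assoc k U U L).symm (↑F.val⁻¹ : U ⊗[k] (U ⊗[k] L)))

variable (𝓛 ι) in
/-- `Γ̄(x ⊗ l) = l⁽¹⁾ γ̄(x) ⊗ l⁽∞⁾`. -/
def gammaBar : U ⊗[k] L →ₗ[k] U ⊗[k] L :=
  TensorProduct.lift ((LinearMap.mul k (U ⊗[k] L)).compl₁₂
    (dCoact 𝓛 (ι : H →ₐ[k] U)).toLinearMap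
    ((Algebra.TensorProduct.includeLeft (R := k) (S := k) (A := U) (B := L)).toLinearMap ∘ₗ
      antipodeInv k U)).flip

/-- `ζ Γ̄(ζ⁻¹)` -/
def nu : U ⊗[k] L := zeta F * gammaBar 𝓛 ι (Ring.inverse (zeta F))

/-- The dynamical R-matrix `F₂₁⁻¹ R F`. -/
def dynR (R : UniversalRMatrix k U) : U ⊗[k] (U ⊗[k] L) :=
  Algebra.TensorProduct.leftComm k U U L (↑F.val⁻¹ : U ⊗[k] (U ⊗[k] L)) *
    Algebra.TensorProduct.map (.id k U) Algebra.TensorProduct.includeLeft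
      (R.val : U ⊗[k] U) * (F.val : U ⊗[k] (U ⊗[k] L))

section Twisted
variable (R : UniversalRMatrix k U)

/-- `F_{(12)(34)} = (Δ ⊗ Δ ⊗ id)(F)`, a dynamical twist of the twisted tensor square. -/
def squareTwist : TwistedSquare R ⊗[k] (TwistedSquare R ⊗[k] L) :=
  Algebra.TensorProduct.map (diag R) (Algebra.TensorProduct.map (diag R) (.id k L))
    (F.val : U ⊗[k] (U ⊗[k] L))

/-- `F ζ_{1|2}`, as an element of `(U ⊗ U) ⊗ L`. -/
def squareGauge : TwistedSquare R ⊗[k] L :=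
  Algebra.TensorProduct.map (toTwisted R).toAlgHom (.id k L)
    ((Algebra.TensorProduct.assoc k k k U U L).symm
      ((F.val : U ⊗[k] (U ⊗[k] L)) *
        Algebra.TensorProduct.map (.id k U) (dCoact 𝓛 (ι : H →ₐ[k] U)) (zeta F)))

/-- The gauge transform of `F_{(12)(34)}` by `F ζ_{1|2}`. -/
def upsilon : TwistedSquare R ⊗[k] (TwistedSquare R ⊗[k] L) :=
  gauge 𝓛 ((diag R).comp (ι : H →ₐ[k] U)) (squareTwist F R) (squareGauge F R)

variable {n : Type*} [Fintype n] [DecidableEq n] (ρ : U →ₐ[k] Matrix n n k)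

variable (L) in
/-- `x ⊗ (y ⊗ l) ↦ (x ▶ a)(y ▶ b) ⊗ l` -/
def actPair (a b : REAlgebra R ρ) :
    TwistedSquare R ⊗[k] (TwistedSquare R ⊗[k] L) →ₗ[k] REAlgebra R ρ ⊗[k] L :=
  (LinearMap.mul' k (REAlgebra R ρ) ∘ₗ
      TensorProduct.map (blackAct R ρ a) (blackAct R ρ b)).rTensor L ∘ₗ
    (TensorProduct.assoc k (TwistedSquare R) (TwistedSquare R) L).symm.toLinearMap

/-- `(a ⊗ l) * (b ⊗ m) = (Υ₁ ▶ a) (Υ₂ l⁽¹⁾ ▶ b) ⊗ Υ_L l⁽∞⁾ m` -/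
def twistedMulPure (a : REAlgebra R ρ) (l : L) (b : REAlgebra R ρ) (m : L) : REAlgebra R ρ ⊗[k] L :=
  actPair L R ρ a b (upsilon F R *
    Algebra.TensorProduct.includeRight (dCoact 𝓛 ((diag R).comp (ι : H →ₐ[k] U)) l)) *
  Algebra.TensorProduct.includeRight m

variable (L) in
/-- `actPair` is bilinear in `a` and `b`. -/
def actPairBil : REAlgebra R ρ →ₗ[k] REAlgebra R ρ →ₗ[k]
    TwistedSquare R ⊗[k] (TwistedSquare R ⊗[k] L) →ₗ[k] REAlgebra R ρ ⊗[k] L :=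
  LinearMap.mk₂ k (actPair L R ρ)
    (fun a a' b => by
      simp only [actPair, map_add, TensorProduct.map_add_left, LinearMap.comp_add,
        LinearMap.rTensor_add, LinearMap.add_comp])
    (fun c a b => by
      simp only [actPair, map_smul, TensorProduct.map_smul_left, LinearMap.comp_smul,
        LinearMap.rTensor_smul, LinearMap.smul_comp])
    (fun a b b' => by
      simp only [actPair, map_add, TensorProduct.map_add_right, LinearMap.comp_add,
        LinearMap.rTensor_add, LinearMap.add_comp])
    (fun c a b => by
      simp only [actPair, map_smul, TensorProduct.map_smul_right, LinearMap.comp_smul,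
        LinearMap.rTensor_smul, LinearMap.smul_comp])

theorem twistedMulPure_eq (a : REAlgebra R ρ) (l : L) (b : REAlgebra R ρ) (m : L) :
    twistedMulPure F R ρ a l b m = actPairBil L R ρ a b (upsilon F R *
      Algebra.TensorProduct.includeRight (dCoact 𝓛 ((diag R).comp (ι : H →ₐ[k] U)) l)) *
      Algebra.TensorProduct.includeRight m := rfl

/-- The twisted multiplication on `K ⊗ L`, the bilinear extension of `twistedMulPure`. -/
def twistedMul : REAlgebra R ρ ⊗[k] L →ₗ[k] REAlgebra R ρ ⊗[k] L →ₗ[k] REAlgebra R ρ ⊗[k] L :=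
  TensorProduct.lift (LinearMap.mk₂ k
    (fun a l => TensorProduct.lift (LinearMap.mk₂ k (fun b m => twistedMulPure F R ρ a l b m)
      (fun b b' m => by
        simp only [twistedMulPure_eq, map_add, LinearMap.add_apply, add_mul])
      (fun c b m => by
        simp only [twistedMulPure_eq, map_smul, LinearMap.smul_apply, smul_mul_assoc])
      (fun b m m' => by simp only [twistedMulPure_eq, map_add, mul_add])
      (fun c b m => by simp only [twistedMulPure_eq, map_smul, mul_smul_comm])))
    (fun a a' l => by
      ext b m
      simp [twistedMulPure_eq, add_mul])
    (fun c a l => by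
      ext b m
      simp [twistedMulPure_eq])
    (fun a l l' => by
      ext b m
      simp [twistedMulPure_eq, add_mul, mul_add, TensorProduct.tmul_add])
    (fun c a l => by
      ext b m
      change twistedMulPure F R ρ a (c • l) b m = c • twistedMulPure F R ρ a l b m
      simp only [twistedMulPure_eq, map_smul, mul_smul_comm, smul_mul_assoc]))

theorem twistedMul_tmul (a : REAlgebra R ρ) (l : L) (b : REAlgebra R ρ) (m : L) :
    twistedMul F R ρ (a ⊗ₜ l) (b ⊗ₜ m) = twistedMulPure F R ρ a l b m := rfl

/-- `((ζΓ̄(ζ̄))₁ ⇀ a) ⊗ (ζΓ̄(ζ̄))_L` -/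
def centralElt : REAlgebra R ρ →ₗ[k] REAlgebra R ρ ⊗[k] L where
  toFun a := (harpoon R ρ a).rTensor L (nu F)
  map_add' a b := by
    have : harpoon R ρ (a + b) = harpoon R ρ a + harpoon R ρ b := by
      ext y; simp [harpoon]
    rw [this, LinearMap.rTensor_add, LinearMap.add_apply]
  map_smul' c a := by
    have : harpoon R ρ (c • a) = c • harpoon R ρ a := by
      ext y; simp [harpoon]
    rw [this, LinearMap.rTensor_smul, LinearMap.smul_apply]; rfl

/-- The matrix of the dynamical R-matrix in the representation `ρ`, with entries in `L`. -/
def dynRMatrix : Matrix (n × n) (n × n) L :=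
  Matrix.of fun p q => TensorProduct.lid k L
    ((Matrix.entryLinearMap k k p q ∘ₗ (rep2 ρ).toLinearMap).rTensor L
      ((TensorProduct.assoc k U U L).symm (dynR F R)))

variable (𝓛 ι) in
/-- `l ↦ ρ(γ(l⁽¹⁾))ᵢₚ ρ(l⁽²⁾)_{qj} l⁽∞⁾` -/
def crossCoef (i p q j : n) : L →ₗ[k] L :=
  (TensorProduct.lid k L).toLinearMap ∘ₗ
    (LinearMap.mul' k k ∘ₗ TensorProduct.map
        (Matrix.entryLinearMap k k i p ∘ₗ ρ.toLinearMap ∘ₗ HopfAlgebra.antipode k)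
        (Matrix.entryLinearMap k k q j ∘ₗ ρ.toLinearMap) ∘ₗ
      Coalgebra.comul (R := k) (A := U)).rTensor L ∘ₗ
    (dCoact 𝓛 (ι : H →ₐ[k] U)).toLinearMap

/-- The generator `Kᵢⱼ` of the free algebra. -/
abbrev freeK (k L : Type*) [Field k] {n : Type*} (i j : n) : FreeAlgebra k ((n × n) ⊕ L) :=
  FreeAlgebra.ι k (Sum.inl (i, j))

/-- The generator of the free algebra that corresponds to `l ∈ L`. -/
abbrev freeL (k n : Type*) [Field k] {L : Type*} (l : L) : FreeAlgebra k ((n × n) ⊕ L) :=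
  FreeAlgebra.ι k (Sum.inr l)

/-- The defining relations of the dynamical RE algebra. -/
inductive DRERel : FreeAlgebra k ((n × n) ⊕ L) → FreeAlgebra k ((n × n) ⊕ L) → Prop
  | scalar (c : k) : DRERel (freeL k n (algebraMap k L c)) (algebraMap k _ c)
  | add (l m : L) : DRERel (freeL k n (l + m)) (freeL k n l + freeL k n m)
  | mul (l m : L) : DRERel (freeL k n (l * m)) (freeL k n l * freeL k n m)
  | cross (l : L) (i j : n) : DRERel (freeL k n l * freeK k L i j)
      (∑ p, ∑ q, freeK k L p q * freeL k n (crossCoef 𝓛 ι ρ i p q j l))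
  | re (p q : n × n) : DRERel
      (reLeft (flipMul ((dynRMatrix F R ρ).map (freeL k n))) (Matrix.of (freeK k L)) p q)
      (reRight (flipMul ((dynRMatrix F R ρ).map (freeL k n))) (Matrix.of (freeK k L)) p q)

/-- The dynamical reflection equation algebra. -/
def DREAlgebra : Type _ := RingQuot (DRERel F R ρ)

instance : Ring (DREAlgebra F R ρ) := inferInstanceAs (Ring (RingQuot (DRERel F R ρ)))
instance : Algebra k (DREAlgebra F R ρ) :=
  inferInstanceAs (Algebra k (RingQuot (DRERel F R ρ)))

/-- The generators `Kᵢⱼ` of the dynamical RE algebra. -/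
def DREAlgebra.gen (i j : n) : DREAlgebra F R ρ :=
  RingQuot.mkAlgHom k (DRERel F R ρ) (freeK k L i j)

/-- The elements of `L` in the dynamical RE algebra. -/
def DREAlgebra.base (l : L) : DREAlgebra F R ρ :=
  RingQuot.mkAlgHom k (DRERel F R ρ) (freeL k n l)

end Twisted
end Twist

end DynRE
end

open DynRE

/-! All identities are read inside one algebra. A tensor is evaluated at linear maps ("legs") into a
common algebra `A` whose values commute (`ev2`, `ev3`); a coproduct then becomes a convolution
(`conv`) and a coaction becomes `shift`. A leg may also take values in the operators on `A`: left
multiplications (`lop`), or right multiplications through the inverse antipode (`rop`). Evaluating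
the inverse twist at `rop f` and `lop f` contracts it to ζ (`inv_ops_one`), so every cocycle or
hexagon identity, read at operator legs and applied to a vector, becomes an identity for ζ. In this
way ζ is seen to be invertible (`zetaUnit`), to commute with the coaction (`zeta_comm`), and to
satisfy `zeta_mul` and `zeta_shift`. The inverse antipode itself comes from Drinfeld's element
(`UniversalRMatrix.invertibleAntipode`).

Quasi-commutativity of the base algebra turns the `H`-invariance of the twist into commutation with
the iterated coaction (`DynamicalTwist.commute`), and only this is kept in `DynCocycle`. Since the
coproduct of `U` is a bialgebra map into the twisted square (`isBialgHom_diag`), F_{(12)(34)} is a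
dynamical twist there. The element ξ = F ζ_{1|2} is invertible, normalized and commutes with the
coaction, so the gauge transform Υ is a dynamical twist as well (`gauge_cocycle`). Any dynamical
twist makes the tensor product of a module algebra with `L` an associative algebra (`tmul_assoc`),
and gauge equivalent twists give isomorphic algebras (`psi_gauge`).

To compare this algebra with the presented one, let `X` be a matrix over an algebra with a
homomorphism from `L`, and consider the matrix of maps b ↦ b ▶ X. The cross relations say that these
maps intertwine the action of `L`, and such intertwiners form an algebra `dynConv` under a product
deformed by the inverse of Υ. The dynamical reflection equation for `X` and the ordinary reflection
equation for the matrix of maps are both equivalent to one and the same relation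
(`dynamical_re_iff`, `re_conv_iff`). The computation behind this is `xi_exchange`, in the form
`upsilon_gam`. Used for left multiplications on 𝒦 ⊗ L, the equivalence gives an action of the
dynamical algebra there (`leftMulHom`); used for the generators of the dynamical algebra, it gives a
homomorphism from 𝒦 to `dynConv` (`convHom`). Evaluating at suitable units gives mutually inverse
linear maps (`dreEquiv`).

For the centers, the reflection equation is a rule for moving `K` past an arbitrary element with
R-matrices acting through the coproduct (`gen_mul_diagScal`); on invariants the R-matrices collapse
to 1. In the product defined by F_{(12)(34)} both `U`-legs act through the coproduct, so an
invariant `a ⊗ 1` multiplies as in the plain tensor product. Finally z(a) is ξ⁻¹ applied to `a`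
(`centralElt_eq`), so the gauge isomorphism takes z(a) to `a ⊗ 1`, and centrality, injectivity and
multiplicativity are visible there. -/

noncomputable section
namespace DynRE

/-! ### Evaluation of tensors at legs -/

section Legs
variable {k : Type*} [Field k]

/-- The linear map `x ⊗ m ↦ f(x) l(m)`. -/
def ev2 {B M A : Type*} [AddCommGroup B] [Module k B] [AddCommGroup M] [Module k M]
    [Ring A] [Algebra k A] (f : B →ₗ[k] A) (l : M →ₗ[k] A) : B ⊗[k] M →ₗ[k] A :=
  TensorProduct.lift ((LinearMap.mul k A).compl₁₂ f l)

@[simp] theorem ev2_tmul {B M A : Type*} [AddCommGroup B] [Module k B] [AddCommGroup M]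
    [Module k M] [Ring A] [Algebra k A] (f : B →ₗ[k] A) (l : M →ₗ[k] A) (x : B) (m : M) :
    ev2 f l (x ⊗ₜ m) = f x * l m := by simp [ev2]

/-- The linear map `f` is unital and multiplicative. -/
structure IsAlgHom {B A : Type*} [Ring B] [Algebra k B] [Ring A] [Algebra k A]
    (f : B →ₗ[k] A) : Prop where
  map_one : f 1 = 1
  map_mul : ∀ x y, f (x * y) = f x * f y

/-- The values of `f` and `g` commute. -/
def Comm {B M A : Type*} [AddCommGroup B] [Module k B] [AddCommGroup M] [Module k M]
    [Ring A] [Algebra k A] (f : B →ₗ[k] A) (g : M →ₗ[k] A) : Prop :=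
  ∀ x y, Commute (f x) (g y)

section Basic
variable {A B M N : Type*} [Ring A] [Algebra k A] [Ring B] [Algebra k B] [Ring M] [Algebra k M]
  [Ring N] [Algebra k N]

theorem isAlgHom_algHom (f : B →ₐ[k] A) : IsAlgHom (f : B →ₐ[k] A).toLinearMap :=
  ⟨map_one f, map_mul f⟩

theorem IsAlgHom.comp {f : B →ₗ[k] A} (hf : IsAlgHom f) {g : M →ₗ[k] B} (hg : IsAlgHom g) :
    IsAlgHom (f ∘ₗ g) :=
  ⟨by simp [hg.map_one, hf.map_one], fun x y => by simp [hg.map_mul, hf.map_mul]⟩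

theorem IsAlgHom.map_inv {f : B →ₗ[k] A} (hf : IsAlgHom f) (u : Bˣ) :
    f (↑u⁻¹ : B) * f (u : B) = 1 := by
  rw [← hf.map_mul, Units.inv_mul, hf.map_one]

theorem IsAlgHom.map_inv' {f : B →ₗ[k] A} (hf : IsAlgHom f) (u : Bˣ) :
    f (u : B) * f (↑u⁻¹ : B) = 1 := by
  rw [← hf.map_mul, Units.mul_inv, hf.map_one]

theorem IsAlgHom.map_commute {f : B →ₗ[k] A} (hf : IsAlgHom f) {x y : B} (h : Commute x y) :
    Commute (f x) (f y) := by
  rw [Commute, SemiconjBy, ← hf.map_mul, h.eq, hf.map_mul]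

theorem Comm.symm {f : B →ₗ[k] A} {g : M →ₗ[k] A} (h : Comm f g) : Comm g f :=
  fun x y => (h y x).symm

/-- Two linear maps intertwined by `u`. -/
theorem ev2_semiconj {f f' : B →ₗ[k] A} {l l' : M →ₗ[k] A} {u : A}
    (hf : ∀ x, SemiconjBy u (f x) (f' x)) (hl : ∀ x, SemiconjBy u (l x) (l' x)) (z : B ⊗[k] M) :
    SemiconjBy u (ev2 f l z) (ev2 f' l' z) := by
  induction z with
  | zero => simp
  | add x y hx hy => simp only [map_add]; exact hx.add_right hy
  | tmul x y => simp only [ev2_tmul]; exact (hf x).mul_right (hl y)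

theorem ev2_commute {f : B →ₗ[k] A} {l : M →ₗ[k] A} {u : A}
    (hf : ∀ x, Commute u (f x)) (hl : ∀ x, Commute u (l x)) (z : B ⊗[k] M) :
    Commute u (ev2 f l z) := ev2_semiconj hf hl z

theorem Comm.ev2_right {g : N →ₗ[k] A} {f : B →ₗ[k] A} {l : M →ₗ[k] A} (hf : Comm g f)
    (hl : Comm g l) : Comm g (ev2 f l) :=
  fun x z => ev2_commute (hf x) (hl x) z

theorem Comm.ev2_left {g : N →ₗ[k] A} {f : B →ₗ[k] A} {l : M →ₗ[k] A} (hf : Comm f g)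
    (hl : Comm l g) : Comm (ev2 f l) g :=
  (Comm.ev2_right hf.symm hl.symm).symm

theorem Comm.comp_right {g : N →ₗ[k] A} {f : B →ₗ[k] A} (h : Comm g f) (p : M →ₗ[k] B) :
    Comm g (f ∘ₗ p) := fun x y => h x (p y)

theorem Comm.comp_left {g : N →ₗ[k] A} {f : B →ₗ[k] A} (h : Comm f g) (p : M →ₗ[k] B) :
    Comm (f ∘ₗ p) g := fun x y => h (p x) y

/-- Commutation of the two images is what allows the inner factors of a product of pure tensors to
be interchanged. -/
theorem IsAlgHom.ev2 {f : B →ₗ[k] A} {l : M →ₗ[k] A} (hf : IsAlgHom f) (hl : IsAlgHom l)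
    (h : Comm f l) : IsAlgHom (ev2 f l) where
  map_one := by simp [Algebra.TensorProduct.one_def, hf.map_one, hl.map_one]
  map_mul z w := by
    induction z with
    | zero => simp
    | add x y hx hy => simp only [add_mul, map_add, hx, hy]
    | tmul x y =>
      induction w with
      | zero => simp
      | add x y hx hy => simp only [mul_add, map_add, hx, hy]
      | tmul a b =>
        simp only [Algebra.TensorProduct.tmul_mul_tmul, ev2_tmul, hf.map_mul, hl.map_mul]
        rw [mul_assoc, mul_assoc, ← mul_assoc (f a), (h a y).eq, mul_assoc]

theorem ev2_map {B' M' : Type*} [AddCommGroup B'] [Module k B'] [AddCommGroup M'] [Module k M']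
    (f : B →ₗ[k] A) (l : M →ₗ[k] A) (p : B' →ₗ[k] B) (q : M' →ₗ[k] M) (z : B' ⊗[k] M') :
    ev2 f l (TensorProduct.map p q z) = ev2 (f ∘ₗ p) (l ∘ₗ q) z := by
  induction z with
  | zero => simp
  | add x y hx hy => simp only [map_add, hx, hy]
  | tmul x y => simp

theorem ev2_algMap {B' M' : Type*} [Ring B'] [Algebra k B'] [Ring M'] [Algebra k M']
    (f : B →ₗ[k] A) (l : M →ₗ[k] A) (p : B' →ₐ[k] B) (q : M' →ₐ[k] M) (z : B' ⊗[k] M') :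
    ev2 f l (Algebra.TensorProduct.map p q z) = ev2 (f ∘ₗ p.toLinearMap) (l ∘ₗ q.toLinearMap) z :=
  ev2_map f l p.toLinearMap q.toLinearMap z

theorem comp_ev2 {A' : Type*} [Ring A'] [Algebra k A'] {φ : A →ₗ[k] A'} (hφ : IsAlgHom φ)
    (f : B →ₗ[k] A) (l : M →ₗ[k] A) : φ ∘ₗ ev2 f l = ev2 (φ ∘ₗ f) (φ ∘ₗ l) := by
  ext x y; simp [hφ.map_mul]

theorem ev2_includeRight (f : B →ₗ[k] A) (hf : f 1 = 1) (l : M →ₗ[k] A) (z : M) :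
    ev2 f l (Algebra.TensorProduct.includeRight z) = l z := by simp [hf]

theorem ev2_includeLeft (f : B →ₗ[k] A) (l : M →ₗ[k] A) (hl : l 1 = 1) (z : B) :
    ev2 f l (Algebra.TensorProduct.includeLeft (S := k) z) = f z := by simp [hl]

theorem ev2_one_right (f : B →ₗ[k] A) (l : M →ₗ[k] A) (hl : l 1 = 1) (z : B) :
    ev2 f l (z ⊗ₜ 1) = f z := by simp [hl]

/-- With this, an identity proved for arbitrary legs specializes to an identity in the tensor
product itself. -/
theorem ev2_include :
    ev2 (Algebra.TensorProduct.includeLeft (R := k) (S := k) (A := B) (B := M)).toLinearMap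
      (Algebra.TensorProduct.includeRight (R := k) (A := B) (B := M)).toLinearMap =
      LinearMap.id := by
  ext x y; simp

end Basic

/-! ### Convolution, and coactions as shifts -/

section Conv
variable {A B L : Type*} [Ring A] [Algebra k A] [Ring B] [Bialgebra k B] [Ring L] [Algebra k L]

/-- The convolution product of linear maps. -/
def conv (f g : B →ₗ[k] A) : B →ₗ[k] A := ev2 f g ∘ₗ Coalgebra.comul

/-- The unit for the convolution product. -/
def eps : B →ₗ[k] A := Algebra.linearMap k A ∘ₗ Coalgebra.counit

theorem eps_apply (x : B) :
    (eps : B →ₗ[k] A) x = algebraMap k A (Coalgebra.counit (R := k) x) := rfl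

theorem IsAlgHom.conv {f g : B →ₗ[k] A} (hf : IsAlgHom f) (hg : IsAlgHom g) (h : Comm f g) :
    IsAlgHom (conv f g) :=
  (hf.ev2 hg h).comp (isAlgHom_algHom (Bialgebra.comulAlgHom k B))

theorem Comm.conv_right {N : Type*} [Ring N] [Algebra k N] {f g : B →ₗ[k] A} {h : N →ₗ[k] A}
    (hf : Comm h f) (hg : Comm h g) : Comm h (DynRE.conv f g) :=
  (Comm.ev2_right hf hg).comp_right _

theorem Comm.conv_left {N : Type*} [Ring N] [Algebra k N] {f g : B →ₗ[k] A} {h : N →ₗ[k] A}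
    (hf : Comm f h) (hg : Comm g h) : Comm (DynRE.conv f g) h :=
  (Comm.ev2_left hf hg).comp_left _

/-- The dictionary between coproducts and convolution. Multiplicativity of the maps plays no role,
so it also serves for maps such as b ↦ b ▶ a. -/
theorem ev2_dDelta (f g : B →ₗ[k] A) (l : L →ₗ[k] A) (z : B ⊗[k] L) :
    ev2 f (ev2 g l) (dDelta z) = ev2 (conv f g) l z := by
  induction z with
  | zero => simp
  | add x y hx hy => simp only [map_add, hx, hy]
  | tmul x y =>
    simp only [dDelta, conv, AlgHom.comp_apply, Algebra.TensorProduct.map_tmul, ev2_tmul,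
      LinearMap.comp_apply, Bialgebra.comulAlgHom_apply]
    induction Coalgebra.comul (R := k) x with
    | zero => simp
    | add a b ha hb => simp only [TensorProduct.add_tmul, map_add, add_mul, ha, hb]
    | tmul a b => simp [mul_assoc]

theorem conv_assoc (f g h : B →ₗ[k] A) : conv (conv f g) h = conv f (conv g h) := by
  ext x
  have h1 := congrArg (ev2 f (ev2 g h)) (Coalgebra.coassoc_apply (R := k) x)
  have h2 := ev2_dDelta f g h (Coalgebra.comul (R := k) x)
  have h3 := ev2_map f (ev2 g h) LinearMap.id Coalgebra.comul (Coalgebra.comul (R := k) x)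
  exact h2.symm.trans (h1.trans h3)

theorem eps_conv (f : B →ₗ[k] A) : conv eps f = f := by
  ext x
  have : ∀ z : B ⊗[k] B, ev2 eps f z =
      f (TensorProduct.lid k B ((Coalgebra.counit (R := k)).rTensor B z)) := by
    intro z
    induction z with
    | zero => simp
    | add a b ha hb => simp only [map_add, ha, hb]
    | tmul a b => simp [eps_apply, Algebra.algebraMap_eq_smul_one]
  simp [conv, this]

theorem conv_eps (f : B →ₗ[k] A) : conv f eps = f := by
  ext x
  have : ∀ z : B ⊗[k] B, ev2 f eps z =
      f (TensorProduct.rid k B ((Coalgebra.counit (R := k)).lTensor B z)) := by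
    intro z
    induction z with
    | zero => simp
    | add a b ha hb => simp only [map_add, ha, hb]
    | tmul a b => simp [eps_apply, Algebra.algebraMap_eq_smul_one]
  simp [conv, this]

theorem conv_semiconj {f f' g g' : B →ₗ[k] A} {u : A}
    (hf : ∀ x, SemiconjBy u (f x) (f' x)) (hg : ∀ x, SemiconjBy u (g x) (g' x)) (x : B) :
    SemiconjBy u (conv f g x) (conv f' g' x) := ev2_semiconj hf hg _

theorem comp_conv {A' : Type*} [Ring A'] [Algebra k A'] {φ : A →ₗ[k] A'} (hφ : IsAlgHom φ)
    (f g : B →ₗ[k] A) : φ ∘ₗ conv f g = conv (φ ∘ₗ f) (φ ∘ₗ g) := by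
  rw [conv, ← LinearMap.comp_assoc, comp_ev2 hφ]; rfl

theorem conv_include : conv
    (Algebra.TensorProduct.includeLeft (R := k) (S := k) (A := B) (B := B)).toLinearMap
    (Algebra.TensorProduct.includeRight (R := k) (A := B) (B := B)).toLinearMap =
      Coalgebra.comul := by
  rw [conv, ev2_include, LinearMap.id_comp]

variable (δ : L →ₐ[k] B ⊗[k] L)

/-- The map `m ↦ f(m⁽¹⁾) l(m⁽∞⁾)`. -/
def shift (f : B →ₗ[k] A) (l : L →ₗ[k] A) : L →ₗ[k] A := ev2 f l ∘ₗ δ.toLinearMap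

theorem shift_apply (f : B →ₗ[k] A) (l : L →ₗ[k] A) (m : L) :
    shift δ f l m = ev2 f l (δ m) := rfl

theorem IsAlgHom.shift {f : B →ₗ[k] A} {l : L →ₗ[k] A} (hf : IsAlgHom f) (hl : IsAlgHom l)
    (h : Comm f l) : IsAlgHom (shift δ f l) :=
  (hf.ev2 hl h).comp (isAlgHom_algHom δ)

variable {δ} in
theorem Comm.shift_right {N : Type*} [Ring N] [Algebra k N] {f : B →ₗ[k] A} {l : L →ₗ[k] A}
    {h : N →ₗ[k] A} (hf : Comm h f) (hl : Comm h l) : Comm h (DynRE.shift δ f l) :=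
  (Comm.ev2_right hf hl).comp_right _

theorem shift_semiconj {f f' : B →ₗ[k] A} {l l' : L →ₗ[k] A} {u : A}
    (hf : ∀ x, SemiconjBy u (f x) (f' x)) (hl : ∀ x, SemiconjBy u (l x) (l' x)) (x : L) :
    SemiconjBy u (shift δ f l x) (shift δ f' l' x) := ev2_semiconj hf hl _

theorem ev2_coact (f : B →ₗ[k] A) (l : L →ₗ[k] A) {M : Type*} [Ring M] [Algebra k M]
    (g : M →ₗ[k] A) (z : M ⊗[k] L) :
    ev2 g (ev2 f l) (Algebra.TensorProduct.map (.id k M) δ z) = ev2 g (shift δ f l) z :=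
  ev2_algMap _ _ _ _ _

theorem comp_shift {A' : Type*} [Ring A'] [Algebra k A'] {φ : A →ₗ[k] A'} (hφ : IsAlgHom φ)
    (f : B →ₗ[k] A) (l : L →ₗ[k] A) :
    φ ∘ₗ shift δ f l = shift δ (φ ∘ₗ f) (φ ∘ₗ l) := by
  rw [shift, ← LinearMap.comp_assoc, comp_ev2 hφ]; rfl

/-- A coassociative and counital coaction of `B` on `L`, which is a homomorphism of algebras. -/
structure IsCoaction : Prop where
  coassoc : ∀ m, dDelta (δ m) = Algebra.TensorProduct.map (.id k B) δ (δ m)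
  counit : ∀ m, TensorProduct.lid k L ((Coalgebra.counit (R := k) (A := B)).rTensor L (δ m)) = m

variable {δ}


/-- This is coassociativity of the coaction in the language of legs. -/
theorem IsCoaction.shift_conv (hδ : IsCoaction δ) (f g : B →ₗ[k] A) (l : L →ₗ[k] A) :
    shift δ (conv f g) l = shift δ f (shift δ g l) := by
  ext m
  rw [shift_apply, ← ev2_dDelta, hδ.coassoc, ev2_coact]; rfl

theorem IsCoaction.shift_eps (hδ : IsCoaction δ) (l : L →ₗ[k] A) : shift δ eps l = l := by
  ext m
  have : ∀ z : B ⊗[k] L, ev2 eps l z =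
      l (TensorProduct.lid k L ((Coalgebra.counit (R := k)).rTensor L z)) := by
    intro z
    induction z with
    | zero => simp
    | add a b ha hb => simp only [map_add, ha, hb]
    | tmul a b => simp [eps_apply, Algebra.algebraMap_eq_smul_one]
  rw [shift_apply, this, hδ.counit]

end Conv
end Legs

end DynRE
end

noncomputable section
namespace DynRE

/-! ### The antipode and its inverse -/

section Antipode
variable {k U A : Type*} [Field k] [Ring U] [HopfAlgebra k U] [Ring A] [Algebra k A]

local notation "γ" => HopfAlgebra.antipode k (A := U)

theorem conv_antipode_right {f : U →ₗ[k] A} (hf : IsAlgHom f) : conv f (f ∘ₗ γ) = eps := by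
  have h := comp_conv hf LinearMap.id γ
  rw [LinearMap.comp_id] at h
  rw [← h]
  ext x
  have e : ∀ z : U ⊗[k] U, ev2 LinearMap.id γ z =
      LinearMap.mul' k U ((HopfAlgebra.antipode k).lTensor U z) := by
    intro z
    induction z with
    | zero => simp
    | add a b ha hb => simp only [map_add, ha, hb]
    | tmul a b => simp
  simp only [LinearMap.comp_apply, conv, e, HopfAlgebra.mul_antipode_lTensor_comul_apply]
  rw [eps_apply, Algebra.algebraMap_eq_smul_one, Algebra.algebraMap_eq_smul_one, map_smul,
    hf.map_one]

theorem conv_antipode_left {f : U →ₗ[k] A} (hf : IsAlgHom f) : conv (f ∘ₗ γ) f = eps := by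
  have h := comp_conv hf γ LinearMap.id
  rw [LinearMap.comp_id] at h
  rw [← h]
  ext x
  have e : ∀ z : U ⊗[k] U, ev2 γ LinearMap.id z =
      LinearMap.mul' k U ((HopfAlgebra.antipode k).rTensor U z) := by
    intro z
    induction z with
    | zero => simp
    | add a b ha hb => simp only [map_add, ha, hb]
    | tmul a b => simp
  simp only [LinearMap.comp_apply, conv, e, HopfAlgebra.mul_antipode_rTensor_comul_apply]
  rw [eps_apply, Algebra.algebraMap_eq_smul_one, Algebra.algebraMap_eq_smul_one, map_smul,
    hf.map_one]

/-- Both sides invert `conv f g` for convolution: the left one by telescoping, the right one because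
`conv f g` is again multiplicative. -/
theorem conv_comp_antipode {f g : U →ₗ[k] A} (hf : IsAlgHom f) (hg : IsAlgHom g)
    (hfg : Comm f g) : conv (g ∘ₗ γ) (f ∘ₗ γ) = conv f g ∘ₗ γ := by
  have h1 : conv (conv f g) (conv (g ∘ₗ γ) (f ∘ₗ γ)) = eps := by
    rw [conv_assoc, ← conv_assoc g, conv_antipode_right hg, eps_conv, conv_antipode_right hf]
  rw [← eps_conv (conv (g ∘ₗ γ) (f ∘ₗ γ)), ← conv_antipode_left (hf.conv hg hfg), conv_assoc, h1,
    conv_eps]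

/-- Take the two embeddings of `U` into `U ⊗ U` in `conv_comp_antipode`; their convolution is the
coproduct. -/
theorem comul_antipode (x : U) : Coalgebra.comul (R := k) (γ x) =
    TensorProduct.comm k U U (TensorProduct.map γ γ (Coalgebra.comul (R := k) x)) := by
  have h := conv_comp_antipode (k := k) (U := U)
    (isAlgHom_algHom (Algebra.TensorProduct.includeLeft (R := k) (S := k) (A := U) (B := U)))
    (isAlgHom_algHom (Algebra.TensorProduct.includeRight (R := k) (A := U) (B := U)))
    (fun x y => by simp [Commute, SemiconjBy])
  rw [conv_include] at h
  rw [← LinearMap.comp_apply, ← h]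
  simp only [conv, LinearMap.comp_apply]
  induction Coalgebra.comul (R := k) x with
  | zero => simp
  | add a b ha hb => simp only [map_add, ha, hb]
  | tmul a b => simp

variable (k U) in
/-- The antipode is invertible. -/
class InvertibleAntipode : Prop where
  isUnit : IsUnit (HopfAlgebra.antipode k (A := U) : Module.End k U)

/-- A quasitriangular Hopf algebra has an invertible antipode. -/
theorem UniversalRMatrix.invertibleAntipode (R : UniversalRMatrix k U) :
    InvertibleAntipode k U := by
  let m : U ⊗[k] U →ₗ[k] U := LinearMap.mul' k U ∘ₗ (TensorProduct.comm k U U).toLinearMap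
  let κ : U ⊗[k] U →ₗ[k] U := m ∘ₗ (γ).lTensor U
  have κ_tmul : ∀ a b : U, κ (a ⊗ₜ b) = γ b * a := fun a b => by simp [κ, m]
  -- Drinfeld's element u = γ(R₂) R₁. It implements the square of the antipode.
  let u : U := κ R.val
  have κ_mul : ∀ (z : U ⊗[k] U) (a b : U), κ (z * (a ⊗ₜ b)) = γ b * κ z * a := by
    intro z a b
    induction z with
    | zero => simp
    | add x y hx hy => simp only [add_mul, mul_add, map_add, hx, hy]
    | tmul x y =>
      simp only [Algebra.TensorProduct.tmul_mul_tmul, κ_tmul,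
        HopfAlgebra.antipode_mul_antidistrib, mul_assoc]
  let M : U ⊗[k] U →ₗ[k] Module.End k U := ev2 (LinearMap.mul k U ∘ₗ γ) (LinearMap.mul k U).flip ∘ₗ
    (TensorProduct.comm k U U).toLinearMap
  have M_tmul : ∀ a b c : U, M (a ⊗ₜ b) c = γ b * (c * a) := fun a b c => by simp [M]
  -- With w = Δ(x), the product γ(x₁) x₂ appears in the middle and reduces to ε(x).
  have κ_mul' : ∀ (z w : U ⊗[k] U), κ (TensorProduct.comm k U U w * z) =
      M z (LinearMap.mul' k U ((γ).rTensor U w)) := by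
    intro z w
    induction z with
    | zero => simp
    | add x y hx hy => simp only [mul_add, map_add, LinearMap.add_apply, hx, hy]
    | tmul x y =>
      induction w with
      | zero => simp
      | add x y hx hy => simp only [add_mul, map_add, hx, hy]
      | tmul a b => simp [κ_tmul, M_tmul, HopfAlgebra.antipode_mul_antidistrib, mul_assoc]
  have M_one : ∀ z : U ⊗[k] U, M z 1 = κ z := by
    intro z
    induction z with
    | zero => simp
    | add x y hx hy => simp only [map_add, LinearMap.add_apply, hx, hy]
    | tmul x y => simp [κ_tmul, M_tmul]
  -- `γ²(x) u = u x`
  have hu : ∀ x : U, γ (γ x) * u = u * x := by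
    intro x
    -- In the opposite algebra, left multiplication by γ(x) is multiplicative in `x`, so that the
    -- antipode axiom applies to it.
    let φ : U →ₗ[k] (Module.End k U)ᵐᵒᵖ :=
      (MulOpposite.opLinearEquiv k).toLinearMap ∘ₗ LinearMap.mul k U ∘ₗ γ
    let p : U →ₗ[k] (Module.End k U)ᵐᵒᵖ :=
      (MulOpposite.opLinearEquiv k).toLinearMap ∘ₗ (LinearMap.mul k U).flip
    have hφ : IsAlgHom φ :=
      ⟨MulOpposite.unop_injective (by ext; simp [φ]), fun x y => MulOpposite.unop_injective (by
        ext; simp [φ, HopfAlgebra.antipode_mul_antidistrib, mul_assoc])⟩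
    have h1 : conv (conv p φ) (φ ∘ₗ γ) = p := by
      rw [conv_assoc, conv_antipode_right hφ, conv_eps]
    have h2 : ∀ w : U ⊗[k] U, (ev2 p φ w).unop u = κ (R.val * w) := by
      intro w
      induction w with
      | zero => simp
      | add a b ha hb => simp only [mul_add, map_add, MulOpposite.unop_add, LinearMap.add_apply,
          ha, hb]
      | tmul a b => rw [κ_mul]; simp [φ, p, u, mul_assoc]
    -- γ(y₂) u y₁ = ε(y) u, obtained by moving R past the coproduct. A further multiplication by γ²
    -- of the last factor cancels γ(y₂).
    have h3 : ∀ y : U, (conv p φ y).unop u = algebraMap k U (Coalgebra.counit (R := k) y) * u := by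
      intro y
      refine (h2 _).trans ?_
      rw [R.comm, κ_mul', HopfAlgebra.mul_antipode_rTensor_comul_apply,
        Algebra.algebraMap_eq_smul_one, map_smul, M_one, smul_mul_assoc, one_mul]
    have h4 : ∀ z : U ⊗[k] U, (ev2 (conv p φ) (φ ∘ₗ γ) z).unop u =
        γ (γ (TensorProduct.lid k U ((Coalgebra.counit (R := k)).rTensor U z))) * u := by
      intro z
      induction z with
      | zero => simp
      | add a b ha hb => simp only [map_add, MulOpposite.unop_add, LinearMap.add_apply, add_mul,
          ha, hb]
      | tmul a b =>
        simp only [ev2_tmul, MulOpposite.unop_mul, Module.End.mul_apply, h3]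
        simp [φ, Algebra.algebraMap_eq_smul_one]
    have h5 := congrArg (fun a => a.unop u) (LinearMap.congr_fun h1 x)
    have h6 := h4 (Coalgebra.comul (R := k) x)
    simp at h6
    exact (h6.symm.trans h5)
  -- v = R₂ γ²(R₁) will be the inverse of u.
  let v : U := m ((γ ∘ₗ γ).rTensor U (R.val : U ⊗[k] U))
  have hγ : TensorProduct.map γ γ (↑R.val⁻¹ : U ⊗[k] U) = (↑R.val⁻¹ : U ⊗[k] U) := by
    have e : ∀ z : U ⊗[k] U, TensorProduct.map γ γ ((γ).rTensor U z) =
        (γ).rTensor U (TensorProduct.map γ γ z) := by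
      intro z
      induction z with
      | zero => simp
      | add x y hx hy => simp only [map_add, hx, hy]
      | tmul x y => simp
    rw [← R.rTensor_antipode, e, R.map_antipode]
  have huv : u * v = 1 := by
    have e : ∀ z : U ⊗[k] U, u * m ((γ ∘ₗ γ).rTensor U z) =
        κ (R.val * TensorProduct.map γ γ ((γ).rTensor U z)) := by
      intro z
      induction z with
      | zero => simp
      | add x y hx hy => simp only [map_add, mul_add, hx, hy]
      | tmul x y =>
        simp only [LinearMap.rTensor_tmul, TensorProduct.map_tmul, κ_mul]
        change _ = γ (γ y) * u * _
        rw [hu]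
        simp [m, mul_assoc]
    rw [e, R.rTensor_antipode, hγ, Units.mul_inv]
    simp [κ_tmul, Algebra.TensorProduct.one_def]
  have hvu : v * u = 1 := by
    let N : U ⊗[k] U →ₗ[k] Module.End k U :=
      ev2 (LinearMap.mul k U) (LinearMap.mul k U).flip ∘ₗ (TensorProduct.comm k U U).toLinearMap
    have e : ∀ z : U ⊗[k] U, m ((γ ∘ₗ γ).rTensor U z) * u = N z u := by
      intro z
      induction z with
      | zero => simp
      | add x y hx hy => simp only [map_add, add_mul, LinearMap.add_apply, hx, hy]
      | tmul x y =>
        have : m ((γ ∘ₗ γ).rTensor U (x ⊗ₜ y)) = y * γ (γ x) := by simp [m]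
        rw [this, mul_assoc, hu]
        simp [N]
    have e2 : ∀ z w : U ⊗[k] U, m (TensorProduct.lift (((LinearMap.mul k (U ⊗[k] U)).compl₁₂
        (LinearMap.mulRight k w ∘ₗ
          (Algebra.TensorProduct.includeLeft (R := k) (S := k) (A := U) (B := U)).toLinearMap)
        ((Algebra.TensorProduct.includeRight (R := k) (A := U) (B := U)).toLinearMap ∘ₗ γ))) z) =
        N w (κ z) := by
      intro z w
      induction z with
      | zero => simp
      | add x y hx hy => simp only [map_add, hx, hy]
      | tmul x y =>
        induction w with
        | zero => simp
        | add a b ha hb =>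
          simp only [map_add, LinearMap.add_apply, ← ha, ← hb]
          simp [mul_add]
        | tmul a b => simp [N, κ_tmul, m, mul_assoc]
    -- By `hu`, v u = R₂ u R₁, and this is `sandwich_self` multiplied out in opposite order.
    refine (e _).trans ((e2 R.val R.val).symm.trans ?_)
    have h := R.sandwich_self
    rw [UniversalRMatrix.sandwich] at h
    rw [h]
    simp [m, Algebra.TensorProduct.one_def]
  refine ⟨(Module.End.isUnit_iff _).2 ⟨?_, ?_⟩⟩
  · rw [injective_iff_map_eq_zero]
    intro x hx
    have h := hu x
    rw [hx, map_zero, zero_mul] at h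
    rw [← one_mul x, ← hvu, mul_assoc, ← h, mul_zero]
  · intro x
    -- γ²(v x u) u = u v x u = x u, and u can be cancelled.
    refine ⟨γ (v * x * u), ?_⟩
    have h := hu (v * x * u)
    rw [← mul_one (γ (γ _)), ← huv, ← mul_assoc, h, mul_assoc v, ← mul_assoc u, huv, one_mul,
      mul_assoc, huv, mul_one]

section Inverse
variable [InvertibleAntipode k U]

local notation "γ'" => antipodeInv k U

theorem antipodeInv_antipode (x : U) : γ' (γ x) = x := by
  have h := Ring.inverse_mul_cancel _ (InvertibleAntipode.isUnit (k := k) (U := U))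
  exact LinearMap.congr_fun h x

theorem antipode_antipodeInv (x : U) : γ (γ' x) = x := by
  have h := Ring.mul_inverse_cancel _ (InvertibleAntipode.isUnit (k := k) (U := U))
  exact LinearMap.congr_fun h x

theorem antipodeInv_mul (x y : U) : γ' (x * y) = γ' y * γ' x := by
  rw [← antipode_antipodeInv (k := k) x, ← antipode_antipodeInv (k := k) y,
    ← HopfAlgebra.antipode_mul_antidistrib]
  simp only [antipodeInv_antipode]

theorem antipodeInv_one : γ' 1 = 1 := by
  conv_lhs => rw [← HopfAlgebra.antipode_one (R := k) (A := U), antipodeInv_antipode]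

theorem counit_antipodeInv (x : U) :
    Coalgebra.counit (R := k) (γ' x) = Coalgebra.counit (R := k) x := by
  conv_rhs => rw [← antipode_antipodeInv (k := k) x, HopfAlgebra.counit_antipode]

theorem comul_antipodeInv (x : U) : Coalgebra.comul (R := k) (γ' x) =
    TensorProduct.comm k U U (TensorProduct.map γ' γ' (Coalgebra.comul (R := k) x)) := by
  conv_rhs => rw [← antipode_antipodeInv (k := k) x, comul_antipode]
  induction Coalgebra.comul (R := k) (γ' x) with
  | zero => simp
  | add a b ha hb => simp only [map_add, ← ha, ← hb]
  | tmul a b => simp [antipodeInv_antipode]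

/-- The inverse antipode reverses the coproduct as well; since `f` and `g` commute, the reversal
only exchanges the two maps. -/
theorem conv_comp_antipodeInv {f g : U →ₗ[k] A} (hfg : Comm f g) :
    conv (g ∘ₗ γ') (f ∘ₗ γ') = conv f g ∘ₗ γ' := by
  ext x
  simp only [conv, LinearMap.comp_apply, comul_antipodeInv]
  induction Coalgebra.comul (R := k) x with
  | zero => simp
  | add a b ha hb => simp only [map_add, ha, hb]
  | tmul a b => simpa using (hfg _ _).eq.symm

end Inverse

end Antipode
end DynRE
end

noncomputable section
namespace DynRE

/-! ### Dynamical twists evaluated at legs -/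

section Cocycle
variable {k : Type*} [Field k]

/-- The linear map `x ⊗ (y ⊗ m) ↦ f(x) g(y) l(m)`. -/
abbrev ev3 {B C M A : Type*} [AddCommGroup B] [Module k B] [AddCommGroup C] [Module k C]
    [AddCommGroup M] [Module k M] [Ring A] [Algebra k A]
    (f : B →ₗ[k] A) (g : C →ₗ[k] A) (l : M →ₗ[k] A) : B ⊗[k] (C ⊗[k] M) →ₗ[k] A :=
  ev2 f (ev2 g l)

section Defs
variable {B L A : Type*} [Ring B] [Bialgebra k B] [Ring L] [Algebra k L] [Ring A] [Algebra k A]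

/-- Three pairwise commuting algebra homomorphisms. -/
structure Legs3 (f g : B →ₗ[k] A) (l : L →ₗ[k] A) : Prop where
  hf : IsAlgHom f
  hg : IsAlgHom g
  hl : IsAlgHom l
  fg : Comm f g
  fl : Comm f l
  gl : Comm g l

theorem Legs3.hom {f g : B →ₗ[k] A} {l : L →ₗ[k] A} (h : Legs3 f g l) : IsAlgHom (ev3 f g l) :=
  h.hf.ev2 (h.hg.ev2 h.hl h.gl) (h.fg.ev2_right h.fl)

theorem Legs3.swap {f g : B →ₗ[k] A} {l : L →ₗ[k] A} (h : Legs3 f g l) : Legs3 g f l :=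
  ⟨h.hg, h.hf, h.hl, h.fg.symm, h.gl, h.fl⟩

/-- Four pairwise commuting algebra homomorphisms. -/
structure Legs4 (f g h : B →ₗ[k] A) (l : L →ₗ[k] A) : Prop where
  hf : IsAlgHom f
  hg : IsAlgHom g
  hh : IsAlgHom h
  hl : IsAlgHom l
  fg : Comm f g
  fh : Comm f h
  fl : Comm f l
  gh : Comm g h
  gl : Comm g l
  hl' : Comm h l

variable {f g h : B →ₗ[k] A} {l : L →ₗ[k] A} (δ : L →ₐ[k] B ⊗[k] L)

theorem Legs4.drop (H : Legs4 f g h l) : Legs3 g h l := ⟨H.hg, H.hh, H.hl, H.gh, H.gl, H.hl'⟩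

theorem Legs4.drop2 (H : Legs4 f g h l) : Legs3 f h l := ⟨H.hf, H.hh, H.hl, H.fh, H.fl, H.hl'⟩

theorem Legs4.convL (H : Legs4 f g h l) : Legs3 (conv f g) h l :=
  ⟨H.hf.conv H.hg H.fg, H.hh, H.hl, H.fh.conv_left H.gh, H.fl.conv_left H.gl, H.hl'⟩

theorem Legs4.convR (H : Legs4 f g h l) : Legs3 f (conv g h) l :=
  ⟨H.hf, H.hg.conv H.hh H.gh, H.hl, H.fg.conv_right H.fh, H.fl, H.gl.conv_left H.hl'⟩

theorem Legs4.shift (H : Legs4 f g h l) : Legs3 f g (DynRE.shift δ h l) :=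
  ⟨H.hf, H.hg, H.hh.shift δ H.hl H.hl', H.fg, H.fh.shift_right H.fl, H.gh.shift_right H.gl⟩

theorem Legs4.swap (H : Legs4 f g h l) : Legs4 g f h l :=
  ⟨H.hg, H.hf, H.hh, H.hl, H.fg.symm, H.gh, H.gl, H.fh, H.fl, H.hl'⟩

theorem Legs4.swap' (H : Legs4 f g h l) : Legs4 f h g l :=
  ⟨H.hf, H.hh, H.hg, H.hl, H.fh, H.fg, H.fl, H.gh.symm, H.hl', H.gl⟩

/-- A dynamical twist over a comodule algebra `L`: the property of being invariant enters only
through the commutation with the coaction. -/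
structure DynCocycle where
  val : (B ⊗[k] (B ⊗[k] L))ˣ
  comm : ∀ m, Commute (val : B ⊗[k] (B ⊗[k] L)) (dDelta (δ m))
  cocycle : dDelta (val : B ⊗[k] (B ⊗[k] L)) *
      Algebra.TensorProduct.map (.id k B) (Algebra.TensorProduct.map (.id k B) δ)
        (val : B ⊗[k] (B ⊗[k] L)) =
    Algebra.TensorProduct.map (.id k B) dDelta (val : B ⊗[k] (B ⊗[k] L)) *
      Algebra.TensorProduct.includeRight (val : B ⊗[k] (B ⊗[k] L))
  counit_left : Algebra.TensorProduct.lid k (B ⊗[k] L)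
    (Algebra.TensorProduct.map (Bialgebra.counitAlgHom k B) (.id k (B ⊗[k] L))
      (val : B ⊗[k] (B ⊗[k] L))) = 1
  counit_right : Algebra.TensorProduct.map (.id k B)
    ((Algebra.TensorProduct.lid k L).toAlgHom.comp
      (Algebra.TensorProduct.map (Bialgebra.counitAlgHom k B) (.id k L)))
      (val : B ⊗[k] (B ⊗[k] L)) = 1

variable {δ} (F : DynCocycle δ)

/-- The value of the twist at three legs. -/
def DynCocycle.ev (f g : B →ₗ[k] A) (l : L →ₗ[k] A) : A := ev3 f g l F.val

/-- The value of the inverse of the twist at three legs. -/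
def DynCocycle.inv (f g : B →ₗ[k] A) (l : L →ₗ[k] A) : A := ev3 f g l (↑F.val⁻¹ : B ⊗[k] (B ⊗[k] L))

/-- The value of the twist as a unit. -/
def DynCocycle.unit (H : Legs3 f g l) : Aˣ :=
  ⟨F.ev f g l, F.inv f g l, H.hom.map_inv' _, H.hom.map_inv _⟩

theorem DynCocycle.ev_comm (H : Legs3 f g l) (m : L) :
    Commute (F.ev f g l) (shift δ (conv f g) l m) := by
  rw [shift_apply, ← ev2_dDelta]
  exact H.hom.map_commute (F.comm m)

theorem DynCocycle.inv_comm (H : Legs3 f g l) (m : L) :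
    Commute (F.inv f g l) (shift δ (conv f g) l m) :=
  Commute.units_inv_left (u := F.unit H) (F.ev_comm H m)

/-- The tensor equation F_{(12)3} F_{12|3} = F_{1(23)} F_{23} at four commuting legs: brackets
become `conv` and the bar becomes `shift`. This is the form in which the twist is used below, mostly
at operator legs. -/
theorem DynCocycle.ev_cocycle (H : Legs4 f g h l) :
    F.ev (conv f g) h l * F.ev f g (shift δ h l) = F.ev f (conv g h) l * F.ev g h l := by
  have e := congrArg (ev2 f (ev3 g h l)) F.cocycle
  have hm := H.hf.ev2 H.drop.hom (H.fg.ev2_right (H.fh.ev2_right H.fl))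
  rw [hm.map_mul, hm.map_mul, ev2_dDelta, ev2_algMap, ev2_algMap, ev2_includeRight _ H.hf.map_one]
    at e
  have e1 : ev3 g h l ∘ₗ (Algebra.TensorProduct.map (.id k B) δ).toLinearMap =
      ev2 g (shift δ h l) := by
    ext1; ext x m; simp [shift]
  have e2 : ev3 g h l ∘ₗ (dDelta : B ⊗[k] L →ₐ[k] _).toLinearMap = ev2 (conv g h) l :=
    LinearMap.ext fun z => ev2_dDelta g h l z
  rw [e1, e2] at e
  exact e

/-- `F̄_{1(23)} = F_{23} F̄_{12|3} F̄_{(12)3}` -/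
theorem DynCocycle.inv_eq (H : Legs4 f g h l) :
    F.inv f (conv g h) l = F.ev g h l * (F.inv f g (shift δ h l) * F.inv (conv f g) h l) := by
  have e : F.unit H.convL * F.unit (H.shift δ) = F.unit H.convR * F.unit H.drop :=
    Units.ext (F.ev_cocycle H)
  have : (F.unit H.convR)⁻¹ = F.unit H.drop * ((F.unit (H.shift δ))⁻¹ * (F.unit H.convL)⁻¹) := by
    rw [← mul_inv_rev, e, mul_inv_rev]; simp
  exact congrArg Units.val this

/-- `F̄_{12|3} F̄_{(12)3} = F̄_{23} F̄_{1(23)}` -/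
theorem DynCocycle.inv_cocycle (H : Legs4 f g h l) :
    F.inv f g (shift δ h l) * F.inv (conv f g) h l = F.inv g h l * F.inv f (conv g h) l := by
  have e : F.unit H.convL * F.unit (H.shift δ) = F.unit H.convR * F.unit H.drop :=
    Units.ext (F.ev_cocycle H)
  have := congrArg (fun u => (u⁻¹ : Aˣ)) e
  simp only [mul_inv_rev] at this
  exact congrArg Units.val this

/-- `F_{12|3} F̄_{23} = F̄_{(12)3} F_{1(23)}` -/
theorem DynCocycle.ev_mul_inv (H : Legs4 f g h l) :
    F.ev f g (shift δ h l) * F.inv g h l = F.inv (conv f g) h l * F.ev f (conv g h) l := by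
  have e : F.unit H.convL * F.unit (H.shift δ) = F.unit H.convR * F.unit H.drop :=
    Units.ext (F.ev_cocycle H)
  have : F.unit (H.shift δ) * (F.unit H.drop)⁻¹ = (F.unit H.convL)⁻¹ * F.unit H.convR := by
    rw [mul_inv_eq_iff_eq_mul, mul_assoc, ← e]; simp
  exact congrArg Units.val this

theorem DynCocycle.lid_counit_inv : Algebra.TensorProduct.lid k (B ⊗[k] L)
    (Algebra.TensorProduct.map (Bialgebra.counitAlgHom k B) (.id k (B ⊗[k] L))
      (↑F.val⁻¹ : B ⊗[k] (B ⊗[k] L))) = 1 :=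
  map_units_inv_eq_one ((Algebra.TensorProduct.lid k (B ⊗[k] L)).toAlgHom.comp
    (Algebra.TensorProduct.map (Bialgebra.counitAlgHom k B) (.id k (B ⊗[k] L)))) F.val F.counit_left

theorem DynCocycle.rid_counit_inv : Algebra.TensorProduct.map (.id k B)
    ((Algebra.TensorProduct.lid k L).toAlgHom.comp
      (Algebra.TensorProduct.map (Bialgebra.counitAlgHom k B) (.id k L)))
      (↑F.val⁻¹ : B ⊗[k] (B ⊗[k] L)) = 1 :=
  map_units_inv_eq_one _ F.val F.counit_right

end Defs

/-! ### Left and right multiplications as legs -/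

section Operators
variable {U L A : Type*} [Ring U] [HopfAlgebra k U] [Ring L] [Algebra k L] [Ring A] [Algebra k A]

/-- Left multiplication by `f(x)`. -/
def lop {B : Type*} [AddCommGroup B] [Module k B] (f : B →ₗ[k] A) : B →ₗ[k] Module.End k A :=
  LinearMap.mul k A ∘ₗ f

/-- Right multiplication by `f(x)`. -/
def rmul (f : U →ₗ[k] A) : U →ₗ[k] Module.End k A := (LinearMap.mul k A).flip ∘ₗ f

/-- Right multiplication by `f(γ⁻¹(x))`. -/
def rop (f : U →ₗ[k] A) : U →ₗ[k] Module.End k A :=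
  (LinearMap.mul k A).flip ∘ₗ f ∘ₗ antipodeInv k U

@[simp] theorem lop_apply {B : Type*} [AddCommGroup B] [Module k B] (f : B →ₗ[k] A) (x : B)
    (b : A) : lop f x b = f x * b := rfl

@[simp] theorem rmul_apply (f : U →ₗ[k] A) (x : U) (b : A) : rmul f x b = b * f x := rfl

@[simp] theorem rop_apply (f : U →ₗ[k] A) (x : U) (b : A) :
    rop f x b = b * f (antipodeInv k U x) := rfl

theorem isAlgHom_lmul : IsAlgHom (LinearMap.mul k A) :=
  ⟨by ext; simp, fun x y => by ext; simp [mul_assoc]⟩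

theorem isAlgHom_lop {B : Type*} [Ring B] [Algebra k B] {f : B →ₗ[k] A} (hf : IsAlgHom f) :
    IsAlgHom (lop f) := isAlgHom_lmul.comp hf

theorem ev2_lop {B C : Type*} [Ring B] [Algebra k B] [Ring C] [Algebra k C]
    (f : B →ₗ[k] A) (g : C →ₗ[k] A) : ev2 (lop f) (lop g) = lop (ev2 f g) :=
  (comp_ev2 isAlgHom_lmul f g).symm

theorem conv_lop (f g : U →ₗ[k] A) : conv (lop f) (lop g) = lop (conv f g) :=
  (comp_conv isAlgHom_lmul f g).symm

theorem shift_lop (δ : L →ₐ[k] U ⊗[k] L) (f : U →ₗ[k] A) (l : L →ₗ[k] A) :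
    shift δ (lop f) (lop l) = lop (shift δ f l) :=
  (comp_shift δ isAlgHom_lmul f l).symm

theorem Comm.lop {B C : Type*} [Ring B] [Algebra k B] [Ring C] [Algebra k C]
    {f : B →ₗ[k] A} {g : C →ₗ[k] A} (h : Comm f g) : Comm (DynRE.lop f) (DynRE.lop g) :=
  fun x y => isAlgHom_lmul.map_commute (h x y)

/-- Associativity alone gives this, so `rop f` and `lop f` can serve together as commuting legs even
when `f` does not commute with itself. -/
theorem comm_rop_lop {C : Type*} [Ring C] [Algebra k C] (f : U →ₗ[k] A) (g : C →ₗ[k] A) :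
    Comm (rop f) (lop g) := fun x y => by
  rw [Commute, SemiconjBy]; ext b; simp [mul_assoc]

theorem comm_lop_rop {C : Type*} [Ring C] [Algebra k C] (g : C →ₗ[k] A) (f : U →ₗ[k] A) :
    Comm (lop g) (rop f) := (comm_rop_lop f g).symm

theorem Comm.rop {f g : U →ₗ[k] A} (h : Comm f g) : Comm (DynRE.rop f) (DynRE.rop g) :=
  fun x y => by
    rw [Commute, SemiconjBy]; ext b; simp [mul_assoc, (h _ _).eq]

variable [InvertibleAntipode k U]

/-- Right multiplication and the inverse antipode each reverse the order of factors. -/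
theorem isAlgHom_rop {f : U →ₗ[k] A} (hf : IsAlgHom f) : IsAlgHom (rop f) :=
  ⟨by ext; simp [antipodeInv_one, hf.map_one], fun x y => by
    ext; simp [antipodeInv_mul, hf.map_mul, mul_assoc]⟩

theorem conv_rop_rop {f g : U →ₗ[k] A} (h : Comm f g) :
    conv (rop g) (rop f) = rop (conv f g) := by
  ext x b
  have e : ∀ z : U ⊗[k] U, ev2 (rop g) (rop f) z b =
      b * ev2 (g ∘ₗ antipodeInv k U) (f ∘ₗ antipodeInv k U) z := by
    intro z
    induction z with
    | zero => simp
    | add x y hx hy => simp only [map_add, LinearMap.add_apply, mul_add, hx, hy]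
    | tmul x y => simp [mul_assoc, (h _ _).eq]
  have h2 := LinearMap.congr_fun (conv_comp_antipodeInv h) x
  exact (e _).trans (congrArg (b * ·) h2)

/-- The inverse antipode applied to γ(x₁) x₂ = ε(x). It serves to undo a right multiplication `rop
f`. -/
theorem conv_rmul_rop {f : U →ₗ[k] A} (hf : IsAlgHom f) : conv (rmul f) (rop f) = eps := by
  ext x b
  have e : ∀ z : U ⊗[k] U, ev2 (rmul f) (rop f) z b =
      b * f (antipodeInv k U (LinearMap.mul' k U ((HopfAlgebra.antipode k).rTensor U z))) := by
    intro z
    induction z with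
    | zero => simp
    | add x y hx hy => simp only [map_add, LinearMap.add_apply, mul_add, hx, hy]
    | tmul x y => simp [mul_assoc, antipodeInv_mul, antipodeInv_antipode, hf.map_mul]
  refine (e _).trans ?_
  rw [HopfAlgebra.mul_antipode_rTensor_comul_apply, Algebra.algebraMap_eq_smul_one, map_smul,
    antipodeInv_one, map_smul, hf.map_one, eps_apply, Algebra.algebraMap_eq_smul_one]
  simp

/-- Once b is moved to the left, this is the inverse antipode applied to x₁ γ(x₂) = ε(x). It is the
collapse that makes a leg split into `rop f` and `lop f` disappear from twists and R-matrices. -/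
theorem conv_rop_lop {f : U →ₗ[k] A} (hf : IsAlgHom f) (x : U) (b : A)
    (hb : ∀ y, Commute b (f y)) :
    conv (rop f) (lop f) x b = Coalgebra.counit (R := k) x • b := by
  have e : ∀ z : U ⊗[k] U, ev2 (rop f) (lop f) z b =
      b * f (antipodeInv k U (LinearMap.mul' k U ((HopfAlgebra.antipode k).lTensor U z))) := by
    intro z
    induction z with
    | zero => simp
    | add x y hx hy => simp only [map_add, LinearMap.add_apply, mul_add, hx, hy]
    | tmul x y =>
      simp [← mul_assoc, antipodeInv_mul, antipodeInv_antipode, hf.map_mul, (hb _).eq]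
  refine (e _).trans ?_
  rw [HopfAlgebra.mul_antipode_lTensor_comul_apply, Algebra.algebraMap_eq_smul_one, map_smul,
    antipodeInv_one, map_smul, hf.map_one]
  simp

end Operators
end Cocycle
end DynRE
end

noncomputable section
namespace DynRE

/-! ### The contraction ζ of the inverse twist -/

section Zeta
variable {k U L A : Type*} [Field k] [Ring U] [HopfAlgebra k U] [Ring L] [Algebra k L]
  [Ring A] [Algebra k A]

variable (k U L) in
/-- `x ⊗ (y ⊗ m) ↦ y γ⁻¹(x) ⊗ m` -/
def contr : U ⊗[k] (U ⊗[k] L) →ₗ[k] U ⊗[k] L :=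
  (LinearMap.mul' k U ∘ₗ (TensorProduct.comm k U U).toLinearMap ∘ₗ
    (antipodeInv k U).rTensor U).rTensor L ∘ₗ (TensorProduct.assoc k U U L).symm.toLinearMap

theorem contr_tmul (x y : U) (m : L) :
    contr k U L (x ⊗ₜ (y ⊗ₜ m)) = (y * antipodeInv k U x) ⊗ₜ m := by simp [contr]

variable {δ : L →ₐ[k] U ⊗[k] L} (F : DynCocycle δ)

/-- `ζ = F̄₂ γ⁻¹(F̄₁) ⊗ F̄_L` -/
def DynCocycle.zeta : U ⊗[k] L := contr k U L (↑F.val⁻¹ : U ⊗[k] (U ⊗[k] L))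

/-- Induction on elements of `M ⊗ (N ⊗ P)`. -/
theorem tensor3_induction {M N P : Type*} [AddCommGroup M] [Module k M] [AddCommGroup N]
    [Module k N] [AddCommGroup P] [Module k P] {p : M ⊗[k] (N ⊗[k] P) → Prop} (h0 : p 0)
    (hadd : ∀ x y, p x → p y → p (x + y)) (h : ∀ x y m, p (x ⊗ₜ (y ⊗ₜ m)))
    (z : M ⊗[k] (N ⊗[k] P)) : p z := by
  induction z with
  | zero => exact h0
  | add x y hx hy => exact hadd x y hx hy
  | tmul x w =>
    induction w with
    | zero => simpa using h0
    | add a b ha hb => rw [TensorProduct.tmul_add]; exact hadd _ _ ha hb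
    | tmul a b => exact h x a b

/-- Linear maps on `M ⊗ (N ⊗ P)` that agree on pure tensors are equal. -/
theorem tensor3_ext {M N P Q : Type*} [AddCommGroup M] [Module k M] [AddCommGroup N]
    [Module k N] [AddCommGroup P] [Module k P] [AddCommGroup Q] [Module k Q]
    {p q : M ⊗[k] (N ⊗[k] P) →ₗ[k] Q} (h : ∀ x y m, p (x ⊗ₜ (y ⊗ₜ m)) = q (x ⊗ₜ (y ⊗ₜ m)))
    (z : M ⊗[k] (N ⊗[k] P)) : p z = q z := by
  induction z using tensor3_induction with
  | h0 => simp
  | hadd x y hx hy => simp only [map_add, hx, hy]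
  | h x y m => exact h x y m

variable {f g : U →ₗ[k] A} {l : L →ₗ[k] A}

/-- The right factor f(γ̄(x)) passes b and l(m) and lands directly behind f(y), which is the
contraction in ζ. -/
theorem ev3_contr (hf : IsAlgHom f) (fl : Comm f l) (b : A) (hb : ∀ y, Commute b (f y))
    (z : U ⊗[k] (U ⊗[k] L)) :
    ev3 (rop f) (lop f) (lop l) z b = ev2 f l (contr k U L z) * b := by
  induction z using tensor3_induction with
  | h0 => simp
  | hadd x y hx hy => simp only [map_add, LinearMap.add_apply, add_mul, hx, hy]
  | h x y m =>
    simp only [contr_tmul, ev2_tmul, Module.End.mul_apply, rop_apply, lop_apply, hf.map_mul,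
      mul_assoc, (hb _).eq]
    rw [← mul_assoc (l m), ← (fl _ _).eq, mul_assoc]

/-- Evaluation of a leg which acts by the counit. -/
theorem ev3_counit_left {P : U →ₗ[k] Module.End k A} {g : U →ₗ[k] A} (b : A)
    (hP : ∀ x y m, P x (g y * (l m * b)) = Coalgebra.counit (R := k) x • (g y * (l m * b)))
    (z : U ⊗[k] (U ⊗[k] L)) : ev3 P (lop g) (lop l) z b =
      ev2 g l (Algebra.TensorProduct.lid k (U ⊗[k] L)
        (Algebra.TensorProduct.map (Bialgebra.counitAlgHom k U) (.id k (U ⊗[k] L)) z)) * b := by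
  induction z using tensor3_induction with
  | h0 => simp
  | hadd x y hx hy => simp only [map_add, LinearMap.add_apply, add_mul, hx, hy]
  | h x y m => simp [hP, mul_assoc]

theorem ev3_counit_right {P : U →ₗ[k] Module.End k A} {g : U →ₗ[k] A} (b : A)
    (hP : ∀ x m, P x (l m * b) = Coalgebra.counit (R := k) x • (l m * b))
    (z : U ⊗[k] (U ⊗[k] L)) : ev3 (lop g) P (lop l) z b =
      ev2 g l (Algebra.TensorProduct.map (.id k U)
    ((Algebra.TensorProduct.lid k L).toAlgHom.comp
      (Algebra.TensorProduct.map (Bialgebra.counitAlgHom k U) (.id k L))) z) * b := by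
  induction z using tensor3_induction with
  | h0 => simp
  | hadd x y hx hy => simp only [map_add, LinearMap.add_apply, add_mul, hx, hy]
  | h x y m => simp [hP, mul_assoc]

theorem shift_counit (hδ : IsCoaction δ) {P : U →ₗ[k] Module.End k A} (b : A)
    (hP : ∀ x m, P x (l m * b) = Coalgebra.counit (R := k) x • (l m * b)) (m : L) :
    shift δ P (lop l) m b = l m * b := by
  have e : ∀ z : U ⊗[k] L, ev2 P (lop l) z b = ev2 eps l z * b := by
    intro z
    induction z with
    | zero => simp
    | add x y hx hy => simp only [map_add, LinearMap.add_apply, add_mul, hx, hy]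
    | tmul x y => simp [hP, eps_apply, Algebra.algebraMap_eq_smul_one]
  rw [shift_apply, e]
  have := LinearMap.congr_fun (hδ.shift_eps l) m
  exact congrArg (· * b) this

/-- The source of all identities for ζ: it is a value of the inverse twist, so relations of the
twist at these operator legs, applied to a vector, are relations of ζ. -/
theorem inv_ops_one (hf : IsAlgHom f) (fl : Comm f l) (b : A) (hb : ∀ y, Commute b (f y)) :
    F.inv (rop f) (lop f) (lop l) b = ev2 f l F.zeta * b := ev3_contr hf fl b hb _

variable [InvertibleAntipode k U]

theorem Legs3.ops (H : Legs3 f g l) : Legs4 (rop f) (lop f) (lop g) (lop l) :=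
  ⟨isAlgHom_rop H.hf, isAlgHom_lop H.hf, isAlgHom_lop H.hg, isAlgHom_lop H.hl, comm_rop_lop _ _,
    comm_rop_lop _ _, comm_rop_lop _ _, H.fg.lop, H.fl.lop, H.gl.lop⟩

/-- `F̄_{(12)3}` acts trivially if `(12)` is contracted. -/
theorem inv_conv_ops (H : Legs3 f g l) : F.inv (conv (rop f) (lop f)) (lop g) (lop l) 1 = 1 := by
  refine (ev3_counit_left 1 (fun x y m => conv_rop_lop H.hf x _ fun u => ?_) _).trans ?_
  · rw [mul_one]; exact ((H.fg u y).mul_right (H.fl u m)).symm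
  · rw [F.lid_counit_inv, Algebra.TensorProduct.one_def, ev2_tmul, H.hg.map_one, H.hl.map_one]
    simp

/-- The contraction of the first two legs of `F̄_{1(23)}` is `F ζ_{1|2}`. -/
theorem inv_contract (H : Legs3 f g l) : F.inv (rop f) (lop (conv f g)) (lop l) 1 =
    F.ev f g l * ev2 f (shift δ g l) F.zeta := by
  -- The identity F̄_{1(23)} = F_{23} F̄_{12|3} F̄_{(12)3} is applied to 1: the last factor fixes 1,
  -- and the middle one then produces ζ_{1|2}.
  rw [← conv_lop, F.inv_eq H.ops, Module.End.mul_apply, Module.End.mul_apply, inv_conv_ops F H,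
    shift_lop, inv_ops_one F H.hf (H.fg.shift_right H.fl) 1 (fun y => Commute.one_left _), mul_one]
  have : F.ev (lop f) (lop g) (lop l) = LinearMap.mul k A (F.ev f g l) := by
    rw [DynCocycle.ev, ev3, ev2_lop, ev2_lop]; rfl
  rw [this]; rfl

/-- `ζ` commutes with the image of the coaction. -/
theorem zeta_comm (hδ : IsCoaction δ) (hf : IsAlgHom f) (hl : IsAlgHom l) (fl : Comm f l) (m : L) :
    Commute (ev2 f l F.zeta) (shift δ f l m) := by
  have Hops : Legs3 (rop f) (lop f) (lop l) := ⟨isAlgHom_rop hf, isAlgHom_lop hf, isAlgHom_lop hl,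
    comm_rop_lop _ _, comm_rop_lop _ _, fl.lop⟩
  -- In Sweedler notation m⁽²⁾ m⁽∞⁾ ζ γ̄(m⁽¹⁾) = ζ m, from the commutation of F̄ with the coaction,
  -- applied to 1.
  have h1 : ∀ m, shift δ (rop f) (shift δ (lop f) (lop l)) m (ev2 f l F.zeta) =
      ev2 f l F.zeta * l m := by
    intro m
    have e := LinearMap.congr_fun (F.inv_comm Hops m).eq 1
    simp only [Module.End.mul_apply] at e
    rw [shift_counit hδ 1 (fun x m => conv_rop_lop hf x _ fun u => by
        rw [mul_one]; exact (fl u m).symm),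
      inv_ops_one F hf fl 1 (fun y => Commute.one_left _), mul_one, mul_one,
      inv_ops_one F hf fl _ (fun y => (fl _ _).symm), hδ.shift_conv] at e
    exact e.symm
  -- One more coaction leg, multiplied from the right, removes γ̄ in the relation `h1`.
  have h2 : shift δ (rmul f) (shift δ (rop f) (shift δ (lop f) (lop l))) =
      shift δ (lop f) (lop l) := by
    rw [← hδ.shift_conv, conv_rmul_rop hf, hδ.shift_eps]
  have h3 : ∀ z : U ⊗[k] L, ev2 (rmul f) (shift δ (rop f) (shift δ (lop f) (lop l))) z
      (ev2 f l F.zeta) = ev2 f l F.zeta * ev2 f l z := by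
    intro z
    induction z with
    | zero => simp
    | add x y hx hy => simp only [map_add, LinearMap.add_apply, mul_add, hx, hy]
    | tmul x y => simp [h1, mul_assoc, (fl _ _).eq]
  have h4 := LinearMap.congr_fun (LinearMap.congr_fun h2 m) (ev2 f l F.zeta)
  exact (h3 (δ m)).symm.trans (h4.trans (by rw [shift_lop]; rfl))

/-- `(Δ ⊗ id)(ζ⁻¹) F ζ_{1|2} ζ_2`, in terms of the inverse of `F` and the inverse antipode. -/
def DynCocycle.antip (f g : U →ₗ[k] A) (l : L →ₗ[k] A) : A :=
  F.inv (rop g) (rop f) (lop (shift δ (conv f g) l)) 1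

/-- The identity F̄_{12|3} F̄_{(12)3} = F̄_{23} F̄_{1(23)} at the legs `rop g`, `rop f`, `lop (conv
f g)`, `lop l`, applied to 1. On one side the first factor to act gives ζ with its leg in `U` split
by the coproduct, and the next gives `antip`. On the other side ζ₂ is produced first, and then F
ζ_{1|2} by `inv_contract`. -/
theorem zeta_mul (hδ : IsCoaction δ) (H : Legs3 f g l) :
    F.ev f g l * ev2 f (shift δ g l) F.zeta * ev2 g l F.zeta =
      ev2 (conv f g) l F.zeta * F.antip f g l := by
  have cfl : Comm (conv f g) l := H.fl.conv_left H.gl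
  have hfg : IsAlgHom (conv f g) := H.hf.conv H.hg H.fg
  have Hops : Legs4 (rop g) (rop f) (lop (conv f g)) (lop l) :=
    ⟨isAlgHom_rop H.hg, isAlgHom_rop H.hf, isAlgHom_lop hfg, isAlgHom_lop H.hl, H.fg.symm.rop,
      comm_rop_lop _ _, comm_rop_lop _ _, comm_rop_lop _ _, comm_rop_lop _ _, cfl.lop⟩
  have e := LinearMap.congr_fun (F.inv_cocycle Hops) 1
  simp only [Module.End.mul_apply] at e
  -- the right-hand side
  have r1 : F.inv (rop g) (conv (rop f) (lop (conv f g))) (lop l) 1 = ev2 g l F.zeta := by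
    have : F.inv (rop g) (conv (rop f) (lop (conv f g))) (lop l) 1 =
        F.inv (rop g) (lop g) (lop l) 1 := by
      unfold DynCocycle.inv
      generalize (↑F.val⁻¹ : U ⊗[k] (U ⊗[k] L)) = z
      induction z using tensor3_induction with
      | h0 => simp
      | hadd x y hx hy => simp only [map_add, LinearMap.add_apply, hx, hy]
      | h x y m =>
        simp only [ev2_tmul, Module.End.mul_apply]
        congr 1
        have e2 : ∀ w : U ⊗[k] U, ev2 (conv (rop f) (lop f)) (lop g) w (lop l m 1) =
            ev2 eps (lop g) w (lop l m 1) := by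
          intro w
          induction w with
          | zero => simp
          | add x y hx hy => simp only [map_add, LinearMap.add_apply, hx, hy]
          | tmul x y =>
            simp only [ev2_tmul, Module.End.mul_apply]
            rw [conv_rop_lop H.hf, eps_apply, Algebra.algebraMap_eq_smul_one]
            · rfl
            · intro u
              simp only [lop_apply, mul_one]
              exact ((H.fg u y).mul_right (H.fl u m)).symm
        -- Regrouping brings `rop f` next to `lop f`, where the pair reduces to the counit and only
        -- `lop g` is left.
        rw [← conv_lop, ← conv_assoc]
        refine (e2 _).trans ?_
        exact LinearMap.congr_fun (LinearMap.congr_fun (eps_conv (lop g)) y) _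
    rw [this, inv_ops_one F H.hg H.gl 1 (fun y => Commute.one_left _), mul_one]
  have r2 : F.inv (rop f) (lop (conv f g)) (lop l) (ev2 g l F.zeta) =
      F.inv (rop f) (lop (conv f g)) (lop l) 1 * ev2 g l F.zeta := by
    unfold DynCocycle.inv
    generalize (↑F.val⁻¹ : U ⊗[k] (U ⊗[k] L)) = z
    induction z using tensor3_induction with
    | h0 => simp
    | hadd x y hx hy => simp only [map_add, LinearMap.add_apply, add_mul, hx, hy]
    | h x y m =>
      have : ∀ x, Commute (f x) (ev2 g l F.zeta) := fun x => ev2_commute (H.fg x) (H.fl x) _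
      simp [mul_assoc, (this _).eq]
  -- the left-hand side
  have l1 : F.inv (conv (rop g) (rop f)) (lop (conv f g)) (lop l) 1 =
      ev2 (conv f g) l F.zeta := by
    rw [conv_rop_rop H.fg, inv_ops_one F hfg cfl 1 (fun y => Commute.one_left _), mul_one]
  have l2 : F.inv (rop g) (rop f) (lop (shift δ (conv f g) l)) (ev2 (conv f g) l F.zeta) =
      ev2 (conv f g) l F.zeta * F.antip f g l := by
    unfold DynCocycle.antip
    -- The third leg is shifted by `conv f g`, exactly the coaction with which this value of ζ
    -- commutes, so ζ can be pulled out to the left.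
    have hc := zeta_comm F hδ hfg H.hl cfl
    generalize ev2 (conv f g) l F.zeta = w at hc
    unfold DynCocycle.inv
    generalize (↑F.val⁻¹ : U ⊗[k] (U ⊗[k] L)) = z
    induction z using tensor3_induction with
    | h0 => simp
    | hadd x y hx hy => simp only [map_add, LinearMap.add_apply, mul_add, hx, hy]
    | h x y m => simp [← mul_assoc, (hc m).eq]
  rw [l1, shift_lop, l2, r1, r2, inv_contract F H] at e
  exact e.symm

end Zeta
end DynRE
end

noncomputable section
namespace DynRE

/-! ### Invertibility of ζ -/

section ZetaInv
variable {k U L A : Type*} [Field k] [Ring U] [HopfAlgebra k U] [Ring L] [Algebra k L]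
  [Ring A] [Algebra k A]
  {δ : L →ₐ[k] U ⊗[k] L} (F : DynCocycle δ) {f g : U →ₗ[k] A} {l : L →ₗ[k] A}

variable (k) in
/-- The embedding of the left factor, as a linear map. -/
abbrev inl (B M : Type*) [Ring B] [Algebra k B] [Ring M] [Algebra k M] : B →ₗ[k] B ⊗[k] M :=
  (Algebra.TensorProduct.includeLeft (R := k) (S := k) (A := B) (B := M)).toLinearMap

variable (k) in
/-- The embedding of the right factor, as a linear map. -/
abbrev inr (B M : Type*) [Ring B] [Algebra k B] [Ring M] [Algebra k M] : M →ₗ[k] B ⊗[k] M :=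
  (Algebra.TensorProduct.includeRight (R := k) (A := B) (B := M)).toLinearMap

section Incl
variable {B M : Type*} [Ring B] [Algebra k B] [Ring M] [Algebra k M]

theorem isAlgHom_inl : IsAlgHom (inl k B M) := isAlgHom_algHom _

theorem isAlgHom_inr : IsAlgHom (inr k B M) := isAlgHom_algHom _

theorem comm_inl_inr : Comm (inl k B M) (inr k B M) := fun x y => by
  simp [Commute, SemiconjBy]

end Incl

theorem legs3_incl {B M : Type*} [Ring B] [Bialgebra k B] [Ring M] [Algebra k M] : Legs3 (inl k B (B ⊗[k] M)) (inr k B (B ⊗[k] M) ∘ₗ inl k B M)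
    (inr k B (B ⊗[k] M) ∘ₗ inr k B M) :=
  ⟨isAlgHom_inl, isAlgHom_inr.comp isAlgHom_inl, isAlgHom_inr.comp isAlgHom_inr,
    comm_inl_inr.comp_right _, comm_inl_inr.comp_right _,
    fun x y => isAlgHom_inr.map_commute (comm_inl_inr x y)⟩

/-- The right factor `F_L⁽¹⁾ γ⁻¹(F₂) F₁ ⊗ F_L⁽∞⁾`, up to a left factor `w`. -/
def zetaInvAux (w : U ⊗[k] L) : U ⊗[k] L :=
  ev3 (rmul (inl k U L)) (rop (inl k U L)) (lop δ.toLinearMap) (F.val : U ⊗[k] (U ⊗[k] L)) w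

theorem shift_incl : shift δ (inl k U L) (inr k U L) = δ.toLinearMap := by
  rw [shift, ev2_include, LinearMap.id_comp]

theorem ev2_incl (z : U ⊗[k] L) : ev2 (inl k U L) (inr k U L) z = z := by
  rw [ev2_include]; rfl

variable [InvertibleAntipode k U]

theorem zeta_comm_coact (hδ : IsCoaction δ) (m : L) : Commute F.zeta (δ m) := by
  have h := zeta_comm F hδ (isAlgHom_inl (k := k) (B := U) (M := L)) isAlgHom_inr comm_inl_inr m
  rwa [shift_incl, ev2_incl] at h

/-- Only the coaction of F_L stands to the left of the argument, and ζ commutes with it. -/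
theorem zetaInvAux_eq (hδ : IsCoaction δ) : zetaInvAux F F.zeta = F.zeta * zetaInvAux F 1 := by
  have hc := zeta_comm_coact F hδ
  unfold zetaInvAux
  generalize F.zeta = w at hc
  generalize (F.val : U ⊗[k] (U ⊗[k] L)) = z
  induction z using tensor3_induction with
  | h0 => simp
  | hadd x y hx hy => simp only [map_add, LinearMap.add_apply, mul_add, hx, hy]
  | h x y m => simp only [ev2_tmul, Module.End.mul_apply, rmul_apply, rop_apply, lop_apply,
      mul_one, ← mul_assoc, AlgHom.toLinearMap_apply, (hc m).eq]

/-- `x ⊗ w ↦ w x` -/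
def foldR : U ⊗[k] (U ⊗[k] L) →ₗ[k] U ⊗[k] L := TensorProduct.lift (rmul (inl k U L))

omit [InvertibleAntipode k U] in
theorem foldR_ev2 {C : Type*} [Ring C] [Algebra k C]
    {Q : C →ₗ[k] Module.End k (U ⊗[k] (U ⊗[k] L))} {Q' : C →ₗ[k] Module.End k (U ⊗[k] L)}
    (hQ : ∀ y w, Q y (1 ⊗ₜ w) = 1 ⊗ₜ (Q' y w)) (z : U ⊗[k] C) (w : U ⊗[k] L) :
    foldR (ev2 (lop (inl k U (U ⊗[k] L))) Q z (1 ⊗ₜ w)) = ev2 (rmul (inl k U L)) Q' z w := by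
  induction z with
  | zero => simp
  | add x y hx hy => simp only [map_add, LinearMap.add_apply, hx, hy]
  | tmul x y => simp [hQ, foldR]

omit [InvertibleAntipode k U] in
theorem one_tmul_ev2 {A B C : Type*} [Ring A] [Algebra k A] [Ring B] [Algebra k B] [Ring C]
    [Algebra k C] {P : B →ₗ[k] Module.End k (U ⊗[k] A)} {P' : B →ₗ[k] Module.End k A}
    {Q : C →ₗ[k] Module.End k (U ⊗[k] A)} {Q' : C →ₗ[k] Module.End k A}
    (hP : ∀ y w, P y (1 ⊗ₜ w) = 1 ⊗ₜ (P' y w))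
    (hQ : ∀ y w, Q y (1 ⊗ₜ w) = 1 ⊗ₜ (Q' y w)) (z : B ⊗[k] C) (w : A) :
    ev2 P Q z (1 ⊗ₜ w) = 1 ⊗ₜ (ev2 P' Q' z w) := by
  induction z with
  | zero => simp
  | add x y hx hy => simp only [map_add, LinearMap.add_apply, TensorProduct.tmul_add, hx, hy]
  | tmul x y => simp [hP, hQ]

/-- The identity F_{12|3} F̄_{23} = F̄_{(12)3} F_{1(23)} at `lop p`, `rop g`, `lop g`, `lop l`,
applied to 1, where `p` is an extra copy of `U`. Multiplying this copy in from the right (`foldR`)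
turns the left side into `zetaInvAux` of ζ, while the right side collapses to 1. -/
theorem zeta_mul_inv (hδ : IsCoaction δ) : F.zeta * zetaInvAux F 1 = 1 := by
  rw [← zetaInvAux_eq F hδ]
  let j := inr k U (U ⊗[k] L)
  let p := inl k U (U ⊗[k] L)
  have H : Legs3 p (j ∘ₗ inl k U L) (j ∘ₗ inr k U L) := legs3_incl
  set g := j ∘ₗ inl k U L
  set l := j ∘ₗ inr k U L
  have Hops : Legs4 (lop p) (rop g) (lop g) (lop l) :=
    ⟨isAlgHom_lop H.hf, isAlgHom_rop H.hg, isAlgHom_lop H.hg, isAlgHom_lop H.hl,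
      comm_lop_rop _ _, H.fg.lop, H.fl.lop, comm_rop_lop _ _, comm_rop_lop _ _, H.gl.lop⟩
  have e := LinearMap.congr_fun (F.ev_mul_inv Hops) 1
  simp only [Module.End.mul_apply] at e
  -- The pair (23) is contracted, so only the normalization of the twist in its second leg remains.
  have e1 : F.ev (lop p) (conv (rop g) (lop g)) (lop l) 1 = 1 := by
    refine (ev3_counit_right 1 (fun x m => conv_rop_lop H.hg x _ fun u => ?_) _).trans ?_
    · rw [mul_one]; exact (H.gl u m).symm
    · rw [F.counit_right, Algebra.TensorProduct.one_def, ev2_tmul, H.hf.map_one, H.hl.map_one]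
      simp
  rw [e1, inv_ops_one F H.hg H.gl 1 (fun y => Commute.one_left _), mul_one, shift_lop] at e
  have ez : ev2 g l F.zeta = j F.zeta := by
    rw [← comp_ev2 isAlgHom_inr, LinearMap.comp_apply, ev2_incl]
  have es : shift δ g l = j ∘ₗ δ.toLinearMap := by
    rw [← comp_shift δ isAlgHom_inr, shift_incl]
  rw [ez, es] at e
  have hrop : ∀ y w, rop g y (1 ⊗ₜ w) = 1 ⊗ₜ (rop (inl k U L) y w) := fun y w => by
    simp [g, j]
  have e2 := foldR_ev2 (one_tmul_ev2 (P := rop g) (P' := rop (inl k U L))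
    (Q := lop (j ∘ₗ δ.toLinearMap)) (Q' := lop δ.toLinearMap) hrop
    (fun y w => by simp [j])) F.val F.zeta
  have e3 : ∀ x w, foldR (conv (lop p) (rop g) x (1 ⊗ₜ w)) =
      conv (rmul (inl k U L)) (rop (inl k U L)) x w := fun x w => foldR_ev2 hrop _ w
  -- After folding, the pair (12) consists of `rmul` and `rop`, which cancel, and the normalization
  -- of F̄ in its first leg finishes.
  have e4 : foldR (F.inv (conv (lop p) (rop g)) (lop g) (lop l) 1) = 1 := by
    have e5 := ev3_counit_left (g := inl k U L) (l := inr k U L) (P := eps) 1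
      (fun x y m => by rw [eps_apply, Algebra.algebraMap_eq_smul_one]; rfl)
      (↑F.val⁻¹ : U ⊗[k] (U ⊗[k] L))
    rw [F.lid_counit_inv, Algebra.TensorProduct.one_def, ev2_tmul,
      ← conv_rmul_rop (isAlgHom_inl (k := k) (B := U) (M := L)), ← Algebra.TensorProduct.one_def]
      at e5
    refine Eq.trans ?_ (e5.trans (by rw [isAlgHom_inl.map_one, isAlgHom_inr.map_one]; simp))
    unfold DynCocycle.inv
    generalize (↑F.val⁻¹ : U ⊗[k] (U ⊗[k] L)) = z
    induction z using tensor3_induction with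
    | h0 => simp
    | hadd x y hx hy => simp only [map_add, LinearMap.add_apply, hx, hy]
    | h x y m =>
      simp only [ev2_tmul, Module.End.mul_apply]
      rw [← e3]
      congr 2
      simp [g, l, j]
  exact e2.symm.trans ((congrArg foldR e).trans e4)

/-- `x ⊗ w ↦ γ⁻¹(x) w` -/
def foldL : U ⊗[k] (U ⊗[k] L) →ₗ[k] U ⊗[k] L :=
  TensorProduct.lift (lop (inl k U L ∘ₗ antipodeInv k U))

/-- `x ⊗ m ↦ m⁽¹⁾ x ⊗ m⁽∞⁾` -/
def coactMul (δ : L →ₐ[k] U ⊗[k] L) : U ⊗[k] L →ₗ[k] U ⊗[k] L :=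
  TensorProduct.lift (((LinearMap.mul k (U ⊗[k] L)).compl₁₂ δ.toLinearMap (inl k U L)).flip)

/-- Start from `inv_contract`, with the second leg in an extra copy of `U`. The inverse antipode of
that copy is multiplied in from the left (`foldL`), and then the coaction of the `L`-component
(`coactMul`). The side with F̄ becomes 1, the side with F ζ_{1|2} becomes the product sought. -/
theorem inv_mul_zeta (hδ : IsCoaction δ) : zetaInvAux F 1 * F.zeta = 1 := by
  let j := inr k U (U ⊗[k] L)
  let p := inl k U (U ⊗[k] L)
  have H : Legs3 (j ∘ₗ inl k U L) p (j ∘ₗ inr k U L) := legs3_incl.swap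
  set f := j ∘ₗ inl k U L
  set l := j ∘ₗ inr k U L
  have e := inv_contract F H
  -- `foldL` contracts the two parts of the split leg to a counit, and the second-leg normalization
  -- of F̄ applies.
  have e1 : foldL (F.inv (rop f) (lop (conv f p)) (lop l) 1) = 1 := by
    have e2 : ∀ (t : U ⊗[k] U) (w : U ⊗[k] L), foldL (ev2 f p t * (1 ⊗ₜ w)) = inl k U L
        (antipodeInv k U (LinearMap.mul' k U ((HopfAlgebra.antipode k).rTensor U t))) * w := by
      intro t w
      induction t with
      | zero => simp
      | add x y hx hy => simp only [map_add, add_mul, hx, hy]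
      | tmul x y =>
        have : (antipodeInv k U y * x) ⊗ₜ[k] (1 : L) =
          (antipodeInv k U y ⊗ₜ 1) * (x ⊗ₜ 1) := by simp
        simp [f, p, j, foldL, antipodeInv_mul, antipodeInv_antipode]
        rw [this, mul_assoc]
    have e3 : ∀ d w, foldL (conv f p d * (1 ⊗ₜ w)) = Coalgebra.counit (R := k) d • w := by
      intro d w
      refine (e2 _ w).trans ?_
      rw [HopfAlgebra.mul_antipode_rTensor_comul_apply, Algebra.algebraMap_eq_smul_one, map_smul,
        map_smul, antipodeInv_one, isAlgHom_inl.map_one, smul_mul_assoc, one_mul]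
    have e4 : ∀ z : U ⊗[k] (U ⊗[k] L), foldL (ev3 (rop f) (lop (conv f p)) (lop l) z 1) =
        (antipodeInv k U).rTensor L (Algebra.TensorProduct.map (.id k U)
          ((Algebra.TensorProduct.lid k L).toAlgHom.comp
          (Algebra.TensorProduct.map (Bialgebra.counitAlgHom k U) (.id k L))) z) := by
      intro z
      induction z using tensor3_induction with
      | h0 => simp
      | hadd x y hx hy => simp only [map_add, LinearMap.add_apply, hx, hy]
      | h x y m =>
        have : l m * 1 * f (antipodeInv k U x) = 1 ⊗ₜ (inl k U L (antipodeInv k U x) * inr k U L m) :=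
          by simp [l, f, j]
        simp only [ev2_tmul, Module.End.mul_apply, lop_apply, rop_apply, mul_assoc] at this ⊢
        rw [this, e3]
        simp
    refine (e4 _).trans ?_
    rw [F.rid_counit_inv]
    simp [Algebra.TensorProduct.one_def, antipodeInv_one]
  have e2 : ∀ z w, coactMul δ (foldL (ev3 f p l z * ev2 f (shift δ p l) w)) =
      ev3 (rmul (inl k U L)) (rop (inl k U L)) (lop δ.toLinearMap) z 1 * w := by
    intro z w
    induction z using tensor3_induction with
    | h0 => simp
    | hadd x y hx hy => simp only [map_add, add_mul, LinearMap.add_apply, hx, hy]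
    | h a b m =>
    induction w with
    | zero => simp
    | add x y hx hy => simp only [map_add, mul_add, hx, hy]
    | tmul q n =>
      have e3 : ∀ t : U ⊗[k] L, coactMul δ (foldL (f a * (p b * l m) * (f q * ev2 p l t))) =
          δ m * ev2 (rop (inl k U L)) (lop δ.toLinearMap) t 1 *
            inl k U L (antipodeInv k U b * (a * q)) := by
        intro t
        induction t with
        | zero => simp
        | add x y hx hy => simp only [map_add, mul_add, add_mul, LinearMap.add_apply, hx, hy]
        | tmul u v => simp [f, p, l, j, foldL, coactMul, antipodeInv_mul, mul_assoc]
      -- The two successive coaction legs of the `L`-component of ζ, one of them carrying γ̄, cancel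
      -- here.
      have e4 := shift_counit hδ (P := conv (rop (inl k U L)) (lop (inl k U L))) (l := inr k U L) 1
        (fun x m => conv_rop_lop isAlgHom_inl x _ fun u => by
          rw [mul_one]; exact (comm_inl_inr u m).symm) n
      rw [hδ.shift_conv, shift_lop, shift_incl] at e4
      rw [ev2_tmul, ev2_tmul, ev2_tmul, shift_apply, e3]
      refine (congrArg (fun y => δ m * y * inl k U L (antipodeInv k U b * (a * q))) e4).trans ?_
      simp [mul_assoc]
  have e5 := (e2 F.val F.zeta).symm.trans ((congrArg (coactMul δ ∘ foldL) e.symm).trans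
    (congrArg (coactMul δ) e1))
  refine e5.trans ?_
  simp [coactMul, Algebra.TensorProduct.one_def]

/-- `ζ` as a unit. -/
def DynCocycle.zetaUnit (hδ : IsCoaction δ) : (U ⊗[k] L)ˣ :=
  ⟨F.zeta, zetaInvAux F 1, zeta_mul_inv F hδ, inv_mul_zeta F hδ⟩

end ZetaInv
end DynRE
end

noncomputable section
namespace DynRE

/-! ### The dynamical R-matrix, its hexagon, and ζ -/

section RLegs
variable {k U L A : Type*} [Field k] [Ring U] [HopfAlgebra k U] [Ring L] [Algebra k L]
  [Ring A] [Algebra k A] (R : UniversalRMatrix k U)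
  {f g h : U →ₗ[k] A} {l : L →ₗ[k] A}

/-- The value of the R-matrix at two legs. -/
def UniversalRMatrix.ev (f g : U →ₗ[k] A) : A := ev2 f g (R.val : U ⊗[k] U)

/-- The value of the R-matrix as a unit. -/
def UniversalRMatrix.unit (hf : IsAlgHom f) (hg : IsAlgHom g) (fg : Comm f g) : Aˣ :=
  ⟨R.ev f g, ev2 f g (↑R.val⁻¹ : U ⊗[k] U), (hf.ev2 hg fg).map_inv' _, (hf.ev2 hg fg).map_inv _⟩

theorem UniversalRMatrix.ev_conv (hf : IsAlgHom f) (hg : IsAlgHom g) (fg : Comm f g) (x : U) :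
    SemiconjBy (R.ev f g) (conv f g x) (conv g f x) := by
  have e := congrArg (ev2 f g) (R.comm x)
  rw [(hf.ev2 hg fg).map_mul, (hf.ev2 hg fg).map_mul] at e
  have e2 : ∀ z : U ⊗[k] U, ev2 f g (TensorProduct.comm k U U z) = ev2 g f z := by
    intro z
    induction z with
    | zero => simp
    | add x y hx hy => simp only [map_add, hx, hy]
    | tmul x y => simp [(fg y x).eq]
  rw [e2] at e
  exact e

theorem UniversalRMatrix.ev_conv_right (hf : IsAlgHom f) (hg : IsAlgHom g) (hh : IsAlgHom h)
    (fg : Comm f g) (fh : Comm f h) (gh : Comm g h) :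
    R.ev f (conv g h) = R.ev f h * R.ev f g := by
  have hm := hf.ev2 (hg.ev2 hh gh) (fg.ev2_right fh)
  have e := congrArg (ev2 f (ev2 g h)) R.comul_right
  rw [hm.map_mul, ev2_algMap, ev2_algMap, ev2_algMap] at e
  have e1 : ev2 g h ∘ₗ (Algebra.TensorProduct.includeRight (R := k) (A := U) (B := U)).toLinearMap =
    h := LinearMap.ext fun z => ev2_includeRight g hg.map_one h z
  have e2 : ev2 g h ∘ₗ (Algebra.TensorProduct.includeLeft (R := k) (S := k) (A := U)
    (B := U)).toLinearMap = g := LinearMap.ext fun z => ev2_includeLeft g h hh.map_one z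
  rw [e1, e2] at e
  exact e

variable {δ : L →ₐ[k] U ⊗[k] L} (F : DynCocycle δ)

/-- The dynamical R-matrix `F₂₁⁻¹ R F`. -/
def DynCocycle.dyn : U ⊗[k] (U ⊗[k] L) :=
  Algebra.TensorProduct.leftComm k U U L (↑F.val⁻¹ : U ⊗[k] (U ⊗[k] L)) *
    Algebra.TensorProduct.map (.id k U) Algebra.TensorProduct.includeLeft
      (R.val : U ⊗[k] U) * (F.val : U ⊗[k] (U ⊗[k] L))

theorem ev3_leftComm (fg : Comm f g) (z : U ⊗[k] (U ⊗[k] L)) :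
    ev3 f g l (Algebra.TensorProduct.leftComm k U U L z) = ev3 g f l z := by
  induction z using tensor3_induction with
  | h0 => simp
  | hadd x y hx hy => simp only [map_add, hx, hy]
  | h x y m => simp [← mul_assoc, (fg y x).eq]

theorem ev_dyn (H : Legs3 f g l) :
    ev3 f g l (F.dyn R) = F.inv g f l * R.ev f g * F.ev f g l := by
  rw [DynCocycle.dyn, H.hom.map_mul, H.hom.map_mul, ev3_leftComm H.fg, ev2_algMap]
  have e : ev2 g l ∘ₗ (Algebra.TensorProduct.includeLeft (R := k) (S := k) (A := U)
    (B := L)).toLinearMap = g := LinearMap.ext fun z => ev2_includeLeft g l H.hl.map_one z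
  rw [e]; rfl

/-- The dynamical hexagon identity `F̄_{23|1} ℛ_{1(23)} = ℛ₁₃ ℛ_{12|3} F̄₂₃`. -/
theorem dyn_hexagon (H : Legs4 f g h l) :
    F.inv g h (shift δ f l) * ev3 f (conv g h) l (F.dyn R) =
      ev3 f h l (F.dyn R) * (ev3 f g (shift δ h l) (F.dyn R) * F.inv g h l) := by
  let r12 := R.unit H.hf H.hg H.fg
  let r13 := R.unit H.hf H.hh H.fh
  have H2 := H.swap
  have H3 := H2.swap'
  have e1 : F.unit H.convL * F.unit (H.shift δ) = F.unit H.convR * F.unit H.drop :=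
    Units.ext (F.ev_cocycle H)
  have e2 : F.unit H2.convL * F.unit (H2.shift δ) = F.unit H2.convR * F.unit H2.drop :=
    Units.ext (F.ev_cocycle H2)
  have e3 : F.unit H3.convL * F.unit (H3.shift δ) = F.unit H3.convR * F.unit H3.drop :=
    Units.ext (F.ev_cocycle H3)
  -- R moves through a twist by reversing a leg split by the coproduct.
  have s1 : r12 * F.unit H.convL = F.unit H2.convL * r12 := Units.ext <|
    ev2_semiconj (R.ev_conv H.hf H.hg H.fg) (fun z => ev2_commute
      (fun x => (Comm.ev2_left H.fh H.gh _ x)) (fun x => (Comm.ev2_left H.fl H.gl _ x)) z) _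
  have s2 : r13 * F.unit H2.convR = F.unit H3.convR * r13 := Units.ext <|
    ev2_semiconj (fun x => Comm.ev2_left H.fg H.gh.symm _ x) (fun z => ev2_semiconj
      (R.ev_conv H.hf H.hh H.fh) (fun x => (Comm.ev2_left H.fl H.hl' _ x)) z) _
  rw [ev_dyn R F H.convR, ev_dyn R F H.drop2, ev_dyn R F (H.shift δ),
    R.ev_conv_right H.hf H.hg H.hh H.fg H.fh H.gh]
  have key : (F.unit (H3.shift δ))⁻¹ * ((F.unit H3.convL)⁻¹ * (r13 * r12) * F.unit H.convR) =
      (F.unit H3.drop)⁻¹ * r13 * F.unit H2.drop * (((F.unit (H2.shift δ))⁻¹ * r12 *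
        F.unit (H.shift δ)) * (F.unit H.drop)⁻¹) := by
    -- Three instances of the cocycle identity, for the leg orders 123, 213 and 231.
    have a1 : F.unit H.convR = F.unit H.convL * F.unit (H.shift δ) * (F.unit H.drop)⁻¹ := by
      rw [e1]; simp
    have a2 : F.unit H2.convL = F.unit H2.convR * F.unit H2.drop * (F.unit (H2.shift δ))⁻¹ := by
      rw [← e2]; simp
    have a3 : F.unit H3.convR = F.unit H3.convL * F.unit (H3.shift δ) * (F.unit H3.drop)⁻¹ := by
      rw [e3]; simp
    calc _ = (F.unit (H3.shift δ))⁻¹ * ((F.unit H3.convL)⁻¹ * (r13 * (r12 * F.unit H.convL) *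
          F.unit (H.shift δ) * (F.unit H.drop)⁻¹)) := by rw [a1]; group
      _ = (F.unit (H3.shift δ))⁻¹ * ((F.unit H3.convL)⁻¹ * ((r13 * F.unit H2.convR) *
          F.unit H2.drop * (F.unit (H2.shift δ))⁻¹ * r12 *
          F.unit (H.shift δ) * (F.unit H.drop)⁻¹)) := by rw [s1, a2]; group
      _ = _ := by rw [s2, a3]; group
  exact congrArg Units.val key

variable [InvertibleAntipode k U]

/-- `ℛ₁ ⊗ ℛ_L⁽¹⁾ γ⁻¹(ℛ₂) ⊗ ℛ_L⁽∞⁾` -/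
def DynCocycle.gam (f g : U →ₗ[k] A) (l : L →ₗ[k] A) : A :=
  ev3 (lop f) (rop g) (lop (shift δ g l)) (F.dyn R) 1

/-- The hexagon at `lop f`, `rop g`, `lop g`, `lop l`, applied to 1. The factor ℛ_{1(23)} fixes 1
because the pair (23) is contracted, and each remaining F̄ becomes a ζ. The result trades a ζ whose
coaction leg lies in `f` for a ζ without it. -/
theorem zeta_shift (hδ : IsCoaction δ) (H : Legs3 f g l) :
    ev2 g (shift δ f l) F.zeta =
      F.inv g f l * R.ev f g * F.ev f g l * (ev2 g l F.zeta * F.gam R f g l) := by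
  have Hops : Legs4 (lop f) (rop g) (lop g) (lop l) :=
    ⟨isAlgHom_lop H.hf, isAlgHom_rop H.hg, isAlgHom_lop H.hg, isAlgHom_lop H.hl,
      comm_lop_rop _ _, H.fg.lop, H.fl.lop, comm_rop_lop _ _, comm_rop_lop _ _, H.gl.lop⟩
  have e := LinearMap.congr_fun (dyn_hexagon R F Hops) 1
  simp only [Module.End.mul_apply] at e
  have c1 : ev3 (lop f) (conv (rop g) (lop g)) (lop l) (F.dyn R) 1 = 1 := by
    rw [ev_dyn R F Hops.convR, Module.End.mul_apply, Module.End.mul_apply]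
    have d1 : F.ev (lop f) (conv (rop g) (lop g)) (lop l) 1 = 1 := by
      refine (ev3_counit_right 1 (fun x m => conv_rop_lop H.hg x _ fun u => ?_) _).trans ?_
      · rw [mul_one]; exact (H.gl u m).symm
      · rw [F.counit_right, Algebra.TensorProduct.one_def, ev2_tmul, H.hf.map_one, H.hl.map_one]
        simp
    have d2 : R.ev (lop f) (conv (rop g) (lop g)) 1 = 1 := by
      have : ∀ z : U ⊗[k] U, ev2 (lop f) (conv (rop g) (lop g)) z 1 = f (TensorProduct.rid k U
          (Algebra.TensorProduct.map (.id k U) (Bialgebra.counitAlgHom k U) z)) := by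
        intro z
        induction z with
        | zero => simp
        | add x y hx hy => simp only [map_add, LinearMap.add_apply, hx, hy]
        | tmul x y =>
          rw [ev2_tmul, Module.End.mul_apply, conv_rop_lop H.hg _ _ fun _ => Commute.one_left _]
          simp
      refine (this _).trans ?_
      rw [R.counit_right, Algebra.TensorProduct.one_def]
      simp [H.hf.map_one]
    rw [d1, d2, inv_conv_ops F H.swap]
  -- ζ commutes with its own coaction and with `f`, so it can be moved to the left of the contracted
  -- R-matrix.
  have c2 : ev3 (lop f) (rop g) (lop (shift δ g l)) (F.dyn R) (ev2 g l F.zeta) =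
      ev2 g l F.zeta * F.gam R f g l := by
    have hc := zeta_comm F hδ H.hg H.hl H.gl
    have hcf : ∀ x, Commute (f x) (ev2 g l F.zeta) := fun x => ev2_commute (H.fg x) (H.fl x) _
    unfold DynCocycle.gam
    generalize ev2 g l F.zeta = w at hc hcf
    generalize F.dyn R = z
    induction z using tensor3_induction with
    | h0 => simp
    | hadd x y hx hy => simp only [map_add, LinearMap.add_apply, mul_add, hx, hy]
    | h x y m =>
      simp only [ev2_tmul, Module.End.mul_apply, lop_apply, rop_apply, mul_one]
      rw [← mul_assoc w, ← (hcf x).eq, ← (hc m).eq]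
      simp only [mul_assoc]
  have c3 : ev3 (lop f) (lop g) (lop l) (F.dyn R) =
      LinearMap.mul k A (F.inv g f l * R.ev f g * F.ev f g l) := by
    rw [← ev_dyn R F H, ev3, ev2_lop, ev2_lop]; rfl
  rw [c1, inv_ops_one F H.hg H.gl 1 fun _ => Commute.one_left _, mul_one, shift_lop, shift_lop,
    inv_ops_one F H.hg (H.fg.symm.shift_right H.gl) 1 fun _ => Commute.one_left _, mul_one, c2,
    c3] at e
  exact e

/-- `F̄_L⁽¹⁾ …`: the contraction which defines `antip`, applied to the dynamical R-matrix. -/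
def DynCocycle.gam2 (f g : U →ₗ[k] A) (l : L →ₗ[k] A) : A :=
  ev3 (rop g) (rop f) (lop (shift δ (conv f g) l)) (F.dyn R) 1

omit [InvertibleAntipode k U] in
/-- The image of a unit under a unital multiplicative linear map. -/
def IsAlgHom.unit {B A : Type*} [Ring B] [Algebra k B] [Ring A] [Algebra k A] {f : B →ₗ[k] A}
    (hf : IsAlgHom f) (u : Bˣ) : Aˣ :=
  ⟨f u, f (↑u⁻¹ : B), hf.map_inv' u, hf.map_inv u⟩

/-- The value of `ζ` at two legs, as a unit. -/
def DynCocycle.zunit (hδ : IsCoaction δ) (hf : IsAlgHom f) (hl : IsAlgHom l) (fl : Comm f l) :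
    Aˣ := (hf.ev2 hl fl).unit (F.zetaUnit hδ)

theorem antip_eq (hδ : IsCoaction δ) (H : Legs3 f g l) : F.antip f g l =
    ↑((F.zunit hδ (H.hf.conv H.hg H.fg) H.hl (H.fl.conv_left H.gl))⁻¹ * (F.unit
      ⟨H.hf, H.hg, H.hl, H.fg, H.fl, H.gl⟩ *
      F.zunit hδ H.hf (H.hg.shift δ H.hl H.gl) (H.fg.shift_right H.fl) *
      F.zunit hδ H.hg H.hl H.gl)) := by
  rw [Units.val_mul, eq_comm, Units.inv_mul_eq_iff_eq_mul]
  exact zeta_mul F hδ H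

theorem isUnit_antip (hδ : IsCoaction δ) (H : Legs3 f g l) : IsUnit (F.antip f g l) := by
  rw [antip_eq F hδ H]; exact Units.isUnit _

/-- Each factor of the expression in `antip_eq` commutes with the coaction through `conv f g`. -/
theorem antip_comm (hδ : IsCoaction δ) (H : Legs3 f g l) (m : L) :
    Commute (F.antip f g l) (shift δ (conv f g) l m) := by
  have cfl : Comm (conv f g) l := H.fl.conv_left H.gl
  rw [antip_eq F hδ H, Units.val_mul, Units.val_mul, Units.val_mul]
  refine Commute.mul_left (Commute.units_inv_left
    (zeta_comm F hδ (H.hf.conv H.hg H.fg) H.hl cfl m)) (Commute.mul_left (Commute.mul_left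
      (F.ev_comm H m) ?_) ?_)
  · rw [hδ.shift_conv]
    exact zeta_comm F hδ H.hf (H.hg.shift δ H.hl H.gl) (H.fg.shift_right H.fl) m
  · rw [hδ.shift_conv]
    exact ev2_commute (fun x => (ev2_commute (H.fg x) (H.fl x) _).symm)
      (fun x => zeta_comm F hδ H.hg H.hl H.gl x) _

/-- Write the dynamical R-matrix as F̄₂₁ R F and let it act on `antip`, which is F̄ at the same
operator legs applied to 1. Then F cancels F̄, R survives because it is invariant under γ ⊗ γ, and
F̄₂₁ gives the flipped `antip`. -/
theorem antip_mul_gam2 (hδ : IsCoaction δ) (H : Legs3 f g l) :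
    F.antip f g l * F.gam2 R f g l = R.ev g f * F.antip g f l := by
  have cfl : Comm (conv f g) l := H.fl.conv_left H.gl
  have hs : IsAlgHom (shift δ (conv f g) l) := (H.hf.conv H.hg H.fg).shift δ H.hl cfl
  have Hops : Legs3 (rop g) (rop f) (lop (shift δ (conv f g) l)) :=
    ⟨isAlgHom_rop H.hg, isAlgHom_rop H.hf, isAlgHom_lop hs, H.fg.symm.rop, comm_rop_lop _ _,
      comm_rop_lop _ _⟩
  -- The third leg commutes with `antip`, so a left factor `antip` can be moved into the argument of
  -- the operator.
  have hC : ∀ z b, F.antip f g l * ev3 (rop g) (rop f) (lop (shift δ (conv f g) l)) z b =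
      ev3 (rop g) (rop f) (lop (shift δ (conv f g) l)) z (F.antip f g l * b) := by
    intro z b
    induction z using tensor3_induction with
    | h0 => simp
    | hadd x y hx hy => simp only [map_add, LinearMap.add_apply, mul_add, hx, hy]
    | h x y m => simp [← mul_assoc, (antip_comm F hδ H m).eq]
  have hR : R.ev (rop g) (rop f) 1 = R.ev g f := by
    have e : ∀ z : U ⊗[k] U, ev2 (rop g) (rop f) (TensorProduct.map (HopfAlgebra.antipode k)
        (HopfAlgebra.antipode k) z) 1 = ev2 g f z := by
      intro z
      induction z with
      | zero => simp
      | add x y hx hy => simp only [map_add, LinearMap.add_apply, hx, hy]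
      | tmul x y => simp [antipodeInv_antipode, (H.fg _ _).eq]
    rw [UniversalRMatrix.ev, ← R.map_antipode, e]; rfl
  have hs2 : ∀ m, SemiconjBy (R.ev g f) (shift δ (conv g f) l m) (shift δ (conv f g) l m) :=
    shift_semiconj δ (R.ev_conv H.hg H.hf H.fg.symm)
      (fun m => (ev2_commute (fun x => (H.gl x m).symm) (fun x => (H.fl x m).symm) _).symm)
  have hfin : ∀ z, ev3 (rop f) (rop g) (lop (shift δ (conv f g) l)) z (R.ev g f) =
      R.ev g f * ev3 (rop f) (rop g) (lop (shift δ (conv g f) l)) z 1 := by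
    intro z
    induction z using tensor3_induction with
    | h0 => simp
    | hadd x y hx hy => simp only [map_add, LinearMap.add_apply, mul_add, hx, hy]
    | h x y m => simp [← mul_assoc, (hs2 m).eq]
  rw [DynCocycle.gam2, hC, mul_one, ev_dyn R F Hops, Module.End.mul_apply, Module.End.mul_apply]
  have h1 : F.ev (rop g) (rop f) (lop (shift δ (conv f g) l)) (F.antip f g l) = 1 :=
    LinearMap.congr_fun (Hops.hom.map_inv' F.val) 1
  rw [h1, hR]
  exact hfin _

end RLegs
end DynRE
end

noncomputable section
namespace DynRE

/-! ### The exchange relation for F ζ_{1|2} -/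

section Main
variable {k U L A : Type*} [Field k] [Ring U] [HopfAlgebra k U] [Ring L] [Algebra k L]
  [Ring A] [Algebra k A] 

/-- Five pairwise commuting algebra homomorphisms. -/
structure Legs5 (f g h p : U →ₗ[k] A) (l : L →ₗ[k] A) : Prop where
  hf : IsAlgHom f
  hg : IsAlgHom g
  hh : IsAlgHom h
  hp : IsAlgHom p
  hl : IsAlgHom l
  fg : Comm f g
  fh : Comm f h
  fp : Comm f p
  fl : Comm f l
  gh : Comm g h
  gp : Comm g p
  gl : Comm g l
  hp' : Comm h p
  hl' : Comm h l
  pl : Comm p l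

variable (R : UniversalRMatrix k U)
  {f g h p : U →ₗ[k] A} {l : L →ₗ[k] A} {δ : L →ₐ[k] U ⊗[k] L} (F : DynCocycle δ)

theorem Legs5.swap (H : Legs5 f g h p l) : Legs5 f h g p l :=
  ⟨H.hf, H.hh, H.hg, H.hp, H.hl, H.fh, H.fg, H.fp, H.fl, H.gh.symm, H.hp', H.hl', H.gp, H.gl, H.pl⟩

theorem Legs5.drop (H : Legs5 f g h p l) : Legs4 g h p l :=
  ⟨H.hg, H.hh, H.hp, H.hl, H.gh, H.gp, H.gl, H.hp', H.hl', H.pl⟩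

theorem Legs5.convR (H : Legs5 f g h p l) : Legs4 f g (conv h p) l :=
  ⟨H.hf, H.hg, H.hh.conv H.hp H.hp', H.hl, H.fg, H.fh.conv_right H.fp, H.fl,
    H.gh.conv_right H.gp, H.gl, H.hl'.conv_left H.pl⟩

/-- `F ζ_{1|2}` -/
def DynCocycle.xi (f g : U →ₗ[k] A) (l : L →ₗ[k] A) : A :=
  F.ev f g l * ev2 f (shift δ g l) F.zeta

variable [InvertibleAntipode k U]

/-- The computational core, with `f`, `g`, `h`, `p` as legs 1 to 4. Repeated use of the cocycle
identity gathers the twists on the left, R₂₃ exchanges the two middle legs, `zeta_shift` absorbs the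
remaining twist and the factor `gam`, and `zeta_mul` recombines the two ζ on legs 1 and 3 into
`antip`. -/
theorem xi_exchange (hδ : IsCoaction δ) (H : Legs5 f g h p l) :
    R.ev g h * (F.ev (conv f g) (conv h p) l * F.xi f g (shift δ (conv h p) l) *
      (F.xi h p l * F.gam R g h (shift δ p l))) =
    F.xi (conv f h) (conv g p) l *
      (F.antip f h (shift δ (conv g p) l) * F.ev g p l) := by
  have Hs := H.swap
  have s1 : shift δ g (shift δ (conv h p) l) = shift δ (conv g (conv h p)) l :=
    (hδ.shift_conv _ _ _).symm
  have s2 : shift δ h (shift δ (conv g p) l) = shift δ (conv h (conv g p)) l :=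
    (hδ.shift_conv _ _ _).symm
  have hr := R.ev_conv H.hg H.hh H.gh
  have rf : ∀ x, Commute (R.ev g h) (f x) := fun x =>
    (ev2_commute (H.fg x) (H.fh x) _).symm
  have rp : ∀ x, Commute (R.ev g h) (p x) := fun x =>
    (ev2_commute (fun y => (H.gp y x).symm) (fun y => (H.hp' y x).symm) _).symm
  have rl : ∀ x, Commute (R.ev g h) (l x) := fun x =>
    (ev2_commute (fun y => (H.gl y x).symm) (fun y => (H.hl' y x).symm) _).symm
  have r3 : ∀ x, SemiconjBy (R.ev g h) (conv g (conv h p) x) (conv h (conv g p) x) := by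
    intro x
    rw [← conv_assoc, ← conv_assoc]
    exact conv_semiconj hr rp x
  have c1 := F.ev_cocycle H.convR
  have c2 := F.ev_cocycle H.drop
  have c3 := F.ev_cocycle Hs.drop
  have c4 := F.ev_cocycle Hs.convR
  have m1 : Commute (F.ev g (conv h p) l) (ev2 f (shift δ (conv g (conv h p)) l) F.zeta) :=
    ev2_commute (fun x => (ev2_commute (H.fg x) (fun y => ev2_commute
      (fun z => H.convR.fh x z) (H.fl x) y) _).symm) (F.ev_comm H.convR.drop) _
  have m2 : Commute (F.ev h (conv g p) l) (ev2 f (shift δ (conv h (conv g p)) l) F.zeta) :=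
    ev2_commute (fun x => (ev2_commute (H.fh x) (fun y => ev2_commute
      (fun z => Hs.convR.fh x z) (H.fl x) y) _).symm) (F.ev_comm Hs.convR.drop) _
  have m3 : Commute (F.ev g p l) (ev2 h (shift δ (conv g p) l) F.zeta) :=
    ev2_commute (fun x => (ev2_commute (fun y => (H.gh y x).symm) (fun y => ev2_commute
      (H.hp' x) (H.hl' x) y) _).symm) (F.ev_comm H.drop.drop2) _
  have j1 : SemiconjBy (R.ev g h) (F.ev f (conv g (conv h p)) l) (F.ev f (conv h (conv g p)) l) :=
    ev2_semiconj rf (fun z => ev2_semiconj r3 rl z) _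
  have j2 : SemiconjBy (R.ev g h) (ev2 f (shift δ (conv g (conv h p)) l) F.zeta)
      (ev2 f (shift δ (conv h (conv g p)) l) F.zeta) :=
    ev2_semiconj rf (shift_semiconj δ r3 rl) _
  have j3 : SemiconjBy (R.ev g h) (F.ev (conv g h) p l) (F.ev (conv h g) p l) :=
    ev2_semiconj hr (fun z => ev2_semiconj rp rl z) _
  -- Multiplied by F_{32}, this expresses R₂₃ F ζ and `gam` together through a single shifted ζ.
  have zs := zeta_shift R F hδ (H.drop.shift δ)
  rw [← hδ.shift_conv g p l] at zs
  have zs' := congrArg (F.ev h g (shift δ p l) * ·) zs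
  have hi : F.ev h g (shift δ p l) * F.inv h g (shift δ p l) = 1 :=
    (Hs.drop.shift δ).hom.map_inv' _
  simp only [← mul_assoc] at zs'
  rw [hi, one_mul] at zs'
  have zm := zeta_mul F hδ (l := shift δ (conv g p) l) (Hs.convR.shift δ)
  rw [s2] at zm
  unfold DynCocycle.xi
  rw [s1]
  have H4 : Legs4 f h (conv g p) l := Hs.convR
  -- `c1` to `c4` are cocycle identities, `j1` to `j3` move R₂₃ to the right, and `m1` to `m3`
  -- interchange a twist with a shifted ζ.
  calc _ = R.ev g h * (F.ev (conv f g) (conv h p) l * F.ev f g (shift δ (conv h p) l)) *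
        ev2 f (shift δ (conv g (conv h p)) l) F.zeta * F.ev h p l *
        ev2 h (shift δ p l) F.zeta * F.gam R g h (shift δ p l) := by simp only [mul_assoc]
    _ = R.ev g h * F.ev f (conv g (conv h p)) l * (F.ev g (conv h p) l *
        ev2 f (shift δ (conv g (conv h p)) l) F.zeta) * F.ev h p l *
        ev2 h (shift δ p l) F.zeta * F.gam R g h (shift δ p l) := by
        rw [c1]; simp only [mul_assoc]
    _ = (R.ev g h * F.ev f (conv g (conv h p)) l) *
        ev2 f (shift δ (conv g (conv h p)) l) F.zeta * (F.ev g (conv h p) l * F.ev h p l) *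
        ev2 h (shift δ p l) F.zeta * F.gam R g h (shift δ p l) := by
        rw [m1.eq]; simp only [mul_assoc]
    _ = F.ev f (conv h (conv g p)) l * (R.ev g h *
        ev2 f (shift δ (conv g (conv h p)) l) F.zeta) * (F.ev (conv g h) p l *
          F.ev g h (shift δ p l)) *
        ev2 h (shift δ p l) F.zeta * F.gam R g h (shift δ p l) := by
        rw [← c2, j1.eq]; simp only [mul_assoc]
    _ = F.ev f (conv h (conv g p)) l * 
        ev2 f (shift δ (conv h (conv g p)) l) F.zeta * (R.ev g h * F.ev (conv g h) p l) *
          F.ev g h (shift δ p l) *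
        ev2 h (shift δ p l) F.zeta * F.gam R g h (shift δ p l) := by
        rw [j2.eq]; simp only [mul_assoc]
    _ = F.ev f (conv h (conv g p)) l * 
        ev2 f (shift δ (conv h (conv g p)) l) F.zeta * F.ev (conv h g) p l * (R.ev g h *
          F.ev g h (shift δ p l) *
        ev2 h (shift δ p l) F.zeta * F.gam R g h (shift δ p l)) := by
        rw [j3.eq]; simp only [mul_assoc]
    _ = F.ev f (conv h (conv g p)) l * 
        ev2 f (shift δ (conv h (conv g p)) l) F.zeta * (F.ev (conv h g) p l *
          F.ev h g (shift δ p l)) * ev2 h (shift δ (conv g p) l) F.zeta := by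
        rw [← zs']; simp only [mul_assoc]
    _ = F.ev f (conv h (conv g p)) l * (F.ev h (conv g p) l *
        ev2 f (shift δ (conv h (conv g p)) l) F.zeta) * (F.ev g p l *
          ev2 h (shift δ (conv g p) l) F.zeta) := by
        rw [c3, m2.eq]; simp only [mul_assoc]
    _ = (F.ev f (conv h (conv g p)) l * F.ev h (conv g p) l) *
        ev2 f (shift δ (conv h (conv g p)) l) F.zeta * ev2 h (shift δ (conv g p) l) F.zeta *
          F.ev g p l := by
        rw [m3.eq]; simp only [mul_assoc]
    _ = F.ev (conv f h) (conv g p) l * (F.ev f h (shift δ (conv g p) l) *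
        ev2 f (shift δ (conv h (conv g p)) l) F.zeta * ev2 h (shift δ (conv g p) l) F.zeta) *
          F.ev g p l := by
        rw [← c4]; simp only [mul_assoc]
    _ = _ := by rw [zm]; simp only [mul_assoc]

end Main
end DynRE
end

noncomputable section
namespace DynRE

/-! ### Normalization of twists: the counit as a leg -/

section Counit
variable {k B L A : Type*} [Field k] [Ring B] [Bialgebra k B] [Ring L] [Algebra k L]
  [Ring A] [Algebra k A]

theorem ev2_eps {M : Type*} [Ring M] [Algebra k M] (l : M →ₗ[k] A) (z : B ⊗[k] M) :
    ev2 eps l z = l (Algebra.TensorProduct.lid k M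
      (Algebra.TensorProduct.map (Bialgebra.counitAlgHom k B) (.id k M) z)) := by
  induction z with
  | zero => simp
  | add a b ha hb => simp only [map_add, ha, hb]
  | tmul a b => simp [eps_apply, Algebra.algebraMap_eq_smul_one]

theorem ev3_eps (f : B →ₗ[k] A) (l : L →ₗ[k] A) (z : B ⊗[k] (B ⊗[k] L)) :
    ev3 f eps l z = ev2 f l (Algebra.TensorProduct.map (.id k B)
    ((Algebra.TensorProduct.lid k L).toAlgHom.comp
      (Algebra.TensorProduct.map (Bialgebra.counitAlgHom k B) (.id k L))) z) := by
  induction z using tensor3_induction with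
  | h0 => simp
  | hadd x y hx hy => simp only [map_add, hx, hy]
  | h x y m => simp [eps_apply, Algebra.algebraMap_eq_smul_one]

theorem isAlgHom_eps : IsAlgHom (eps : B →ₗ[k] A) :=
  ⟨by simp [eps_apply], fun x y => by simp [eps_apply]⟩

theorem comm_eps_left {M : Type*} [Ring M] [Algebra k M] (l : M →ₗ[k] A) :
    Comm (eps : B →ₗ[k] A) l := fun _ _ => Algebra.commutes _ _

variable {δ : L →ₐ[k] B ⊗[k] L} (Ψ : DynCocycle δ)

theorem DynCocycle.ev_eps_left {g : B →ₗ[k] A} {l : L →ₗ[k] A} (hg : g 1 = 1) (hl : l 1 = 1) :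
    Ψ.ev eps g l = 1 := by
  rw [DynCocycle.ev, ev3, ev2_eps, Ψ.counit_left]
  simp [Algebra.TensorProduct.one_def, hg, hl]

theorem DynCocycle.ev_eps_right {g : B →ₗ[k] A} {l : L →ₗ[k] A} (hg : g 1 = 1) (hl : l 1 = 1) :
    Ψ.ev g eps l = 1 := by
  rw [DynCocycle.ev, ev3_eps, Ψ.counit_right]
  simp [Algebra.TensorProduct.one_def, hg, hl]

end Counit

/-! ### Gauge transformations of dynamical twists -/

section Gauge
variable {k B L A : Type*} [Field k] [Ring B] [Bialgebra k B] [Ring L] [Algebra k L]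
  [Ring A] [Algebra k A] {δ : L →ₐ[k] B ⊗[k] L} (Ψ : DynCocycle δ) (ξ : (B ⊗[k] L)ˣ)

/-- The universal legs. Together with `ev4_incl` they convert a relation known at all commuting legs
into an equation of tensors. -/
theorem legs4_incl : Legs4 (inl k B (B ⊗[k] (B ⊗[k] L)))
    (inr k B (B ⊗[k] (B ⊗[k] L)) ∘ₗ inl k B (B ⊗[k] L))
    (inr k B (B ⊗[k] (B ⊗[k] L)) ∘ₗ inr k B (B ⊗[k] L) ∘ₗ inl k B L)
    (inr k B (B ⊗[k] (B ⊗[k] L)) ∘ₗ inr k B (B ⊗[k] L) ∘ₗ inr k B L) :=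
  ⟨isAlgHom_inl, isAlgHom_inr.comp isAlgHom_inl, isAlgHom_inr.comp (isAlgHom_inr.comp isAlgHom_inl),
    isAlgHom_inr.comp (isAlgHom_inr.comp isAlgHom_inr),
    comm_inl_inr.comp_right _, comm_inl_inr.comp_right _, comm_inl_inr.comp_right _,
    fun _ _ => isAlgHom_inr.map_commute (comm_inl_inr _ _),
    fun _ _ => isAlgHom_inr.map_commute (comm_inl_inr _ _),
    fun _ _ => isAlgHom_inr.map_commute (isAlgHom_inr.map_commute (comm_inl_inr _ _))⟩

theorem ev2_incl' {M : Type*} [Ring M] [Algebra k M] (z : B ⊗[k] M) :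
    ev2 (inl k B M) (inr k B M) z = z := by
  rw [ev2_include]; rfl

theorem ev3_incl (z : B ⊗[k] (B ⊗[k] L)) : ev3 (inl k B (B ⊗[k] L))
    (inr k B (B ⊗[k] L) ∘ₗ inl k B L) (inr k B (B ⊗[k] L) ∘ₗ inr k B L) z = z := by
  rw [ev3, ← comp_ev2 isAlgHom_inr, ev2_include, LinearMap.comp_id, ev2_incl']

theorem ev4_incl (z : B ⊗[k] (B ⊗[k] (B ⊗[k] L))) : ev2 (inl k B (B ⊗[k] (B ⊗[k] L)))
    (ev3 (inr k B (B ⊗[k] (B ⊗[k] L)) ∘ₗ inl k B (B ⊗[k] L))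
    (inr k B (B ⊗[k] (B ⊗[k] L)) ∘ₗ inr k B (B ⊗[k] L) ∘ₗ inl k B L)
    (inr k B (B ⊗[k] (B ⊗[k] L)) ∘ₗ inr k B (B ⊗[k] L) ∘ₗ inr k B L)) z = z := by
  have : ev3 (inr k B (B ⊗[k] (B ⊗[k] L)) ∘ₗ inl k B (B ⊗[k] L))
    (inr k B (B ⊗[k] (B ⊗[k] L)) ∘ₗ inr k B (B ⊗[k] L) ∘ₗ inl k B L)
    (inr k B (B ⊗[k] (B ⊗[k] L)) ∘ₗ inr k B (B ⊗[k] L) ∘ₗ inr k B L) =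
      inr k B (B ⊗[k] (B ⊗[k] L)) := by
    rw [ev3, ← comp_ev2 isAlgHom_inr, ← comp_ev2 isAlgHom_inr]
    ext1; ext1 x; ext1; ext y m; simp
  rw [this, ev2_incl']

/-- The gauge transform, as a unit. -/
def gaugeUnit : (B ⊗[k] (B ⊗[k] L))ˣ :=
  Units.map (dDelta : B ⊗[k] L →ₐ[k] B ⊗[k] (B ⊗[k] L)).toMonoidHom ξ⁻¹ * Ψ.val *
    (Units.map (Algebra.TensorProduct.map (.id k B) δ).toMonoidHom ξ *
      Units.map (Algebra.TensorProduct.includeRight (R := k) (A := B)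
        (B := B ⊗[k] L)).toMonoidHom ξ)

theorem gaugeUnit_val : (gaugeUnit Ψ ξ : B ⊗[k] (B ⊗[k] L)) =
    dDelta (↑ξ⁻¹ : B ⊗[k] L) * (Ψ.val : B ⊗[k] (B ⊗[k] L)) *
    (Algebra.TensorProduct.map (.id k B) δ (ξ : B ⊗[k] L) *
      Algebra.TensorProduct.includeRight (ξ : B ⊗[k] L)) := rfl

theorem ev3_gaugeUnit {f g : B →ₗ[k] A} {l : L →ₗ[k] A} (H : Legs3 f g l) :
    ev3 f g l (gaugeUnit Ψ ξ : B ⊗[k] (B ⊗[k] L)) =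
      ev2 (conv f g) l (↑ξ⁻¹ : B ⊗[k] L) * Ψ.ev f g l *
        (ev2 f (shift δ g l) (ξ : B ⊗[k] L) * ev2 g l (ξ : B ⊗[k] L)) := by
  rw [gaugeUnit_val, H.hom.map_mul, H.hom.map_mul, H.hom.map_mul, ev2_dDelta, ev2_coact,
    ev2_includeRight _ H.hf.map_one]
  rfl

variable {ξ} (hξ : ∀ m, Commute (ξ : B ⊗[k] L) (δ m))
  (hε : Algebra.TensorProduct.lid k L
    (Algebra.TensorProduct.map (Bialgebra.counitAlgHom k B) (.id k L) (ξ : B ⊗[k] L)) = 1)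

include hξ in
theorem gauge_comm {f : B →ₗ[k] A} {l : L →ₗ[k] A} (hf : IsAlgHom f) (hl : IsAlgHom l)
    (fl : Comm f l) (m : L) : Commute (ev2 f l (ξ : B ⊗[k] L)) (shift δ f l m) :=
  (hf.ev2 hl fl).map_commute (hξ m)

include hξ in
-- The last ξ commutes with `f`, `g` and with its own coaction, hence with everything whose base leg
-- is shifted by `h`; it can be moved to the far right. The inner ξ⁻¹ then meets its inverse, and
-- the cocycle identity of the original twist applies.
theorem gauge_cocycle (hδ : IsCoaction δ) {f g h : B →ₗ[k] A} {l : L →ₗ[k] A}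
    (H : Legs4 f g h l) :
    ev3 (conv f g) h l (gaugeUnit Ψ ξ : B ⊗[k] (B ⊗[k] L)) *
      ev3 f g (shift δ h l) (gaugeUnit Ψ ξ : B ⊗[k] (B ⊗[k] L)) =
    ev3 f (conv g h) l (gaugeUnit Ψ ξ : B ⊗[k] (B ⊗[k] L)) *
      ev3 g h l (gaugeUnit Ψ ξ : B ⊗[k] (B ⊗[k] L)) := by
  rw [ev3_gaugeUnit Ψ ξ H.convL, ev3_gaugeUnit Ψ ξ (H.shift δ), ev3_gaugeUnit Ψ ξ H.convR,
    ev3_gaugeUnit Ψ ξ H.drop, ← hδ.shift_conv g h l, conv_assoc]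
  have c := Ψ.ev_cocycle H
  have hx : ∀ m, Commute (ev2 h l (ξ : B ⊗[k] L)) (shift δ h l m) :=
    gauge_comm hξ H.hh H.hl H.hl'
  have xf : ∀ x, Commute (ev2 h l (ξ : B ⊗[k] L)) (f x) := fun x =>
    (ev2_commute (H.fh x) (H.fl x) _).symm
  have xg : ∀ x, Commute (ev2 h l (ξ : B ⊗[k] L)) (g x) := fun x =>
    (ev2_commute (H.gh x) (H.gl x) _).symm
  have x1 : Commute (ev2 h l (ξ : B ⊗[k] L)) (ev2 (conv f g) (shift δ h l) (↑ξ⁻¹ : B ⊗[k] L)) :=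
    ev2_commute (f := conv f g) (fun x => ev2_commute xf xg (Coalgebra.comul (R := k) x)) hx _
  have x2 : Commute (ev2 h l (ξ : B ⊗[k] L)) (Ψ.ev f g (shift δ h l)) :=
    ev2_commute xf (fun z => ev2_commute xg hx z) _
  have x3 : Commute (ev2 h l (ξ : B ⊗[k] L)) (ev2 f (shift δ (conv g h) l) (ξ : B ⊗[k] L)) := by
    rw [hδ.shift_conv]
    exact ev2_commute (l := shift δ g (shift δ h l)) xf (fun m => ev2_commute xg hx (δ m)) _
  have x4 : Commute (ev2 h l (ξ : B ⊗[k] L)) (ev2 g (shift δ h l) (ξ : B ⊗[k] L)) :=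
    ev2_commute xg hx _
  have x5 : Commute (Ψ.ev g h l) (ev2 f (shift δ (conv g h) l) (ξ : B ⊗[k] L)) :=
    ev2_commute (fun x => (ev2_commute (H.fg x) (fun z => ev2_commute (H.fh x) (H.fl x) z) _).symm)
      (Ψ.ev_comm H.drop) _
  have i1 : ev2 (conv f g) (shift δ h l) (ξ : B ⊗[k] L) *
      ev2 (conv f g) (shift δ h l) (↑ξ⁻¹ : B ⊗[k] L) = 1 :=
    ((H.shift δ).hf.conv H.hg H.fg |>.ev2 (H.shift δ).hl
      ((H.shift δ).fl.conv_left (H.shift δ).gl)).map_inv' ξ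
  have i2 : ev2 (conv g h) l (ξ : B ⊗[k] L) * ev2 (conv g h) l (↑ξ⁻¹ : B ⊗[k] L) = 1 :=
    (H.convR.hg.ev2 H.hl H.convR.gl).map_inv' ξ
  set a := ev2 (conv f (conv g h)) l (↑ξ⁻¹ : B ⊗[k] L)
  set z := ev2 h l (ξ : B ⊗[k] L)
  calc _ = a * Ψ.ev (conv f g) h l * ev2 (conv f g) (shift δ h l) (ξ : B ⊗[k] L) *
        (z * ev2 (conv f g) (shift δ h l) (↑ξ⁻¹ : B ⊗[k] L)) * Ψ.ev f g (shift δ h l) *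
        ev2 f (shift δ (conv g h) l) (ξ : B ⊗[k] L) *
        ev2 g (shift δ h l) (ξ : B ⊗[k] L) := by simp only [mul_assoc]
    _ = a * Ψ.ev (conv f g) h l * (ev2 (conv f g) (shift δ h l) (ξ : B ⊗[k] L) *
        ev2 (conv f g) (shift δ h l) (↑ξ⁻¹ : B ⊗[k] L)) * (z * Ψ.ev f g (shift δ h l)) *
        ev2 f (shift δ (conv g h) l) (ξ : B ⊗[k] L) *
        ev2 g (shift δ h l) (ξ : B ⊗[k] L) := by rw [x1.eq]; simp only [mul_assoc]
    _ = a * (Ψ.ev (conv f g) h l * Ψ.ev f g (shift δ h l)) * (z *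
        ev2 f (shift δ (conv g h) l) (ξ : B ⊗[k] L)) *
        ev2 g (shift δ h l) (ξ : B ⊗[k] L) := by
        rw [i1, x2.eq]; simp only [mul_assoc, one_mul]
    _ = a * (Ψ.ev f (conv g h) l * Ψ.ev g h l) *
        ev2 f (shift δ (conv g h) l) (ξ : B ⊗[k] L) * (z *
        ev2 g (shift δ h l) (ξ : B ⊗[k] L)) := by
        rw [c, x3.eq]; simp only [mul_assoc]
    _ = a * Ψ.ev f (conv g h) l * (Ψ.ev g h l *
        ev2 f (shift δ (conv g h) l) (ξ : B ⊗[k] L)) * (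
        ev2 g (shift δ h l) (ξ : B ⊗[k] L) * z) := by
        rw [x4.eq]; simp only [mul_assoc]
    _ = a * Ψ.ev f (conv g h) l * ev2 f (shift δ (conv g h) l) (ξ : B ⊗[k] L) *
        (ev2 (conv g h) l (ξ : B ⊗[k] L) * ev2 (conv g h) l (↑ξ⁻¹ : B ⊗[k] L)) *
        Ψ.ev g h l * (ev2 g (shift δ h l) (ξ : B ⊗[k] L) * z) := by
        rw [x5.eq, i2]; simp only [mul_assoc, one_mul]
    _ = _ := by simp only [mul_assoc]

include hε in
theorem gauge_eps {l : L →ₗ[k] A} (hl : l 1 = 1) : ev2 eps l (ξ : B ⊗[k] L) = 1 := by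
  rw [ev2_eps, hε, hl]

/-- The gauge transform of a dynamical twist. -/
def DynCocycle.gauge (hδ : IsCoaction δ) : DynCocycle δ where
  val := gaugeUnit Ψ ξ
  comm m := by
    rw [gaugeUnit_val]
    refine Commute.mul_left (Commute.mul_left ((Commute.units_inv_left (hξ m)).map
      (dDelta : B ⊗[k] L →ₐ[k] B ⊗[k] (B ⊗[k] L))) (Ψ.comm m)) ?_
    -- Coassociativity gives the form (id ⊗ δ)δ(m), in which both ξ_{1|2} and ξ₂ are seen to
    -- commute.
    rw [hδ.coassoc]
    refine Commute.mul_left ((hξ m).map (Algebra.TensorProduct.map (.id k B) δ)) ?_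
    generalize δ m = w
    induction w with
    | zero => simp
    | add x y hx hy => simp only [map_add]; exact hx.add_right hy
    | tmul x y =>
      rw [Commute, SemiconjBy]
      simp only [Algebra.TensorProduct.map_tmul, Algebra.TensorProduct.includeRight_apply,
        Algebra.TensorProduct.tmul_mul_tmul, AlgHom.id_apply, one_mul, mul_one, (hξ y).eq]
  cocycle := by
    have H := legs4_incl (k := k) (B := B) (L := L)
    have e := gauge_cocycle Ψ hξ hδ H
    have hm := H.hf.ev2 H.drop.hom (H.fg.ev2_right (H.fh.ev2_right H.fl))
    rw [← ev4_incl (dDelta _ * _), ← ev4_incl (_ * Algebra.TensorProduct.includeRight _),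
      hm.map_mul, hm.map_mul, ev2_dDelta, ev2_algMap, ev2_algMap, ev2_includeRight _ H.hf.map_one]
    set g := inr k B (B ⊗[k] (B ⊗[k] L)) ∘ₗ inl k B (B ⊗[k] L)
    set h := inr k B (B ⊗[k] (B ⊗[k] L)) ∘ₗ inr k B (B ⊗[k] L) ∘ₗ inl k B L
    set l := inr k B (B ⊗[k] (B ⊗[k] L)) ∘ₗ inr k B (B ⊗[k] L) ∘ₗ inr k B L
    have e1 : ev3 g h l ∘ₗ (Algebra.TensorProduct.map (.id k B) δ).toLinearMap =
        ev2 g (shift δ h l) := LinearMap.ext fun z => ev2_coact δ h l g z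
    have e2 : ev3 g h l ∘ₗ (dDelta : B ⊗[k] L →ₐ[k] _).toLinearMap = ev2 (conv g h) l :=
      LinearMap.ext fun z => ev2_dDelta g h l z
    rw [e1, e2]
    exact e
  counit_left := by
    have H : Legs3 (eps (k := k)) (inl k B L) (inr k B L) := ⟨isAlgHom_eps, isAlgHom_inl,
      isAlgHom_inr, comm_eps_left _, comm_eps_left _, comm_inl_inr⟩
    have e := ev3_gaugeUnit Ψ ξ H
    rw [ev3, ev2_eps, ev2_incl', eps_conv, ev2_incl', Ψ.ev_eps_left isAlgHom_inl.map_one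
      isAlgHom_inr.map_one, gauge_eps hε (H.hg.shift δ H.hl H.gl).map_one, ev2_incl'] at e
    rw [e]; simp
  counit_right := by
    have H : Legs3 (inl k B L) (eps (k := k)) (inr k B L) := ⟨isAlgHom_inl, isAlgHom_eps,
      isAlgHom_inr, (comm_eps_left _).symm, comm_inl_inr, comm_eps_left _⟩
    have e := ev3_gaugeUnit Ψ ξ H
    rw [ev3_eps, ev2_incl', conv_eps, ev2_incl', Ψ.ev_eps_right isAlgHom_inl.map_one
      isAlgHom_inr.map_one, gauge_eps hε isAlgHom_inr.map_one, hδ.shift_eps, ev2_incl'] at e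
    rw [e]; simp

end Gauge
end DynRE
end

noncomputable section
namespace DynRE

set_option maxSynthPendingDepth 6

/-! ### The twisted product on a module algebra tensored with `L` -/

section TwistedProduct
variable {k B L A : Type*} [Field k] [Ring B] [Bialgebra k B] [Ring L] [Algebra k L]
  [Ring A] [Algebra k A]

/-- `act` makes `A` into a `B`-module algebra. -/
structure ModAlg (act : A →ₗ[k] B →ₗ[k] A) : Prop where
  one_act : ∀ a, act a 1 = a
  act_act : ∀ a b c, act (act a c) b = act a (b * c)
  act_mul : ∀ a a', act (a * a') = conv (act a) (act a')
  act_one : act 1 = eps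

variable (act : A →ₗ[k] B →ₗ[k] A)

/-- `b ↦ (b ▶ a) ⊗ 1` -/
def actL (L : Type*) [Ring L] [Algebra k L] (a : A) : B →ₗ[k] A ⊗[k] L := inl k A L ∘ₗ act a

/-- `x ⊗ (y ⊗ m) ↦ (x ▶ a)(y ▶ b) ⊗ m` -/
def act2 (a b : A) : B ⊗[k] (B ⊗[k] L) →ₗ[k] A ⊗[k] L :=
  ev3 (actL act L a) (actL act L b) (inr k A L)

/-- `x ⊗ m ↦ (x ▶ a) ⊗ m` -/
def act1 (a : A) : B ⊗[k] L →ₗ[k] A ⊗[k] L := ev2 (actL act L a) (inr k A L)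

theorem act1_tmul (a : A) (x : B) (m : L) : act1 act a (x ⊗ₜ m) = act a x ⊗ₜ m := by
  simp [act1, actL]

theorem act2_tmul (a b : A) (x y : B) (m : L) :
    act2 act a b (x ⊗ₜ (y ⊗ₜ m)) = (act a x * act b y) ⊗ₜ m := by
  simp [act2, actL]

theorem act2_mul_inr (a b : A) (z : B ⊗[k] (B ⊗[k] L)) (m : L) :
    act2 act a b z * (1 ⊗ₜ m) = act2 act a b (z * (1 ⊗ₜ (1 ⊗ₜ m))) := by
  induction z using tensor3_induction with
  | h0 => simp
  | hadd x y hx hy => simp only [map_add, add_mul, hx, hy]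
  | h x y m => simp [act2_tmul]

variable {δ : L →ₐ[k] B ⊗[k] L} (Υ : DynCocycle δ)

/-- `act2` is linear in both arguments. -/
def act2Bil : A →ₗ[k] A →ₗ[k] B ⊗[k] (B ⊗[k] L) →ₗ[k] A ⊗[k] L :=
  LinearMap.mk₂ k (act2 act)
    (fun a a' b => LinearMap.ext (tensor3_ext fun x y m => by
      simp [act2_tmul, add_mul, TensorProduct.add_tmul]))
    (fun c a b => LinearMap.ext (tensor3_ext fun x y m => by
      simp [act2_tmul, TensorProduct.smul_tmul']))
    (fun a b b' => LinearMap.ext (tensor3_ext fun x y m => by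
      simp [act2_tmul, mul_add, TensorProduct.add_tmul]))
    (fun c a b => LinearMap.ext (tensor3_ext fun x y m => by
      simp [act2_tmul, TensorProduct.smul_tmul']))

/-- The bilinear map `(a ⊗ l) * (b ⊗ m) = (Υ₁ ▶ a) (Υ₂ l⁽¹⁾ ▶ b) ⊗ Υ_L l⁽∞⁾ m`. -/
def DynCocycle.tmul : A ⊗[k] L →ₗ[k] A ⊗[k] L →ₗ[k] A ⊗[k] L :=
  TensorProduct.lift (LinearMap.mk₂ k
    (fun a l => TensorProduct.lift (LinearMap.mk₂ k (fun b m => act2Bil act a b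
      ((Υ.val : B ⊗[k] (B ⊗[k] L)) * (1 ⊗ₜ (δ l * (1 ⊗ₜ m)))))
      (fun b b' m => by simp only [map_add, LinearMap.add_apply])
      (fun c b m => by simp only [map_smul, LinearMap.smul_apply])
      (fun b m m' => by simp only [map_add, mul_add, TensorProduct.tmul_add])
      (fun c b m => by simp only [map_smul, TensorProduct.tmul_smul, mul_smul_comm])))
    (fun a a' l => by ext b m; simp)
    (fun c a l => by ext b m; simp only [map_smul, LinearMap.smul_apply]; rfl)
    (fun a l l' => by ext b m; simp [add_mul, mul_add, TensorProduct.tmul_add])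
    (fun c a l => by ext b m; simp [TensorProduct.tmul_smul]))

theorem DynCocycle.tmul_tmul (a b : A) (l m : L) : Υ.tmul act (a ⊗ₜ l) (b ⊗ₜ m) =
    act2 act a b ((Υ.val : B ⊗[k] (B ⊗[k] L)) * (1 ⊗ₜ (δ l * (1 ⊗ₜ m)))) := rfl

variable {act}

theorem act1_one (hact : ModAlg act) (a : A) (m : L) : act1 act a ((1 : B) ⊗ₜ m) = a ⊗ₜ m := by
  rw [act1_tmul, hact.one_act]

theorem act2_act (hact : ModAlg act) (a b : A) (x y : B) (z : B ⊗[k] (B ⊗[k] L)) :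
    act2 act (act a x) (act b y) z = act2 act a b (z * (x ⊗ₜ (y ⊗ₜ 1))) := by
  induction z using tensor3_induction with
  | h0 => simp
  | hadd x y hx hy => simp only [map_add, add_mul, hx, hy]
  | h x y m => simp [act2_tmul, hact.act_act]

theorem tmul_act1 (hact : ModAlg act) (a b : A) (z w : B ⊗[k] L) :
    Υ.tmul act (act1 act a z) (act1 act b w) =
      act2 act a b ((Υ.val : B ⊗[k] (B ⊗[k] L)) * Algebra.TensorProduct.map (.id k B) δ z * (1 ⊗ₜ w)) := by
  induction z with
  | zero => simp
  | add x y hx hy => simp only [map_add, mul_add, add_mul, LinearMap.add_apply, hx, hy]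
  | tmul x l =>
  induction w with
  | zero => simp
  | add x y hx hy => simp only [map_add, mul_add, TensorProduct.tmul_add, hx, hy]
  | tmul y m =>
    rw [act1_tmul, act1_tmul, Υ.tmul_tmul, act2_act hact, mul_assoc, mul_assoc]
    congr 2
    simp [mul_assoc]

/-- `x ⊗ w ↦ (x ▶ a) w` on four legs -/
def act3 (act : A →ₗ[k] B →ₗ[k] A) (a b c : A) : B ⊗[k] (B ⊗[k] (B ⊗[k] L)) →ₗ[k] A ⊗[k] L :=
  ev2 (actL act L a) (act2 act b c)

/-- The module algebra axiom says that the action on a product is a convolution. -/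
theorem act2_mul_left (hact : ModAlg act) (a b c : A) (z : B ⊗[k] (B ⊗[k] L)) :
    act2 act (a * b) c z = act3 act a b c (dDelta z) := by
  have : actL act L (a * b) = conv (actL act L a) (actL act L b) := by
    rw [actL, hact.act_mul, comp_conv isAlgHom_inl]; rfl
  rw [act3, act2, act2, this, ev2_dDelta]

theorem act2_mul_right (hact : ModAlg act) (a b c : A) (z : B ⊗[k] (B ⊗[k] L)) :
    act2 act a (b * c) z =
      act3 act a b c (Algebra.TensorProduct.map (.id k B) dDelta z) := by
  have : actL act L (b * c) = conv (actL act L b) (actL act L c) := by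
    rw [actL, hact.act_mul, comp_conv isAlgHom_inl]; rfl
  rw [act3, act2, act2, this, ev2_algMap]
  have e : ev3 (actL act L b) (actL act L c) (inr k A L) ∘ₗ
      (dDelta : B ⊗[k] L →ₐ[k] _).toLinearMap =
      ev2 (conv (actL act L b) (actL act L c)) (inr k A L) :=
    LinearMap.ext fun z => ev2_dDelta _ _ _ z
  exact congrArg (fun t => ev2 (actL act L a) t z) e.symm

theorem act3_act (hact : ModAlg act) (a b c : A) (x y w : B) (z : B ⊗[k] (B ⊗[k] (B ⊗[k] L))) :
    act3 act (act a x) (act b y) (act c w) z = act3 act a b c (z * (x ⊗ₜ (y ⊗ₜ (w ⊗ₜ 1)))) := by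
  induction z with
  | zero => simp
  | add x y hx hy => simp only [map_add, add_mul, hx, hy]
  | tmul p q => simp [act3, act2_act hact, actL, hact.act_act]

theorem dDelta_mul {M : Type*} [Ring M] [Algebra k M] (z w : B ⊗[k] M) :
    dDelta (z * w) = dDelta z * dDelta w := map_mul _ _ _

theorem dDelta_one_tmul {M : Type*} [Ring M] [Algebra k M] (m : M) :
    dDelta ((1 : B) ⊗ₜ[k] m) = 1 ⊗ₜ (1 ⊗ₜ m) := by
  simp [dDelta, Algebra.TensorProduct.one_def]

theorem idDelta_mul (z w : B ⊗[k] (B ⊗[k] L)) :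
    Algebra.TensorProduct.map (.id k B) dDelta (z * w) =
      Algebra.TensorProduct.map (.id k B) dDelta z *
        Algebra.TensorProduct.map (.id k B) dDelta w := map_mul _ _ _

theorem tmul_act2_left (hact : ModAlg act) (a b c : A) (z : B ⊗[k] (B ⊗[k] L)) (m : L) :
    Υ.tmul act (act2 act a b z) (c ⊗ₜ m) = act3 act a b c (dDelta (Υ.val : B ⊗[k] (B ⊗[k] L)) *
      Algebra.TensorProduct.map (.id k B) (Algebra.TensorProduct.map (.id k B) δ) z *
        (1 ⊗ₜ (1 ⊗ₜ (1 ⊗ₜ m)))) := by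
  induction z using tensor3_induction with
  | h0 => simp
  | hadd x y hx hy => simp only [map_add, mul_add, add_mul, LinearMap.add_apply, hx, hy]
  | h x y l =>
    -- Writing `c` as 1 ▶ c gives all three arguments the form that `act3_act` absorbs.
    rw [act2_tmul, Υ.tmul_tmul, act2_mul_left hact, ← hact.one_act c, act3_act hact,
      hact.one_act, dDelta_mul, mul_assoc, mul_assoc]
    congr 2
    rw [dDelta_one_tmul]
    simp only [Algebra.TensorProduct.map_tmul, AlgHom.id_apply,
      Algebra.TensorProduct.tmul_mul_tmul, one_mul, mul_one]
    rw [← Algebra.TensorProduct.one_def, mul_one]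

theorem tmul_act2_right (hact : ModAlg act) (a b c : A) (z : B ⊗[k] (B ⊗[k] L)) (l : L) :
    Υ.tmul act (a ⊗ₜ l) (act2 act b c z) = act3 act a b c
      (Algebra.TensorProduct.map (.id k B) dDelta ((Υ.val : B ⊗[k] (B ⊗[k] L)) * (1 ⊗ₜ δ l)) * (1 ⊗ₜ z)) := by
  induction z using tensor3_induction with
  | h0 => simp
  | hadd x y hx hy => simp only [map_add, mul_add, TensorProduct.tmul_add, hx, hy]
  | h x y m =>
    rw [act2_tmul, Υ.tmul_tmul, act2_mul_right hact, ← hact.one_act a, act3_act hact,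
      hact.one_act, idDelta_mul, idDelta_mul, mul_assoc, mul_assoc]
    congr 2
    simp only [Algebra.TensorProduct.map_tmul, map_one, map_mul,
      Algebra.TensorProduct.tmul_mul_tmul, mul_one]
    rw [mul_assoc]
    simp [dDelta, Algebra.TensorProduct.one_def]

/-- Both bracketings are values of `act3` at elements of B ⊗ B ⊗ B ⊗ L. These elements agree by the
cocycle identity, after the twist in the last three factors has been moved past the iterated
coaction of `l`. -/
theorem tmul_assoc (hact : ModAlg act) (hδ : IsCoaction δ) (u v w : A ⊗[k] L) :
    Υ.tmul act (Υ.tmul act u v) w = Υ.tmul act u (Υ.tmul act v w) := by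
  induction u with
  | zero => simp
  | add x y hx hy => simp only [map_add, LinearMap.add_apply, hx, hy]
  | tmul a l =>
  induction v with
  | zero => simp
  | add x y hx hy => simp only [map_add, LinearMap.add_apply, hx, hy]
  | tmul b m =>
  induction w with
  | zero => simp
  | add x y hx hy => simp only [map_add, hx, hy]
  | tmul c p =>
    rw [Υ.tmul_tmul, Υ.tmul_tmul, tmul_act2_left Υ hact, tmul_act2_right Υ hact]
    congr 1
    have e1 : ∀ x : B ⊗[k] (B ⊗[k] L), (1 : B) ⊗ₜ[k] x =
      Algebra.TensorProduct.includeRight (R := k) (A := B) x := fun _ => rfl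
    have e2 := Υ.cocycle
    have e3 : Algebra.TensorProduct.map (.id k B) (Algebra.TensorProduct.map (.id k B) δ)
        ((1 : B) ⊗ₜ[k] (δ l * ((1 : B) ⊗ₜ[k] m))) =
        (1 ⊗ₜ dDelta (δ l)) * (1 ⊗ₜ (1 ⊗ₜ δ m)) := by
      simp [hδ.coassoc]
    have e4 : (1 : B) ⊗ₜ[k] (Υ.val : B ⊗[k] (B ⊗[k] L)) * (1 ⊗ₜ dDelta (δ l)) =
        (1 ⊗ₜ dDelta (δ l)) * (1 : B) ⊗ₜ[k] (Υ.val : B ⊗[k] (B ⊗[k] L)) := by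
      simp [(Υ.comm l).eq]
    rw [map_mul, e3, map_mul, ← mul_assoc, ← mul_assoc, e2, ← e1,
      mul_assoc _ ((1 : B) ⊗ₜ[k] (Υ.val : B ⊗[k] (B ⊗[k] L))), e4]
    simp [mul_assoc]

theorem one_tmul' (hact : ModAlg act) (v : A ⊗[k] L) : Υ.tmul act (1 ⊗ₜ 1) v = v := by
  induction v with
  | zero => simp
  | add x y hx hy => simp only [map_add, hx, hy]
  | tmul b m =>
    have : actL act L (1 : A) = eps := by
      rw [actL, hact.act_one]; ext; simp [eps_apply, Algebra.TensorProduct.algebraMap_apply]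
    rw [Υ.tmul_tmul, act2, this, ev3, ev2_eps, map_mul, map_mul, Υ.counit_left, one_mul, map_one,
      one_mul]
    simp [actL, hact.one_act]

theorem tmul_one_tmul (hact : ModAlg act) (hδ : IsCoaction δ) (a : A) (l m : L) :
    Υ.tmul act (a ⊗ₜ l) (1 ⊗ₜ m) = a ⊗ₜ (l * m) := by
  have h1 : actL act L (1 : A) = eps := by
    rw [actL, hact.act_one]; ext; simp [eps_apply, Algebra.TensorProduct.algebraMap_apply]
  have h2 : (Algebra.TensorProduct.lid k L) (Algebra.TensorProduct.map
      (Bialgebra.counitAlgHom k B) (.id k L) (δ l)) = l := hδ.counit l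
  rw [Υ.tmul_tmul, act2, h1, ev3_eps, map_mul, Υ.counit_right, one_mul]
  simp [h2, actL, hact.one_act]

/-- `a ⊗ m ↦ (ξ₁ ▶ a) ⊗ ξ_L m` -/
def psi (act : A →ₗ[k] B →ₗ[k] A) (ξ : B ⊗[k] L) : A ⊗[k] L →ₗ[k] A ⊗[k] L :=
  TensorProduct.lift (LinearMap.mk₂ k (fun a m => act1 act a (ξ * (1 ⊗ₜ m)))
    (fun a a' m => by
      induction ξ * ((1 : B) ⊗ₜ[k] m) with
      | zero => simp
      | add x y hx hy => simp only [map_add, hx, hy]; abel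
      | tmul x y => simp [act1_tmul, TensorProduct.add_tmul])
    (fun c a m => by
      induction ξ * ((1 : B) ⊗ₜ[k] m) with
      | zero => simp
      | add x y hx hy => simp only [map_add, hx, hy, smul_add]
      | tmul x y => simp [act1_tmul, TensorProduct.smul_tmul'])
    (fun a m m' => by rw [TensorProduct.tmul_add, mul_add, map_add])
    (fun c a m => by rw [TensorProduct.tmul_smul, mul_smul_comm, map_smul]))

theorem psi_tmul (ξ : B ⊗[k] L) (a : A) (m : L) :
    psi act ξ (a ⊗ₜ m) = act1 act a (ξ * (1 ⊗ₜ m)) := rfl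

theorem act1_act (hact : ModAlg act) (a : A) (x : B) (z : B ⊗[k] L) :
    act1 act (act a x) z = act1 act a (z * (x ⊗ₜ 1)) := by
  induction z with
  | zero => simp
  | add x y hx hy => simp only [map_add, add_mul, hx, hy]
  | tmul p q => simp [act1_tmul, hact.act_act]

theorem psi_act1 (hact : ModAlg act) (ξ : B ⊗[k] L) (a : A) (z : B ⊗[k] L) :
    psi act ξ (act1 act a z) = act1 act a (ξ * z) := by
  induction z with
  | zero => simp
  | add x y hx hy => simp only [map_add, mul_add, hx, hy]
  | tmul x m =>
    rw [act1_tmul, psi_tmul, act1_act hact, mul_assoc]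
    simp

theorem psi_act2 (hact : ModAlg act) (ξ : B ⊗[k] L) (a b : A) (z : B ⊗[k] (B ⊗[k] L)) :
    psi act ξ (act2 act a b z) = act2 act a b (dDelta ξ * z) := by
  induction z using tensor3_induction with
  | h0 => simp
  | hadd x y hx hy => simp only [map_add, mul_add, hx, hy]
  | h x y m =>
    have e : act1 act (act a x * act b y) (ξ * ((1 : B) ⊗ₜ m)) =
        act2 act (act a x) (act b y) (dDelta (ξ * ((1 : B) ⊗ₜ m))) := by
      rw [act2, ev2_dDelta, act1]
      congr 2
      rw [actL, hact.act_mul, comp_conv isAlgHom_inl]; rfl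
    rw [act2_tmul, psi_tmul, e, act2_act hact, dDelta_mul, mul_assoc]
    congr 2
    simp [dDelta, Algebra.TensorProduct.one_def]

/-- Acting by ξ on a product brings out Δ(ξ), which cancels the factor Δ(ξ⁻¹) of the gauged twist.
The factors ξ_{1|2} and ξ₂ left over are those produced by acting with ξ on each argument, where ξ₂
must pass the coaction of `l`. -/
theorem psi_gauge (hact : ModAlg act) (hδ : IsCoaction δ) {ξ : (B ⊗[k] L)ˣ}
    (hξ : ∀ m, Commute (ξ : B ⊗[k] L) (δ m))
    (hε : Algebra.TensorProduct.lid k L (Algebra.TensorProduct.map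
      (Bialgebra.counitAlgHom k B) (.id k L) (ξ : B ⊗[k] L)) = 1) (u v : A ⊗[k] L) :
    psi act (ξ : B ⊗[k] L) ((Υ.gauge hξ hε hδ).tmul act u v) =
      Υ.tmul act (psi act (ξ : B ⊗[k] L) u) (psi act (ξ : B ⊗[k] L) v) := by
  induction u with
  | zero => simp
  | add x y hx hy => simp only [map_add, LinearMap.add_apply, hx, hy]
  | tmul a l =>
  induction v with
  | zero => simp
  | add x y hx hy => simp only [map_add, hx, hy]
  | tmul b m =>
    have e : ((Υ.gauge hξ hε hδ).val : B ⊗[k] (B ⊗[k] L)) =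
      dDelta (↑ξ⁻¹ : B ⊗[k] L) * (Υ.val : B ⊗[k] (B ⊗[k] L)) *
      (Algebra.TensorProduct.map (.id k B) δ (ξ : B ⊗[k] L) *
      Algebra.TensorProduct.includeRight (ξ : B ⊗[k] L)) := rfl
    have e3 : Algebra.TensorProduct.map (.id k B) δ ((ξ : B ⊗[k] L) * (1 ⊗ₜ l)) =
        Algebra.TensorProduct.map (.id k B) δ (ξ : B ⊗[k] L) * (1 ⊗ₜ δ l) := by
      rw [map_mul]; simp
    rw [DynCocycle.tmul_tmul, psi_act2 hact, psi_tmul, psi_tmul, tmul_act1 Υ hact, e, e3]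
    congr 1
    have e2 : dDelta (ξ : B ⊗[k] L) * dDelta (↑ξ⁻¹ : B ⊗[k] L) = 1 := by
      rw [← dDelta_mul, Units.mul_inv, map_one]
    simp only [← mul_assoc]
    rw [e2, one_mul]
    simp only [mul_assoc]
    congr 2
    simp [← mul_assoc, (hξ l).eq]

end TwistedProduct
end DynRE
end

noncomputable section
namespace DynRE

/-! ### The dynamical convolution algebra of intertwiners -/

section DynConv
set_option maxSynthPendingDepth 6
variable {k B L A : Type*} [Field k] [Ring B] [Bialgebra k B] [Ring L] [Algebra k L]
  [Ring A] [Algebra k A] {δ : L →ₐ[k] B ⊗[k] L} (Υ : DynCocycle δ) (s : L →ₐ[k] A)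

theorem dDelta_dDelta (z : B ⊗[k] L) :
    dDelta (dDelta z) = Algebra.TensorProduct.map (.id k B) dDelta (dDelta z) := by
  rw [← ev4_incl (dDelta (dDelta z)), ← ev4_incl (Algebra.TensorProduct.map (.id k B) dDelta (dDelta z)), ev2_dDelta,
    ev2_dDelta, ev2_algMap]
  set f := inl k B (B ⊗[k] (B ⊗[k] L))
  set g := inr k B (B ⊗[k] (B ⊗[k] L)) ∘ₗ inl k B (B ⊗[k] L)
  set h := inr k B (B ⊗[k] (B ⊗[k] L)) ∘ₗ inr k B (B ⊗[k] L) ∘ₗ inl k B L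
  set l := inr k B (B ⊗[k] (B ⊗[k] L)) ∘ₗ inr k B (B ⊗[k] L) ∘ₗ inr k B L
  have e2 : ev3 g h l ∘ₗ (dDelta : B ⊗[k] L →ₐ[k] _).toLinearMap = ev2 (conv g h) l :=
    LinearMap.ext fun z => ev2_dDelta g h l z
  rw [e2, ev2_dDelta, conv_assoc]; rfl

theorem DynCocycle.inv_cocycle_tensor : Algebra.TensorProduct.map (.id k B)
      (Algebra.TensorProduct.map (.id k B) δ) (↑Υ.val⁻¹ : B ⊗[k] (B ⊗[k] L)) *
      dDelta (↑Υ.val⁻¹ : B ⊗[k] (B ⊗[k] L)) =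
    Algebra.TensorProduct.includeRight (↑Υ.val⁻¹ : B ⊗[k] (B ⊗[k] L)) *
      Algebra.TensorProduct.map (.id k B) dDelta (↑Υ.val⁻¹ : B ⊗[k] (B ⊗[k] L)) := by
  have e : Units.map (dDelta : B ⊗[k] (B ⊗[k] L) →ₐ[k] _).toMonoidHom Υ.val *
      Units.map (Algebra.TensorProduct.map (.id k B)
      (Algebra.TensorProduct.map (.id k B) δ)).toMonoidHom Υ.val =
      Units.map (Algebra.TensorProduct.map (.id k B)
        (dDelta : B ⊗[k] L →ₐ[k] _)).toMonoidHom Υ.val *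
      Units.map (Algebra.TensorProduct.includeRight (R := k) (A := B)
        (B := B ⊗[k] (B ⊗[k] L))).toMonoidHom Υ.val := Units.ext Υ.cocycle
  have e' := congrArg (fun u => u⁻¹) e
  simp only [mul_inv_rev] at e'
  exact congrArg Units.val e'

/-- The product `(f ⋆ g)(b) = f(Ῡ₁ b⁽¹⁾) g(Ῡ₂ b⁽²⁾) Ῡ_L`, where `Ῡ` is the inverse of the twist. -/
def DynCocycle.star (f g : B →ₗ[k] A) : B →ₗ[k] A :=
  ev3 f g s.toLinearMap ∘ₗ LinearMap.mulLeft k (↑Υ.val⁻¹ : B ⊗[k] (B ⊗[k] L)) ∘ₗ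
    (dDelta : B ⊗[k] L →ₐ[k] _).toLinearMap ∘ₗ inl k B L

theorem DynCocycle.star_apply (f g : B →ₗ[k] A) (b : B) : Υ.star s f g b =
    ev3 f g s.toLinearMap ((↑Υ.val⁻¹ : B ⊗[k] (B ⊗[k] L)) * dDelta (b ⊗ₜ (1 : L))) := rfl

theorem ev2_mul_right {M : Type*} [Ring M] [Algebra k M] (f : M →ₗ[k] A) (z : M ⊗[k] L) (m : L) :
    ev2 f s.toLinearMap (z * (1 ⊗ₜ m)) = ev2 f s.toLinearMap z * s m := by
  induction z with
  | zero => simp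
  | add x y hx hy => simp only [map_add, add_mul, hx, hy]
  | tmul x y => simp [mul_assoc]

theorem ev3_mul_right (f g : B →ₗ[k] A) (z : B ⊗[k] (B ⊗[k] L)) (m : L) :
    ev3 f g s.toLinearMap (z * (1 ⊗ₜ (1 ⊗ₜ m))) = ev3 f g s.toLinearMap z * s m := by
  induction z using tensor3_induction with
  | h0 => simp
  | hadd x y hx hy => simp only [map_add, add_mul, hx, hy]
  | h x y m => simp [mul_assoc]

theorem ev2_star (f g : B →ₗ[k] A) (z : B ⊗[k] L) :
    ev2 (Υ.star s f g) s.toLinearMap z =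
      ev3 f g s.toLinearMap ((↑Υ.val⁻¹ : B ⊗[k] (B ⊗[k] L)) * dDelta z) := by
  induction z with
  | zero => simp
  | add x y hx hy => simp only [map_add, mul_add, hx, hy]
  | tmul x m =>
    have : x ⊗ₜ[k] m = (x ⊗ₜ[k] (1 : L)) * ((1 : B) ⊗ₜ[k] m) := by simp
    rw [this, ev2_mul_right, dDelta_mul, dDelta_one_tmul, ← mul_assoc, ev3_mul_right,
      ← Υ.star_apply]
    simp

variable {s}

/-- `f` intertwines the multiplication by `L` with the coaction: `m f(b) = f(m⁽¹⁾ b) m⁽∞⁾`. -/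
def Intertwines (s : L →ₐ[k] A) (δ : L →ₐ[k] B ⊗[k] L) (f : B →ₗ[k] A) : Prop :=
  ∀ m b, ev2 f s.toLinearMap (δ m * (b ⊗ₜ 1)) = s m * f b

theorem Intertwines.ev2 {f : B →ₗ[k] A} (hf : Intertwines s δ f) (m : L) (z : B ⊗[k] L) :
    ev2 f s.toLinearMap (δ m * z) = s m * DynRE.ev2 f s.toLinearMap z := by
  induction z with
  | zero => simp
  | add x y hx hy => simp only [map_add, mul_add, hx, hy]
  | tmul x n =>
    have : x ⊗ₜ[k] n = (x ⊗ₜ[k] (1 : L)) * ((1 : B) ⊗ₜ[k] n) := by simp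
    rw [this, ← mul_assoc, ev2_mul_right, hf, ev2_mul_right, mul_assoc]
    simp

theorem Intertwines.ev3 (hδ : IsCoaction δ) {f g : B →ₗ[k] A} (hf : Intertwines s δ f)
    (hg : Intertwines s δ g) (m : L) (z : B ⊗[k] (B ⊗[k] L)) :
    ev3 f g s.toLinearMap (dDelta (δ m) * z) = s m * DynRE.ev3 f g s.toLinearMap z := by
  rw [hδ.coassoc]
  induction z with
  | zero => simp
  | add x y hx hy => simp only [map_add, mul_add, hx, hy]
  | tmul x w =>
    rw [ev2_tmul, ← mul_assoc, ← hf]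
    generalize δ m = d
    induction d with
    | zero => simp
    | add x y hx hy => simp only [map_add, add_mul, hx, hy]
    | tmul p q => simp [hg.ev2, mul_assoc]

/-- The inverse twist commutes with the iterated coaction, so an element of `L` can be drawn out of
both factors at once. -/
theorem Intertwines.star (hδ : IsCoaction δ) {f g : B →ₗ[k] A} (hf : Intertwines s δ f)
    (hg : Intertwines s δ g) : Intertwines s δ (Υ.star s f g) := by
  intro m b
  have hc : Commute (↑Υ.val⁻¹ : B ⊗[k] (B ⊗[k] L)) (dDelta (δ m)) :=
    Commute.units_inv_left (Υ.comm m)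
  rw [ev2_star, dDelta_mul, ← mul_assoc, hc.eq, mul_assoc, Intertwines.ev3 hδ hf hg,
    ← Υ.star_apply]

theorem intertwines_eps (hδ : IsCoaction δ) : Intertwines s δ (eps : B →ₗ[k] A) := by
  intro m b
  have h := hδ.counit m
  have h2 : Algebra.TensorProduct.lid k L (Algebra.TensorProduct.map
      (Bialgebra.counitAlgHom k B) (.id k L) (δ m)) = m := h
  rw [ev2_eps, map_mul, map_mul, h2]
  simp [eps_apply, Algebra.algebraMap_eq_smul_one]

theorem dDelta_tmul_coact {M : Type*} [Ring M] [Algebra k M] (x : B) (w : M) (δ : L →ₐ[k] M) :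
    Algebra.TensorProduct.map (.id k B) (Algebra.TensorProduct.map (.id k B) δ)
      (dDelta (x ⊗ₜ[k] (1 : L))) * (1 ⊗ₜ (1 ⊗ₜ w)) = dDelta (x ⊗ₜ w) := by
  simp only [dDelta, AlgHom.comp_apply, Algebra.TensorProduct.map_tmul,
    Bialgebra.comulAlgHom_apply, AlgHom.id_apply]
  induction Coalgebra.comul (R := k) x with
  | zero => simp
  | add x y hx hy => simp only [map_add, add_mul, TensorProduct.add_tmul, hx, hy]
  | tmul p q => simp

/-- The `L`-component of `z` stands to the left of the values of `h`. Moving it to the right costs a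
coaction into the leg of `h`, which is where the bar in F̄_{12|3} comes from. -/
theorem ev3_mul_ev2 {f g h : B →ₗ[k] A} (hh : Intertwines s δ h) (z : B ⊗[k] (B ⊗[k] L))
    (w : B ⊗[k] L) : ev3 f g s.toLinearMap z * ev2 h s.toLinearMap w =
      ev2 f (ev3 g h s.toLinearMap) (Algebra.TensorProduct.map (.id k B)
        (Algebra.TensorProduct.map (.id k B) δ) z * (1 ⊗ₜ (1 ⊗ₜ w))) := by
  induction z using tensor3_induction with
  | h0 => simp
  | hadd x y hx hy => simp only [map_add, add_mul, hx, hy]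
  | h x y m => simp [hh.ev2, mul_assoc]

theorem ev2_star_left {f g h : B →ₗ[k] A} (hh : Intertwines s δ h) (z : B ⊗[k] (B ⊗[k] L)) :
    ev2 (Υ.star s f g) (ev2 h s.toLinearMap) z = ev2 f (ev3 g h s.toLinearMap)
      (Algebra.TensorProduct.map (.id k B) (Algebra.TensorProduct.map (.id k B) δ)
        (↑Υ.val⁻¹ : B ⊗[k] (B ⊗[k] L)) * dDelta z) := by
  induction z with
  | zero => simp
  | add x y hx hy => simp only [map_add, mul_add, hx, hy]
  | tmul x w =>
    rw [ev2_tmul, Υ.star_apply, ev3_mul_ev2 hh, ← dDelta_tmul_coact x w δ, ← mul_assoc, map_mul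
      (Algebra.TensorProduct.map (.id k B) (Algebra.TensorProduct.map (.id k B) δ))]

theorem ev2_star_right {f g h : B →ₗ[k] A} (z : B ⊗[k] (B ⊗[k] L)) :
    ev2 f (ev2 (Υ.star s g h) s.toLinearMap) z = ev2 f (ev3 g h s.toLinearMap)
      (Algebra.TensorProduct.includeRight (↑Υ.val⁻¹ : B ⊗[k] (B ⊗[k] L)) *
        Algebra.TensorProduct.map (.id k B) dDelta z) := by
  induction z with
  | zero => simp
  | add x y hx hy => simp only [map_add, mul_add, hx, hy]
  | tmul x w => simp [ev2_star]

/-- Both bracketings evaluate the twice iterated coproduct multiplied on the left by one side of the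
inverse cocycle identity. Intertwining is needed for the last factor alone. -/
theorem star_assoc {f g h : B →ₗ[k] A} (hh : Intertwines s δ h) :
    Υ.star s (Υ.star s f g) h = Υ.star s f (Υ.star s g h) := by
  ext b
  rw [Υ.star_apply, Υ.star_apply, ev3, ev2_star_left Υ hh, ev3, ev2_star_right, dDelta_mul,
    dDelta_dDelta, idDelta_mul, ← mul_assoc, ← mul_assoc, Υ.inv_cocycle_tensor]

theorem eps_star (g : B →ₗ[k] A) : Υ.star s eps g = g := by
  ext b
  have : Algebra.TensorProduct.lid k (B ⊗[k] L) (Algebra.TensorProduct.map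
      (Bialgebra.counitAlgHom k B) (.id k (B ⊗[k] L)) (dDelta (b ⊗ₜ[k] (1 : L)))) = b ⊗ₜ 1 := by
    have e := ev2_eps (k := k) (B := B) (LinearMap.id : B ⊗[k] L →ₗ[k] B ⊗[k] L)
      (dDelta (b ⊗ₜ[k] (1 : L)))
    rw [LinearMap.id_apply, ← ev2_include, ev2_dDelta, eps_conv, ev2_incl'] at e
    exact e.symm
  rw [Υ.star_apply, ev3, ev2_eps, map_mul, map_mul, Υ.lid_counit_inv, one_mul, this]
  simp

theorem star_eps (g : B →ₗ[k] A) : Υ.star s g eps = g := by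
  ext b
  have : Algebra.TensorProduct.map (.id k B)
    ((Algebra.TensorProduct.lid k L).toAlgHom.comp
      (Algebra.TensorProduct.map (Bialgebra.counitAlgHom k B) (.id k L)))
        (dDelta (b ⊗ₜ[k] (1 : L))) = b ⊗ₜ 1 := by
    have e := ev3_eps (k := k) (inl k B L) (inr k B L) (dDelta (b ⊗ₜ[k] (1 : L)))
    rw [ev2_incl', ev3, ev2_dDelta, conv_eps, ev2_incl'] at e
    exact e.symm
  rw [Υ.star_apply, ev3_eps, map_mul, Υ.rid_counit_inv, one_mul, this]
  simp

variable (s) in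
/-- The space of linear maps `B → A` which intertwine the actions of `L`. -/
def dynConv (_Υ : DynCocycle δ) (s : L →ₐ[k] A) : Submodule k (B →ₗ[k] A) where
  carrier := {f | Intertwines s δ f}
  add_mem' {f g} hf hg m b := by
    have e : ∀ z, ev2 (f + g) s.toLinearMap z = ev2 f s.toLinearMap z + ev2 g s.toLinearMap z := by
      intro z
      induction z with
      | zero => simp
      | add x y hx hy => simp only [map_add, hx, hy]; abel
      | tmul x y => simp [add_mul]
    rw [e, hf, hg, LinearMap.add_apply, mul_add]
  zero_mem' m b := by
    have e : ∀ z, ev2 (0 : B →ₗ[k] A) s.toLinearMap z = 0 := by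
      intro z
      induction z with
      | zero => simp
      | add x y hx hy => simp only [map_add, hx, hy, add_zero]
      | tmul x y => simp
    rw [e, LinearMap.zero_apply, mul_zero]
  smul_mem' c f hf m b := by
    have e : ∀ z, ev2 (c • f) s.toLinearMap z = c • ev2 f s.toLinearMap z := by
      intro z
      induction z with
      | zero => simp
      | add x y hx hy => simp only [map_add, hx, hy, smul_add]
      | tmul x y => simp
    rw [e, hf, LinearMap.smul_apply, mul_smul_comm]

theorem star_add_left (f f' g : B →ₗ[k] A) :
    Υ.star s (f + f') g = Υ.star s f g + Υ.star s f' g := by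
  ext b
  simp only [Υ.star_apply, LinearMap.add_apply]
  generalize (↑Υ.val⁻¹ : B ⊗[k] (B ⊗[k] L)) * _ = z
  induction z using tensor3_induction with
  | h0 => simp
  | hadd x y hx hy => simp only [map_add, hx, hy]; abel
  | h x y m => simp [add_mul]

theorem star_add_right (f g g' : B →ₗ[k] A) :
    Υ.star s f (g + g') = Υ.star s f g + Υ.star s f g' := by
  ext b
  simp only [Υ.star_apply, LinearMap.add_apply]
  generalize (↑Υ.val⁻¹ : B ⊗[k] (B ⊗[k] L)) * _ = z
  induction z using tensor3_induction with
  | h0 => simp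
  | hadd x y hx hy => simp only [map_add, hx, hy]; abel
  | h x y m => simp [add_mul, mul_add]

theorem star_smul_left (c : k) (f g : B →ₗ[k] A) :
    Υ.star s (c • f) g = c • Υ.star s f g := by
  ext b
  simp only [Υ.star_apply, LinearMap.smul_apply]
  generalize (↑Υ.val⁻¹ : B ⊗[k] (B ⊗[k] L)) * _ = z
  induction z using tensor3_induction with
  | h0 => simp
  | hadd x y hx hy => simp only [map_add, hx, hy, smul_add]
  | h x y m => simp

theorem star_smul_right (c : k) (f g : B →ₗ[k] A) :
    Υ.star s f (c • g) = c • Υ.star s f g := by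
  ext b
  simp only [Υ.star_apply, LinearMap.smul_apply]
  generalize (↑Υ.val⁻¹ : B ⊗[k] (B ⊗[k] L)) * _ = z
  induction z using tensor3_induction with
  | h0 => simp
  | hadd x y hx hy => simp only [map_add, hx, hy, smul_add]
  | h x y m => simp

variable [hδ : Fact (IsCoaction δ)]

/-- The product depends on the twist, which is therefore recorded in the type `dynConv`. With the
zero twisting data of a trivial base it would be the usual convolution algebra. -/
instance : Ring (dynConv Υ s) :=
  { (inferInstance : AddCommGroup (dynConv Υ s)) with
    mul := fun f g => ⟨Υ.star s f.1 g.1, Intertwines.star Υ hδ.out f.2 g.2⟩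
    one := ⟨eps, intertwines_eps hδ.out⟩
    mul_assoc := fun f g h => Subtype.ext (star_assoc Υ h.2)
    one_mul := fun f => Subtype.ext (eps_star Υ f.1)
    mul_one := fun f => Subtype.ext (star_eps Υ f.1)
    left_distrib := fun f g h => Subtype.ext (star_add_right Υ f.1 g.1 h.1)
    right_distrib := fun f g h => Subtype.ext (star_add_left Υ f.1 g.1 h.1)
    zero_mul := fun f => Subtype.ext (by
      have := star_smul_left Υ (s := s) 0 f.1 f.1; rw [zero_smul, zero_smul] at this; exact this)
    mul_zero := fun f => Subtype.ext (by
      have := star_smul_right Υ (s := s) 0 f.1 f.1; rw [zero_smul, zero_smul] at this; exact this) }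

instance : Algebra k (dynConv Υ s) :=
  Algebra.ofModule (fun c f g => Subtype.ext (star_smul_left Υ c f.1 g.1))
    (fun c f g => Subtype.ext (star_smul_right Υ c f.1 g.1))

theorem dynConv_mul (f g : dynConv Υ s) : (f * g).1 = Υ.star s f.1 g.1 := rfl

theorem dynConv_one : (1 : dynConv Υ s).1 = eps := rfl

end DynConv
end DynRE
end

noncomputable section
namespace DynRE

/-! ### From base algebras and bialgebra maps to dynamical twists -/

section Concrete
set_option maxSynthPendingDepth 6
variable {k H U L : Type*} [Field k] [Ring H] [HopfAlgebra k H] [Ring U] [HopfAlgebra k U]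
  [Ring L] [Algebra k L] (𝓛 : BaseAlgebra k H L)

theorem isCoaction_coact : IsCoaction 𝓛.coact :=
  ⟨𝓛.coassoc, 𝓛.counit_coact⟩

/-- An algebra map which respects the coalgebra structures. -/
structure IsBialgHom {B C : Type*} [Ring B] [Bialgebra k B] [Ring C] [Bialgebra k C]
    (p : B →ₐ[k] C) : Prop where
  comul : ∀ x, Coalgebra.comul (R := k) (p x) =
    Algebra.TensorProduct.map p p (Coalgebra.comul (R := k) x)
  counit : ∀ x, Coalgebra.counit (R := k) (p x) = Coalgebra.counit (R := k) x

theorem isBialgHom_coe {B C : Type*} [Ring B] [Bialgebra k B] [Ring C] [Bialgebra k C]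
    (p : B →ₐc[k] C) : IsBialgHom (p : B →ₐ[k] C) :=
  ⟨fun x => (CoalgHomClass.map_comp_comul_apply p x).symm,
    fun x => CoalgHomClass.counit_comp_apply p x⟩

section Push
variable {B C : Type*} [Ring B] [Bialgebra k B] [Ring C] [Bialgebra k C] {p : B →ₐ[k] C}

theorem IsBialgHom.dDelta (hp : IsBialgHom p) {M N : Type*} [Ring M] [Algebra k M]
    [Ring N] [Algebra k N] (q : M →ₐ[k] N) (z : B ⊗[k] M) :
    DynRE.dDelta (Algebra.TensorProduct.map p q z) =
      Algebra.TensorProduct.map p (Algebra.TensorProduct.map p q) (DynRE.dDelta z) := by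
  induction z with
  | zero => simp
  | add x y hx hy => simp only [map_add, hx, hy]
  | tmul x m =>
    simp only [DynRE.dDelta, AlgHom.comp_apply, Algebra.TensorProduct.map_tmul,
      Bialgebra.comulAlgHom_apply, hp.comul]
    induction Coalgebra.comul (R := k) x with
    | zero => simp
    | add x y hx hy => simp only [map_add, TensorProduct.add_tmul, hx, hy]
    | tmul a b => simp

theorem IsBialgHom.lid_counit (hp : IsBialgHom p) {M N : Type*} [Ring M] [Algebra k M]
    [Ring N] [Algebra k N] (q : M →ₐ[k] N) (z : B ⊗[k] M) :
    Algebra.TensorProduct.lid k N (Algebra.TensorProduct.map (Bialgebra.counitAlgHom k C)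
      (.id k N) (Algebra.TensorProduct.map p q z)) =
    q (Algebra.TensorProduct.lid k M (Algebra.TensorProduct.map (Bialgebra.counitAlgHom k B)
      (.id k M) z)) := by
  induction z with
  | zero => simp
  | add x y hx hy => simp only [map_add, hx, hy]
  | tmul x m => simp [hp.counit]

variable {δ : L →ₐ[k] B ⊗[k] L}

/-- The coaction pushed forward along `p`. -/
abbrev pushCoact (p : B →ₐ[k] C) (δ : L →ₐ[k] B ⊗[k] L) : L →ₐ[k] C ⊗[k] L :=
  (Algebra.TensorProduct.map p (.id k L)).comp δ

theorem map_pushCoact (p : B →ₐ[k] C) {M N : Type*} [Ring M] [Algebra k M] [Ring N] [Algebra k N]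
    (q : M →ₐ[k] N) (z : M ⊗[k] L) :
    Algebra.TensorProduct.map (.id k N) (pushCoact p δ) (Algebra.TensorProduct.map q (.id k L) z) =
      Algebra.TensorProduct.map q (Algebra.TensorProduct.map p (.id k L))
        (Algebra.TensorProduct.map (.id k M) δ z) := by
  induction z with
  | zero => simp
  | add x y hx hy => simp only [map_add, hx, hy]
  | tmul x m => simp

theorem IsCoaction.push (hδ : IsCoaction δ) (hp : IsBialgHom p) : IsCoaction (pushCoact p δ) where
  coassoc m := by
    rw [AlgHom.comp_apply, hp.dDelta, hδ.coassoc, map_pushCoact]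
  counit m := (hp.lid_counit (.id k L) (δ m)).trans (hδ.counit m)

/-- The image of a dynamical twist under a homomorphism of bialgebras. -/
def DynCocycle.push (F : DynCocycle δ) (hp : IsBialgHom p) : DynCocycle (pushCoact p δ) where
  val := Units.map (Algebra.TensorProduct.map p
    (Algebra.TensorProduct.map p (.id k L))).toMonoidHom F.val
  comm m := by
    rw [AlgHom.comp_apply, hp.dDelta]
    exact (F.comm m).map (Algebra.TensorProduct.map p (Algebra.TensorProduct.map p (.id k L)))
  cocycle := by
    have h1 := hp.dDelta (Algebra.TensorProduct.map p (.id k L)) (F.val : B ⊗[k] (B ⊗[k] L))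
    have h2 : ∀ z : B ⊗[k] (B ⊗[k] L), Algebra.TensorProduct.map (.id k C)
        (Algebra.TensorProduct.map (.id k C) (pushCoact p δ))
        (Algebra.TensorProduct.map p (Algebra.TensorProduct.map p (.id k L)) z) =
        Algebra.TensorProduct.map p (Algebra.TensorProduct.map p
          (Algebra.TensorProduct.map p (.id k L))) (Algebra.TensorProduct.map (.id k B)
            (Algebra.TensorProduct.map (.id k B) δ) z) := by
      intro z
      induction z with
      | zero => simp
      | add x y hx hy => simp only [map_add, hx, hy]
      | tmul x m => simp [map_pushCoact]
    have h3 : ∀ z : B ⊗[k] (B ⊗[k] L), Algebra.TensorProduct.map (.id k C) DynRE.dDelta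
        (Algebra.TensorProduct.map p (Algebra.TensorProduct.map p (.id k L)) z) =
        Algebra.TensorProduct.map p (Algebra.TensorProduct.map p
          (Algebra.TensorProduct.map p (.id k L))) (Algebra.TensorProduct.map (.id k B)
            DynRE.dDelta z) := by
      intro z
      induction z with
      | zero => simp
      | add x y hx hy => simp only [map_add, hx, hy]
      | tmul x m => simp [hp.dDelta]
    have h4 : ∀ z : B ⊗[k] (B ⊗[k] L), Algebra.TensorProduct.includeRight (A := C)
        (Algebra.TensorProduct.map p (Algebra.TensorProduct.map p (.id k L)) z) =
        Algebra.TensorProduct.map p (Algebra.TensorProduct.map p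
          (Algebra.TensorProduct.map p (.id k L))) (Algebra.TensorProduct.includeRight (R := k) z) := by
      intro z; simp
    change DynRE.dDelta (Algebra.TensorProduct.map p _ _) * Algebra.TensorProduct.map (.id k C) _
      (Algebra.TensorProduct.map p _ _) = Algebra.TensorProduct.map (.id k C) _
      (Algebra.TensorProduct.map p _ _) * Algebra.TensorProduct.includeRight
        (Algebra.TensorProduct.map p _ _)
    rw [h1, h2, h3, h4, ← map_mul, ← map_mul, F.cocycle]
  counit_left := by
    refine (hp.lid_counit _ _).trans ?_
    rw [F.counit_left, map_one]
  counit_right := by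
    have h : ∀ z : B ⊗[k] (B ⊗[k] L), Algebra.TensorProduct.map (.id k C)
        ((Algebra.TensorProduct.lid k L).toAlgHom.comp
          (Algebra.TensorProduct.map (Bialgebra.counitAlgHom k C) (.id k L)))
          (Algebra.TensorProduct.map p (Algebra.TensorProduct.map p (.id k L)) z) =
        Algebra.TensorProduct.map p (.id k L) (Algebra.TensorProduct.map (.id k B)
        ((Algebra.TensorProduct.lid k L).toAlgHom.comp
          (Algebra.TensorProduct.map (Bialgebra.counitAlgHom k B) (.id k L))) z) := by
      intro z
      induction z using tensor3_induction with
      | h0 => simp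
      | hadd x y hx hy => simp only [map_add, hx, hy]
      | h x y m => simp [hp.counit]
    refine (h _).trans ?_
    rw [F.counit_right, map_one]

end Push

section Twist
variable {𝓛} {ι : H →ₐc[k] U} (F : DynamicalTwist 𝓛 ι)

theorem isCoaction_dCoact : IsCoaction (dCoact 𝓛 (ι : H →ₐ[k] U)) :=
  (isCoaction_coact 𝓛).push (isBialgHom_coe ι)

/-- Let m⁽¹⁾ act diagonally and multiply by m⁽∞⁾ in `L`. By coassociativity the last part of m⁽¹⁾
meets m⁽∞⁾, and quasi-commutativity replaces their action on p by left multiplication. -/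
theorem diagAct_comm (x y : U) (p m : L) :
    TensorProduct.lift ((LinearMap.mul k (U ⊗[k] (U ⊗[k] L))).compl₁₂
        ((diagAct 𝓛 ι).flip (x ⊗ₜ (y ⊗ₜ p)))
        (inr k U (U ⊗[k] L) ∘ₗ inr k U L)) (𝓛.coact m) =
      dDelta (dCoact 𝓛 (ι : H →ₐ[k] U) m) * (x ⊗ₜ (y ⊗ₜ p)) := by
  let f : H →ₗ[k] U ⊗[k] (U ⊗[k] L) :=
    inl k U (U ⊗[k] L) ∘ₗ LinearMap.mulRight k x ∘ₗ (ι : H →ₐ[k] U).toLinearMap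
  let g : H →ₗ[k] U ⊗[k] (U ⊗[k] L) := inr k U (U ⊗[k] L) ∘ₗ inl k U L ∘ₗ LinearMap.mulRight k y ∘ₗ
    (ι : H →ₐ[k] U).toLinearMap
  let a : H →ₗ[k] U ⊗[k] (U ⊗[k] L) := inr k U (U ⊗[k] L) ∘ₗ inr k U L ∘ₗ 𝓛.act.toLinearMap.flip p
  let c : L →ₗ[k] U ⊗[k] (U ⊗[k] L) := inr k U (U ⊗[k] L) ∘ₗ inr k U L
  have e1 : (diagAct 𝓛 ι).flip (x ⊗ₜ (y ⊗ₜ p)) = conv f (conv g a) := by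
    ext h
    have e2 : ∀ w : H ⊗[k] H, (TensorProduct.homTensorHomMap (RingHom.id k) U L U L
        (TensorProduct.map (LinearMap.mul k U ∘ₗ (ι : H →ₐ[k] U).toLinearMap)
          𝓛.act.toLinearMap w)) (y ⊗ₜ p) = ev2 (inl k U L ∘ₗ LinearMap.mulRight k y ∘ₗ
    (ι : H →ₐ[k] U).toLinearMap) (inr k U L ∘ₗ 𝓛.act.toLinearMap.flip p) w := by
      intro w
      induction w with
      | zero => simp
      | add x y hx hy => simp only [map_add, LinearMap.add_apply, hx, hy]
      | tmul p q => simp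
    have e3 : conv g a = inr k U (U ⊗[k] L) ∘ₗ conv (inl k U L ∘ₗ LinearMap.mulRight k y ∘ₗ
        (ι : H →ₐ[k] U).toLinearMap) (inr k U L ∘ₗ 𝓛.act.toLinearMap.flip p) :=
      (comp_conv isAlgHom_inr _ _).symm
    rw [e3]
    simp only [LinearMap.flip_apply, diagAct, LinearMap.comp_apply, conv]
    induction Coalgebra.comul (R := k) h with
    | zero => simp
    | add x y hx hy => simp only [map_add, LinearMap.add_apply, hx, hy]
    | tmul p q =>
      simp only [TensorProduct.map_tmul, LinearMap.comp_apply, TensorProduct.homTensorHomMap_apply,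
        TensorProduct.homTensorHomMap_apply, ev2_tmul, f]
      rw [e2]
      simp
  -- Quasi-commutativity: (m⁽¹⁾ ▷ p) m⁽∞⁾ = m p.
  have e4 : ev2 a c ∘ₗ 𝓛.coact.toLinearMap = c ∘ₗ LinearMap.mulRight k p := by
    ext1 m
    have : ∀ z : H ⊗[k] L, ev2 a c z = c (LinearMap.mul' k L
        ((𝓛.act.toLinearMap.flip p).rTensor L z)) := by
      intro z
      induction z with
      | zero => simp
      | add x y hx hy => simp only [map_add, hx, hy]
      | tmul p q => simp [a, c]
    refine (this _).trans ?_
    rw [AlgHom.toLinearMap_apply, ← 𝓛.quasi_comm]; rfl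
  have e5 : ∀ z : H ⊗[k] L, ev2 (conv f g) (c ∘ₗ LinearMap.mulRight k p) z =
      dDelta (Algebra.TensorProduct.map (ι : H →ₐ[k] U) (.id k L) z) * (x ⊗ₜ (y ⊗ₜ p)) := by
    intro z
    induction z with
    | zero => simp
    | add x y hx hy => simp only [map_add, add_mul, hx, hy]
    | tmul h m =>
      rw [(isBialgHom_coe ι).dDelta]
      simp only [dDelta, AlgHom.comp_apply, Algebra.TensorProduct.map_tmul, ev2_tmul, conv,
        Bialgebra.comulAlgHom_apply, LinearMap.comp_apply]
      induction Coalgebra.comul (R := k) h with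
      | zero => simp
      | add x y hx hy => simp only [map_add, add_mul, TensorProduct.add_tmul, hx, hy]
      | tmul p q => simp [f, g, c]
  rw [e1]
  change ev2 (conv f (conv g a)) c (𝓛.coact m) = _
  rw [← conv_assoc, ← ev2_dDelta, (isCoaction_coact 𝓛).coassoc, ev2_algMap, e4]
  exact e5 _

/-- Apply m⁽¹⁾ diagonally to F and multiply by m⁽∞⁾. Invariance evaluates this as F times the
iterated coaction of m, and `diagAct_comm` as the iterated coaction times F. -/
theorem DynamicalTwist.commute (m : L) : Commute (F.val : U ⊗[k] (U ⊗[k] L))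
    (dDelta (dCoact 𝓛 (ι : H →ₐ[k] U) m)) := by
  have h1 : ∀ z : U ⊗[k] (U ⊗[k] L), TensorProduct.lift ((LinearMap.mul k
      (U ⊗[k] (U ⊗[k] L))).compl₁₂ ((diagAct 𝓛 ι).flip z)
        (inr k U (U ⊗[k] L) ∘ₗ inr k U L)) (𝓛.coact m) =
      dDelta (dCoact 𝓛 (ι : H →ₐ[k] U) m) * z := by
    intro z
    have e : ∀ w : H ⊗[k] L, ∀ z z' : U ⊗[k] (U ⊗[k] L), TensorProduct.lift ((LinearMap.mul k
      (U ⊗[k] (U ⊗[k] L))).compl₁₂ ((diagAct 𝓛 ι).flip (z + z'))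
        (inr k U (U ⊗[k] L) ∘ₗ inr k U L)) w = TensorProduct.lift ((LinearMap.mul k
      (U ⊗[k] (U ⊗[k] L))).compl₁₂ ((diagAct 𝓛 ι).flip z)
        (inr k U (U ⊗[k] L) ∘ₗ inr k U L)) w + TensorProduct.lift ((LinearMap.mul k
      (U ⊗[k] (U ⊗[k] L))).compl₁₂ ((diagAct 𝓛 ι).flip z')
        (inr k U (U ⊗[k] L) ∘ₗ inr k U L)) w := by
      intro w z z'
      induction w with
      | zero => simp
      | add x y hx hy => simp only [map_add] at hx hy ⊢; rw [hx, hy]; abel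
      | tmul x y => simp
    induction z using tensor3_induction with
    | h0 =>
      have := e (𝓛.coact m) 0 0
      rw [add_zero, left_eq_add] at this
      rw [this, mul_zero]
    | hadd x y hx hy => rw [e, hx, hy, mul_add]
    | h x y p => exact diagAct_comm x y p m
  have h2 : ∀ w : H ⊗[k] L, TensorProduct.lift ((LinearMap.mul k
      (U ⊗[k] (U ⊗[k] L))).compl₁₂ ((diagAct 𝓛 ι).flip (F.val : U ⊗[k] (U ⊗[k] L)))
        (inr k U (U ⊗[k] L) ∘ₗ inr k U L)) w =
      (F.val : U ⊗[k] (U ⊗[k] L)) * dDelta (Algebra.TensorProduct.map (ι : H →ₐ[k] U)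
        (.id k L) w) := by
    intro w
    induction w with
    | zero => simp
    | add x y hx hy => simp only [map_add, mul_add, hx, hy]
    | tmul x y =>
      have : Algebra.TensorProduct.map (ι : H →ₐ[k] U) (.id k L) (x ⊗ₜ y) =
        (ι x ⊗ₜ (1 : L)) * ((1 : U) ⊗ₜ y) := by simp
      rw [this, dDelta_mul, dDelta_one_tmul, ← mul_assoc, ← F.invariant]
      simp
  exact (h2 _).symm.trans (h1 _)

/-- A dynamical twist over the base algebra as a twist over the comodule algebra `L`. -/
def DynamicalTwist.toCocycle : DynCocycle (dCoact 𝓛 (ι : H →ₐ[k] U)) :=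
  ⟨F.val, F.commute, F.cocycle, F.counit_left, F.counit_right⟩

theorem zeta_eq : zeta F = F.toCocycle.zeta := rfl

end Twist
end Concrete
end DynRE
end

noncomputable section
namespace DynRE

/-! ### The twisted square and its action on the RE algebra -/

section Square
set_option maxSynthPendingDepth 6
variable {k U : Type*} [Field k] [Ring U] [HopfAlgebra k U] (R : UniversalRMatrix k U)

theorem comul_tensor_eq (z : U ⊗[k] U) : Coalgebra.comul (R := k) z =
    ev2 (conv (inl k (U ⊗[k] U) (U ⊗[k] U) ∘ₗ inl k U U) (inr k (U ⊗[k] U) (U ⊗[k] U) ∘ₗ inl k U U))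
      (conv (inl k (U ⊗[k] U) (U ⊗[k] U) ∘ₗ inr k U U)
        (inr k (U ⊗[k] U) (U ⊗[k] U) ∘ₗ inr k U U)) z := by
  induction z with
  | zero => simp
  | add x y hx hy => simp only [map_add, hx, hy]
  | tmul x y =>
    have h : x ⊗ₜ[k] y = (x ⊗ₜ 1) * (1 ⊗ₜ y) := by simp
    rw [ev2_tmul, h, Bialgebra.comul_mul, comul_one_tmul, comul_tmul_left]
    congr 1
    · simp only [conv, LinearMap.comp_apply]
      induction Coalgebra.comul (R := k) x with
      | zero => simp
      | add x y hx hy => simp only [map_add, hx, hy]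
      | tmul p q => simp
    · simp only [conv, LinearMap.comp_apply]
      induction Coalgebra.comul (R := k) y with
      | zero => simp
      | add x y hx hy => simp only [map_add, hx, hy]
      | tmul p q => simp

theorem map_comul_eq (z : U ⊗[k] U) :
    Algebra.TensorProduct.map (Bialgebra.comulAlgHom k U) (Bialgebra.comulAlgHom k U) z =
    ev2 (conv (inl k (U ⊗[k] U) (U ⊗[k] U) ∘ₗ inl k U U) (inl k (U ⊗[k] U) (U ⊗[k] U) ∘ₗ inr k U U))
      (conv (inr k (U ⊗[k] U) (U ⊗[k] U) ∘ₗ inl k U U)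
        (inr k (U ⊗[k] U) (U ⊗[k] U) ∘ₗ inr k U U)) z := by
  rw [← comp_conv isAlgHom_inl, ← comp_conv isAlgHom_inr, conv_include]
  induction z with
  | zero => simp
  | add x y hx hy => simp only [map_add, hx, hy]
  | tmul x y => simp

theorem unit23_eq : (R.unit23 : (U ⊗[k] U) ⊗[k] (U ⊗[k] U)) =
    R.ev (inl k (U ⊗[k] U) (U ⊗[k] U) ∘ₗ inr k U U)
      (inr k (U ⊗[k] U) (U ⊗[k] U) ∘ₗ inl k U U) := by
  have : ∀ z : U ⊗[k] U, embed23 k U z = ev2 (inl k (U ⊗[k] U) (U ⊗[k] U) ∘ₗ inr k U U)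
      (inr k (U ⊗[k] U) (U ⊗[k] U) ∘ₗ inl k U U) z := by
    intro z
    induction z with
    | zero => simp
    | add x y hx hy => simp only [map_add, hx, hy]
    | tmul x y => simp
  exact this _

/-- The two elements are the fourfold coproduct of x with the middle factors in the two orders, and
R₂₃ exchanges them. This is why `diag` respects the twisted coproduct. -/
theorem comul_diag_semiconj (x : U) : SemiconjBy (R.unit23 : (U ⊗[k] U) ⊗[k] (U ⊗[k] U))
    (Algebra.TensorProduct.map (Bialgebra.comulAlgHom k U) (Bialgebra.comulAlgHom k U)
      (Coalgebra.comul (R := k) x)) (Coalgebra.comul (R := k) (Coalgebra.comul (R := k) x)) := by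
  rw [comul_tensor_eq, map_comul_eq, unit23_eq]
  set f := inl k (U ⊗[k] U) (U ⊗[k] U) ∘ₗ inl k U U
  set g := inl k (U ⊗[k] U) (U ⊗[k] U) ∘ₗ inr k U U
  set h := inr k (U ⊗[k] U) (U ⊗[k] U) ∘ₗ inl k U U
  set p := inr k (U ⊗[k] U) (U ⊗[k] U) ∘ₗ inr k U U
  have hg : IsAlgHom g := isAlgHom_inl.comp isAlgHom_inr
  have hh : IsAlgHom h := isAlgHom_inr.comp isAlgHom_inl
  have gh : Comm g h := fun _ _ => comm_inl_inr _ _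
  have fg : Comm f g := fun _ _ => isAlgHom_inl.map_commute (comm_inl_inr _ _)
  have fh : Comm f h := fun _ _ => comm_inl_inr _ _
  have gp : Comm g p := fun _ _ => comm_inl_inr _ _
  have hp : Comm h p := fun _ _ => isAlgHom_inr.map_commute (comm_inl_inr _ _)
  change SemiconjBy _ (conv (conv f g) (conv h p) x) (conv (conv f h) (conv g p) x)
  rw [conv_assoc, conv_assoc, ← conv_assoc g, ← conv_assoc h]
  refine conv_semiconj (fun y => ?_) (fun y => conv_semiconj (R.ev_conv hg hh gh) (fun y => ?_) y) x
  · exact (ev2_commute (fg y) (fh y) _).symm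
  · exact (ev2_commute (fun x => (gp x y).symm) (fun x => (hp x y).symm) _).symm

theorem isBialgHom_diag : IsBialgHom (diag R) where
  comul x := by
    have h := comul_diag_semiconj R x
    change (↑R.unit23⁻¹ : (U ⊗[k] U) ⊗[k] (U ⊗[k] U)) *
      Coalgebra.comul (R := k) (Coalgebra.comul (R := k) x) * R.unit23.val =
      Algebra.TensorProduct.map (Bialgebra.comulAlgHom k U) (Bialgebra.comulAlgHom k U)
      (Coalgebra.comul (R := k) x)
    rw [mul_assoc, ← h.eq, ← mul_assoc, Units.inv_mul, one_mul]
  counit x := by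
    change Coalgebra.counit (R := k) (A := U ⊗[k] U) (Coalgebra.comul (R := k) x) = _
    have e : ∀ z : U ⊗[k] U, Coalgebra.counit (R := k) (A := U ⊗[k] U) z =
        Coalgebra.counit (R := k) (TensorProduct.lid k U
          ((Coalgebra.counit (R := k)).rTensor U z)) := by
      intro z
      induction z with
      | zero => simp
      | add x y hx hy => simp only [map_add, hx, hy]
      | tmul x y => simp [mul_comm]
    rw [e]
    simp

variable {n : Type*} [Fintype n] [DecidableEq n] (ρ : U →ₐ[k] Matrix n n k)

theorem REAlgebra.induction {P : REAlgebra R ρ → Prop} (halg : ∀ c, P (algebraMap k _ c))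
    (hgen : ∀ i j, P (REAlgebra.gen R ρ i j)) (hmul : ∀ a b, P a → P b → P (a * b))
    (hadd : ∀ a b, P a → P b → P (a + b)) (a : REAlgebra R ρ) : P a := by
  obtain ⟨z, rfl⟩ := RingQuot.mkAlgHom_surjective k (RERel R ρ) a
  change P (REAlgebra.mk R ρ z)
  induction z using FreeAlgebra.induction with
  | grade0 c => rw [AlgHom.commutes]; exact halg c
  | grade1 p => exact hgen p.1 p.2
  | mul a b ha hb => rw [map_mul]; exact hmul _ _ ha hb
  | add a b ha hb => rw [map_add]; exact hadd _ _ ha hb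

theorem REAlgebra.lift_gen {A : Type*} [Ring A] [Algebra k A] (X : Matrix n n A)
    (h : reLeft (braid A R ρ) X = reRight (braid A R ρ) X) (i j : n) :
    REAlgebra.lift R ρ X h (REAlgebra.gen R ρ i j) = X i j := by
  change RingQuot.liftAlgHom k _ (RingQuot.mkAlgHom k (RERel R ρ) (FreeAlgebra.ι k (i, j))) = _
  rw [RingQuot.liftAlgHom_mkAlgHom_apply]
  simp

theorem blackAct_gen (b : TwistedSquare R) (i j : n) :
    blackAct R ρ (REAlgebra.gen R ρ i j) b = sandwichK ρ (REAlgebra.gen R ρ) b i j := by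
  change (actHom R ρ (REAlgebra.gen R ρ i j)).ofConv b = _
  rw [actHom, REAlgebra.lift_gen]; rfl

theorem blackAct_mul (a a' : REAlgebra R ρ) :
    blackAct R ρ (a * a') = conv (blackAct R ρ a) (blackAct R ρ a') := by
  ext b
  change (actHom R ρ (a * a')).ofConv b = _
  rw [map_mul]
  have : ∀ w, LinearMap.mul' k (REAlgebra R ρ)
      (TensorProduct.map (blackAct R ρ a) (blackAct R ρ a') w) =
      ev2 (blackAct R ρ a) (blackAct R ρ a') w := by
    intro w
    induction w with
    | zero => simp
    | add x y hx hy => simp only [map_add, hx, hy]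
    | tmul x y => simp
  exact this (Coalgebra.comul (R := k) b)

theorem blackAct_algebraMap (c : k) (b : TwistedSquare R) :
    blackAct R ρ (algebraMap k _ c) b = Coalgebra.counit (R := k) b • algebraMap k _ c := by
  change (actHom R ρ (algebraMap k _ c)).ofConv b = _
  rw [AlgHom.commutes, Algebra.algebraMap_eq_smul_one]
  change c • (algebraMap k (REAlgebra R ρ) (Coalgebra.counit (R := k) b)) = _
  rw [Algebra.algebraMap_eq_smul_one, Algebra.algebraMap_eq_smul_one, smul_comm]

omit R in
theorem sandwichK_mul_tmul {A : Type*} [Ring A] [Algebra k A] (X : Matrix n n A) (b : U ⊗[k] U)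
    (x y : U) : sandwichK ρ X (b * (x ⊗ₜ y)) =
      repA A ρ (HopfAlgebra.antipode k x) * sandwichK ρ X b * repA A ρ y := by
  induction b with
  | zero => simp
  | add x y hx hy => simp only [map_add, mul_add, add_mul, hx, hy]
  | tmul p q =>
    simp only [Algebra.TensorProduct.tmul_mul_tmul, sandwichK_tmul,
      HopfAlgebra.antipode_mul_antidistrib, map_mul, mul_assoc]

theorem sandwichK_act (x y : U) (b : TwistedSquare R) (i j : n) :
    blackAct R ρ (sandwichK ρ (REAlgebra.gen R ρ) (x ⊗ₜ y) i j) b =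
      (repA (REAlgebra R ρ) ρ (HopfAlgebra.antipode k x) *
        sandwichK ρ (REAlgebra.gen R ρ) b * repA (REAlgebra R ρ) ρ y) i j := by
  rw [sandwichK_tmul]
  simp only [Matrix.mul_apply, map_sum, LinearMap.sum_apply]
  refine Finset.sum_congr rfl fun p _ => ?_
  simp only [Finset.sum_mul, map_sum, LinearMap.sum_apply]
  refine Finset.sum_congr rfl fun q _ => ?_
  have : ∀ x i j, repA (REAlgebra R ρ) ρ x i j = algebraMap k _ (ρ x i j) := fun _ _ _ => rfl
  rw [this, this, ← Algebra.commutes, ← Algebra.smul_def, ← Algebra.smul_def, map_smul, map_smul,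
    LinearMap.smul_apply, LinearMap.smul_apply, blackAct_gen, ← Algebra.commutes,
    ← Algebra.smul_def, ← Algebra.smul_def]

/-- Multiplicativity was built into `actHom`. The module axioms are then checked by induction: on
generators they follow from the antimultiplicativity of γ, and on products from the multiplicativity
of the coproduct. -/
theorem modAlg_blackAct : ModAlg (blackAct R ρ) where
  one_act a := by
    induction a using REAlgebra.induction with
    | halg c => rw [blackAct_algebraMap, Bialgebra.counit_one, one_smul]
    | hgen i j =>
      rw [blackAct_gen]
      change sandwichK ρ _ ((1 : U) ⊗ₜ[k] (1 : U)) i j = _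
      rw [sandwichK_tmul]; simp
    | hmul a b ha hb =>
      rw [blackAct_mul, conv, LinearMap.comp_apply, Bialgebra.comul_one,
        Algebra.TensorProduct.one_def, ev2_tmul, ha, hb]
    | hadd a b ha hb => rw [map_add, LinearMap.add_apply, ha, hb]
  act_act a := by
    induction a using REAlgebra.induction with
    | halg c =>
      intro b d
      rw [blackAct_algebraMap, blackAct_algebraMap, map_smul, LinearMap.smul_apply,
        blackAct_algebraMap, Bialgebra.counit_mul, smul_smul, mul_comm]
    | hgen i j =>
      intro b d
      rw [blackAct_gen, blackAct_gen]
      have : ∀ b d : U ⊗[k] U, blackAct R ρ (sandwichK ρ (REAlgebra.gen R ρ) d i j)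
          (toTwisted R b) = sandwichK ρ (REAlgebra.gen R ρ) (b * d) i j := by
        intro b d
        induction d with
        | zero => simp
        | add x y hx hy =>
          simp only [map_add, mul_add, Matrix.add_apply, LinearMap.add_apply, hx, hy]
        | tmul x y =>
          refine (sandwichK_act R ρ x y (toTwisted R b) i j).trans ?_
          rw [sandwichK_mul_tmul]
          rfl
      exact this b d
    | hmul a a' ha hb =>
      intro b d
      have : ∀ w : TwistedSquare R ⊗[k] TwistedSquare R,
          blackAct R ρ (ev2 (blackAct R ρ a) (blackAct R ρ a') w) b =
          ev2 (blackAct R ρ a) (blackAct R ρ a') (Coalgebra.comul (R := k) b * w) := by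
        intro w
        induction w with
        | zero => simp
        | add x y hx hy => simp only [map_add, LinearMap.add_apply, mul_add, hx, hy]
        | tmul p q =>
          rw [ev2_tmul, blackAct_mul, conv, LinearMap.comp_apply]
          induction Coalgebra.comul (R := k) b with
          | zero => simp
          | add x y hx hy => simp only [map_add, add_mul, hx, hy]
          | tmul x y => simp [ha, hb]
      rw [blackAct_mul, conv, LinearMap.comp_apply, this, ← Bialgebra.comul_mul]
      rfl
    | hadd a a' ha hb =>
      intro b d
      simp only [map_add, LinearMap.add_apply, ha, hb]
  act_mul := blackAct_mul R ρ
  act_one := by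
    ext b
    have := blackAct_algebraMap R ρ 1 b
    rw [map_one] at this
    rw [this, eps_apply, Algebra.algebraMap_eq_smul_one]

end Square

/-! ### Υ as a gauge transformed dynamical twist -/

section Upsilon
set_option maxSynthPendingDepth 6
variable {k H U L : Type*} [Field k] [Ring H] [HopfAlgebra k H] [Ring U] [HopfAlgebra k U]
  [Ring L] [Algebra k L] {𝓛 : BaseAlgebra k H L} {ι : H →ₐc[k] U} (F : DynamicalTwist 𝓛 ι)
  (R : UniversalRMatrix k U)

variable (𝓛 ι) in
/-- The coaction of the twisted tensor square on `L`. -/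
abbrev coactB : L →ₐ[k] TwistedSquare R ⊗[k] L :=
  pushCoact (diag R) (dCoact 𝓛 (ι : H →ₐ[k] U))

theorem dCoact_diag : dCoact 𝓛 ((diag R).comp (ι : H →ₐ[k] U)) = coactB 𝓛 ι R := by
  rw [dCoact, coactB, pushCoact, dCoact, ← AlgHom.comp_assoc, ← Algebra.TensorProduct.map_comp]
  rfl

theorem isCoaction_coactB : IsCoaction (coactB 𝓛 ι R) :=
  isCoaction_dCoact.push (isBialgHom_diag R)

instance : Fact (IsCoaction (coactB 𝓛 ι R)) := ⟨isCoaction_coactB R⟩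

/-- The twist `F_{(12)(34)}` of the twisted tensor square. -/
def squareCocycle : DynCocycle (coactB 𝓛 ι R) := F.toCocycle.push (isBialgHom_diag R)

variable (L) in
/-- `x ⊗ (y ⊗ m) ↦ (x ⊗ y) ⊗ m` -/
def assocB : U ⊗[k] (U ⊗[k] L) →ₐ[k] TwistedSquare R ⊗[k] L :=
  (Algebra.TensorProduct.map (toTwisted R).toAlgHom (.id k L)).comp
    (Algebra.TensorProduct.assoc k k k U U L).symm.toAlgHom

theorem assocB_dDelta (z : U ⊗[k] L) :
    assocB L R (dDelta z) = Algebra.TensorProduct.map (diag R) (.id k L) z := by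
  have : (Algebra.TensorProduct.assoc k k k U U L).symm (dDelta z) =
      Algebra.TensorProduct.map (Bialgebra.comulAlgHom k U) (.id k L) z :=
    (Algebra.TensorProduct.assoc k k k U U L).symm_apply_apply _
  change Algebra.TensorProduct.map _ _ ((Algebra.TensorProduct.assoc k k k U U L).symm _) = _
  rw [this, ← AlgHom.comp_apply, ← Algebra.TensorProduct.map_comp]
  rfl

variable [InvertibleAntipode k U]

/-- The gauge transformation `F ζ_{1|2}`, as a unit. -/
def gaugeB : (TwistedSquare R ⊗[k] L)ˣ :=
  Units.map (assocB L R).toMonoidHom (F.val * Units.map (Algebra.TensorProduct.map (.id k U)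
    (dCoact 𝓛 (ι : H →ₐ[k] U))).toMonoidHom (F.toCocycle.zetaUnit isCoaction_dCoact))

theorem gaugeB_val : (gaugeB F R : TwistedSquare R ⊗[k] L) = squareGauge F R := rfl

/-- The coaction of the twisted square is a regrouping of the iterated coaction. F commutes with it,
and so does ζ_{1|2}, because ζ commutes with the coaction and the latter is coassociative. -/
theorem gaugeB_commute (m : L) :
    Commute (gaugeB F R : TwistedSquare R ⊗[k] L) (coactB 𝓛 ι R m) := by
  rw [coactB, AlgHom.comp_apply, ← assocB_dDelta]
  refine Commute.map (Commute.mul_left (F.commute m) ?_) (assocB L R)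
  rw [isCoaction_dCoact.coassoc]
  exact (zeta_comm_coact F.toCocycle isCoaction_dCoact m).map
    (Algebra.TensorProduct.map (.id k U) (dCoact 𝓛 (ι : H →ₐ[k] U)))

/-- The counit ignores the inverse antipode and the order of factors, so this comes down to the
normalization of F̄. -/
theorem counit_zeta : Algebra.TensorProduct.lid k L (Algebra.TensorProduct.map
    (Bialgebra.counitAlgHom k U) (.id k L) F.toCocycle.zeta) = 1 := by
  have : ∀ z, Algebra.TensorProduct.lid k L (Algebra.TensorProduct.map
      (Bialgebra.counitAlgHom k U) (.id k L) (contr k U L z)) = Algebra.TensorProduct.lid k L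
      (Algebra.TensorProduct.map (Bialgebra.counitAlgHom k U) (.id k L)
        (Algebra.TensorProduct.lid k (U ⊗[k] L) (Algebra.TensorProduct.map
          (Bialgebra.counitAlgHom k U) (.id k (U ⊗[k] L)) z))) := by
    intro z
    induction z using tensor3_induction with
    | h0 => simp
    | hadd x y hx hy => simp only [map_add, hx, hy]
    | h x y m => simp [contr_tmul, counit_antipodeInv, smul_smul, mul_comm]
  refine (this _).trans ?_
  rw [F.toCocycle.lid_counit_inv, map_one, map_one]

theorem gaugeB_counit : Algebra.TensorProduct.lid k L (Algebra.TensorProduct.map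
    (Bialgebra.counitAlgHom k (TwistedSquare R)) (.id k L)
      (gaugeB F R : TwistedSquare R ⊗[k] L)) = 1 := by
  have e : ∀ z : U ⊗[k] (U ⊗[k] L), Algebra.TensorProduct.lid k L (Algebra.TensorProduct.map
      (Bialgebra.counitAlgHom k (TwistedSquare R)) (.id k L) (assocB L R z)) =
      Algebra.TensorProduct.lid k L
      (Algebra.TensorProduct.map (Bialgebra.counitAlgHom k U) (.id k L)
        (Algebra.TensorProduct.lid k (U ⊗[k] L) (Algebra.TensorProduct.map
          (Bialgebra.counitAlgHom k U) (.id k (U ⊗[k] L)) z))) := by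
    intro z
    induction z using tensor3_induction with
    | h0 => simp
    | hadd x y hx hy => simp only [map_add, hx, hy]
    | h x y m =>
      have : Coalgebra.counit (R := k) (toTwisted R (x ⊗ₜ y)) =
          Coalgebra.counit (R := k) (A := U ⊗[k] U) (x ⊗ₜ y) := rfl
      simp [assocB, this, smul_smul, mul_comm]
  have e2 : ∀ z : U ⊗[k] L, Algebra.TensorProduct.lid k (U ⊗[k] L) (Algebra.TensorProduct.map
      (Bialgebra.counitAlgHom k U) (.id k (U ⊗[k] L)) (Algebra.TensorProduct.map (.id k U)
        (dCoact 𝓛 (ι : H →ₐ[k] U)) z)) = dCoact 𝓛 (ι : H →ₐ[k] U)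
      (Algebra.TensorProduct.lid k L (Algebra.TensorProduct.map
        (Bialgebra.counitAlgHom k U) (.id k L) z)) := by
    intro z
    induction z with
    | zero => simp
    | add x y hx hy => simp only [map_add, hx, hy]
    | tmul x y => simp
  refine (e _).trans ?_
  change Algebra.TensorProduct.lid k L (Algebra.TensorProduct.map _ _ (Algebra.TensorProduct.lid k _
    (Algebra.TensorProduct.map _ _ ((F.val : U ⊗[k] (U ⊗[k] L)) * _)))) = 1
  rw [map_mul, map_mul, F.counit_left, one_mul]
  refine (congrArg (fun t => Algebra.TensorProduct.lid k L (Algebra.TensorProduct.map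
    (Bialgebra.counitAlgHom k U) (.id k L) t)) (e2 F.toCocycle.zeta)).trans ?_
  rw [counit_zeta, map_one, map_one, map_one]

/-- `Υ` as a dynamical twist of the twisted tensor square. -/
def upsilonCocycle : DynCocycle (coactB 𝓛 ι R) :=
  (squareCocycle F R).gauge (gaugeB_commute F R) (gaugeB_counit F R) (isCoaction_coactB R)

theorem upsilonCocycle_val :
    ((upsilonCocycle F R).val : TwistedSquare R ⊗[k] (TwistedSquare R ⊗[k] L)) = upsilon F R := by
  rw [upsilon, gauge, ← gaugeB_val, Ring.inverse_unit, dCoact_diag]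
  rfl

variable {n : Type*} [Fintype n] [DecidableEq n] (ρ : U →ₐ[k] Matrix n n k)

omit [InvertibleAntipode k U] in
theorem actPair_eq (a b : REAlgebra R ρ) (z : TwistedSquare R ⊗[k] (TwistedSquare R ⊗[k] L)) :
    actPair L R ρ a b z = act2 (blackAct R ρ) a b z := by
  induction z using tensor3_induction with
  | h0 => simp
  | hadd x y hx hy => simp only [map_add, hx, hy]
  | h x y m => simp [act2_tmul, actPair]

theorem twistedMul_eq : twistedMul F R ρ = (upsilonCocycle F R).tmul (blackAct R ρ) := by
  ext a l b m
  change twistedMulPure F R ρ a l b m = DynCocycle.tmul _ _ (a ⊗ₜ l) (b ⊗ₜ m)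
  rw [twistedMulPure, actPair_eq, DynCocycle.tmul_tmul, upsilonCocycle_val, dCoact_diag]
  refine (act2_mul_inr _ _ _ _ _).trans ?_
  rw [mul_assoc]
  simp

end Upsilon
end DynRE
end

noncomputable section
namespace DynRE

/-! ### Legs of the twisted square -/

section SquareLegs
set_option maxSynthPendingDepth 6
variable {k U : Type*} [Field k] [Ring U] [HopfAlgebra k U] (R : UniversalRMatrix k U)

/-- `x ↦ x ⊗ 1`, with values in the twisted tensor square. -/
def sqL : U →ₗ[k] TwistedSquare R := (toTwisted R).toLinearMap ∘ₗ inl k U U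

/-- `y ↦ 1 ⊗ y`, with values in the twisted tensor square. -/
def sqR : U →ₗ[k] TwistedSquare R := (toTwisted R).toLinearMap ∘ₗ inr k U U

theorem isAlgHom_sqL : IsAlgHom (sqL R) :=
  (isAlgHom_algHom (toTwisted R).toAlgHom).comp isAlgHom_inl

theorem isAlgHom_sqR : IsAlgHom (sqR R) :=
  (isAlgHom_algHom (toTwisted R).toAlgHom).comp isAlgHom_inr

theorem comm_sqL_sqR : Comm (sqL R) (sqR R) := fun x y =>
  (isAlgHom_algHom (toTwisted R).toAlgHom).map_commute (comm_inl_inr x y)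

theorem sqL_mul_sqR (x y : U) : sqL R x * sqR R y = toTwisted R (x ⊗ₜ y) := by
  change toTwisted R (x ⊗ₜ 1) * toTwisted R (1 ⊗ₜ y) = _
  rw [← map_mul, Algebra.TensorProduct.tmul_mul_tmul, mul_one, one_mul]

theorem conv_sqL_sqR : conv (sqL R) (sqR R) = (diag R).toLinearMap := by
  have e := comp_conv (isAlgHom_algHom (toTwisted R).toAlgHom) (inl k U U) (inr k U U)
  rw [conv_include] at e
  exact e.symm

variable {L A : Type*} [Ring L] [Algebra k L] [Ring A] [Algebra k A]

theorem IsAlgHom.toTwisted_apply {G : TwistedSquare R →ₗ[k] A} (hG : IsAlgHom G) (z : U ⊗[k] U) :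
    G (toTwisted R z) = DynRE.ev2 (G ∘ₗ sqL R) (G ∘ₗ sqR R) z := by
  induction z with
  | zero => simp
  | add x y hx hy => simp only [map_add, hx, hy]
  | tmul x y => rw [← sqL_mul_sqR, hG.map_mul]; simp

theorem comp_diag {G : TwistedSquare R →ₗ[k] A} (hG : IsAlgHom G) :
    G ∘ₗ (diag R).toLinearMap = conv (G ∘ₗ sqL R) (G ∘ₗ sqR R) := by
  rw [← conv_sqL_sqR, comp_conv hG]

variable {F₁ F₂ : TwistedSquare R →ₗ[k] A} {l : L →ₗ[k] A}

theorem Legs3.square (H : Legs3 F₁ F₂ l) :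
    Legs5 (F₁ ∘ₗ sqL R) (F₁ ∘ₗ sqR R) (F₂ ∘ₗ sqL R) (F₂ ∘ₗ sqR R) l :=
  ⟨H.hf.comp (isAlgHom_sqL R), H.hf.comp (isAlgHom_sqR R), H.hg.comp (isAlgHom_sqL R),
    H.hg.comp (isAlgHom_sqR R), H.hl, fun x y => H.hf.map_commute (comm_sqL_sqR R x y),
    fun _ _ => H.fg _ _, fun _ _ => H.fg _ _, fun _ _ => H.fl _ _, fun _ _ => H.fg _ _,
    fun _ _ => H.fg _ _, fun _ _ => H.fl _ _, fun x y => H.hg.map_commute (comm_sqL_sqR R x y),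
    fun _ _ => H.gl _ _, fun _ _ => H.gl _ _⟩

/-- The coproduct of the twisted tensor square in terms of legs. -/
theorem conv_square (hf : IsAlgHom F₁) (hg : IsAlgHom F₂) (fg : Comm F₁ F₂) (b : U ⊗[k] U) :
    SemiconjBy (R.ev (F₁ ∘ₗ sqR R) (F₂ ∘ₗ sqL R)) (conv F₁ F₂ (toTwisted R b))
      (ev2 (conv (F₁ ∘ₗ sqL R) (F₂ ∘ₗ sqL R)) (conv (F₁ ∘ₗ sqR R) (F₂ ∘ₗ sqR R)) b) := by
  let G₁ : U ⊗[k] U →ₗ[k] A := F₁ ∘ₗ (toTwisted R).toLinearMap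
  let G₂ : U ⊗[k] U →ₗ[k] A := F₂ ∘ₗ (toTwisted R).toLinearMap
  have h₁ : IsAlgHom G₁ := hf.comp (isAlgHom_algHom (toTwisted R).toAlgHom)
  have h₂ : IsAlgHom G₂ := hg.comp (isAlgHom_algHom (toTwisted R).toAlgHom)
  have hG : IsAlgHom (ev2 G₁ G₂) := h₁.ev2 h₂ fun _ _ => fg _ _
  have e0 : conv F₁ F₂ (toTwisted R b) = ev2 G₁ G₂ ((↑R.unit23⁻¹ : (U ⊗[k] U) ⊗[k] (U ⊗[k] U)) *
      Coalgebra.comul (R := k) b * R.unit23.val) := rfl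
  have i1 : ∀ f : U →ₗ[k] U ⊗[k] U,
      ev2 G₁ G₂ ∘ₗ (inl k (U ⊗[k] U) (U ⊗[k] U) ∘ₗ f) = G₁ ∘ₗ f := by
    intro f; ext x; simp [h₂.map_one]
  have i2 : ∀ f : U →ₗ[k] U ⊗[k] U,
      ev2 G₁ G₂ ∘ₗ (inr k (U ⊗[k] U) (U ⊗[k] U) ∘ₗ f) = G₂ ∘ₗ f := by
    intro f; ext x; simp [h₁.map_one]
  have e1 : ev2 G₁ G₂ (R.unit23 : (U ⊗[k] U) ⊗[k] (U ⊗[k] U)) =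
      R.ev (F₁ ∘ₗ sqR R) (F₂ ∘ₗ sqL R) := by
    rw [unit23_eq, UniversalRMatrix.ev, ← LinearMap.comp_apply, comp_ev2 hG, i1, i2]
    rfl
  have e2 : ev2 G₁ G₂ (Coalgebra.comul (R := k) b) = ev2 (conv (F₁ ∘ₗ sqL R) (F₂ ∘ₗ sqL R))
      (conv (F₁ ∘ₗ sqR R) (F₂ ∘ₗ sqR R)) b := by
    rw [comul_tensor_eq, ← LinearMap.comp_apply, comp_ev2 hG, comp_conv hG, comp_conv hG,
      i1, i1, i2, i2]
    rfl
  rw [SemiconjBy, e0, ← e1, ← e2, ← hG.map_mul, ← hG.map_mul, ← mul_assoc, ← mul_assoc,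
    Units.mul_inv, one_mul]

theorem ev2_assocB {G : TwistedSquare R →ₗ[k] A} (hG : ∀ x y, G (toTwisted R (x ⊗ₜ y)) =
    G (sqL R x) * G (sqR R y)) (z : U ⊗[k] (U ⊗[k] L)) :
    ev2 G l (assocB L R z) = ev3 (G ∘ₗ sqL R) (G ∘ₗ sqR R) l z := by
  induction z using tensor3_induction with
  | h0 => simp
  | hadd x y hx hy => simp only [map_add, hx, hy]
  | h x y m =>
    have : assocB L R (x ⊗ₜ (y ⊗ₜ m)) = toTwisted R (x ⊗ₜ y) ⊗ₜ m := by simp [assocB]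
    rw [this]
    simp [hG, mul_assoc]

end SquareLegs

/-! ### Υ evaluated at the four legs of two twisted squares -/

section UpsilonLegs
set_option maxSynthPendingDepth 6
variable {k H U L A : Type*} [Field k] [Ring H] [HopfAlgebra k H] [Ring U] [HopfAlgebra k U]
  [Ring L] [Algebra k L] {𝓛 : BaseAlgebra k H L} {ι : H →ₐc[k] U} (F : DynamicalTwist 𝓛 ι)
  (R : UniversalRMatrix k U) [Ring A] [Algebra k A]
  {F₁ F₂ : TwistedSquare R →ₗ[k] A} {l : L →ₗ[k] A}

/-- The coaction of the square factors through `diag`, which is the convolution of its two legs. -/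
theorem shift_coactB {G : TwistedSquare R →ₗ[k] A} (hG : IsAlgHom G) :
    shift (coactB 𝓛 ι R) G l =
      shift (dCoact 𝓛 (ι : H →ₐ[k] U)) (conv (G ∘ₗ sqL R) (G ∘ₗ sqR R)) l := by
  ext m
  rw [shift_apply, shift_apply, ← comp_diag R hG, AlgHom.comp_apply, ev2_algMap]
  rfl

theorem squareCocycle_ev (T : Legs3 F₁ F₂ l) : (squareCocycle F R).ev F₁ F₂ l =
    F.toCocycle.ev (conv (F₁ ∘ₗ sqL R) (F₁ ∘ₗ sqR R)) (conv (F₂ ∘ₗ sqL R) (F₂ ∘ₗ sqR R)) l := by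
  rw [← comp_diag R T.hf, ← comp_diag R T.hg]
  change ev3 F₁ F₂ l (Algebra.TensorProduct.map (diag R) (Algebra.TensorProduct.map (diag R)
    (.id k L)) (F.val : U ⊗[k] (U ⊗[k] L))) = _
  have : ∀ z : U ⊗[k] (U ⊗[k] L), ev3 F₁ F₂ l (Algebra.TensorProduct.map (diag R)
      (Algebra.TensorProduct.map (diag R) (.id k L)) z) =
      ev3 (F₁ ∘ₗ (diag R).toLinearMap) (F₂ ∘ₗ (diag R).toLinearMap) l z := by
    intro z
    induction z using tensor3_induction with
    | h0 => simp
    | hadd x y hx hy => simp only [map_add, hx, hy]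
    | h x y m => simp
  exact this _

variable [InvertibleAntipode k U]

theorem ev2_gaugeB {f g : U →ₗ[k] A} (H : Legs3 f g l) {G : TwistedSquare R →ₗ[k] A}
    (hG : ∀ z, G (toTwisted R z) = ev2 f g z) :
    ev2 G l (gaugeB F R : TwistedSquare R ⊗[k] L) = F.toCocycle.xi f g l := by
  have hL : G ∘ₗ sqL R = f := by
    ext x; exact (hG _).trans (ev2_one_right f g H.hg.map_one x)
  have hR : G ∘ₗ sqR R = g := by
    ext x; exact (hG _).trans (ev2_includeRight f H.hf.map_one g x)
  have e : ∀ x y, G (toTwisted R (x ⊗ₜ y)) = G (sqL R x) * G (sqR R y) := by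
    intro x y
    rw [hG, ev2_tmul, ← hL, ← hR]; rfl
  refine (ev2_assocB R e _).trans ?_
  rw [hL, hR]
  refine (H.hom.map_mul _ _).trans ?_
  exact congrArg (F.toCocycle.ev f g l * ·) (ev2_coact _ _ _ _ _)

/-- The definition of Υ with Δ(ξ⁻¹) cleared. The twisted coproduct pairs legs 1, 3 and 2, 4 only
after conjugation by R₂₃, so R₂₃ appears on both sides. -/
theorem upsilon_ev (T : Legs3 F₁ F₂ l) :
    F.toCocycle.xi (conv (F₁ ∘ₗ sqL R) (F₂ ∘ₗ sqL R)) (conv (F₁ ∘ₗ sqR R) (F₂ ∘ₗ sqR R)) l *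
      (R.ev (F₁ ∘ₗ sqR R) (F₂ ∘ₗ sqL R) * (upsilonCocycle F R).ev F₁ F₂ l) =
    R.ev (F₁ ∘ₗ sqR R) (F₂ ∘ₗ sqL R) *
      (F.toCocycle.ev (conv (F₁ ∘ₗ sqL R) (F₁ ∘ₗ sqR R)) (conv (F₂ ∘ₗ sqL R) (F₂ ∘ₗ sqR R)) l *
      F.toCocycle.xi (F₁ ∘ₗ sqL R) (F₁ ∘ₗ sqR R) (shift (dCoact 𝓛 (ι : H →ₐ[k] U))
        (conv (F₂ ∘ₗ sqL R) (F₂ ∘ₗ sqR R)) l) *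
      F.toCocycle.xi (F₂ ∘ₗ sqL R) (F₂ ∘ₗ sqR R) l) := by
  have S := T.square R
  set f := F₁ ∘ₗ sqL R
  set g := F₁ ∘ₗ sqR R
  set h := F₂ ∘ₗ sqL R
  set p := F₂ ∘ₗ sqR R
  have e := ev3_gaugeUnit (squareCocycle F R) (gaugeB F R) T
  rw [squareCocycle_ev F R T, shift_coactB R T.hg,
    ev2_gaugeB F R ⟨S.hf, S.hg, (S.hh.conv S.hp S.hp').shift _ S.hl (S.hl'.conv_left S.pl), S.fg,
      (S.fh.conv_right S.fp).shift_right S.fl, (S.gh.conv_right S.gp).shift_right S.gl⟩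
      (T.hf.toTwisted_apply R), ev2_gaugeB F R S.drop.drop (T.hg.toTwisted_apply R)] at e
  change (upsilonCocycle F R).ev F₁ F₂ l = _ at e
  have hc : IsAlgHom (ev2 (conv F₁ F₂) l) :=
    (T.hf.conv T.hg T.fg).ev2 T.hl (T.fl.conv_left T.gl)
  have hx : Legs3 (conv f h) (conv g p) l :=
    ⟨S.hf.conv S.hh S.fh, S.hg.conv S.hp S.gp, S.hl,
      (S.fg.conv_right S.fp).conv_left ((S.gh.symm).conv_right S.hp'),
      S.fl.conv_left S.hl', S.gl.conv_left S.pl⟩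
  have hs : SemiconjBy (R.ev g h) (ev2 (conv F₁ F₂) l (gaugeB F R : TwistedSquare R ⊗[k] L))
      (F.toCocycle.xi (conv f h) (conv g p) l) := by
    rw [← ev2_gaugeB F R hx (G := ev2 (conv f h) (conv g p) ∘ₗ
      (toTwisted R).symm.toLinearMap) (fun z => rfl)]
    exact ev2_semiconj (fun b => conv_square R T.hf T.hg T.fg b)
      (fun m => (ev2_commute (fun x => (S.gl x m).symm) (fun x => (S.hl' x m).symm) _).symm) _
  rw [e, ← mul_assoc, ← hs.eq, mul_assoc, mul_assoc, ← mul_assoc (ev2 (conv F₁ F₂) l _),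
    ← hc.map_mul, Units.mul_inv, hc.map_one, one_mul]
  simp only [mul_assoc]
  rfl

theorem isUnit_xi {f g : U →ₗ[k] A} (H : Legs3 f g l) : IsUnit (F.toCocycle.xi f g l) := by
  refine IsUnit.mul (F.toCocycle.unit H).isUnit ?_
  exact (F.toCocycle.zunit isCoaction_dCoact H.hf (H.hg.shift _ H.hl H.gl)
    (H.fg.shift_right H.fl)).isUnit

/-- `upsilon_ev` and `xi_exchange` have the common left factor ξ at the pairs (13) and (24). It is
invertible and cancels, so that Υ is expressed through `gam` and `antip`, the quantities that occur
in the dynamical reflection equation. -/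
theorem upsilon_gam (T : Legs3 F₁ F₂ l) :
    R.ev (F₁ ∘ₗ sqR R) (F₂ ∘ₗ sqL R) * ((upsilonCocycle F R).ev F₁ F₂ l *
      F.toCocycle.gam R (F₁ ∘ₗ sqR R) (F₂ ∘ₗ sqL R)
        (shift (dCoact 𝓛 (ι : H →ₐ[k] U)) (F₂ ∘ₗ sqR R) l)) =
    F.toCocycle.antip (F₁ ∘ₗ sqL R) (F₂ ∘ₗ sqL R) (shift (dCoact 𝓛 (ι : H →ₐ[k] U))
      (conv (F₁ ∘ₗ sqR R) (F₂ ∘ₗ sqR R)) l) * F.toCocycle.ev (F₁ ∘ₗ sqR R) (F₂ ∘ₗ sqR R) l := by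
  have S := T.square R
  have e := upsilon_ev F R T
  have e2 := xi_exchange R F.toCocycle isCoaction_dCoact S
  have hx : Legs3 (conv (F₁ ∘ₗ sqL R) (F₂ ∘ₗ sqL R)) (conv (F₁ ∘ₗ sqR R) (F₂ ∘ₗ sqR R)) l :=
    ⟨S.hf.conv S.hh S.fh, S.hg.conv S.hp S.gp, S.hl,
      (S.fg.conv_right S.fp).conv_left ((S.gh.symm).conv_right S.hp'),
      S.fl.conv_left S.hl', S.gl.conv_left S.pl⟩
  refine (isUnit_xi F hx).mul_left_cancel ?_
  rw [← e2]
  rw [← mul_assoc, ← mul_assoc, mul_assoc (F.toCocycle.xi _ _ _), e]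
  simp only [mul_assoc]

end UpsilonLegs
end DynRE
end

noncomputable section
namespace DynRE

/-! ### Matrix products as values of a map on the twisted squares -/

section ReTheta
set_option maxSynthPendingDepth 6
variable {k U L A n : Type*} [Field k] [Ring U] [HopfAlgebra k U] [Ring L] [Algebra k L]
  [Ring A] [Algebra k A] [Fintype n] [DecidableEq n]
  (R : UniversalRMatrix k U) (ρ : U →ₐ[k] Matrix n n k) (X : Matrix n n A) (s : L →ₐ[k] A)

variable (A) in
/-- `x ↦ ρ(x) ⊗ 1`, with entries in `A`. -/
abbrev repLeg1 : U →ₐ[k] Matrix (n × n) (n × n) A := (leg1Hom k).comp (repA A ρ)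

variable (A) in
/-- `x ↦ 1 ⊗ ρ(x)`, with entries in `A`. -/
abbrev repLeg2 : U →ₐ[k] Matrix (n × n) (n × n) A := (leg2Hom k).comp (repA A ρ)

variable (n) in
/-- Scalar matrices with entries in the image of `L`. -/
abbrev scal : L →ₐ[k] Matrix n n A := (Matrix.scalarAlgHom n k).comp s

theorem repA_scal (x : U) (m : L) : Commute (repA A ρ x) (scal n s m) := by
  ext i j
  simp only [AlgHom.comp_apply, Matrix.scalarAlgHom_apply, Matrix.scalar_apply,
    Matrix.diagonal_mul, Matrix.mul_diagonal]
  exact Algebra.commutes _ _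

theorem leg1_scal (m : L) : leg1 (scal n s m) = scal (n × n) s m := by
  ext p q
  simp only [leg1_apply, AlgHom.comp_apply, Matrix.scalarAlgHom_apply, Matrix.scalar_apply,
    Matrix.diagonal_apply, Prod.ext_iff]
  by_cases h : p.2 = q.2 <;> simp [h]

theorem leg2_scal (m : L) : leg2 (scal n s m) = scal (n × n) s m := by
  ext p q
  simp only [leg2_apply, AlgHom.comp_apply, Matrix.scalarAlgHom_apply, Matrix.scalar_apply,
    Matrix.diagonal_apply, Prod.ext_iff]
  by_cases h : p.1 = q.1 <;> simp [h]

theorem legs3_rep : Legs3 (repLeg1 A ρ).toLinearMap (repLeg2 A ρ).toLinearMap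
    (scal (n × n) s).toLinearMap where
  hf := isAlgHom_algHom _
  hg := isAlgHom_algHom _
  hl := isAlgHom_algHom _
  fg x y := leg1_comm ρ _ y
  fl x m := by
    have := (repA_scal ρ s x m).map (leg1Hom k)
    change Commute _ (leg1 (scal n s m)) at this
    rw [leg1_scal] at this
    exact this
  gl x m := by
    have := (repA_scal ρ s x m).map (leg2Hom k)
    change Commute _ (leg2 (scal n s m)) at this
    rw [leg2_scal] at this
    exact this

/-- `b ↦ b ▶ X` -/
def kMap : TwistedSquare R →ₗ[k] Matrix n n A :=
  sandwichK ρ X ∘ₗ (toTwisted R).symm.toLinearMap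

theorem kMap_mul (b : TwistedSquare R) (x y : U) : kMap R ρ X (b * toTwisted R (x ⊗ₜ y)) =
    repA A ρ (HopfAlgebra.antipode k x) * kMap R ρ X b * repA A ρ y :=
  sandwichK_mul_tmul ρ X b x y

theorem antipode_one : HopfAlgebra.antipode k (1 : U) = 1 := by simp

theorem kMap_mul_sqL (b : TwistedSquare R) (x : U) : kMap R ρ X (b * sqL R x) =
    repA A ρ (HopfAlgebra.antipode k x) * kMap R ρ X b :=
  (kMap_mul R ρ X b x 1).trans (by rw [map_one, mul_one])

theorem kMap_mul_sqR (b : TwistedSquare R) (x : U) : kMap R ρ X (b * sqR R x) =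
    kMap R ρ X b * repA A ρ x :=
  (kMap_mul R ρ X b 1 x).trans (by rw [antipode_one, map_one, one_mul])

theorem kMap_one : kMap R ρ X 1 = X := by
  change sandwichK ρ X ((1 : U) ⊗ₜ[k] (1 : U)) = X
  rw [sandwichK_tmul]; simp

/-- `b ⊗ c ⊗ m ↦ (b ▶ X)₁ (c ▶ X)₂ m` -/
def reTheta : TwistedSquare R ⊗[k] (TwistedSquare R ⊗[k] L) →ₗ[k] Matrix (n × n) (n × n) A :=
  ev3 ((leg1Hom k).toLinearMap ∘ₗ kMap R ρ X) ((leg2Hom k).toLinearMap ∘ₗ kMap R ρ X)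
    (scal (n × n) s).toLinearMap

theorem reTheta_tmul (b c : TwistedSquare R) (m : L) : reTheta R ρ X s (b ⊗ₜ (c ⊗ₜ m)) =
    leg1 (kMap R ρ X b) * (leg2 (kMap R ρ X c) * scal (n × n) s m) := rfl

local notation "Θ" => reTheta R ρ X s
local notation "ℓ₁" => inl k (TwistedSquare R) (TwistedSquare R ⊗[k] L) ∘ₗ sqL R
local notation "ℓ₂" => inl k (TwistedSquare R) (TwistedSquare R ⊗[k] L) ∘ₗ sqR R
local notation "ℓ₃" => (inr k (TwistedSquare R) (TwistedSquare R ⊗[k] L) ∘ₗ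
  inl k (TwistedSquare R) L) ∘ₗ sqL R
local notation "ℓ₄" => (inr k (TwistedSquare R) (TwistedSquare R ⊗[k] L) ∘ₗ
  inl k (TwistedSquare R) L) ∘ₗ sqR R
local notation "ℓ₀" => inr k (TwistedSquare R) (TwistedSquare R ⊗[k] L) ∘ₗ
  inr k (TwistedSquare R) L

/-- Right factors on the five legs become matrix factors: legs 1 and 3 multiply from the left
through γ, legs 2, 4 and the base leg from the right. These rules allow both reflection equations to
be rewritten as relations between values of Θ. -/
theorem reTheta_mul_leg1 (z : TwistedSquare R ⊗[k] (TwistedSquare R ⊗[k] L)) (x : U) :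
    Θ (z * (ℓ₁) x) = repLeg1 A ρ (HopfAlgebra.antipode k x) * Θ z := by
  induction z using tensor3_induction with
  | h0 => simp
  | hadd x y hx hy => simp only [map_add, add_mul, mul_add, hx, hy]
  | h b c m =>
    have : (b ⊗ₜ[k] (c ⊗ₜ[k] m)) * (ℓ₁) x = (b * sqL R x) ⊗ₜ (c ⊗ₜ m) := by simp
    rw [this, reTheta_tmul, reTheta_tmul, kMap_mul_sqL, leg1_mul, mul_assoc]
    rfl

theorem reTheta_mul_leg2 (z : TwistedSquare R ⊗[k] (TwistedSquare R ⊗[k] L)) (x : U) :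
    Θ (z * (ℓ₂) x) = Θ z * repLeg1 A ρ x := by
  induction z using tensor3_induction with
  | h0 => simp
  | hadd x y hx hy => simp only [map_add, add_mul, hx, hy]
  | h b c m =>
    have : (b ⊗ₜ[k] (c ⊗ₜ[k] m)) * (ℓ₂) x = (b * sqR R x) ⊗ₜ (c ⊗ₜ m) := by simp
    have e1 : leg1 (repA A ρ x) * scal (n × n) s m = scal (n × n) s m * leg1 (repA A ρ x) :=
      (legs3_rep ρ s).fl x m
    rw [this, reTheta_tmul, reTheta_tmul, kMap_mul_sqR, leg1_mul, mul_assoc, mul_assoc,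
      ← mul_assoc (leg1 (repA A ρ x)), ← leg2_comm, mul_assoc (leg2 _), e1, mul_assoc]
    rfl

theorem reTheta_mul_leg3 (z : TwistedSquare R ⊗[k] (TwistedSquare R ⊗[k] L)) (x : U) :
    Θ (z * (ℓ₃) x) = repLeg2 A ρ (HopfAlgebra.antipode k x) * Θ z := by
  induction z using tensor3_induction with
  | h0 => simp
  | hadd x y hx hy => simp only [map_add, add_mul, mul_add, hx, hy]
  | h b c m =>
    have : (b ⊗ₜ[k] (c ⊗ₜ[k] m)) * (ℓ₃) x = b ⊗ₜ ((c * sqL R x) ⊗ₜ m) := by simp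
    rw [this, reTheta_tmul, reTheta_tmul, kMap_mul_sqL, leg2_mul, mul_assoc, ← mul_assoc (leg1 _),
      leg1_comm, mul_assoc]
    rfl

theorem reTheta_mul_leg4 (z : TwistedSquare R ⊗[k] (TwistedSquare R ⊗[k] L)) (x : U) :
    Θ (z * (ℓ₄) x) = Θ z * repLeg2 A ρ x := by
  induction z using tensor3_induction with
  | h0 => simp
  | hadd x y hx hy => simp only [map_add, add_mul, hx, hy]
  | h b c m =>
    have : (b ⊗ₜ[k] (c ⊗ₜ[k] m)) * (ℓ₄) x = b ⊗ₜ ((c * sqR R x) ⊗ₜ m) := by simp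
    have e1 : leg2 (repA A ρ x) * scal (n × n) s m = scal (n × n) s m * leg2 (repA A ρ x) :=
      (legs3_rep ρ s).gl x m
    rw [this, reTheta_tmul, reTheta_tmul, kMap_mul_sqR, leg2_mul, mul_assoc (leg2 _), e1]
    simp only [mul_assoc]
    rfl

theorem reTheta_mul_base (z : TwistedSquare R ⊗[k] (TwistedSquare R ⊗[k] L)) (l : L) :
    Θ (z * (ℓ₀) l) = Θ z * scal (n × n) s l := by
  induction z using tensor3_induction with
  | h0 => simp
  | hadd x y hx hy => simp only [map_add, add_mul, hx, hy]
  | h b c m =>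
    have : (b ⊗ₜ[k] (c ⊗ₜ[k] m)) * (ℓ₀) l = b ⊗ₜ (c ⊗ₜ (m * l)) := by simp
    rw [this, reTheta_tmul, reTheta_tmul, map_mul]
    simp only [mul_assoc]

theorem reTheta_mul_ev' (z : TwistedSquare R ⊗[k] (TwistedSquare R ⊗[k] L))
    (w : U ⊗[k] (U ⊗[k] L)) : Θ (z * ev3 (ℓ₄) (ℓ₂) (ℓ₀) w) = Θ z * ev3 (repLeg2 A ρ).toLinearMap
      (repLeg1 A ρ).toLinearMap (scal (n × n) s).toLinearMap w := by
  induction w using tensor3_induction with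
  | h0 => simp
  | hadd x y hx hy => simp only [map_add, mul_add, hx, hy]
  | h x y m =>
    simp only [ev3, ev2_tmul]
    rw [← mul_assoc, ← mul_assoc, reTheta_mul_base, reTheta_mul_leg2, reTheta_mul_leg4]
    simp only [mul_assoc]
    rfl

/-- Conjugation by the flip. -/
def swapM (M : Matrix (n × n) (n × n) A) : Matrix (n × n) (n × n) A :=
  M.submatrix Prod.swap Prod.swap

omit [DecidableEq n] [Algebra k A] in
theorem swapM_mul (M N : Matrix (n × n) (n × n) A) : swapM (M * N) = swapM M * swapM N := by
  ext p q
  simp only [swapM, Matrix.submatrix_apply, Matrix.mul_apply]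
  exact (Equiv.sum_comp (Equiv.prodComm n n) (fun r => M p.swap r * N r q.swap)).symm

theorem swapM_leg1 (Y : Matrix n n A) : swapM (leg1 Y) = leg2 Y := by
  ext p q; simp [swapM, leg1_apply, leg2_apply]

theorem swapM_leg2 (Y : Matrix n n A) : swapM (leg2 Y) = leg1 Y := by
  ext p q; simp [swapM, leg1_apply, leg2_apply]

theorem swapM_scal (m : L) : swapM (scal (n × n) s m) = scal (n × n) s m := by
  rw [← leg1_scal s m, swapM_leg1, leg2_scal, leg1_scal]

/-- The two flips in the reflection equation combine to a conjugation of one factor, which removes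
`P` from the equation. -/
theorem reLeft_flipMul (M : Matrix (n × n) (n × n) A) : reLeft (flipMul M) X =
    swapM M * (leg1 X * M * leg2 X) := by
  have e : ∀ M N : Matrix (n × n) (n × n) A, flipMul M * flipMul N = swapM M * N := by
    intro M N
    ext p q
    simp only [flipMul, swapM, Matrix.mul_apply, Matrix.submatrix_apply, id]
    exact (Equiv.sum_comp (Equiv.prodComm n n) (fun r => M p.swap r * N r.swap q)).symm
  rw [reLeft, mul_assoc (flipMul M), mul_assoc (flipMul M), ← flipMul_leg1, flipMul_mul (leg1 X * M), e]

theorem reRight_flipMul (M : Matrix (n × n) (n × n) A) : reRight (flipMul M) X =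
    swapM ((leg1 X * M * leg2 X) * swapM M) := by
  have e : ∀ M N : Matrix (n × n) (n × n) A, flipMul M * flipMul N = swapM M * N := by
    intro M N
    ext p q
    simp only [flipMul, swapM, Matrix.mul_apply, Matrix.submatrix_apply, id]
    exact (Equiv.sum_comp (Equiv.prodComm n n) (fun r => M p.swap r * N r.swap q)).symm
  have e2 : swapM (swapM M) = M := by ext p q; simp [swapM]
  rw [reRight, ← flipMul_leg1, flipMul_mul, e, swapM_mul (_ * _ * _), e2]

end ReTheta
end DynRE
end

noncomputable section
namespace DynRE

/-! ### Naturality of contracted twists in the legs -/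

section OpsNatural
variable {k U L A : Type*} [Field k] [Ring U] [HopfAlgebra k U] [Ring L] [Algebra k L]
  [Ring A] [Algebra k A] {f g : U →ₗ[k] A} {l l' : L →ₗ[k] A}

theorem ev3_rop_rop_semiconj {u : A} (hf : ∀ x, Commute u (f x)) (hg : ∀ x, Commute u (g x))
    (hl : ∀ m, SemiconjBy u (l m) (l' m)) (z : U ⊗[k] (U ⊗[k] L)) :
    SemiconjBy u (ev3 (rop g) (rop f) (lop l) z 1) (ev3 (rop g) (rop f) (lop l') z 1) := by
  induction z using tensor3_induction with
  | h0 => simp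
  | hadd x y hx hy => simp only [map_add, LinearMap.add_apply]; exact hx.add_right hy
  | h x y m =>
    simp only [ev3, ev2_tmul, Module.End.mul_apply, rop_apply, lop_apply, mul_one]
    exact ((hl m).mul_right (hf _)).mul_right (hg _)

theorem map_ev3_rop_rop {A' : Type*} [Ring A'] [Algebra k A'] {φ : A →ₗ[k] A'} (hφ : IsAlgHom φ)
    (z : U ⊗[k] (U ⊗[k] L)) : φ (ev3 (rop g) (rop f) (lop l) z 1) =
      ev3 (rop (φ ∘ₗ g)) (rop (φ ∘ₗ f)) (lop (φ ∘ₗ l)) z 1 := by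
  induction z using tensor3_induction with
  | h0 => simp
  | hadd x y hx hy => simp only [map_add, LinearMap.add_apply, hx, hy]
  | h x y m => simp [hφ.map_mul]

variable {δ : L →ₐ[k] U ⊗[k] L} (F : DynCocycle δ)

theorem antip_semiconj {u : A} (hf : ∀ x, Commute u (f x)) (hg : ∀ x, Commute u (g x))
    (hl : ∀ m, SemiconjBy u (l m) (l' m)) : SemiconjBy u (F.antip f g l) (F.antip f g l') :=
  ev3_rop_rop_semiconj hf hg (fun m => shift_semiconj δ
    (fun x => conv_semiconj hf hg x) hl m) _

theorem map_antip {A' : Type*} [Ring A'] [Algebra k A'] {φ : A →ₗ[k] A'} (hφ : IsAlgHom φ) :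
    φ (F.antip f g l) = F.antip (φ ∘ₗ f) (φ ∘ₗ g) (φ ∘ₗ l) := by
  refine (map_ev3_rop_rop hφ _).trans ?_
  rw [comp_shift δ hφ, comp_conv hφ]
  rfl

theorem map_ev {A' : Type*} [Ring A'] [Algebra k A'] {φ : A →ₗ[k] A'} (hφ : IsAlgHom φ) :
    φ (F.ev f g l) = F.ev (φ ∘ₗ f) (φ ∘ₗ g) (φ ∘ₗ l) := by
  rw [DynCocycle.ev, DynCocycle.ev, ev3, ← LinearMap.comp_apply, comp_ev2 hφ, comp_ev2 hφ]

end OpsNatural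

/-! ### Absorbing the dynamical R-matrix into Θ -/

section ReMain
set_option maxSynthPendingDepth 6
variable {k H U L A n : Type*} [Field k] [Ring H] [HopfAlgebra k H] [Ring U] [HopfAlgebra k U]
  [Ring L] [Algebra k L] {𝓛 : BaseAlgebra k H L} {ι : H →ₐc[k] U} (F : DynamicalTwist 𝓛 ι)
  [Ring A] [Algebra k A] [Fintype n] [DecidableEq n]
  (R : UniversalRMatrix k U) (ρ : U →ₐ[k] Matrix n n k) (X : Matrix n n A) (s : L →ₐ[k] A)

theorem shift_square {F₁ F₂ : TwistedSquare R →ₗ[k] A} {l : L →ₗ[k] A} (T : Legs3 F₁ F₂ l) (m : L) :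
    SemiconjBy (R.ev (F₁ ∘ₗ sqR R) (F₂ ∘ₗ sqL R)) (shift (coactB 𝓛 ι R) (conv F₁ F₂) l m)
      (shift (dCoact 𝓛 (ι : H →ₐ[k] U)) (conv (F₁ ∘ₗ sqL R) (F₂ ∘ₗ sqL R))
        (shift (dCoact 𝓛 (ι : H →ₐ[k] U)) (conv (F₁ ∘ₗ sqR R) (F₂ ∘ₗ sqR R)) l) m) := by
  have S := T.square R
  rw [← (isCoaction_dCoact (𝓛 := 𝓛) (ι := ι)).shift_conv, shift_apply, AlgHom.comp_apply, ev2_algMap, shift_apply]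
  refine ev2_semiconj (f := conv F₁ F₂ ∘ₗ (diag R).toLinearMap)
    (l := l ∘ₗ (AlgHom.id k L).toLinearMap) (fun x => conv_square R T.hf T.hg T.fg
      (Coalgebra.comul (R := k) x)) (fun m => ?_) _
  exact (ev2_commute (f := F₁ ∘ₗ sqR R) (l := F₂ ∘ₗ sqL R) (fun x => (S.gl x m).symm)
    (fun x => (S.hl' x m).symm) (R.val : U ⊗[k] U)).symm

local notation "Θ" => reTheta R ρ X s
local notation "F₁" => inl k (TwistedSquare R) (TwistedSquare R ⊗[k] L)
local notation "F₂" => inr k (TwistedSquare R) (TwistedSquare R ⊗[k] L) ∘ₗ inl k (TwistedSquare R) L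
local notation "ℓ₁" => inl k (TwistedSquare R) (TwistedSquare R ⊗[k] L) ∘ₗ sqL R
local notation "ℓ₂" => inl k (TwistedSquare R) (TwistedSquare R ⊗[k] L) ∘ₗ sqR R
local notation "ℓ₃" => (inr k (TwistedSquare R) (TwistedSquare R ⊗[k] L) ∘ₗ
  inl k (TwistedSquare R) L) ∘ₗ sqL R
local notation "ℓ₄" => (inr k (TwistedSquare R) (TwistedSquare R ⊗[k] L) ∘ₗ
  inl k (TwistedSquare R) L) ∘ₗ sqR R
local notation "ℓ₀" => inr k (TwistedSquare R) (TwistedSquare R ⊗[k] L) ∘ₗ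
  inr k (TwistedSquare R) L
local notation "Δδ" => shift (dCoact 𝓛 (ι : H →ₐ[k] U))

variable (L) in
theorem legs5_square : Legs5 (ℓ₁) (ℓ₂) (ℓ₃) (ℓ₄) (ℓ₀) := legs3_incl.square R

variable (L) in
/-- The unit `R₂₃` in the algebra of five legs. -/
def rUnit : (TwistedSquare R ⊗[k] (TwistedSquare R ⊗[k] L))ˣ :=
  R.unit (legs5_square L R).hg (legs5_square L R).hh (legs5_square L R).gh

local notation "Rinv" => Units.val (rUnit L R)⁻¹
local notation "Υinv" => Units.val (DynCocycle.val (upsilonCocycle F R))⁻¹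

theorem dDelta_coactB (m : L) : dDelta (coactB 𝓛 ι R m) * Rinv =
    Rinv * Δδ (conv (ℓ₁) (ℓ₃)) (Δδ (conv (ℓ₂) (ℓ₄)) (ℓ₀)) m := by
  have e : dDelta (coactB 𝓛 ι R m) = shift (coactB 𝓛 ι R) (conv (F₁) (F₂)) (ℓ₀) m := by
    rw [shift_apply, ← ev2_dDelta]
    exact (ev3_incl _).symm
  rw [e]
  have h := shift_square (𝓛 := 𝓛) (ι := ι) R (legs3_incl (k := k) (B := TwistedSquare R) (M := L)) m
  exact (SemiconjBy.units_inv_symm_left (a := rUnit L R) h).eq.symm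

variable {X s} [InvertibleAntipode k U]

omit [InvertibleAntipode k U] in
theorem Intertwines.map_leg1
    (hX : Intertwines (scal n s) (coactB 𝓛 ι R) (kMap R ρ X)) :
    Intertwines (scal (n × n) s) (coactB 𝓛 ι R) ((leg1Hom k).toLinearMap ∘ₗ kMap R ρ X) := by
  intro m b
  have e := (congrArg (leg1Hom k) (hX m b)).trans
    (map_mul (leg1Hom k) (scal n s m) (kMap R ρ X b))
  have e2 : (leg1Hom k).toLinearMap ∘ₗ (scal n s).toLinearMap = (scal (n × n) s).toLinearMap :=
    LinearMap.ext fun m => leg1_scal s m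
  have e3 := LinearMap.congr_fun (comp_ev2 (isAlgHom_algHom (leg1Hom k))
    (kMap R ρ X) (scal n s).toLinearMap) (coactB 𝓛 ι R m * (b ⊗ₜ 1))
  rw [e2] at e3
  exact e3.symm.trans (e.trans (congrArg (· * _) (leg1_scal s m)))

omit [InvertibleAntipode k U] in
theorem Intertwines.map_leg2
    (hX : Intertwines (scal n s) (coactB 𝓛 ι R) (kMap R ρ X)) :
    Intertwines (scal (n × n) s) (coactB 𝓛 ι R) ((leg2Hom k).toLinearMap ∘ₗ kMap R ρ X) := by
  intro m b
  have e := (congrArg (leg2Hom k) (hX m b)).trans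
    (map_mul (leg2Hom k) (scal n s m) (kMap R ρ X b))
  have e2 : (leg2Hom k).toLinearMap ∘ₗ (scal n s).toLinearMap = (scal (n × n) s).toLinearMap :=
    LinearMap.ext fun m => leg2_scal s m
  have e3 := LinearMap.congr_fun (comp_ev2 (isAlgHom_algHom (leg2Hom k))
    (kMap R ρ X) (scal n s).toLinearMap) (coactB 𝓛 ι R m * (b ⊗ₜ 1))
  rw [e2] at e3
  exact e3.symm.trans (e.trans (congrArg (· * _) (leg2_scal s m)))

/-- The first leg of `w` is absorbed by X₁ from the right, the second by X₂ from the left, which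
costs an inverse antipode. The `L`-component passes X₂ by intertwining. For the dynamical R-matrix
the argument of Θ is `gam`. -/
theorem leg1_mul_ev_mul_leg2 (hX : Intertwines (scal n s) (coactB 𝓛 ι R) (kMap R ρ X))
    (w : U ⊗[k] (U ⊗[k] L)) :
    leg1 X * ev3 (repLeg1 A ρ).toLinearMap (repLeg2 A ρ).toLinearMap
      (scal (n × n) s).toLinearMap w * leg2 X =
    Θ (ev3 (lop (ℓ₂)) (rop (ℓ₃)) (lop (Δδ (ℓ₃) (Δδ (ℓ₄) (ℓ₀)))) w 1) := by
  have S := legs5_square L R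
  have D := legs3_rep (n := n) ρ s
  induction w using tensor3_induction with
  | h0 => simp
  | hadd x y hx hy => simp only [map_add, add_mul, mul_add, LinearMap.add_apply, hx, hy]
  | h x y m =>
    have e1 : Δδ (ℓ₃) (Δδ (ℓ₄) (ℓ₀)) m = (1 : TwistedSquare R) ⊗ₜ (coactB 𝓛 ι R m) := by
      rw [← isCoaction_dCoact.shift_conv, ← shift_coactB R (isAlgHom_inr.comp isAlgHom_inl),
        ← comp_shift _ isAlgHom_inr, LinearMap.comp_apply, shift_apply, ev2_incl']
      rfl
    have e2 : Θ ((1 : TwistedSquare R) ⊗ₜ (coactB 𝓛 ι R m)) =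
        leg1 X * (scal (n × n) s m * leg2 X) := by
      have hX2 : Intertwines (scal (n × n) s) (coactB 𝓛 ι R)
          ((leg2Hom k).toLinearMap ∘ₗ kMap R ρ X) := hX.map_leg2 R ρ
      have := hX2 m 1
      rw [Algebra.TensorProduct.one_def.symm, mul_one, LinearMap.comp_apply, kMap_one] at this
      rw [reTheta, ev3, ev2_tmul, this, LinearMap.comp_apply, kMap_one]
      rfl
    have c1 : Commute ((ℓ₂) x) (Δδ (ℓ₃) (Δδ (ℓ₄) (ℓ₀)) m * (ℓ₃) (antipodeInv k U y)) :=
      ((S.gh.shift_right (S.gp.shift_right S.gl)) x m).mul_right (S.gh _ _)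
    have c2 : leg1 X * repLeg2 A ρ y = repLeg2 A ρ y * leg1 X := leg1_comm ρ X y
    have c3 : leg2 X * repLeg1 A ρ x = repLeg1 A ρ x * leg2 X := leg2_comm ρ X x
    have c4 : repLeg1 A ρ x * repLeg2 A ρ y = repLeg2 A ρ y * repLeg1 A ρ x := D.fg x y
    have c5 : repLeg1 A ρ x * scal (n × n) s m = scal (n × n) s m * repLeg1 A ρ x := D.fl x m
    simp only [ev3, ev2_tmul, Module.End.mul_apply, rop_apply, lop_apply, mul_one]
    rw [c1.eq, reTheta_mul_leg2, reTheta_mul_leg3, antipode_antipodeInv, e1, e2]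
    change leg1 X * (repLeg1 A ρ x * (repLeg2 A ρ y * scal (n × n) s m)) * leg2 X = _
    rw [← mul_assoc (repLeg1 A ρ x), c4, mul_assoc (repLeg2 A ρ y), c5, ← mul_assoc (leg1 X), c2]
    simp only [mul_assoc]
    rw [c3]

/-- A matrix factor on the left enters Θ through legs 1 and 3 with inverse antipodes. Its
`L`-component enters as an iterated coaction, which commutes with Υ⁻¹, has its legs regrouped by
R₂₃⁻¹, and passes `z` by assumption. -/
theorem ev_mul_reTheta (hX : Intertwines (scal n s) (coactB 𝓛 ι R) (kMap R ρ X))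
    (z : TwistedSquare R ⊗[k] (TwistedSquare R ⊗[k] L))
    (hz : ∀ m, Commute z (Δδ (conv (ℓ₁) (ℓ₃)) (Δδ (conv (ℓ₂) (ℓ₄)) (ℓ₀)) m))
    (w : U ⊗[k] (U ⊗[k] L)) :
    ev3 (repLeg2 A ρ).toLinearMap (repLeg1 A ρ).toLinearMap
      (scal (n × n) s).toLinearMap w * Θ (Υinv *
        (Rinv * z)) =
    Θ (Υinv *
        (Rinv * (z * ev3 (rop (ℓ₃)) (rop (ℓ₁))
      (lop (Δδ (conv (ℓ₁) (ℓ₃)) (Δδ (conv (ℓ₂) (ℓ₄)) (ℓ₀)))) w 1))) := by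
  induction w using tensor3_induction with
  | h0 => simp
  | hadd x y hx hy => simp only [map_add, add_mul, mul_add, LinearMap.add_apply, hx, hy]
  | h x y m =>
    -- The scalar m on the left is drawn through both copies of X into the argument of Θ.
    have e1 := Intertwines.ev3 (isCoaction_coactB R) (hX.map_leg1 R ρ) (hX.map_leg2 R ρ) m
      (Υinv *
        (Rinv * z))
    change Θ _ = scal (n × n) s m * Θ _ at e1
    have e2 : Commute (dDelta (coactB 𝓛 ι R m))
      Υinv :=
      (Commute.units_inv_left ((upsilonCocycle F R).comm m)).symm
    rw [← mul_assoc, e2.eq, mul_assoc, ← mul_assoc (dDelta _), dDelta_coactB, mul_assoc Rinv,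
      ← (hz m).eq] at e1
    simp only [ev3, ev2_tmul, Module.End.mul_apply, rop_apply, lop_apply, mul_one]
    have e3 := reTheta_mul_leg1 R ρ X s
    have e4 := reTheta_mul_leg3 R ρ X s
    simp only [← mul_assoc] at e1 ⊢
    rw [e4, e3, antipode_antipodeInv, antipode_antipodeInv, e1]
    simp only [mul_assoc]
    rfl


omit [InvertibleAntipode k U] in
-- Right multiplication on the legs acts on Θ by matrix factors on the two outer sides, and
-- conjugation by the flip exchanges the legs of the two squares. Hence such a relation is stable
-- under right multiplication, with the factor flipped on one side.
theorem reTheta_rel_mul {a b : TwistedSquare R ⊗[k] (TwistedSquare R ⊗[k] L)}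
    (h : Θ a = swapM (Θ b)) (z : TwistedSquare R ⊗[k] (TwistedSquare R ⊗[k] L)) :
    Θ (a * z) = swapM (Θ (b * Algebra.TensorProduct.leftComm k (TwistedSquare R)
      (TwistedSquare R) L z)) := by
  induction z using tensor3_induction with
  | h0 => simp [swapM]
  | hadd x y hx hy => simp only [map_add, mul_add, hx, hy]; rfl
  | h c d m =>
    rw [Algebra.TensorProduct.leftComm_tmul]
    have key : ∀ c d : U ⊗[k] U, Θ (a * (toTwisted R c ⊗ₜ (toTwisted R d ⊗ₜ m))) =
        swapM (Θ (b * (toTwisted R d ⊗ₜ (toTwisted R c ⊗ₜ m)))) := by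
      intro c d
      induction c with
      | zero => simp [swapM]
      | add x y hx hy =>
        simp only [map_add, TensorProduct.tmul_add, TensorProduct.add_tmul, mul_add, hx, hy]; rfl
      | tmul x y =>
        induction d with
        | zero => simp [swapM]
        | add x y hx hy =>
          simp only [map_add, TensorProduct.tmul_add, TensorProduct.add_tmul, mul_add, hx, hy]; rfl
        | tmul u v =>
          have e : ∀ x y u v : U, toTwisted R (x ⊗ₜ y) ⊗ₜ[k] (toTwisted R (u ⊗ₜ v) ⊗ₜ[k] m) =
              (ℓ₁) x * ((ℓ₃) u * ((ℓ₂) y * ((ℓ₄) v * (ℓ₀) m))) := by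
            intro x y u v
            rw [← sqL_mul_sqR, ← sqL_mul_sqR]
            simp
          have s1 : swapM (repLeg1 A ρ (HopfAlgebra.antipode k u)) =
            repLeg2 A ρ (HopfAlgebra.antipode k u) := swapM_leg1 _
          have s2 : swapM (repLeg2 A ρ (HopfAlgebra.antipode k x)) =
            repLeg1 A ρ (HopfAlgebra.antipode k x) := swapM_leg2 _
          have s3 : swapM (repLeg1 A ρ v) = repLeg2 A ρ v := swapM_leg1 _
          have s4 : swapM (repLeg2 A ρ y) = repLeg1 A ρ y := swapM_leg2 _
          have c : (ℓ₁) u * ((ℓ₃) x * ((ℓ₂) v * ((ℓ₄) y * (ℓ₀) m))) =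
              (ℓ₃) x * ((ℓ₁) u * ((ℓ₄) y * ((ℓ₂) v * (ℓ₀) m))) := by
            rw [((legs5_square L R).fh u x).left_comm, ((legs5_square L R).gp v y).left_comm]
          rw [e, e, c]
          simp only [← mul_assoc]
          rw [reTheta_mul_base, reTheta_mul_base, reTheta_mul_leg4, reTheta_mul_leg2,
            reTheta_mul_leg2, reTheta_mul_leg4, reTheta_mul_leg3, reTheta_mul_leg1,
            reTheta_mul_leg1, reTheta_mul_leg3, h]
          simp only [swapM_mul, swapM_scal, mul_assoc, s1, s2, s3, s4]
    exact key c d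

end ReMain
end DynRE
end

noncomputable section
namespace DynRE

/-! ### The dynamical reflection equation as a relation between values of Θ -/

section ReIff
set_option maxSynthPendingDepth 6
variable {k H U L A n : Type*} [Field k] [Ring H] [HopfAlgebra k H] [Ring U] [HopfAlgebra k U]
  [Ring L] [Algebra k L] {𝓛 : BaseAlgebra k H L} {ι : H →ₐc[k] U} (F : DynamicalTwist 𝓛 ι)
  [Ring A] [Algebra k A] [Fintype n] [DecidableEq n]
  (R : UniversalRMatrix k U) (ρ : U →ₐ[k] Matrix n n k) (X : Matrix n n A) (s : L →ₐ[k] A)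

local notation "Θ" => reTheta R ρ X s
local notation "F₁" => inl k (TwistedSquare R) (TwistedSquare R ⊗[k] L)
local notation "F₂" => inr k (TwistedSquare R) (TwistedSquare R ⊗[k] L) ∘ₗ inl k (TwistedSquare R) L
local notation "ℓ₁" => inl k (TwistedSquare R) (TwistedSquare R ⊗[k] L) ∘ₗ sqL R
local notation "ℓ₂" => inl k (TwistedSquare R) (TwistedSquare R ⊗[k] L) ∘ₗ sqR R
local notation "ℓ₃" => (inr k (TwistedSquare R) (TwistedSquare R ⊗[k] L) ∘ₗ
  inl k (TwistedSquare R) L) ∘ₗ sqL R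
local notation "ℓ₄" => (inr k (TwistedSquare R) (TwistedSquare R ⊗[k] L) ∘ₗ
  inl k (TwistedSquare R) L) ∘ₗ sqR R
local notation "ℓ₀" => inr k (TwistedSquare R) (TwistedSquare R ⊗[k] L) ∘ₗ
  inr k (TwistedSquare R) L
local notation "Δδ" => shift (dCoact 𝓛 (ι : H →ₐ[k] U))
local notation "Rinv" => Units.val (rUnit L R)⁻¹
local notation "Υinv" => Units.val (DynCocycle.val (upsilonCocycle F R))⁻¹

variable (L) in
/-- The exchange of the first two factors, as a linear map. -/
def flipLegs : TwistedSquare R ⊗[k] (TwistedSquare R ⊗[k] L) →ₗ[k]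
    TwistedSquare R ⊗[k] (TwistedSquare R ⊗[k] L) :=
  (Algebra.TensorProduct.leftComm k (TwistedSquare R) (TwistedSquare R) L).toLinearMap

theorem isAlgHom_flipLegs : IsAlgHom (flipLegs L R) :=
  isAlgHom_algHom (Algebra.TensorProduct.leftComm k (TwistedSquare R) (TwistedSquare R) L).toAlgHom

theorem flipLegs_leg1 : flipLegs L R ∘ₗ (ℓ₁) = ℓ₃ := by
  ext x; exact Algebra.TensorProduct.leftComm_tmul ..

theorem flipLegs_leg2 : flipLegs L R ∘ₗ (ℓ₂) = ℓ₄ := by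
  ext x; exact Algebra.TensorProduct.leftComm_tmul ..

theorem flipLegs_leg3 : flipLegs L R ∘ₗ (ℓ₃) = ℓ₁ := by
  ext x; exact Algebra.TensorProduct.leftComm_tmul ..

theorem flipLegs_leg4 : flipLegs L R ∘ₗ (ℓ₄) = ℓ₂ := by
  ext x; exact Algebra.TensorProduct.leftComm_tmul ..

theorem flipLegs_base : flipLegs L R ∘ₗ (ℓ₀) = ℓ₀ := by
  ext x; exact Algebra.TensorProduct.leftComm_tmul ..

theorem swapM_ev (w : U ⊗[k] (U ⊗[k] L)) : swapM (ev3 (repLeg1 A ρ).toLinearMap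
    (repLeg2 A ρ).toLinearMap (scal (n × n) s).toLinearMap w) = ev3 (repLeg2 A ρ).toLinearMap
    (repLeg1 A ρ).toLinearMap (scal (n × n) s).toLinearMap w := by
  induction w using tensor3_induction with
  | h0 => simp [swapM]
  | hadd x y hx hy => simp only [map_add, ← hx, ← hy]; rfl
  | h x y m =>
    have s1 : swapM (repLeg1 A ρ x) = repLeg2 A ρ x := swapM_leg1 _
    have s2 : swapM (repLeg2 A ρ y) = repLeg1 A ρ y := swapM_leg2 _
    change swapM (repLeg1 A ρ x * (repLeg2 A ρ y * scal (n × n) s m)) =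
      repLeg2 A ρ x * (repLeg1 A ρ y * scal (n × n) s m)
    rw [swapM_mul, swapM_mul, s1, s2, swapM_scal]

variable [InvertibleAntipode k U]

/-- The factor which transforms the dynamical reflection equation into the reflection equation. -/
def reFactor : TwistedSquare R ⊗[k] (TwistedSquare R ⊗[k] L) :=
  F.toCocycle.antip (ℓ₃) (ℓ₁) (Δδ (conv (ℓ₂) (ℓ₄)) (ℓ₀)) * F.toCocycle.ev (ℓ₂) (ℓ₄) (ℓ₀)

theorem isUnit_reFactor : IsUnit (reFactor F R) := by
  have S := legs5_square L R
  refine IsUnit.mul (isUnit_antip F.toCocycle isCoaction_dCoact ⟨S.hh, S.hf,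
    (S.hg.conv S.hp S.gp).shift _ S.hl (S.gl.conv_left S.pl), S.fh.symm,
    ((S.gh.symm).conv_right S.hp').shift_right S.hl',
    (S.fg.conv_right S.fp).shift_right S.fl⟩) ?_
  exact (F.toCocycle.unit ⟨S.hg, S.hp, S.hl, S.gp, S.gl, S.pl⟩).isUnit

omit [InvertibleAntipode k U] in
theorem flipLegs_reFactor : flipLegs L R (reFactor F R) =
    F.toCocycle.antip (ℓ₁) (ℓ₃) (Δδ (conv (ℓ₄) (ℓ₂)) (ℓ₀)) * F.toCocycle.ev (ℓ₄) (ℓ₂) (ℓ₀) := by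
  have h := isAlgHom_flipLegs (L := L) R
  rw [reFactor, h.map_mul, map_antip _ h, map_ev _ h, comp_shift _ h, comp_conv h, flipLegs_leg1,
    flipLegs_leg2, flipLegs_leg3, flipLegs_leg4, flipLegs_base]

/-- The element of the algebra of five legs which represents `X₁ ℛ X₂`. -/
theorem gam_eq : F.toCocycle.gam R (ℓ₂) (ℓ₃) (Δδ (ℓ₄) (ℓ₀)) = Υinv * (Rinv *
    (F.toCocycle.antip (ℓ₁) (ℓ₃) (Δδ (conv (ℓ₂) (ℓ₄)) (ℓ₀)) *
      F.toCocycle.ev (ℓ₂) (ℓ₄) (ℓ₀))) := by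
  have h := upsilon_gam F R (legs3_incl (k := k) (B := TwistedSquare R) (M := L))
  have e : (upsilonCocycle F R).ev (F₁) (F₂) (ℓ₀) = (upsilonCocycle F R).val.val := ev3_incl _
  rw [e] at h
  rw [← h]
  change _ = Υinv * (Rinv * ((rUnit L R).val * _))
  rw [Units.inv_mul_cancel_left, Units.inv_mul_cancel_left]

variable {X s}

omit [InvertibleAntipode k U] in
theorem reTheta_rel_iff {a b z : TwistedSquare R ⊗[k] (TwistedSquare R ⊗[k] L)} (hz : IsUnit z) :
    Θ (a * z) = swapM (Θ (b * flipLegs L R z)) ↔ Θ a = swapM (Θ b) := by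
  constructor
  · intro h
    obtain ⟨w, rfl⟩ := hz
    have h2 := reTheta_rel_mul R ρ h (↑w⁻¹)
    change _ = swapM (Θ (_ * flipLegs L R ↑w⁻¹)) at h2
    rwa [mul_assoc, Units.mul_inv, mul_one, mul_assoc, ← (isAlgHom_flipLegs R).map_mul,
      Units.mul_inv, (isAlgHom_flipLegs R).map_one, mul_one] at h2
  · intro h
    exact reTheta_rel_mul R ρ h z

/-- After removal of the flips the two sides are ℛ₂₁ (X₁ ℛ X₂) and the swap of (X₁ ℛ X₂) ℛ₂₁. The
bracket is Θ of the element in `gam_eq`. Absorbing ℛ₂₁ on either side leaves R at legs (3,1) or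
(4,2), times `reFactor` or its flip, and that factor is invertible. -/
theorem dynamical_re_iff (hX : Intertwines (scal n s) (coactB 𝓛 ι R) (kMap R ρ X)) :
    reLeft (flipMul (ev3 (repLeg1 A ρ).toLinearMap (repLeg2 A ρ).toLinearMap
      (scal (n × n) s).toLinearMap (dynR F R))) X =
    reRight (flipMul (ev3 (repLeg1 A ρ).toLinearMap (repLeg2 A ρ).toLinearMap
      (scal (n × n) s).toLinearMap (dynR F R))) X ↔
    Θ (Υinv * (Rinv * R.ev (ℓ₃) (ℓ₁))) = swapM (Θ (Υinv * (Rinv * R.ev (ℓ₄) (ℓ₂)))) := by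
  have S := legs5_square L R
  have T13 : Legs3 (ℓ₁) (ℓ₃) (Δδ (conv (ℓ₂) (ℓ₄)) (ℓ₀)) := ⟨S.hf, S.hh,
    (S.hg.conv S.hp S.gp).shift _ S.hl (S.gl.conv_left S.pl), S.fh,
    (S.fg.conv_right S.fp).shift_right S.fl, ((S.gh.symm).conv_right S.hp').shift_right S.hl'⟩
  have T24 : Legs3 (ℓ₂) (ℓ₄) (ℓ₀) := ⟨S.hg, S.hp, S.hl, S.gp, S.gl, S.pl⟩
  set a := F.toCocycle.antip (ℓ₁) (ℓ₃) (Δδ (conv (ℓ₂) (ℓ₄)) (ℓ₀)) with ha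
  set e := F.toCocycle.ev (ℓ₂) (ℓ₄) (ℓ₀) with he
  set D := dynR F R with hD
  have hN := leg1_mul_ev_mul_leg2 R ρ hX D
  have hg : Θ (ev3 (lop (ℓ₂)) (rop (ℓ₃)) (lop (Δδ (ℓ₃) (Δδ (ℓ₄) (ℓ₀)))) D 1) =
    Θ (Υinv * (Rinv * (a * e))) := congrArg (Θ) (gam_eq F R)
  rw [hg] at hN
  have ce1 : ∀ x, Commute e ((ℓ₁) x) := fun x => (ev2_commute (fun y => S.fg x y)
    (fun y => ev2_commute (fun y => S.fp x y) (fun y => S.fl x y) y) _).symm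
  have ce3 : ∀ x, Commute e ((ℓ₃) x) := fun x => (ev2_commute (fun y => (S.gh y x).symm)
    (fun y => ev2_commute (fun y => S.hp' x y) (fun y => S.hl' x y) y) _).symm
  have ce0 : ∀ m, Commute e (Δδ (conv (ℓ₂) (ℓ₄)) (ℓ₀) m) := F.toCocycle.ev_comm T24
  have hz : ∀ m, Commute (a * e) (Δδ (conv (ℓ₁) (ℓ₃)) (Δδ (conv (ℓ₂) (ℓ₄)) (ℓ₀)) m) := by
    intro m
    refine (antip_comm F.toCocycle isCoaction_dCoact T13 m).mul_left ?_
    exact shift_semiconj _ (fun x => conv_semiconj ce1 ce3 x) ce0 m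
  have hL := ev_mul_reTheta F R ρ hX (a * e) hz D
  -- Left side: `e` passes the contracted R-matrix, which `antip_mul_gam2` then turns into an
  -- ordinary R.
  have hg2 : a * e * ev3 (rop (ℓ₃)) (rop (ℓ₁))
      (lop (Δδ (conv (ℓ₁) (ℓ₃)) (Δδ (conv (ℓ₂) (ℓ₄)) (ℓ₀)))) D 1 =
      R.ev (ℓ₃) (ℓ₁) * reFactor F R := by
    have c : Commute e (ev3 (rop (ℓ₃)) (rop (ℓ₁))
      (lop (Δδ (conv (ℓ₁) (ℓ₃)) (Δδ (conv (ℓ₂) (ℓ₄)) (ℓ₀)))) D 1) :=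
      ev3_rop_rop_semiconj ce1 ce3
        (fun m => shift_semiconj _ (fun x => conv_semiconj ce1 ce3 x) ce0 m) _
    have := antip_mul_gam2 R F.toCocycle isCoaction_dCoact T13
    rw [mul_assoc, c.eq, ← mul_assoc]
    refine (congrArg (· * e) this).trans ?_
    rw [mul_assoc]; rfl
  -- Right side: `e` is a value of F and cancels the F̄ in the dynamical R-matrix; the ordinary R is
  -- then moved to the left of `a`, reversing a coaction leg.
  have hr : a * e * ev3 (ℓ₄) (ℓ₂) (ℓ₀) D = R.ev (ℓ₄) (ℓ₂) * flipLegs L R (reFactor F R) := by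
    have h1 : ev3 (ℓ₄) (ℓ₂) (ℓ₀) D = F.toCocycle.inv (ℓ₂) (ℓ₄) (ℓ₀) * R.ev (ℓ₄) (ℓ₂) *
        F.toCocycle.ev (ℓ₄) (ℓ₂) (ℓ₀) := ev_dyn R F.toCocycle T24.swap
    have h2 : e * F.toCocycle.inv (ℓ₂) (ℓ₄) (ℓ₀) = 1 := (F.toCocycle.unit T24).mul_inv
    have h3 : SemiconjBy (R.ev (ℓ₄) (ℓ₂))
        (F.toCocycle.antip (ℓ₁) (ℓ₃) (Δδ (conv (ℓ₄) (ℓ₂)) (ℓ₀))) a := by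
      refine antip_semiconj F.toCocycle
        (fun x => (ev2_commute (fun y => S.fp x y) (fun y => S.fg x y) _).symm)
        (fun x => (ev2_commute (fun y => S.hp' x y) (fun y => (S.gh y x).symm) _).symm)
        (fun m => shift_semiconj _ (fun x => R.ev_conv S.hp S.hg S.gp.symm x)
          (fun m => (ev2_commute (fun y => (S.pl y m).symm) (fun y => (S.gl y m).symm) _).symm) m)
    rw [flipLegs_reFactor, ← mul_assoc (R.ev (ℓ₄) (ℓ₂)), h3.eq, h1, mul_assoc, ← mul_assoc e,
      ← mul_assoc e, h2, one_mul, mul_assoc]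
  rw [reLeft_flipMul, reRight_flipMul, hN, swapM_ev, hL, hg2, ← reTheta_mul_ev', mul_assoc Υinv,
    mul_assoc Rinv, hr]
  -- The two leftover factors are exchanged by the flip of the squares, so they can be cancelled
  -- together.
  have key := reTheta_rel_iff (X := X) (s := s) R ρ (a := Υinv * (Rinv * R.ev (ℓ₃) (ℓ₁)))
    (b := Υinv * (Rinv * R.ev (ℓ₄) (ℓ₂))) (isUnit_reFactor F R)
  simpa only [mul_assoc] using key

end ReIff
end DynRE
end

noncomputable section
namespace DynRE

/-! ### The reflection equation over the convolution algebra -/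

section ReConv
set_option maxSynthPendingDepth 6
variable {k H U L A n : Type*} [Field k] [Ring H] [HopfAlgebra k H] [Ring U] [HopfAlgebra k U]
  [Ring L] [Algebra k L] {𝓛 : BaseAlgebra k H L} {ι : H →ₐc[k] U} (F : DynamicalTwist 𝓛 ι)
  [Ring A] [Algebra k A] [Fintype n] [DecidableEq n]
  (R : UniversalRMatrix k U) (ρ : U →ₐ[k] Matrix n n k) (X : Matrix n n A) (s : L →ₐ[k] A)

local notation "Θ" => reTheta R ρ X s
local notation "F₁" => inl k (TwistedSquare R) (TwistedSquare R ⊗[k] L)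
local notation "F₂" => inr k (TwistedSquare R) (TwistedSquare R ⊗[k] L) ∘ₗ inl k (TwistedSquare R) L
local notation "ℓ₁" => inl k (TwistedSquare R) (TwistedSquare R ⊗[k] L) ∘ₗ sqL R
local notation "ℓ₂" => inl k (TwistedSquare R) (TwistedSquare R ⊗[k] L) ∘ₗ sqR R
local notation "ℓ₃" => (inr k (TwistedSquare R) (TwistedSquare R ⊗[k] L) ∘ₗ
  inl k (TwistedSquare R) L) ∘ₗ sqL R
local notation "ℓ₄" => (inr k (TwistedSquare R) (TwistedSquare R ⊗[k] L) ∘ₗ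
  inl k (TwistedSquare R) L) ∘ₗ sqR R
local notation "ℓ₀" => inr k (TwistedSquare R) (TwistedSquare R ⊗[k] L) ∘ₗ
  inr k (TwistedSquare R) L
local notation "Δδ" => shift (dCoact 𝓛 (ι : H →ₐ[k] U))
local notation "Rinv" => Units.val (rUnit L R)⁻¹
local notation "Υinv" => Units.val (DynCocycle.val (upsilonCocycle F R))⁻¹

theorem entry_ev2_scal {M : Type*} [AddCommGroup M] [Module k M] (f : M →ₗ[k] Matrix n n A)
    (i j : n) (z : M ⊗[k] L) : ev2 f (scal n s).toLinearMap z i j =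
      ev2 (Matrix.entryLinearMap k A i j ∘ₗ f) s.toLinearMap z := by
  induction z with
  | zero => simp
  | add x y hx hy => simp only [map_add, Matrix.add_apply, hx, hy]
  | tmul x m => simp [Matrix.mul_diagonal]

variable {s} in
theorem intertwines_entry {B : Type*} [Ring B] [Bialgebra k B] {δ : L →ₐ[k] B ⊗[k] L}
    {f : B →ₗ[k] Matrix n n A} (hf : Intertwines (scal n s) δ f) (i j : n) :
    Intertwines s δ (Matrix.entryLinearMap k A i j ∘ₗ f) := by
  intro m b
  rw [← entry_ev2_scal, hf m b]
  simp [Matrix.diagonal_mul]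

theorem entry_reTheta (z : TwistedSquare R ⊗[k] (TwistedSquare R ⊗[k] L)) (p q : n × n) :
    Θ z p q = ev3 (Matrix.entryLinearMap k A p.1 q.1 ∘ₗ kMap R ρ X)
      (Matrix.entryLinearMap k A p.2 q.2 ∘ₗ kMap R ρ X) s.toLinearMap z := by
  induction z using tensor3_induction with
  | h0 => simp
  | hadd x y hx hy => simp only [map_add, Matrix.add_apply, hx, hy]
  | h b c m =>
    rw [reTheta_tmul, ← mul_assoc]
    simp [Matrix.mul_diagonal, leg_mul_apply, mul_assoc]

/-- Legs 3 and 1 act through γ, and R is invariant under γ ⊗ γ. -/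
theorem reTheta_mul_rev (z : TwistedSquare R ⊗[k] (TwistedSquare R ⊗[k] L)) :
    Θ (z * R.ev (ℓ₃) (ℓ₁)) = swapM (rep2A A ρ (R.val : U ⊗[k] U)) * Θ z := by
  have e : ∀ w : U ⊗[k] U, Θ (z * ev2 (ℓ₃) (ℓ₁) w) = swapM (rep2A A ρ
      (TensorProduct.map (HopfAlgebra.antipode k) (HopfAlgebra.antipode k) w)) * Θ z := by
    intro w
    induction w with
    | zero => simp [swapM]
    | add x y hx hy => simp only [map_add, mul_add, hx, hy, ← add_mul]; rfl
    | tmul x y =>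
      rw [ev2_tmul, ← mul_assoc, reTheta_mul_leg1, reTheta_mul_leg3, TensorProduct.map_tmul,
        rep2A_tmul, swapM_mul, swapM_leg1, swapM_leg2, ← mul_assoc]
      exact congrArg (· * Θ z) (leg1_comm ρ _ _)
  rw [UniversalRMatrix.ev, e, R.map_antipode]

theorem reTheta_mul_rev' (z : TwistedSquare R ⊗[k] (TwistedSquare R ⊗[k] L)) :
    Θ (z * R.ev (ℓ₄) (ℓ₂)) = Θ z * swapM (rep2A A ρ (R.val : U ⊗[k] U)) := by
  have e : ∀ w : U ⊗[k] U, Θ (z * ev2 (ℓ₄) (ℓ₂) w) = Θ z * swapM (rep2A A ρ w) := by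
    intro w
    induction w with
    | zero => simp [swapM]
    | add x y hx hy => 
      simp only [map_add, mul_add, hx, hy]
      rw [← mul_add]
      rfl
    | tmul x y =>
      rw [ev2_tmul, ← mul_assoc, reTheta_mul_leg2, reTheta_mul_leg4,
        rep2A_tmul, swapM_mul, swapM_leg1, swapM_leg2, mul_assoc]
      rfl
  exact e _

variable [InvertibleAntipode k U]

theorem ev_antipodeInv {f g : U →ₗ[k] A} :
    ev2 f (g ∘ₗ antipodeInv k U) (R.val : U ⊗[k] U) = ev2 f g (↑R.val⁻¹ : U ⊗[k] U) := by
  rw [← R.lTensor_antipode_inv]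
  generalize (↑R.val⁻¹ : U ⊗[k] U) = w
  induction w with
  | zero => simp
  | add x y hx hy => simp only [map_add, hx, hy]
  | tmul x y => simp [antipodeInv_antipode]

variable {X s} (hX : Intertwines (scal n s) (coactB 𝓛 ι R) (kMap R ρ X))

/-- The matrix `b ↦ b ▶ X` over the convolution algebra of intertwiners. -/
def kConv : Matrix n n (dynConv (upsilonCocycle F R) s) :=
  Matrix.of fun i j => ⟨Matrix.entryLinearMap k A i j ∘ₗ kMap R ρ X, intertwines_entry hX i j⟩

variable (s) in
/-- The value at `b`. -/
def evConv (b : TwistedSquare R) : dynConv (upsilonCocycle F R) s →ₗ[k] A :=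
  LinearMap.applyₗ b ∘ₗ (dynConv (upsilonCocycle F R) s).subtype

theorem evConv_apply (b : TwistedSquare R) (f : dynConv (upsilonCocycle F R) s) :
    evConv F R s b f = f.1 b := rfl

theorem evConv_algebraMap_mul (b : TwistedSquare R) (c : k) (f : dynConv (upsilonCocycle F R) s) :
    evConv F R s b (algebraMap k _ c * f) = algebraMap k A c * evConv F R s b f := by
  rw [← Algebra.smul_def, ← Algebra.smul_def, map_smul]

theorem evConv_mul_algebraMap (b : TwistedSquare R) (c : k)
    (f : dynConv (upsilonCocycle F R) s) :
    evConv F R s b (f * algebraMap k _ c) = evConv F R s b f * algebraMap k A c := by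
  rw [← Algebra.commutes, ← Algebra.commutes, evConv_algebraMap_mul]

theorem kConv_mul_apply (b : TwistedSquare R) (x : U) (i j : n) :
    ((kConv F R ρ hX * repA (dynConv (upsilonCocycle F R) s) ρ x :
      Matrix n n (dynConv (upsilonCocycle F R) s)) i j).1 b = kMap R ρ X (b * sqR R x) i j := by
  rw [kMap_mul_sqR, ← evConv_apply, Matrix.mul_apply, Matrix.mul_apply, map_sum]
  exact Finset.sum_congr rfl fun _ _ => evConv_mul_algebraMap F R b _ _

theorem mul_kConv_apply (b : TwistedSquare R) (x : U) (i j : n) :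
    ((repA (dynConv (upsilonCocycle F R) s) ρ x * kConv F R ρ hX :
      Matrix n n (dynConv (upsilonCocycle F R) s)) i j).1 b = kMap R ρ X (b * sqL R (antipodeInv k U x)) i j := by
  rw [kMap_mul_sqL, antipode_antipodeInv, ← evConv_apply, Matrix.mul_apply, Matrix.mul_apply,
    map_sum]
  exact Finset.sum_congr rfl fun _ _ => evConv_algebraMap_mul F R b _ _

/-- The first factor of `T` joins the left matrix as a right multiplication, the second joins the
right matrix as a left multiplication, hence with γ̄. The product of the convolution algebra
supplies Υ⁻¹ and the coproduct of b. -/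
theorem evConv_middle (b : TwistedSquare R) (T : U ⊗[k] U) :
    (leg1 (kConv F R ρ hX) * rep2A _ ρ T * leg2 (kConv F R ρ hX)).map (evConv F R s b) =
      Θ (Υinv * dDelta (b ⊗ₜ 1) * ev2 (ℓ₂) ((ℓ₃) ∘ₗ antipodeInv k U) T) := by
  induction T with
  | zero => ext; simp
  | add x y hx hy =>
    have e : ∀ M N : Matrix (n × n) (n × n) (dynConv (upsilonCocycle F R) s),
      (M + N).map (evConv F R s b) = M.map (evConv F R s b) + N.map (evConv F R s b) :=
      fun M N => Matrix.map_add _ (map_add _) M N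
    simp only [map_add, mul_add, add_mul, e, hx, hy]
  | tmul x y =>
    rw [rep2A_tmul, ← mul_assoc, mul_assoc (leg1 _ * leg1 _), ← leg1_mul, ← leg2_mul]
    ext p q
    rw [Matrix.map_apply, leg_mul_apply, evConv_apply, dynConv_mul, DynCocycle.star_apply,
      entry_reTheta]
    generalize Υinv * dDelta (b ⊗ₜ 1) = z
    induction z using tensor3_induction with
    | h0 => simp
    | hadd x y hx hy => simp only [map_add, add_mul, hx, hy]
    | h c d m =>
      have e : (c ⊗ₜ[k] (d ⊗ₜ[k] m)) * ev2 (ℓ₂) ((ℓ₃) ∘ₗ antipodeInv k U) (x ⊗ₜ y) =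
          (c * sqR R x) ⊗ₜ ((d * sqL R (antipodeInv k U y)) ⊗ₜ m) := by simp
      rw [e]
      simp only [ev3, ev2_tmul, kConv_mul_apply, mul_kConv_apply]
      rfl

/-- Since (id ⊗ γ̄)(R) = R⁻¹, the middle R becomes R₂₃⁻¹. It cancels the right half of the
conjugation in the twisted coproduct and leaves the untwisted pairs (13) and (24). -/
theorem evConv_middle_rmatrix (b : U ⊗[k] U) :
    (leg1 (kConv F R ρ hX) * rep2A _ ρ (R.val : U ⊗[k] U) * leg2 (kConv F R ρ hX)).map
      (evConv F R s (toTwisted R b)) =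
      Θ (Υinv * (Rinv * ev2 (conv (ℓ₁) (ℓ₃)) (conv (ℓ₂) (ℓ₄)) b)) := by
  have T := legs3_incl (k := k) (B := TwistedSquare R) (M := L)
  have e1 : dDelta (toTwisted R b ⊗ₜ[k] (1 : L)) = conv (F₁) (F₂) (toTwisted R b) := by
    rw [← ev2_one_right (conv (F₁) (F₂)) (ℓ₀) T.hl.map_one, ← ev2_dDelta]
    exact (ev3_incl _).symm
  have e2 : ev2 (ℓ₂) ((ℓ₃) ∘ₗ antipodeInv k U) (R.val : U ⊗[k] U) = Rinv := ev_antipodeInv R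
  have h := conv_square R T.hf T.hg T.fg b
  rw [evConv_middle, e1, e2, mul_assoc]
  congr 2
  exact (SemiconjBy.units_inv_symm_left (a := rUnit L R) h).eq.symm

theorem evConv_rep2A_mul (b : TwistedSquare R) (w : U ⊗[k] U)
    (N : Matrix (n × n) (n × n) (dynConv (upsilonCocycle F R) s)) :
    (swapM (rep2A _ ρ w) * N).map (evConv F R s b) =
      swapM (rep2A A ρ w) * N.map (evConv F R s b) := by
  ext p q
  rw [Matrix.map_apply, Matrix.mul_apply, Matrix.mul_apply, map_sum]
  exact Finset.sum_congr rfl fun _ _ => evConv_algebraMap_mul F R _ _ _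

theorem evConv_mul_rep2A (b : TwistedSquare R) (w : U ⊗[k] U)
    (N : Matrix (n × n) (n × n) (dynConv (upsilonCocycle F R) s)) :
    (N * swapM (rep2A _ ρ w)).map (evConv F R s b) =
      N.map (evConv F R s b) * swapM (rep2A A ρ w) := by
  ext p q
  rw [Matrix.map_apply, Matrix.mul_apply, Matrix.mul_apply, map_sum]
  exact Finset.sum_congr rfl fun _ _ => evConv_mul_algebraMap F R _ _ _

theorem reLeft_kConv (b : U ⊗[k] U) : (reLeft (braid _ R ρ) (kConv F R ρ hX)).map
    (evConv F R s (toTwisted R b)) = Θ (Υinv * (Rinv * R.ev (ℓ₃) (ℓ₁)) *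
      ev2 (conv (ℓ₃) (ℓ₁)) (conv (ℓ₂) (ℓ₄)) b) := by
  have S := legs5_square L R
  have c := ev2_semiconj (u := R.ev (ℓ₃) (ℓ₁)) (f := conv (ℓ₃) (ℓ₁)) (f' := conv (ℓ₁) (ℓ₃))
    (l := conv (ℓ₂) (ℓ₄)) (l' := conv (ℓ₂) (ℓ₄)) (R.ev_conv S.hh S.hf S.fh.symm)
    (fun x => (ev2_commute (fun y => ((S.gh.symm.conv_right S.hp') y x).symm)
      (fun y => ((S.fg.conv_right S.fp) y x).symm) _).symm) b
  rw [braid, reLeft_flipMul, evConv_rep2A_mul, evConv_middle_rmatrix, ← reTheta_mul_rev]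
  simp only [mul_assoc]
  rw [c.eq]

theorem reRight_kConv (b : U ⊗[k] U) : (reRight (braid _ R ρ) (kConv F R ρ hX)).map
    (evConv F R s (toTwisted R b)) = swapM (Θ (Υinv * (Rinv * R.ev (ℓ₄) (ℓ₂)) *
      flipLegs L R (ev2 (conv (ℓ₃) (ℓ₁)) (conv (ℓ₂) (ℓ₄)) b))) := by
  have S := legs5_square L R
  have c := ev2_semiconj (u := R.ev (ℓ₄) (ℓ₂)) (f := conv (ℓ₁) (ℓ₃)) (f' := conv (ℓ₁) (ℓ₃))
    (l := conv (ℓ₄) (ℓ₂)) (l' := conv (ℓ₂) (ℓ₄))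
    (fun x => (ev2_commute (fun y => ((S.fp.conv_left S.hp') x y))
      (fun y => ((S.fg.conv_left S.gh.symm) x y)) _).symm)
    (R.ev_conv S.hp S.hg S.gp.symm) b
  have e := LinearMap.congr_fun (comp_ev2 (isAlgHom_flipLegs (L := L) R)
    (conv (ℓ₃) (ℓ₁)) (conv (ℓ₂) (ℓ₄))) b
  rw [comp_conv (isAlgHom_flipLegs R), comp_conv (isAlgHom_flipLegs R), flipLegs_leg1,
    flipLegs_leg2, flipLegs_leg3, flipLegs_leg4] at e
  have e' : flipLegs L R (ev2 (conv (ℓ₃) (ℓ₁)) (conv (ℓ₂) (ℓ₄)) b) =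
    ev2 (conv (ℓ₁) (ℓ₃)) (conv (ℓ₄) (ℓ₂)) b := e
  have h : ∀ M : Matrix (n × n) (n × n) (dynConv (upsilonCocycle F R) s),
    (swapM M).map (evConv F R s (toTwisted R b)) =
      swapM (M.map (evConv F R s (toTwisted R b))) := fun _ => rfl
  rw [braid, reRight_flipMul, h, evConv_mul_rep2A, evConv_middle_rmatrix, ← reTheta_mul_rev', e']
  simp only [mul_assoc]
  rw [c.eq]

/-- Evaluated at b, the two sides are the stated relation multiplied on the right by the coproduct
of b, with the squares flipped on one side. At b = 1 this is the relation itself, and stability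
under right multiplication gives every b. -/
theorem re_conv_iff :
    reLeft (braid _ R ρ) (kConv F R ρ hX) = reRight (braid _ R ρ) (kConv F R ρ hX) ↔
    Θ (Υinv * (Rinv * R.ev (ℓ₃) (ℓ₁))) = swapM (Θ (Υinv * (Rinv * R.ev (ℓ₄) (ℓ₂)))) := by
  constructor
  · intro h
    have S := legs5_square L R
    have e := congrArg (fun M => M.map (evConv F R s (toTwisted R 1))) h
    simp only [reLeft_kConv, reRight_kConv] at e
    have e1 : ev2 (conv (ℓ₃) (ℓ₁)) (conv (ℓ₂) (ℓ₄)) (1 : U ⊗[k] U) = 1 := by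
      rw [Algebra.TensorProduct.one_def, ev2_tmul, (S.hh.conv S.hf S.fh.symm).map_one,
        (S.hg.conv S.hp S.gp).map_one, mul_one]
    rwa [e1, (isAlgHom_flipLegs R).map_one, mul_one, mul_one] at e
  · intro h
    ext p q b
    have e := reTheta_rel_mul R ρ h (ev2 (conv (ℓ₃) (ℓ₁)) (conv (ℓ₂) (ℓ₄)) b)
    exact congrFun (congrFun ((reLeft_kConv F R ρ hX b).trans
      (e.trans (reRight_kConv F R ρ hX b).symm)) p) q

end ReConv
end DynRE
end

noncomputable section
namespace DynRE

/-! ### The cross relations as intertwining -/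

section Cross
set_option maxSynthPendingDepth 6
variable {k H U L A n : Type*} [Field k] [Ring H] [HopfAlgebra k H] [Ring U] [HopfAlgebra k U]
  [Ring L] [Algebra k L] {𝓛 : BaseAlgebra k H L} {ι : H →ₐc[k] U} (F : DynamicalTwist 𝓛 ι)
  [Ring A] [Algebra k A] [Fintype n] [DecidableEq n]
  (R : UniversalRMatrix k U) (ρ : U →ₐ[k] Matrix n n k) (X : Matrix n n A) (s : L →ₐ[k] A)

theorem kMap_coact_apply (m : L) (i j : n) :
    ev2 (kMap R ρ X) (scal n s).toLinearMap (coactB 𝓛 ι R m) i j =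
      ∑ p, ∑ q, X p q * s (crossCoef 𝓛 ι ρ i p q j m) := by
  rw [coactB, AlgHom.comp_apply]
  simp only [crossCoef, LinearMap.comp_apply, AlgHom.toLinearMap_apply]
  induction dCoact 𝓛 (ι : H →ₐ[k] U) m with
  | zero => simp
  | add x y hx hy => simp only [map_add, mul_add, Finset.sum_add_distrib, Matrix.add_apply, hx, hy]
  | tmul y l =>
    have e : diag R y = toTwisted R (Coalgebra.comul (R := k) y) := rfl
    rw [Algebra.TensorProduct.map_tmul, e]
    simp only [LinearMap.rTensor_tmul, LinearMap.comp_apply]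
    induction Coalgebra.comul (R := k) y with
    | zero => simp
    | add x y hx hy =>
      simp only [map_add, TensorProduct.add_tmul, mul_add, Finset.sum_add_distrib,
        Matrix.add_apply, hx, hy]
    | tmul x y =>
      have e2 : kMap R ρ X (toTwisted R (x ⊗ₜ y)) =
        repA A ρ (HopfAlgebra.antipode k x) * X * repA A ρ y := sandwichK_tmul ρ X x y
      have e3 : ∀ x i j, repA A ρ x i j = algebraMap k _ (ρ x i j) := fun _ _ _ => rfl
      rw [ev2_tmul, e2]
      change (_ * Matrix.scalar n (s l) : Matrix n n A) i j = _
      rw [Matrix.scalar_apply, Matrix.mul_diagonal]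
      simp only [Matrix.mul_apply, Finset.sum_mul]
      rw [Finset.sum_comm]
      refine Finset.sum_congr rfl fun p _ => Finset.sum_congr rfl fun q _ => ?_
      have e5 : ∀ c d : k, ∀ x : A, algebraMap k A c * x * algebraMap k A d * s l =
          x * s ((c * d) • l) := by
        intro c d x
        rw [map_smul, mul_smul_comm, Algebra.smul_def, map_mul, ← Algebra.commutes d]
        rw [← mul_assoc, ← Algebra.commutes, ← map_mul, mul_assoc]
      rw [e3, e3, e5]
      simp

theorem kMap_mul_scal (z : TwistedSquare R ⊗[k] L) (x y : U) :
    ev2 (kMap R ρ X) (scal n s).toLinearMap (z * (toTwisted R (x ⊗ₜ y) ⊗ₜ 1)) =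
      repA A ρ (HopfAlgebra.antipode k x) *
        ev2 (kMap R ρ X) (scal n s).toLinearMap z * repA A ρ y := by
  induction z with
  | zero => simp
  | add x y hx hy => simp only [map_add, mul_add, add_mul, hx, hy]
  | tmul b m =>
    rw [Algebra.TensorProduct.tmul_mul_tmul, mul_one, ev2_tmul, ev2_tmul, kMap_mul]
    have := (repA_scal (A := A) ρ s y m).eq
    simp only [mul_assoc]
    exact congrArg (fun t => _ * (_ * t)) this

variable {X s} in
-- The hypothesis is the intertwining property at b = 1. Other b act by multiplying with scalar
-- matrices from both sides, and these commute with the image of `L`.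
theorem intertwines_kMap (hc : ∀ l i j, s l * X i j =
    ∑ p, ∑ q, X p q * s (crossCoef 𝓛 ι ρ i p q j l)) :
    Intertwines (scal n s) (coactB 𝓛 ι R) (kMap R ρ X) := by
  intro m b
  have h1 : ev2 (kMap R ρ X) (scal n s).toLinearMap (coactB 𝓛 ι R m) = scal n s m * X := by
    ext i j
    rw [kMap_coact_apply, ← hc]
    change _ = (Matrix.scalar n (s m) * X) i j
    rw [Matrix.scalar_apply, Matrix.diagonal_mul]
  obtain ⟨b, rfl⟩ := (toTwisted R).surjective b
  induction b with
  | zero => simp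
  | add x y hx hy => simp only [map_add, TensorProduct.add_tmul, mul_add, hx, hy]
  | tmul x y =>
    have e2 : kMap R ρ X (toTwisted R (x ⊗ₜ y)) =
        repA A ρ (HopfAlgebra.antipode k x) * X * repA A ρ y := sandwichK_tmul ρ X x y
    rw [kMap_mul_scal, h1, e2, ← mul_assoc, (repA_scal (A := A) ρ s _ m).eq]
    simp only [mul_assoc]

variable {X s} in
theorem cross_of_intertwines (hX : Intertwines (scal n s) (coactB 𝓛 ι R) (kMap R ρ X))
    (l : L) (i j : n) : s l * X i j = ∑ p, ∑ q, X p q * s (crossCoef 𝓛 ι ρ i p q j l) := by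
  have h := congrFun (congrFun (hX l 1) i) j
  rw [← Algebra.TensorProduct.one_def, mul_one, kMap_coact_apply, kMap_one] at h
  rw [h]
  change _ = (Matrix.scalar n (s l) * X) i j
  rw [Matrix.scalar_apply, Matrix.diagonal_mul]

/-- Connects the coefficients in the presentation with the legs used in `dynamical_re_iff`. -/
theorem dynRMatrix_map : (dynRMatrix F R ρ).map s = ev3 (repLeg1 A ρ).toLinearMap
    (repLeg2 A ρ).toLinearMap (scal (n × n) s).toLinearMap (dynR F R) := by
  ext p q
  rw [Matrix.map_apply, dynRMatrix, Matrix.of_apply]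
  induction dynR F R using tensor3_induction with
  | h0 => simp
  | hadd x y hx hy => simp only [map_add, Matrix.add_apply, hx, hy]
  | h x y m =>
    have e : repLeg1 A ρ x * repLeg2 A ρ y = rep2A A ρ (x ⊗ₜ y) := (rep2A_tmul ρ x y).symm
    have e2 : rep2A A ρ (x ⊗ₜ y) p q = algebraMap k A (rep2 ρ (x ⊗ₜ y) p q) := rfl
    simp only [ev3, ev2_tmul]
    change _ = (repLeg1 A ρ x * (repLeg2 A ρ y * Matrix.scalar (n × n) (s m))) p q
    rw [← mul_assoc, e, Matrix.scalar_apply, Matrix.mul_diagonal, e2, ← Algebra.smul_def,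
      ← map_smul]
    rfl

end Cross
end DynRE
end

noncomputable section
namespace DynRE

/-! ### Left multiplications in the twisted product -/

section LeftMul
set_option maxSynthPendingDepth 6
variable {k B L A : Type*} [Field k] [Ring B] [Bialgebra k B] [Ring L] [Algebra k L]
  [Ring A] [Algebra k A] {act : A →ₗ[k] B →ₗ[k] A} {δ : L →ₐ[k] B ⊗[k] L} (Υ : DynCocycle δ)

theorem one_tmul_tmul (hact : ModAlg act) (a : A) (l m : L) :
    Υ.tmul act (1 ⊗ₜ l) (a ⊗ₜ m) = act1 act a (δ l * (1 ⊗ₜ m)) := by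
  have : actL act L (1 : A) = eps := by
    rw [actL, hact.act_one]; ext; simp [eps_apply, Algebra.TensorProduct.algebraMap_apply]
  rw [Υ.tmul_tmul, act2, this, ev3, ev2_eps, map_mul, map_mul, Υ.counit_left, one_mul]
  simp [act1]

/-- Left multiplication by `1 ⊗ l` in the twisted product. -/
def DynCocycle.baseEnd (hact : ModAlg act) (hδ : IsCoaction δ) :
    L →ₐ[k] Module.End k (A ⊗[k] L) :=
  AlgHom.ofLinearMap (Υ.tmul act ∘ₗ inr k A L)
    (LinearMap.ext fun v => one_tmul' Υ hact v)
    (fun l m => LinearMap.ext fun v => by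
      change Υ.tmul act (1 ⊗ₜ (l * m)) v = Υ.tmul act (1 ⊗ₜ l) (Υ.tmul act (1 ⊗ₜ m) v)
      rw [← tmul_assoc Υ hact hδ, tmul_one_tmul Υ hact hδ])

variable (act) in
/-- Left multiplication by `(b ▶ a) ⊗ 1` in the twisted product. -/
def DynCocycle.actEnd (a : A) : B →ₗ[k] Module.End k (A ⊗[k] L) := Υ.tmul act ∘ₗ actL act L a

theorem ev2_actEnd (hact : ModAlg act) (hδ : IsCoaction δ) (a : A) (z : B ⊗[k] L) :
    ev2 (Υ.actEnd act a) (Υ.baseEnd hact hδ).toLinearMap z = Υ.tmul act (act1 act a z) := by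
  induction z with
  | zero => simp
  | add x y hx hy => simp only [map_add, hx, hy]
  | tmul b m =>
    refine LinearMap.ext fun v => ?_
    change Υ.tmul act (act a b ⊗ₜ 1) (Υ.tmul act (1 ⊗ₜ m) v) = _
    rw [← tmul_assoc Υ hact hδ, tmul_one_tmul Υ hact hδ, act1_tmul, one_mul]

theorem ev3_actEnd (hact : ModAlg act) (hδ : IsCoaction δ) (a b : A) (z : B ⊗[k] (B ⊗[k] L)) :
    ev3 (Υ.actEnd act a) (Υ.actEnd act b) (Υ.baseEnd hact hδ).toLinearMap z =
      Υ.tmul act (act2 act a b ((Υ.val : B ⊗[k] (B ⊗[k] L)) * z)) := by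
  induction z using tensor3_induction with
  | h0 => simp
  | hadd x y hx hy => simp only [map_add, mul_add, hx, hy]
  | h x y m =>
    have e := tmul_act1 Υ hact a b (x ⊗ₜ (1 : L)) (y ⊗ₜ m)
    rw [mul_assoc, Algebra.TensorProduct.map_tmul, map_one, AlgHom.id_apply,
      Algebra.TensorProduct.tmul_mul_tmul, mul_one, one_mul] at e
    rw [ev3, ev2_tmul, ev2_actEnd, ← e]
    refine LinearMap.ext fun v => ?_
    change Υ.tmul act (act a x ⊗ₜ 1) (Υ.tmul act _ v) = _
    rw [← tmul_assoc Υ hact hδ, act1_tmul act a]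

/-- By associativity this is the formula for the product of 1 ⊗ m with (b ▶ a) ⊗ 1, in which only
the coaction of m enters. -/
theorem intertwines_actEnd (hact : ModAlg act) (hδ : IsCoaction δ) (a : A) :
    Intertwines (Υ.baseEnd hact hδ) δ (Υ.actEnd act a) := by
  intro m b
  rw [ev2_actEnd, ← act1_act hact]
  refine LinearMap.ext fun v => ?_
  change _ = Υ.tmul act (1 ⊗ₜ m) (Υ.tmul act (act a b ⊗ₜ 1) v)
  rw [← tmul_assoc Υ hact hδ, one_tmul_tmul Υ hact, ← Algebra.TensorProduct.one_def, mul_one]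

theorem act2_dDelta (hact : ModAlg act) (a b : A) (z : B ⊗[k] L) :
    act2 act a b (dDelta z) = act1 act (a * b) z := by
  have : actL act L (a * b) = conv (actL act L a) (actL act L b) := by
    rw [actL, hact.act_mul, comp_conv isAlgHom_inl]; rfl
  rw [act2, ev2_dDelta, act1, this]

/-- The twist in the product of `A ⊗ L` cancels against its inverse in `star`, leaving the action on
the undeformed product. -/
theorem star_actEnd (hact : ModAlg act) (hδ : IsCoaction δ) (a b : A) :
    Υ.star (Υ.baseEnd hact hδ) (Υ.actEnd act a) (Υ.actEnd act b) = Υ.actEnd act (a * b) := by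
  ext1 x
  rw [Υ.star_apply, ev3_actEnd, Units.mul_inv_cancel_left, act2_dDelta hact, act1_tmul]
  rfl

/-- The homomorphism `a ↦ (b ↦ (b ▶ a) ⊗ 1)`. -/
def DynCocycle.actConv (hact : ModAlg act) [hδ : Fact (IsCoaction δ)] :
    A →ₐ[k] dynConv Υ (Υ.baseEnd hact hδ.out) :=
  AlgHom.ofLinearMap
    { toFun := fun a => ⟨Υ.actEnd act a, intertwines_actEnd Υ hact hδ.out a⟩
      map_add' := fun a b => Subtype.ext (LinearMap.ext fun x => by
        change Υ.tmul act (act (a + b) x ⊗ₜ 1) =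
          Υ.tmul act (act a x ⊗ₜ 1) + Υ.tmul act (act b x ⊗ₜ 1)
        rw [← map_add, ← TensorProduct.add_tmul, ← LinearMap.add_apply, ← map_add])
      map_smul' := fun c a => Subtype.ext (LinearMap.ext fun x => by
        change Υ.tmul act (act (c • a) x ⊗ₜ 1) = c • Υ.tmul act (act a x ⊗ₜ 1)
        rw [← map_smul, TensorProduct.smul_tmul', ← LinearMap.smul_apply, ← map_smul]) }
    (Subtype.ext (LinearMap.ext fun x => by
      change Υ.tmul act (act 1 x ⊗ₜ 1) = algebraMap k _ (Coalgebra.counit (R := k) x)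
      have h1 : Υ.tmul act ((1 : A) ⊗ₜ (1 : L)) = 1 := LinearMap.ext fun v => one_tmul' Υ hact v
      rw [hact.act_one, eps_apply, Algebra.algebraMap_eq_smul_one, Algebra.algebraMap_eq_smul_one,
        ← TensorProduct.smul_tmul', map_smul, h1]))
    (fun a b => Subtype.ext (star_actEnd Υ hact hδ.out a b).symm)

end LeftMul

/-! ### From equivariant maps into `dynConv` to maps on the twisted product -/

section EquivariantHom
set_option maxSynthPendingDepth 6
variable {k B L A D : Type*} [Field k] [Ring B] [Bialgebra k B] [Ring L] [Algebra k L]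
  [Ring A] [Algebra k A] [Ring D] [Algebra k D] {act : A →ₗ[k] B →ₗ[k] A}
  {δ : L →ₐ[k] B ⊗[k] L} {Υ : DynCocycle δ} [Fact (IsCoaction δ)] {s : L →ₐ[k] D}
  (G : A →ₐ[k] dynConv Υ s)

variable (act) in
/-- `G` respects the actions of `B`. -/
def Equivariant : Prop := ∀ a x c, (G (act a x)).1 c = (G a).1 (c * x)

/-- `a ⊗ m ↦ G(a)(1) m` -/
def toBase : A ⊗[k] L →ₗ[k] D :=
  ev2 (LinearMap.applyₗ (1 : B) ∘ₗ (dynConv Υ s).subtype ∘ₗ G.toLinearMap) s.toLinearMap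

theorem toBase_tmul (a : A) (m : L) : toBase G (a ⊗ₜ m) = (G a).1 1 * s m := ev2_tmul ..

variable {G}

theorem ev3_mul_tmul (hG : Equivariant act G) (a b : A) (x y : B) (z : B ⊗[k] (B ⊗[k] L)) :
    ev3 (G (act a x)).1 (G (act b y)).1 s.toLinearMap z =
      ev3 (G a).1 (G b).1 s.toLinearMap (z * (x ⊗ₜ (y ⊗ₜ 1))) := by
  induction z using tensor3_induction with
  | h0 => simp
  | hadd x y hx hy => simp only [map_add, add_mul, hx, hy]
  | h p q m => simp [hG a x, hG b y]

/-- At 1 a product in `dynConv` is evaluated at the inverse twist alone, and equivariance turns the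
actions on the factors into right multiplications of that element. -/
theorem toBase_act2 (hG : Equivariant act G) (a b : A) (z : B ⊗[k] (B ⊗[k] L)) :
    toBase G (act2 act a b z) =
      ev3 (G a).1 (G b).1 s.toLinearMap ((↑Υ.val⁻¹ : B ⊗[k] (B ⊗[k] L)) * z) := by
  induction z using tensor3_induction with
  | h0 => simp
  | hadd x y hx hy => simp only [map_add, mul_add, hx, hy]
  | h x y m =>
    have e1 : dDelta ((1 : B) ⊗ₜ[k] (1 : L)) = 1 := by
      rw [← Algebra.TensorProduct.one_def, map_one]
    have e2 : x ⊗ₜ[k] (y ⊗ₜ[k] m) = (x ⊗ₜ (y ⊗ₜ 1)) * (1 ⊗ₜ (1 ⊗ₜ m)) := by simp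
    rw [act2_tmul, toBase_tmul, map_mul, dynConv_mul, Υ.star_apply, e1, mul_one, ev3_mul_tmul hG,
      e2, ← mul_assoc, ev3_mul_right]

/-- The inverse twist coming from `dynConv` cancels the twist of the product. What remains is moving
`l` past the second factor, which is its intertwining property. -/
theorem toBase_tmul_mul (hG : Equivariant act G) (u v : A ⊗[k] L) :
    toBase G (Υ.tmul act u v) = toBase G u * toBase G v := by
  induction u with
  | zero => simp
  | add x y hx hy => simp only [map_add, LinearMap.add_apply, add_mul, hx, hy]
  | tmul a l =>
  induction v with
  | zero => simp
  | add x y hx hy => simp only [map_add, mul_add, hx, hy]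
  | tmul b m =>
    rw [Υ.tmul_tmul, toBase_act2 hG, Units.inv_mul_cancel_left, ev3, ev2_tmul,
      (G b).2.ev2, ev2_tmul, toBase_tmul, toBase_tmul, ← mul_assoc, ← mul_assoc, ← mul_assoc]
    rfl

end EquivariantHom
end DynRE
end

noncomputable section
namespace DynRE

/-! ### The dynamical RE algebra and the two homomorphisms -/

section Iso
set_option maxSynthPendingDepth 6
variable {k H U L A n : Type*} [Field k] [Ring H] [HopfAlgebra k H] [Ring U] [HopfAlgebra k U]
  [Ring L] [Algebra k L] {𝓛 : BaseAlgebra k H L} {ι : H →ₐc[k] U} (F : DynamicalTwist 𝓛 ι)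
  [Ring A] [Algebra k A] [Fintype n] [DecidableEq n]
  (R : UniversalRMatrix k U) (ρ : U →ₐ[k] Matrix n n k)

theorem kMap_tmul_apply (X : Matrix n n A) (x y : U) (i j : n) :
    kMap R ρ X (toTwisted R (x ⊗ₜ y)) i j =
      ∑ q, ∑ p, (ρ (HopfAlgebra.antipode k x) i p * ρ y q j) • X p q := by
  refine (congrFun (congrFun (sandwichK_tmul ρ X x y) i) j).trans ?_
  simp only [Matrix.mul_apply, Finset.sum_mul]
  have e : ∀ (c d : k) (a : A), algebraMap k A c * a * algebraMap k A d = (c * d) • a := by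
    intro c d a
    rw [← Algebra.commutes, ← mul_assoc, ← map_mul, mul_comm d, Algebra.smul_def]
  exact Finset.sum_congr rfl fun q _ => Finset.sum_congr rfl fun p _ => e _ _ _

theorem kMap_map {A' : Type*} [Ring A'] [Algebra k A'] (g : A →ₗ[k] A') (X : Matrix n n A)
    (b : TwistedSquare R) : (kMap R ρ X b).map g = kMap R ρ (X.map g) b := by
  obtain ⟨b, rfl⟩ := (toTwisted R).surjective b
  induction b with
  | zero => ext; simp
  | add x y hx hy => rw [map_add, map_add, map_add, ← hx, ← hy]; ext; simp
  | tmul x y =>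
    refine Matrix.ext fun i j => ?_
    rw [Matrix.map_apply, kMap_tmul_apply, kMap_tmul_apply]
    simp only [map_sum, map_smul, Matrix.map_apply]

variable {R ρ} in
theorem intertwines_of_entry {X : Matrix n n A} {s : L →ₐ[k] A}
    (h : ∀ i j, Intertwines s (coactB 𝓛 ι R) (Matrix.entryLinearMap k A i j ∘ₗ kMap R ρ X)) :
    Intertwines (scal n s) (coactB 𝓛 ι R) (kMap R ρ X) := by
  intro m b
  ext i j
  rw [entry_ev2_scal, h i j m b]
  change _ = (Matrix.scalar n (s m) * kMap R ρ X b : Matrix n n A) i j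
  rw [Matrix.scalar_apply, Matrix.diagonal_mul]
  rfl

section Presentation

/-- The inclusion of `L` in the dynamical RE algebra. -/
def DREAlgebra.baseHom : L →ₐ[k] DREAlgebra F R ρ where
  toFun := DREAlgebra.base F R ρ
  map_one' := by
    have := RingQuot.mkAlgHom_rel k (DRERel.scalar (F := F) (R := R) (ρ := ρ) 1)
    rw [map_one, map_one, map_one] at this
    exact this
  map_mul' l m := (RingQuot.mkAlgHom_rel k (DRERel.mul (F := F) (R := R) (ρ := ρ) l m)).trans
    (map_mul _ _ _)
  map_zero' := by
    have := RingQuot.mkAlgHom_rel k (DRERel.scalar (F := F) (R := R) (ρ := ρ) 0)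
    rw [map_zero, map_zero, map_zero] at this
    exact this
  map_add' l m := (RingQuot.mkAlgHom_rel k (DRERel.add (F := F) (R := R) (ρ := ρ) l m)).trans
    (map_add _ _ _)
  commutes' c := (RingQuot.mkAlgHom_rel k (DRERel.scalar (F := F) (R := R) (ρ := ρ) c)).trans
    (AlgHom.commutes _ _)

/-- The matrix of generators of the dynamical RE algebra. -/
def DREAlgebra.genMatrix : Matrix n n (DREAlgebra F R ρ) := Matrix.of (DREAlgebra.gen F R ρ)

theorem DREAlgebra.cross (l : L) (i j : n) :
    DREAlgebra.baseHom F R ρ l * DREAlgebra.genMatrix F R ρ i j =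
      ∑ p, ∑ q, DREAlgebra.genMatrix F R ρ p q *
        DREAlgebra.baseHom F R ρ (crossCoef 𝓛 ι ρ i p q j l) := by
  have h := RingQuot.mkAlgHom_rel k (DRERel.cross (F := F) (R := R) (ρ := ρ) l i j)
  rw [map_mul] at h
  refine h.trans ?_
  simp only [map_sum, map_mul]
  rfl

theorem DREAlgebra.relation :
    reLeft (flipMul ((dynRMatrix F R ρ).map (DREAlgebra.baseHom F R ρ)))
      (DREAlgebra.genMatrix F R ρ) =
    reRight (flipMul ((dynRMatrix F R ρ).map (DREAlgebra.baseHom F R ρ)))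
      (DREAlgebra.genMatrix F R ρ) := by
  have h : (RingQuot.mkAlgHom k (DRERel F R ρ)).mapMatrix
        (reLeft (flipMul ((dynRMatrix F R ρ).map (freeL k n))) (Matrix.of (freeK k L))) =
      (RingQuot.mkAlgHom k (DRERel F R ρ)).mapMatrix
        (reRight (flipMul ((dynRMatrix F R ρ).map (freeL k n))) (Matrix.of (freeK k L))) := by
    ext p q
    exact RingQuot.mkAlgHom_rel k (DRERel.re p q)
  rw [map_reLeft, map_reRight] at h
  exact h

variable {F R ρ} in
/-- The universal property of the dynamical RE algebra. -/
def DREAlgebra.lift (X : Matrix n n A) (s : L →ₐ[k] A)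
    (hc : ∀ l i j, s l * X i j = ∑ p, ∑ q, X p q * s (crossCoef 𝓛 ι ρ i p q j l))
    (hr : reLeft (flipMul ((dynRMatrix F R ρ).map s)) X =
      reRight (flipMul ((dynRMatrix F R ρ).map s)) X) : DREAlgebra F R ρ →ₐ[k] A :=
  RingQuot.liftAlgHom k ⟨FreeAlgebra.lift k (Sum.elim (fun p => X p.1 p.2) s), by
    set f := FreeAlgebra.lift k (Sum.elim (fun p : n × n => X p.1 p.2) s) with hf
    have fl : ∀ l, f (freeL k n l) = s l := fun l => by simp [hf]
    have fk : ∀ i j, f (freeK k L i j) = X i j := fun i j => by simp [hf]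
    have e1 : f.mapMatrix (Matrix.of (freeK k L)) = X := by ext i j; exact fk i j
    have e2 : f.mapMatrix (flipMul ((dynRMatrix F R ρ).map (freeL k n))) =
        flipMul ((dynRMatrix F R ρ).map s) := by ext p q; exact fl _
    rintro _ _ (⟨c⟩ | ⟨l, m⟩ | ⟨l, m⟩ | ⟨l, i, j⟩ | ⟨p, q⟩)
    · rw [fl, AlgHom.commutes, AlgHom.commutes]
    · rw [map_add, fl, fl, fl, map_add]
    · rw [map_mul, fl, fl, fl, map_mul]
    · simp only [map_mul, map_sum, fl, fk]
      exact hc l i j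
    · have h1 := congrFun (congrFun (map_reLeft f (flipMul ((dynRMatrix F R ρ).map (freeL k n)))
        (Matrix.of (freeK k L))) p) q
      have h2 := congrFun (congrFun (map_reRight f (flipMul ((dynRMatrix F R ρ).map (freeL k n)))
        (Matrix.of (freeK k L))) p) q
      rw [e1, e2] at h1 h2
      rw [hr, ← h2] at h1
      exact h1⟩

variable {F R ρ}

theorem DREAlgebra.lift_gen {X : Matrix n n A} {s : L →ₐ[k] A}
    (hc : ∀ l i j, s l * X i j = ∑ p, ∑ q, X p q * s (crossCoef 𝓛 ι ρ i p q j l))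
    (hr : reLeft (flipMul ((dynRMatrix F R ρ).map s)) X =
      reRight (flipMul ((dynRMatrix F R ρ).map s)) X) (i j : n) :
    DREAlgebra.lift X s hc hr (DREAlgebra.gen F R ρ i j) = X i j := by
  refine (RingQuot.liftAlgHom_mkAlgHom_apply ..).trans ?_
  simp

theorem DREAlgebra.lift_base {X : Matrix n n A} {s : L →ₐ[k] A}
    (hc : ∀ l i j, s l * X i j = ∑ p, ∑ q, X p q * s (crossCoef 𝓛 ι ρ i p q j l))
    (hr : reLeft (flipMul ((dynRMatrix F R ρ).map s)) X =
      reRight (flipMul ((dynRMatrix F R ρ).map s)) X) (l : L) :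
    DREAlgebra.lift X s hc hr (DREAlgebra.base F R ρ l) = s l := by
  refine (RingQuot.liftAlgHom_mkAlgHom_apply ..).trans ?_
  simp

theorem DREAlgebra.induction {P : DREAlgebra F R ρ → Prop} (halg : ∀ c, P (algebraMap k _ c))
    (hgen : ∀ i j, P (DREAlgebra.gen F R ρ i j)) (hbase : ∀ l, P (DREAlgebra.base F R ρ l))
    (hmul : ∀ a b, P a → P b → P (a * b))
    (hadd : ∀ a b, P a → P b → P (a + b)) (a : DREAlgebra F R ρ) : P a := by
  obtain ⟨z, rfl⟩ := RingQuot.mkAlgHom_surjective k (DRERel F R ρ) a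
  induction z using FreeAlgebra.induction with
  | grade0 c => rw [AlgHom.commutes]; exact halg c
  | grade1 p =>
    rcases p with ⟨i, j⟩ | l
    · exact hgen i j
    · exact hbase l
  | mul a b ha hb => rw [map_mul]; exact hmul _ _ ha hb
  | add a b ha hb => rw [map_add]; exact hadd _ _ ha hb

end Presentation

variable [InvertibleAntipode k U]

/-- The action of `L` on `K ⊗ L` by left multiplication. -/
abbrev baseEndT : L →ₐ[k] Module.End k (REAlgebra R ρ ⊗[k] L) :=
  (upsilonCocycle F R).baseEnd (modAlg_blackAct R ρ) (isCoaction_coactB R)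

/-- The matrix of left multiplications by `Kᵢⱼ ⊗ 1`. -/
def genEnd : Matrix n n (Module.End k (REAlgebra R ρ ⊗[k] L)) :=
  Matrix.of fun i j => (upsilonCocycle F R).tmul (blackAct R ρ) (REAlgebra.gen R ρ i j ⊗ₜ 1)

/-- Acting on a generator and then multiplying is the same as sandwiching the matrix of
multiplication operators, because sandwiching uses only scalar coefficients. -/
theorem actEnd_gen (i j : n) : (upsilonCocycle F R).actEnd (blackAct R ρ) (REAlgebra.gen R ρ i j) =
    Matrix.entryLinearMap k _ i j ∘ₗ kMap R ρ (genEnd F R ρ) := by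
  ext1 b
  have h := kMap_map R ρ ((upsilonCocycle F R).tmul (blackAct R ρ) ∘ₗ inl k _ L)
    (REAlgebra.gen R ρ) b
  refine Eq.trans ?_ (congrFun (congrFun h i) j)
  change (upsilonCocycle F R).tmul (blackAct R ρ) (blackAct R ρ _ b ⊗ₜ 1) = _
  rw [blackAct_gen]
  rfl

theorem intertwines_genEnd :
    Intertwines (scal n (baseEndT F R ρ)) (coactB 𝓛 ι R) (kMap R ρ (genEnd F R ρ)) :=
  intertwines_of_entry fun i j => by
    rw [← actEnd_gen]
    exact intertwines_actEnd _ (modAlg_blackAct R ρ) (isCoaction_coactB R) _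

/-- The homomorphism `actConv` carries the reflection equation of 𝒦 to the convolution algebra.
There it is equivalent to the dynamical one by `re_conv_iff` and `dynamical_re_iff`. -/
theorem re_genEnd :
    reLeft (flipMul ((dynRMatrix F R ρ).map (baseEndT F R ρ))) (genEnd F R ρ) =
      reRight (flipMul ((dynRMatrix F R ρ).map (baseEndT F R ρ))) (genEnd F R ρ) := by
  rw [dynRMatrix_map, dynamical_re_iff F R ρ (intertwines_genEnd F R ρ),
    ← re_conv_iff F R ρ (intertwines_genEnd F R ρ)]
  have h := congrArg ((upsilonCocycle F R).actConv (modAlg_blackAct R ρ)).mapMatrix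
    (REAlgebra.relation R ρ)
  rw [map_reLeft, map_reRight, map_braid] at h
  have e : ((upsilonCocycle F R).actConv (modAlg_blackAct R ρ)).mapMatrix (REAlgebra.gen R ρ) =
      kConv F R ρ (intertwines_genEnd F R ρ) :=
    Matrix.ext fun i j => Subtype.ext (actEnd_gen F R ρ i j)
  rwa [e] at h

/-- The action of the dynamical RE algebra on `K ⊗ L` by left multiplication. -/
def leftMulHom : DREAlgebra F R ρ →ₐ[k] Module.End k (REAlgebra R ρ ⊗[k] L) :=
  DREAlgebra.lift (genEnd F R ρ) (baseEndT F R ρ)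
    (cross_of_intertwines R ρ (intertwines_genEnd F R ρ)) (re_genEnd F R ρ)

omit [InvertibleAntipode k U] in
theorem intertwines_gen : Intertwines (scal n (DREAlgebra.baseHom F R ρ)) (coactB 𝓛 ι R)
    (kMap R ρ (DREAlgebra.genMatrix F R ρ)) :=
  intertwines_kMap R ρ (DREAlgebra.cross F R ρ)

/-- The homomorphism `Kᵢⱼ ↦ (b ↦ (b ▶ K)ᵢⱼ)`. -/
def convHom : REAlgebra R ρ →ₐ[k] dynConv (upsilonCocycle F R) (DREAlgebra.baseHom F R ρ) :=
  REAlgebra.lift R ρ (kConv F R ρ (intertwines_gen F R ρ)) (by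
    -- The same equivalence, read in the opposite direction, for the generators of the dynamical
    -- algebra.
    rw [re_conv_iff, ← dynamical_re_iff F R ρ (intertwines_gen F R ρ), ← dynRMatrix_map]
    exact DREAlgebra.relation F R ρ)

theorem convHom_gen (i j : n) (b : TwistedSquare R) :
    (convHom F R ρ (REAlgebra.gen R ρ i j)).1 b = kMap R ρ (DREAlgebra.genMatrix F R ρ) b i j := by
  rw [convHom, REAlgebra.lift_gen]; rfl

theorem convHom_algebraMap (c : k) (b : TwistedSquare R) :
    (convHom F R ρ (algebraMap k _ c)).1 b = c • (eps : TwistedSquare R →ₗ[k] DREAlgebra F R ρ) b := by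
  rw [AlgHom.commutes, Algebra.algebraMap_eq_smul_one]; rfl

end Iso
end DynRE
end

noncomputable section
namespace DynRE

/-! ### The linear isomorphism -/

section Inverse
set_option maxSynthPendingDepth 6
variable {k H U L A n : Type*} [Field k] [Ring H] [HopfAlgebra k H] [Ring U] [HopfAlgebra k U]
  [Ring L] [Algebra k L] {𝓛 : BaseAlgebra k H L} {ι : H →ₐc[k] U} (F : DynamicalTwist 𝓛 ι)
  [Ring A] [Algebra k A] [Fintype n] [DecidableEq n]
  (R : UniversalRMatrix k U) (ρ : U →ₐ[k] Matrix n n k)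

theorem kMap_kMap (X : Matrix n n A) (c b : TwistedSquare R) :
    kMap R ρ (kMap R ρ X c) b = kMap R ρ X (c * b) := by
  obtain ⟨b, rfl⟩ := (toTwisted R).surjective b
  induction b with
  | zero => simp
  | add x y hx hy => simp only [map_add, mul_add, hx, hy]
  | tmul x y =>
    rw [kMap_mul]
    exact sandwichK_tmul ρ _ x y

theorem comp_star {B A' : Type*} [Ring B] [Bialgebra k B] [Ring A'] [Algebra k A']
    {δ : L →ₐ[k] B ⊗[k] L} (Υ : DynCocycle δ) (φ : A →ₐ[k] A') (s : L →ₐ[k] A)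
    (f g : B →ₗ[k] A) : φ.toLinearMap ∘ₗ Υ.star s f g =
      Υ.star (φ.comp s) (φ.toLinearMap ∘ₗ f) (φ.toLinearMap ∘ₗ g) := by
  ext b
  have h := LinearMap.congr_fun (comp_ev2 (isAlgHom_algHom φ) f (ev2 g s.toLinearMap))
    ((↑Υ.val⁻¹ : B ⊗[k] (B ⊗[k] L)) * dDelta (b ⊗ₜ (1 : L)))
  exact h.trans (congrArg (fun t => ev2 (φ.toLinearMap ∘ₗ f) t _)
    (comp_ev2 (isAlgHom_algHom φ) g s.toLinearMap))

variable [InvertibleAntipode k U]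

/-- Induction on the element: generators reduce to `kMap_kMap`, and products to the multiplicativity
of the twisted coproduct. -/
theorem equivariant_convHom : Equivariant (blackAct R ρ) (convHom F R ρ) := by
  intro a
  induction a using REAlgebra.induction with
  | halg c =>
    intro x d
    rw [blackAct_algebraMap, map_smul, Submodule.coe_smul, LinearMap.smul_apply, convHom_algebraMap, convHom_algebraMap, eps_apply, eps_apply, Bialgebra.counit_mul,
      map_mul, ← Algebra.commutes, ← Algebra.smul_def, smul_comm]
  | hgen i j =>
    intro x d
    set g : REAlgebra R ρ →ₗ[k] DREAlgebra F R ρ :=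
      LinearMap.applyₗ d ∘ₗ (dynConv (upsilonCocycle F R) (DREAlgebra.baseHom F R ρ)).subtype ∘ₗ
        (convHom F R ρ).toLinearMap with hg
    have e : (REAlgebra.gen R ρ).map g = kMap R ρ (DREAlgebra.genMatrix F R ρ) d :=
      Matrix.ext fun i j => convHom_gen F R ρ i j d
    have h := congrFun (congrFun (kMap_map R ρ g (REAlgebra.gen R ρ) x) i) j
    rw [e, kMap_kMap, ← convHom_gen F R ρ i j (d * x)] at h
    rw [blackAct_gen]
    exact h
  | hmul a b ha hb =>
    intro x d
    have e : dDelta ((d * x) ⊗ₜ[k] (1 : L)) = dDelta (d ⊗ₜ[k] (1 : L)) *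
        TensorProduct.map LinearMap.id (inl k (TwistedSquare R) L)
          (Coalgebra.comul (R := k) x) := by
      have : (d * x) ⊗ₜ[k] (1 : L) = (d ⊗ₜ 1) * (x ⊗ₜ 1) := by simp
      rw [this, map_mul]
      congr 1
      simp only [dDelta, AlgHom.comp_apply, Algebra.TensorProduct.map_tmul,
        Bialgebra.comulAlgHom_apply, AlgHom.id_apply]
      induction Coalgebra.comul (R := k) x with
      | zero => simp
      | add x y hx hy => simp only [map_add, TensorProduct.add_tmul, hx, hy]
      | tmul p q => simp
    rw [blackAct_mul, map_mul (convHom F R ρ), dynConv_mul, DynCocycle.star_apply, e, ← mul_assoc]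
    simp only [conv, LinearMap.comp_apply]
    induction Coalgebra.comul (R := k) x with
    | zero => simp
    | add x y hx hy =>
      simp only [map_add, mul_add, ← hx, ← hy]
      rfl
    | tmul p q =>
      rw [ev2_tmul, map_mul (convHom F R ρ), dynConv_mul, DynCocycle.star_apply]
      generalize _ * dDelta (d ⊗ₜ[k] (1 : L)) = z
      rw [TensorProduct.map_tmul, LinearMap.id_apply]
      induction z using tensor3_induction with
      | h0 => simp
      | hadd x y hx hy => simp only [map_add, add_mul, hx, hy]
      | h u v m => simp [ha, hb]
  | hadd a b ha hb =>
    intro x d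
    have e : ∀ a b : REAlgebra R ρ, (convHom F R ρ (a + b)).1 =
      (convHom F R ρ a).1 + (convHom F R ρ b).1 := fun a b => by rw [map_add]; rfl
    rw [map_add, LinearMap.add_apply, e, e, LinearMap.add_apply, LinearMap.add_apply, ha, hb]

theorem convHom_one_one : (convHom F R ρ 1).1 1 = 1 := by
  rw [map_one (convHom F R ρ), dynConv_one, eps_apply, Bialgebra.counit_one, map_one]

theorem toBase_gen (i j : n) : toBase (convHom F R ρ) (REAlgebra.gen R ρ i j ⊗ₜ 1) =
    DREAlgebra.gen F R ρ i j := by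
  rw [toBase_tmul, convHom_gen, kMap_one, map_one, mul_one]
  rfl

theorem toBase_one_tmul (l : L) : toBase (convHom F R ρ) (1 ⊗ₜ l) = DREAlgebra.base F R ρ l := by
  rw [toBase_tmul, convHom_one_one, one_mul]
  rfl

/-- It suffices to take d among the generators, where `toBase` is multiplicative. At t = 1 ⊗ 1 this
gives one of the two inverse relations. -/
theorem toBase_leftMulHom (d : DREAlgebra F R ρ) (t : REAlgebra R ρ ⊗[k] L) :
    toBase (convHom F R ρ) (leftMulHom F R ρ d t) = d * toBase (convHom F R ρ) t := by
  induction d using DREAlgebra.induction generalizing t with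
  | halg c =>
    rw [AlgHom.commutes, Module.algebraMap_end_apply, map_smul, Algebra.smul_def]
  | hgen i j =>
    rw [leftMulHom, DREAlgebra.lift_gen]
    change toBase (convHom F R ρ) ((upsilonCocycle F R).tmul (blackAct R ρ)
      (REAlgebra.gen R ρ i j ⊗ₜ 1) t) = _
    rw [toBase_tmul_mul (equivariant_convHom F R ρ), toBase_gen]
  | hbase l =>
    rw [leftMulHom, DREAlgebra.lift_base]
    change toBase (convHom F R ρ) ((upsilonCocycle F R).tmul (blackAct R ρ) (1 ⊗ₜ l) t) = _
    rw [toBase_tmul_mul (equivariant_convHom F R ρ), toBase_one_tmul]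
  | hmul a b ha hb => rw [map_mul, Module.End.mul_apply, ha, hb, mul_assoc]
  | hadd a b ha hb => rw [map_add, LinearMap.add_apply, map_add, ha, hb, add_mul]

/-- Both sides are multiplicative in `a` for the product `star`, which is natural in the target
algebra (`comp_star`), and they agree on generators. -/
theorem leftMulHom_convHom (a : REAlgebra R ρ) :
    (leftMulHom F R ρ).toLinearMap ∘ₗ (convHom F R ρ a).1 =
      (upsilonCocycle F R).actEnd (blackAct R ρ) a := by
  induction a using REAlgebra.induction with
  | halg c =>
    have h : (upsilonCocycle F R).actEnd (blackAct R ρ) (algebraMap k _ c) =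
        c • (eps : TwistedSquare R →ₗ[k] _) := congrArg Subtype.val
      (((upsilonCocycle F R).actConv (modAlg_blackAct R ρ)).commutes c |>.trans
        (Algebra.algebraMap_eq_smul_one _))
    rw [h]
    ext1 b
    change leftMulHom F R ρ ((convHom F R ρ (algebraMap k _ c)).1 b) = c • eps b
    rw [convHom_algebraMap, map_smul, eps_apply, eps_apply, AlgHom.commutes]
  | hgen i j =>
    rw [actEnd_gen]
    ext1 b
    have e : (DREAlgebra.genMatrix F R ρ).map (leftMulHom F R ρ).toLinearMap = genEnd F R ρ :=
      Matrix.ext fun i j => DREAlgebra.lift_gen _ _ i j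
    have h := congrFun (congrFun (kMap_map R ρ (leftMulHom F R ρ).toLinearMap
      (DREAlgebra.genMatrix F R ρ) b) i) j
    rw [e] at h
    refine Eq.trans ?_ h
    exact congrArg (leftMulHom F R ρ) (convHom_gen F R ρ i j b)
  | hmul a b ha hb =>
    have e : (leftMulHom F R ρ).comp (DREAlgebra.baseHom F R ρ) = baseEndT F R ρ :=
      AlgHom.ext fun l => DREAlgebra.lift_base _ _ l
    rw [map_mul, dynConv_mul, comp_star, ha, hb, e, star_actEnd]
  | hadd a b ha hb =>
    have e : (convHom F R ρ (a + b)).1 = (convHom F R ρ a).1 + (convHom F R ρ b).1 := by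
      rw [map_add]; rfl
    have e2 : (upsilonCocycle F R).actEnd (blackAct R ρ) (a + b) =
      (upsilonCocycle F R).actEnd (blackAct R ρ) a +
        (upsilonCocycle F R).actEnd (blackAct R ρ) b := congrArg Subtype.val
      (map_add ((upsilonCocycle F R).actConv (modAlg_blackAct R ρ)) a b)
    rw [e, LinearMap.comp_add, ha, hb, e2]

/-- Applied to 1 ⊗ 1, this yields the other inverse relation. -/
theorem leftMulHom_toBase (t : REAlgebra R ρ ⊗[k] L) :
    leftMulHom F R ρ (toBase (convHom F R ρ) t) = (upsilonCocycle F R).tmul (blackAct R ρ) t := by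
  induction t with
  | zero => simp
  | add x y hx hy => simp only [map_add, hx, hy]
  | tmul a l =>
    have h : leftMulHom F R ρ ((convHom F R ρ a).1 1) = _ :=
      LinearMap.congr_fun (leftMulHom_convHom F R ρ a) 1
    have h2 : leftMulHom F R ρ (DREAlgebra.baseHom F R ρ l) = baseEndT F R ρ l :=
      DREAlgebra.lift_base _ _ l
    rw [toBase_tmul, map_mul, h, h2]
    refine LinearMap.ext fun v => ?_
    change (upsilonCocycle F R).tmul _ (blackAct R ρ a 1 ⊗ₜ 1)
      ((upsilonCocycle F R).tmul _ (1 ⊗ₜ l) v) = _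
    rw [← tmul_assoc _ (modAlg_blackAct R ρ) (isCoaction_coactB R),
      tmul_one_tmul _ (modAlg_blackAct R ρ) (isCoaction_coactB R), one_mul,
      (modAlg_blackAct R ρ).one_act]

theorem tmul_one_right (t : REAlgebra R ρ ⊗[k] L) :
    (upsilonCocycle F R).tmul (blackAct R ρ) t (1 ⊗ₜ 1) = t := by
  induction t with
  | zero => simp
  | add x y hx hy => simp only [map_add, LinearMap.add_apply, hx, hy]
  | tmul a l => rw [tmul_one_tmul _ (modAlg_blackAct R ρ) (isCoaction_coactB R), mul_one]

/-- The linear isomorphism of the dynamical RE algebra with `K ⊗ L`. -/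
def dreEquiv : DREAlgebra F R ρ ≃ₗ[k] REAlgebra R ρ ⊗[k] L :=
  LinearEquiv.ofLinearMap (LinearMap.applyₗ (1 ⊗ₜ 1) ∘ₗ (leftMulHom F R ρ).toLinearMap)
    (toBase (convHom F R ρ))
    (LinearMap.ext fun t => by
      change leftMulHom F R ρ (toBase (convHom F R ρ) t) (1 ⊗ₜ 1) = t
      rw [leftMulHom_toBase, tmul_one_right])
    (LinearMap.ext fun d => by
      change toBase (convHom F R ρ) (leftMulHom F R ρ d (1 ⊗ₜ 1)) = d
      rw [toBase_leftMulHom, toBase_tmul, convHom_one_one, map_one, mul_one, mul_one])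

theorem dreEquiv_gen (i j : n) :
    dreEquiv F R ρ (DREAlgebra.gen F R ρ i j) = REAlgebra.gen R ρ i j ⊗ₜ 1 :=
  (dreEquiv F R ρ).symm_apply_eq.1 (toBase_gen F R ρ i j) |>.symm

theorem dreEquiv_base (l : L) :
    dreEquiv F R ρ (DREAlgebra.base F R ρ l) = 1 ⊗ₜ l :=
  (dreEquiv F R ρ).symm_apply_eq.1 (toBase_one_tmul F R ρ l) |>.symm

theorem dreEquiv_symm_mul (u v : REAlgebra R ρ ⊗[k] L) :
    (dreEquiv F R ρ).symm (twistedMul F R ρ u v) =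
      (dreEquiv F R ρ).symm u * (dreEquiv F R ρ).symm v := by
  rw [twistedMul_eq]
  exact toBase_tmul_mul (equivariant_convHom F R ρ) u v

theorem dreEquiv_mul (u v : DREAlgebra F R ρ) : dreEquiv F R ρ (u * v) =
    twistedMul F R ρ (dreEquiv F R ρ u) (dreEquiv F R ρ v) := by
  apply (dreEquiv F R ρ).symm.injective
  rw [dreEquiv_symm_mul]
  simp

end Inverse
end DynRE
end

noncomputable section
namespace DynRE

/-! ### Invariants are central in the RE algebra -/

section CenterRE
set_option maxSynthPendingDepth 6
variable {k U A n : Type*} [Field k] [Ring U] [HopfAlgebra k U] [Ring A] [Algebra k A]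
  [Fintype n] [DecidableEq n] (R : UniversalRMatrix k U) (ρ : U →ₐ[k] Matrix n n k)

/-- `(id ⊗ Δ)(R⁻¹) = R⁻¹₁₂ R⁻¹₁₃`, for linear maps. -/
theorem ev2_inv_conv {r f g : U →ₗ[k] A} (hr : IsAlgHom r) (rf : Comm r f) :
    ev2 r (conv f g) (↑R.val⁻¹ : U ⊗[k] U) =
      ev2 r f (↑R.val⁻¹ : U ⊗[k] U) * ev2 r g (↑R.val⁻¹ : U ⊗[k] U) := by
  have h := congrArg (ev3 r f g) R.comul_right_inv
  have e1 : ∀ z : U ⊗[k] U, ev3 r f g (Algebra.TensorProduct.map (.id k U)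
      (Bialgebra.comulAlgHom k U) z) = ev2 r (conv f g) z := fun z => ev2_algMap _ _ _ _ z
  have e2 : ∀ z w : U ⊗[k] U, ev3 r f g (Algebra.TensorProduct.map (AlgHom.id k U)
      Algebra.TensorProduct.includeLeft z * Algebra.TensorProduct.map (AlgHom.id k U)
      Algebra.TensorProduct.includeRight w) = ev2 r f z * ev2 r g w := by
    intro z w
    induction z with
    | zero => simp
    | add x y hx hy => simp only [map_add, add_mul, hx, hy]
    | tmul x y =>
    induction w with
    | zero => simp
    | add x y hx hy => simp only [map_add, mul_add, hx, hy]
    | tmul p q =>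
      simp only [Algebra.TensorProduct.map_tmul, AlgHom.id_apply,
        Algebra.TensorProduct.includeLeft_apply, Algebra.TensorProduct.includeRight_apply,
        Algebra.TensorProduct.tmul_mul_tmul, one_mul, mul_one, ev2_tmul, hr.map_mul]
      rw [mul_assoc, mul_assoc, (rf p y).left_comm]
  rwa [e1, e2] at h

/-- `(Δ ⊗ id)(R) = R₁₃ R₂₃`, for linear maps. -/
theorem ev2_conv_val {r f g : U →ₗ[k] A} (hr : IsAlgHom r) (rg : Comm r g) :
    ev2 (conv f g) r (R.val : U ⊗[k] U) =
      ev2 f r (R.val : U ⊗[k] U) * ev2 g r (R.val : U ⊗[k] U) := by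
  have h := congrArg (ev3 f g r) R.comul_left
  have e1 : ∀ z : U ⊗[k] U, ev3 f g r (Algebra.TensorProduct.assoc k k k U U U
      (Algebra.TensorProduct.map (Bialgebra.comulAlgHom k U) (AlgHom.id k U) z)) =
      ev2 (conv f g) r z := fun z => ev2_dDelta f g r z
  have e2 : ∀ z w : U ⊗[k] U, ev3 f g r (Algebra.TensorProduct.map (AlgHom.id k U)
      Algebra.TensorProduct.includeRight z * Algebra.TensorProduct.includeRight w) =
      ev2 f r z * ev2 g r w := by
    intro z w
    induction z with
    | zero => simp
    | add x y hx hy => simp only [map_add, add_mul, hx, hy]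
    | tmul x y =>
    induction w with
    | zero => simp
    | add x y hx hy => simp only [map_add, mul_add, hx, hy]
    | tmul p q =>
      simp only [Algebra.TensorProduct.map_tmul, AlgHom.id_apply,
        Algebra.TensorProduct.includeRight_apply,
        Algebra.TensorProduct.tmul_mul_tmul, one_mul, mul_one, ev2_tmul, hr.map_mul]
      rw [mul_assoc, (rg y p).left_comm]
  rwa [e1, e2] at h

/-- The diagonal action on X₂ multiplies it on both sides. The hexagon for R⁻¹ splits these two
factors, and (id ⊗ γ)(R⁻¹) = R handles the left one. -/
theorem leg1_mul_sandwich (X : Matrix n n A) :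
    leg1 X * ev2 (repLeg1 A ρ).toLinearMap
      ((leg2Hom k).toLinearMap ∘ₗ kMap R ρ X ∘ₗ (diag R).toLinearMap) (↑R.val⁻¹ : U ⊗[k] U) =
    leg1 X * rep2A A ρ (R.val : U ⊗[k] U) * leg2 X * rep2A A ρ (↑R.val⁻¹ : U ⊗[k] U) := by
  set f : U →ₗ[k] Matrix (n × n) (n × n) A := (LinearMap.mul k _).flip (leg2 X) ∘ₗ
    (repLeg2 A ρ).toLinearMap ∘ₗ HopfAlgebra.antipode k with hf
  have e : (leg2Hom k).toLinearMap ∘ₗ kMap R ρ X ∘ₗ (diag R).toLinearMap =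
      conv f (repLeg2 A ρ).toLinearMap := by
    ext1 x
    change leg2Hom k (kMap R ρ X (toTwisted R (Coalgebra.comul (R := k) x))) =
      ev2 f (repLeg2 A ρ).toLinearMap (Coalgebra.comul (R := k) x)
    induction Coalgebra.comul (R := k) x with
    | zero => simp
    | add x y hx hy => simp only [map_add, hx, hy]
    | tmul x y =>
      have e2 : kMap R ρ X (toTwisted R (x ⊗ₜ y)) =
        repA A ρ (HopfAlgebra.antipode k x) * X * repA A ρ y := sandwichK_tmul ρ X x y
      rw [e2, map_mul (leg2Hom k), map_mul (leg2Hom k)]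
      rfl
  have D := legs3_rep (A := A) (n := n) ρ (Algebra.ofId k A)
  have hc : Comm (repLeg1 A ρ).toLinearMap f := fun x y =>
    (D.fg x (HopfAlgebra.antipode k y)).mul_right (leg2_comm ρ X x).symm
  have e3 : ∀ w : U ⊗[k] U, ev2 (repLeg1 A ρ).toLinearMap f w =
      rep2A A ρ ((HopfAlgebra.antipode k (A := U)).lTensor U w) * leg2 X := by
    intro w
    induction w with
    | zero => simp
    | add x y hx hy => simp only [map_add, add_mul, hx, hy]
    | tmul x y => rw [ev2_tmul, LinearMap.lTensor_tmul, rep2A_tmul, mul_assoc]; rfl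
  have e4 : ∀ w : U ⊗[k] U, ev2 (repLeg1 A ρ).toLinearMap (repLeg2 A ρ).toLinearMap w =
      rep2A A ρ w := by
    intro w
    induction w with
    | zero => simp
    | add x y hx hy => simp only [map_add, hx, hy]
    | tmul x y => rw [ev2_tmul, rep2A_tmul]; rfl
  rw [e, ev2_inv_conv R D.hf hc, e3, e4, R.lTensor_antipode_inv]
  simp only [mul_assoc]

/-- The companion of `leg1_mul_sandwich`, with the other hexagon and (γ ⊗ id)(R) = R⁻¹. -/
theorem sandwich_mul_leg1 (X : Matrix n n A) :
    ev2 ((leg2Hom k).toLinearMap ∘ₗ kMap R ρ X ∘ₗ (diag R).toLinearMap)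
      (repLeg1 A ρ).toLinearMap (R.val : U ⊗[k] U) * leg1 X =
    swapM (rep2A A ρ (↑R.val⁻¹ : U ⊗[k] U)) * leg2 X * swapM (rep2A A ρ (R.val : U ⊗[k] U)) *
      leg1 X := by
  set f : U →ₗ[k] Matrix (n × n) (n × n) A := (LinearMap.mul k _).flip (leg2 X) ∘ₗ
    (repLeg2 A ρ).toLinearMap ∘ₗ HopfAlgebra.antipode k with hf
  have e : (leg2Hom k).toLinearMap ∘ₗ kMap R ρ X ∘ₗ (diag R).toLinearMap =
      conv f (repLeg2 A ρ).toLinearMap := by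
    ext1 x
    change leg2Hom k (kMap R ρ X (toTwisted R (Coalgebra.comul (R := k) x))) =
      ev2 f (repLeg2 A ρ).toLinearMap (Coalgebra.comul (R := k) x)
    induction Coalgebra.comul (R := k) x with
    | zero => simp
    | add x y hx hy => simp only [map_add, hx, hy]
    | tmul x y =>
      have e2 : kMap R ρ X (toTwisted R (x ⊗ₜ y)) =
        repA A ρ (HopfAlgebra.antipode k x) * X * repA A ρ y := sandwichK_tmul ρ X x y
      rw [e2, map_mul (leg2Hom k), map_mul (leg2Hom k)]
      rfl
  have D := legs3_rep (A := A) (n := n) ρ (Algebra.ofId k A)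
  have s1 : ∀ x, swapM (leg1 (repA A ρ x)) = leg2 (repA A ρ x) := fun x => swapM_leg1 _
  have s2 : ∀ x, swapM (leg2 (repA A ρ x)) = leg1 (repA A ρ x) := fun x => swapM_leg2 _
  have e3 : ∀ w : U ⊗[k] U, ev2 f (repLeg1 A ρ).toLinearMap w =
      swapM (rep2A A ρ ((HopfAlgebra.antipode k (A := U)).rTensor U w)) * leg2 X := by
    intro w
    induction w with
    | zero => simp [swapM]
    | add x y hx hy =>
      simp only [map_add, hx, hy]
      rw [← add_mul]
      rfl
    | tmul x y =>
      rw [ev2_tmul, LinearMap.rTensor_tmul, rep2A_tmul, swapM_mul, s1, s2, mul_assoc,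
        ← leg2_comm, ← mul_assoc]
      rfl
  have e4 : ∀ w : U ⊗[k] U, ev2 (repLeg2 A ρ).toLinearMap (repLeg1 A ρ).toLinearMap w =
      swapM (rep2A A ρ w) := by
    intro w
    induction w with
    | zero => simp [swapM]
    | add x y hx hy => simp only [map_add, hx, hy]; rfl
    | tmul x y => rw [ev2_tmul, rep2A_tmul, swapM_mul, s1, s2]; rfl
  rw [e, ev2_conv_val R D.hf D.fg, e3, e4, R.rTensor_antipode]

/-- The reflection equation without flips, multiplied by R₂₁⁻¹ on the left and R⁻¹ on the right. -/
theorem re_exchange (X : Matrix n n A) (hX : reLeft (braid A R ρ) X = reRight (braid A R ρ) X) :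
    leg1 X * rep2A A ρ (R.val : U ⊗[k] U) * leg2 X * rep2A A ρ (↑R.val⁻¹ : U ⊗[k] U) =
    swapM (rep2A A ρ (↑R.val⁻¹ : U ⊗[k] U)) * leg2 X * swapM (rep2A A ρ (R.val : U ⊗[k] U)) *
      leg1 X := by
  have h := hX
  have ss : swapM (swapM (rep2A A ρ (R.val : U ⊗[k] U))) = rep2A A ρ (R.val : U ⊗[k] U) := rfl
  rw [braid, reLeft_flipMul, reRight_flipMul, swapM_mul, swapM_mul, swapM_mul, swapM_leg1,
    swapM_leg2, ss] at h
  have i1 : rep2A A ρ (R.val : U ⊗[k] U) * rep2A A ρ (↑R.val⁻¹ : U ⊗[k] U) = 1 := by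
    rw [← map_mul, Units.mul_inv, map_one]
  have i2 : swapM (rep2A A ρ (↑R.val⁻¹ : U ⊗[k] U)) * swapM (rep2A A ρ (R.val : U ⊗[k] U)) = 1 := by
    rw [← swapM_mul, ← map_mul, Units.inv_mul, map_one]
    ext p q
    simp [swapM, Matrix.one_apply, Prod.ext_iff, and_comm]
  calc _ = swapM (rep2A A ρ (↑R.val⁻¹ : U ⊗[k] U)) * (swapM (rep2A A ρ (R.val : U ⊗[k] U)) *
        (leg1 X * rep2A A ρ (R.val : U ⊗[k] U) * leg2 X)) * rep2A A ρ (↑R.val⁻¹ : U ⊗[k] U) := by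
        rw [← mul_assoc, i2, one_mul]
    _ = _ := by rw [h]; simp only [mul_assoc, i1, mul_one]

/-- The action of `U` on the RE algebra through the coproduct, as scalar matrices. -/
def diagScal (a : REAlgebra R ρ) : U →ₗ[k] Matrix n n (REAlgebra R ρ) :=
  (scal n (AlgHom.id k (REAlgebra R ρ))).toLinearMap ∘ₗ blackAct R ρ a ∘ₗ (diag R).toLinearMap

theorem blackAct_mul_diag (a b : REAlgebra R ρ) : blackAct R ρ (a * b) ∘ₗ (diag R).toLinearMap =
    conv (blackAct R ρ a ∘ₗ (diag R).toLinearMap) (blackAct R ρ b ∘ₗ (diag R).toLinearMap) := by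
  ext1 x
  have h := (isBialgHom_diag R).comul x
  have e := ev2_algMap (blackAct R ρ a) (blackAct R ρ b) (diag R) (diag R)
    (Coalgebra.comul (R := k) x)
  rw [← h] at e
  rw [blackAct_mul]
  exact e

theorem diagScal_mul (a b : REAlgebra R ρ) :
    diagScal R ρ (a * b) = conv (diagScal R ρ a) (diagScal R ρ b) := by
  rw [diagScal, blackAct_mul_diag, comp_conv (isAlgHom_algHom _)]
  rfl

theorem diagScal_of_invariant {a : REAlgebra R ρ} (ha : IsUInvariant R ρ a) (x : U) :
    diagScal R ρ a x = Coalgebra.counit (R := k) x • scal n (AlgHom.id k _) a := by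
  rw [← map_smul, ← ha x]
  rfl

theorem ev2_diagScal_inv {a : REAlgebra R ρ} (ha : IsUInvariant R ρ a) :
    ev2 (repA (REAlgebra R ρ) ρ).toLinearMap (diagScal R ρ a) (↑R.val⁻¹ : U ⊗[k] U) =
      scal n (AlgHom.id k _) a := by
  have e : ∀ w : U ⊗[k] U, ev2 (repA (REAlgebra R ρ) ρ).toLinearMap (diagScal R ρ a) w =
      repA (REAlgebra R ρ) ρ (Algebra.TensorProduct.rid k k U (Algebra.TensorProduct.map
        (AlgHom.id k U) (Bialgebra.counitAlgHom k U) w)) * scal n (AlgHom.id k _) a := by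
    intro w
    induction w with
    | zero => simp
    | add x y hx hy => simp only [map_add, add_mul, hx, hy]
    | tmul x y => simp [diagScal_of_invariant R ρ ha]
  rw [e, map_units_inv_eq_one _ _ R.counit_right, map_one, map_one, one_mul]

theorem ev2_diagScal_val {a : REAlgebra R ρ} (ha : IsUInvariant R ρ a) :
    ev2 (diagScal R ρ a) (repA (REAlgebra R ρ) ρ).toLinearMap (R.val : U ⊗[k] U) =
      scal n (AlgHom.id k _) a := by
  have e : ∀ w : U ⊗[k] U, ev2 (diagScal R ρ a) (repA (REAlgebra R ρ) ρ).toLinearMap w =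
      scal n (AlgHom.id k _) a * repA (REAlgebra R ρ) ρ (Algebra.TensorProduct.lid k U
        (Algebra.TensorProduct.map (Bialgebra.counitAlgHom k U) (AlgHom.id k U) w)) := by
    intro w
    induction w with
    | zero => simp
    | add x y hx hy => simp only [map_add, mul_add, hx, hy]
    | tmul x y => simp [diagScal_of_invariant R ρ ha]
  rw [e, R.counit_left, map_one, map_one, mul_one]

theorem isUInvariant_algebraMap (c : k) : IsUInvariant R ρ (algebraMap k _ c) := by
  intro x
  rw [blackAct_algebraMap, (isBialgHom_diag R).counit]

/-- A commutation rule of `K` with every element of 𝒦, in which R acts through the coproduct. For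
generators it is the reflection equation in the form `re_exchange`; the hexagons for R and R⁻¹ make
it pass to products. -/
theorem gen_mul_diagScal (a : REAlgebra R ρ) :
    REAlgebra.gen R ρ * ev2 (repA (REAlgebra R ρ) ρ).toLinearMap (diagScal R ρ a)
      (↑R.val⁻¹ : U ⊗[k] U) =
    ev2 (diagScal R ρ a) (repA (REAlgebra R ρ) ρ).toLinearMap (R.val : U ⊗[k] U) *
      REAlgebra.gen R ρ := by
  have hr : IsAlgHom (repA (REAlgebra R ρ) ρ).toLinearMap := isAlgHom_algHom _
  have hc : ∀ a, Comm (repA (REAlgebra R ρ) ρ).toLinearMap (diagScal R ρ a) :=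
    fun a x y => repA_scal ρ (AlgHom.id k _) x _
  induction a using REAlgebra.induction with
  | halg c =>
    rw [ev2_diagScal_inv R ρ (isUInvariant_algebraMap R ρ c),
      ev2_diagScal_val R ρ (isUInvariant_algebraMap R ρ c), AlgHom.commutes, Algebra.commutes]
  | hgen i j =>
    have h := ((leg1_mul_sandwich R ρ (REAlgebra.gen R ρ)).trans (re_exchange R ρ _
      (REAlgebra.relation R ρ))).trans (sandwich_mul_leg1 R ρ (REAlgebra.gen R ρ)).symm
    set X := REAlgebra.gen R ρ with hX
    have e0 : ∀ x, blackAct R ρ (X i j) (diag R x) = kMap R ρ X (diag R x) i j :=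
      fun x => blackAct_gen R ρ (diag R x) i j
    ext p q
    -- The first tensor factor carries the entry of `K` that is moved, the second the entry K_ij in
    -- the role of a.
    have h2 := congrFun (congrFun h (p, i)) (q, j)
    have e1 : ∀ w : U ⊗[k] U, (leg1 X * ev2 (repLeg1 (REAlgebra R ρ) ρ).toLinearMap
        ((leg2Hom k).toLinearMap ∘ₗ kMap R ρ X ∘ₗ (diag R).toLinearMap) w) (p, i) (q, j) =
        (X * ev2 (repA (REAlgebra R ρ) ρ).toLinearMap (diagScal R ρ (X i j)) w) p q := by
      intro w
      induction w with
      | zero => simp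
      | add x y hx hy => simp only [map_add, mul_add, Matrix.add_apply, hx, hy]
      | tmul x y =>
        rw [ev2_tmul, ev2_tmul, ← mul_assoc, ← mul_assoc]
        change (leg1 X * leg1 (repA _ ρ x) * leg2 (kMap R ρ X (diag R y)) :
          Matrix (n × n) (n × n) (REAlgebra R ρ)) (p, i) (q, j) =
          (X * repA _ ρ x * Matrix.scalar n (blackAct R ρ (X i j) (diag R y)) :
            Matrix n n (REAlgebra R ρ)) p q
        rw [← leg1_mul, leg_mul_apply, Matrix.scalar_apply, Matrix.mul_diagonal, e0]
    have e2 : ∀ w : U ⊗[k] U, (ev2 ((leg2Hom k).toLinearMap ∘ₗ kMap R ρ X ∘ₗ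
        (diag R).toLinearMap) (repLeg1 (REAlgebra R ρ) ρ).toLinearMap w * leg1 X) (p, i) (q, j) =
        (ev2 (diagScal R ρ (X i j)) (repA (REAlgebra R ρ) ρ).toLinearMap w * X) p q := by
      intro w
      induction w with
      | zero => simp
      | add x y hx hy => simp only [map_add, add_mul, Matrix.add_apply, hx, hy]
      | tmul x y =>
        rw [ev2_tmul, ev2_tmul, mul_assoc, mul_assoc]
        change (leg2 (kMap R ρ X (diag R x)) * (leg1 (repA _ ρ y) * leg1 X) :
          Matrix (n × n) (n × n) (REAlgebra R ρ)) (p, i) (q, j) =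
          (Matrix.scalar n (blackAct R ρ (X i j) (diag R x)) * (repA _ ρ y * X) :
            Matrix n n (REAlgebra R ρ)) p q
        rw [← leg1_mul, leg_mul_apply', Matrix.scalar_apply, Matrix.diagonal_mul, e0]
    rw [← e1, ← e2]
    exact h2
  | hmul a b ha hb =>
    rw [diagScal_mul, ev2_inv_conv R hr (hc a), ev2_conv_val R hr (hc b), ← mul_assoc, ha,
      mul_assoc, hb, mul_assoc]
  | hadd a b ha hb => 
    have e : diagScal R ρ (a + b) = diagScal R ρ a + diagScal R ρ b := by
      ext1 x; simp only [diagScal, map_add, LinearMap.comp_apply, LinearMap.add_apply]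
    have e1 : ∀ (f g : U →ₗ[k] Matrix n n (REAlgebra R ρ)) (w : U ⊗[k] U),
        ev2 (repA (REAlgebra R ρ) ρ).toLinearMap (f + g) w =
        ev2 (repA (REAlgebra R ρ) ρ).toLinearMap f w +
          ev2 (repA (REAlgebra R ρ) ρ).toLinearMap g w := by
      intro f g w
      induction w with
      | zero => simp
      | add x y hx hy => simp only [map_add, hx, hy]; abel
      | tmul x y => simp [mul_add]
    have e2 : ∀ (f g : U →ₗ[k] Matrix n n (REAlgebra R ρ)) (w : U ⊗[k] U),
        ev2 (f + g) (repA (REAlgebra R ρ) ρ).toLinearMap w =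
        ev2 f (repA (REAlgebra R ρ) ρ).toLinearMap w +
          ev2 g (repA (REAlgebra R ρ) ρ).toLinearMap w := by
      intro f g w
      induction w with
      | zero => simp
      | add x y hx hy => simp only [map_add, hx, hy]; abel
      | tmul x y => simp [add_mul]
    rw [e, e1, e2, mul_add, add_mul, ha, hb]

/-- On an invariant, the leg of R acting through the coproduct is a counit, so both R-matrices in
`gen_mul_diagScal` become 1. -/
theorem invariant_commute_gen {a : REAlgebra R ρ} (ha : IsUInvariant R ρ a) (i j : n) :
    REAlgebra.gen R ρ i j * a = a * REAlgebra.gen R ρ i j := by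
  have h := gen_mul_diagScal R ρ a
  rw [ev2_diagScal_inv R ρ ha, ev2_diagScal_val R ρ ha] at h
  have h2 : REAlgebra.gen R ρ * Matrix.scalar n a = Matrix.scalar n a * REAlgebra.gen R ρ := h
  have h3 := congrFun (congrFun h2 i) j
  rwa [Matrix.scalar_apply, Matrix.mul_diagonal, Matrix.diagonal_mul] at h3

/-- The invariants of the RE algebra are central. -/
theorem invariant_mem_center {a : REAlgebra R ρ} (ha : IsUInvariant R ρ a) :
    a ∈ Subalgebra.center k (REAlgebra R ρ) := by
  rw [Subalgebra.mem_center_iff]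
  intro b
  induction b using REAlgebra.induction with
  | halg c => exact Algebra.commutes c a
  | hgen i j => exact invariant_commute_gen R ρ ha i j
  | hmul b c hb hc => rw [mul_assoc, hc, ← mul_assoc, hb, mul_assoc]
  | hadd b c hb hc => rw [add_mul, mul_add, hb, hc]

theorem IsUInvariant.mul {a b : REAlgebra R ρ} (ha : IsUInvariant R ρ a)
    (hb : IsUInvariant R ρ b) : IsUInvariant R ρ (a * b) := by
  intro x
  have h := LinearMap.congr_fun (blackAct_mul_diag R ρ a b) x
  refine h.trans ?_
  have e : ∀ w : U ⊗[k] U, ev2 (blackAct R ρ a ∘ₗ (diag R).toLinearMap)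
      (blackAct R ρ b ∘ₗ (diag R).toLinearMap) w = Coalgebra.counit (R := k) (A := U)
      (TensorProduct.lid k U ((Coalgebra.counit (R := k)).rTensor U w)) • (a * b) := by
    intro w
    induction w with
    | zero => simp
    | add x y hx hy => simp only [map_add, add_smul, hx, hy]
    | tmul x y =>
      have h1 := ha x
      have h2 := hb y
      simp [h1, h2, smul_smul, mul_comm]
  rw [conv, LinearMap.comp_apply, e]
  simp

end CenterRE
end DynRE
end

noncomputable section
namespace DynRE

/-! ### Central elements of the dynamical RE algebra -/

section Center
set_option maxSynthPendingDepth 6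
variable {k H U L n : Type*} [Field k] [Ring H] [HopfAlgebra k H] [Ring U] [HopfAlgebra k U]
  [Ring L] [Algebra k L] {𝓛 : BaseAlgebra k H L} {ι : H →ₐc[k] U} (F : DynamicalTwist 𝓛 ι)
  [Fintype n] [DecidableEq n]
  (R : UniversalRMatrix k U) (ρ : U →ₐ[k] Matrix n n k)

/-- Legs that come from the coproduct of `U` act on an invariant by the counit. -/
theorem act2_square_left {a : REAlgebra R ρ} (ha : IsUInvariant R ρ a) (b : REAlgebra R ρ)
    (z : U ⊗[k] (U ⊗[k] L)) :
    act2 (blackAct R ρ) a b (Algebra.TensorProduct.map (diag R)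
      (Algebra.TensorProduct.map (diag R) (.id k L)) z) =
    (a ⊗ₜ 1) * act1 (blackAct R ρ) b (Algebra.TensorProduct.map (diag R) (.id k L)
      (Algebra.TensorProduct.lid k (U ⊗[k] L) (Algebra.TensorProduct.map
        (Bialgebra.counitAlgHom k U) (.id k (U ⊗[k] L)) z))) := by
  induction z using tensor3_induction with
  | h0 => simp
  | hadd x y hx hy => simp only [map_add, mul_add, hx, hy]
  | h x y m =>
    have h := ha x
    simp [act2_tmul, act1_tmul, h, TensorProduct.smul_tmul']

theorem act2_square_right {a : REAlgebra R ρ} (ha : IsUInvariant R ρ a) (b : REAlgebra R ρ)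
    (z : U ⊗[k] (U ⊗[k] L)) :
    act2 (blackAct R ρ) b a (Algebra.TensorProduct.map (diag R)
      (Algebra.TensorProduct.map (diag R) (.id k L)) z) =
    act1 (blackAct R ρ) b (Algebra.TensorProduct.map (diag R) (.id k L)
      (Algebra.TensorProduct.map (.id k U) ((Algebra.TensorProduct.lid k L).toAlgHom.comp
      (Algebra.TensorProduct.map (Bialgebra.counitAlgHom k U) (.id k L))) z)) * (a ⊗ₜ 1) := by
  induction z using tensor3_induction with
  | h0 => simp
  | hadd x y hx hy => simp only [map_add, add_mul, hx, hy]
  | h x y m =>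
    have h := ha y
    simp [act2_tmul, act1_tmul, h, TensorProduct.smul_tmul']

theorem squareCocycle_val : ((squareCocycle F R).val : TwistedSquare R ⊗[k] _) =
    Algebra.TensorProduct.map (diag R) (Algebra.TensorProduct.map (diag R) (.id k L))
      (F.val : U ⊗[k] (U ⊗[k] L)) := rfl

theorem square_tmul_left {a : REAlgebra R ρ} (ha : IsUInvariant R ρ a)
    (u : REAlgebra R ρ ⊗[k] L) :
    (squareCocycle F R).tmul (blackAct R ρ) (a ⊗ₜ 1) u = (a ⊗ₜ 1) * u := by
  induction u with
  | zero => simp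
  | add x y hx hy => simp only [map_add, mul_add, hx, hy]
  | tmul b m =>
    rw [DynCocycle.tmul_tmul, map_one, one_mul, ← act2_mul_inr, squareCocycle_val,
      act2_square_left R ρ ha, F.counit_left, map_one, Algebra.TensorProduct.one_def,
      act1_one (modAlg_blackAct R ρ)]
    simp

/-- The coaction of the left factor also enters through `diag`, so the invariant collapses it
together with the twist. -/
theorem square_tmul_right {a : REAlgebra R ρ} (ha : IsUInvariant R ρ a)
    (u : REAlgebra R ρ ⊗[k] L) :
    (squareCocycle F R).tmul (blackAct R ρ) u (a ⊗ₜ 1) = u * (a ⊗ₜ 1) := by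
  induction u with
  | zero => simp
  | add x y hx hy => simp only [map_add, LinearMap.add_apply, add_mul, hx, hy]
  | tmul b m =>
    have e : (1 : TwistedSquare R) ⊗ₜ[k] (coactB 𝓛 ι R m) =
        Algebra.TensorProduct.map (diag R) (Algebra.TensorProduct.map (diag R) (.id k L))
          (1 ⊗ₜ dCoact 𝓛 (ι : H →ₐ[k] U) m) := by
      simp
    have e2 : ((Algebra.TensorProduct.lid k L).toAlgHom.comp
      (Algebra.TensorProduct.map (Bialgebra.counitAlgHom k U) (.id k L)))
        (dCoact 𝓛 (ι : H →ₐ[k] U) m) = m := isCoaction_dCoact.counit m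
    rw [DynCocycle.tmul_tmul, ← Algebra.TensorProduct.one_def, mul_one, e, squareCocycle_val,
      ← map_mul (Algebra.TensorProduct.map (diag R)
        (Algebra.TensorProduct.map (diag R) (.id k L))), act2_square_right R ρ ha, map_mul
        (Algebra.TensorProduct.map (.id k U) _), F.counit_right, one_mul,
      Algebra.TensorProduct.map_tmul, e2, Algebra.TensorProduct.map_tmul, map_one, map_one,
      AlgHom.id_apply, act1_one (modAlg_blackAct R ρ)]

variable [InvertibleAntipode k U]

/-- In `U ⊗ U` one has x ⊗ 1 = (1 ⊗ γ̄(x₂)) Δ(x₁), and Δ(x₁) acts on an invariant by the counit.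
This is where the contraction y γ̄(x) in the formula for z(a) comes from. -/
theorem blackAct_toTwisted {a : REAlgebra R ρ} (ha : IsUInvariant R ρ a) (x y : U) :
    blackAct R ρ a (toTwisted R (x ⊗ₜ y)) = blackAct R ρ a (sqR R (y * antipodeInv k U x)) := by
  have e1 : conv (conv (lop (sqL R)) (rmul (sqR R))) (rop (sqR R)) = lop (sqL R) := by
    rw [conv_assoc, conv_rmul_rop (isAlgHom_sqR R), conv_eps]
  have e2 : ∀ p q : U, conv (lop (sqL R)) (rmul (sqR R)) p (sqR R q) = sqR R q * diag R p := by
    intro p q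
    have h := LinearMap.congr_fun (conv_sqL_sqR R) p
    change _ = _ * (diag R).toLinearMap p
    rw [← h]
    simp only [conv, LinearMap.comp_apply]
    induction Coalgebra.comul (R := k) p with
    | zero => simp
    | add x y hx hy => simp only [map_add, LinearMap.add_apply, mul_add, hx, hy]
    | tmul u v =>
      simp only [ev2_tmul, Module.End.mul_apply, lop_apply, rmul_apply]
      rw [(comm_sqL_sqR R u q).left_comm]
  have e3 : ∀ w : U ⊗[k] U, blackAct R ρ a (sqR R y * ev2 (conv (lop (sqL R)) (rmul (sqR R)))
      (rop (sqR R)) w 1) = blackAct R ρ a (sqR R (y * antipodeInv k U (TensorProduct.lid k U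
        ((Coalgebra.counit (R := k)).rTensor U w)))) := by
    intro w
    induction w with
    | zero => simp
    | add x y hx hy => simp only [map_add, LinearMap.add_apply, mul_add, hx, hy]
    | tmul p q =>
      have h := ha p
      rw [ev2_tmul, Module.End.mul_apply, rop_apply, one_mul, e2, ← mul_assoc,
        ← (isAlgHom_sqR R).map_mul, ← (modAlg_blackAct R ρ).act_act, h]
      simp
  have h := e3 (Coalgebra.comul (R := k) x)
  rw [Coalgebra.rTensor_counit_comul] at h
  have h2 := LinearMap.congr_fun (LinearMap.congr_fun e1 x) (1 : TwistedSquare R)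
  rw [lop_apply, mul_one] at h2
  rw [← sqL_mul_sqR, comm_sqL_sqR R x y, ← h2]
  refine h.trans ?_
  simp

theorem act1_assocB {a : REAlgebra R ρ} (ha : IsUInvariant R ρ a) (z : U ⊗[k] (U ⊗[k] L)) :
    act1 (blackAct R ρ) a (assocB L R z) = (harpoon R ρ a).rTensor L (contr k U L z) := by
  induction z using tensor3_induction with
  | h0 => simp
  | hadd x y hx hy => simp only [map_add, hx, hy]
  | h x y m =>
    have e : assocB L R (x ⊗ₜ (y ⊗ₜ m)) = toTwisted R (x ⊗ₜ y) ⊗ₜ m := rfl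
    rw [e, act1_tmul, blackAct_toTwisted R ρ ha, contr_tmul, LinearMap.rTensor_tmul]
    rfl

/-- Contracting w_{1|2} F̄ puts the coaction of w before ζ and γ̄ of its first leg after it. The
coaction commutes with ζ and then forms Γ̄(w). -/
theorem contr_coact_mul (w : U ⊗[k] L) :
    contr k U L (Algebra.TensorProduct.map (.id k U) (dCoact 𝓛 (ι : H →ₐ[k] U)) w *
      (↑F.val⁻¹ : U ⊗[k] (U ⊗[k] L))) = zeta F * gammaBar 𝓛 ι w := by
  rw [zeta_eq]
  induction w with
  | zero => simp
  | add x y hx hy => simp only [map_add, add_mul, mul_add, hx, hy]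
  | tmul u l =>
    have h := (zeta_comm_coact F.toCocycle isCoaction_dCoact l).eq
    have e : gammaBar 𝓛 ι (u ⊗ₜ l) =
        dCoact 𝓛 (ι : H →ₐ[k] U) l * (antipodeInv k U u ⊗ₜ 1) := rfl
    rw [e, ← mul_assoc, h, Algebra.TensorProduct.map_tmul, AlgHom.id_apply]
    change contr k U L (u ⊗ₜ _ * (↑F.val⁻¹ : U ⊗[k] (U ⊗[k] L))) =
      _ * contr k U L (↑F.val⁻¹ : U ⊗[k] (U ⊗[k] L)) * _
    generalize (↑F.val⁻¹ : U ⊗[k] (U ⊗[k] L)) = z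
    generalize dCoact 𝓛 (ι : H →ₐ[k] U) l = d
    induction z using tensor3_induction with
    | h0 => simp
    | hadd x y hx hy => simp only [map_add, add_mul, mul_add, hx, hy]
    | h x y m =>
      induction d with
      | zero => simp
      | add x y hx hy => simp only [TensorProduct.tmul_add, map_add, add_mul, hx, hy]
      | tmul p q => simp [contr_tmul, antipodeInv_mul, mul_assoc]

/-- Here ξ⁻¹ = (ζ⁻¹)_{1|2} F̄. Its action on an invariant is the contraction of its two legs,
computed by `contr_coact_mul`. -/
theorem centralElt_eq {a : REAlgebra R ρ} (ha : IsUInvariant R ρ a) : centralElt F R ρ a =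
    act1 (blackAct R ρ) a (↑(gaugeB F R)⁻¹ : TwistedSquare R ⊗[k] L) := by
  have e : (↑(gaugeB F R)⁻¹ : TwistedSquare R ⊗[k] L) = assocB L R
      (Algebra.TensorProduct.map (.id k U) (dCoact 𝓛 (ι : H →ₐ[k] U))
        (↑(F.toCocycle.zetaUnit isCoaction_dCoact)⁻¹ : U ⊗[k] L) *
      (↑F.val⁻¹ : U ⊗[k] (U ⊗[k] L))) := by
    rw [gaugeB, ← map_inv, mul_inv_rev, ← map_inv]
    rfl
  have e2 : Ring.inverse (zeta F) = (↑(F.toCocycle.zetaUnit isCoaction_dCoact)⁻¹ : U ⊗[k] L) :=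
    (congrArg Ring.inverse (zeta_eq F)).trans
      (Ring.inverse_unit (F.toCocycle.zetaUnit isCoaction_dCoact))
  rw [e, act1_assocB R ρ ha, contr_coact_mul, ← e2]
  rfl

theorem psi_centralElt {a : REAlgebra R ρ} (ha : IsUInvariant R ρ a) :
    psi (blackAct R ρ) (gaugeB F R : TwistedSquare R ⊗[k] L) (centralElt F R ρ a) = a ⊗ₜ 1 := by
  rw [centralElt_eq F R ρ ha, psi_act1 (modAlg_blackAct R ρ), Units.mul_inv,
    Algebra.TensorProduct.one_def, act1_one (modAlg_blackAct R ρ)]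

theorem psi_injective : Function.Injective
    (psi (blackAct R ρ) (gaugeB F R : TwistedSquare R ⊗[k] L)) := by
  refine Function.LeftInverse.injective
    (g := psi (blackAct R ρ) (↑(gaugeB F R)⁻¹ : TwistedSquare R ⊗[k] L)) fun u => ?_
  induction u with
  | zero => simp
  | add x y hx hy => simp only [map_add, hx, hy]
  | tmul a m =>
    rw [psi_tmul, psi_act1 (modAlg_blackAct R ρ), Units.inv_mul_cancel_left,
      act1_one (modAlg_blackAct R ρ)]

theorem psi_twistedMul (u v : REAlgebra R ρ ⊗[k] L) :
    psi (blackAct R ρ) (gaugeB F R : TwistedSquare R ⊗[k] L) (twistedMul F R ρ u v) =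
      (squareCocycle F R).tmul (blackAct R ρ)
        (psi (blackAct R ρ) (gaugeB F R : TwistedSquare R ⊗[k] L) u)
        (psi (blackAct R ρ) (gaugeB F R : TwistedSquare R ⊗[k] L) v) := by
  rw [twistedMul_eq]
  exact psi_gauge (squareCocycle F R) (modAlg_blackAct R ρ) (isCoaction_coactB R)
    (gaugeB_commute F R) (gaugeB_counit F R) u v

/-- Through `psi` the claim becomes commutation with `a ⊗ 1` in the plain tensor product, that is,
the centrality of `a` in 𝒦. -/
theorem centralElt_commute {a : REAlgebra R ρ} (ha : IsUInvariant R ρ a)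
    (u : REAlgebra R ρ ⊗[k] L) :
    twistedMul F R ρ u (centralElt F R ρ a) = twistedMul F R ρ (centralElt F R ρ a) u := by
  apply psi_injective F R ρ
  rw [psi_twistedMul, psi_twistedMul, psi_centralElt F R ρ ha, square_tmul_left F R ρ ha,
    square_tmul_right F R ρ ha]
  generalize psi (blackAct R ρ) (gaugeB F R : TwistedSquare R ⊗[k] L) u = v
  have h := Subalgebra.mem_center_iff.1 (invariant_mem_center R ρ ha)
  induction v with
  | zero => simp
  | add x y hx hy => simp only [add_mul, mul_add, hx, hy]
  | tmul b m => simp [h b]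

theorem centralElt_mul {a b : REAlgebra R ρ} (ha : IsUInvariant R ρ a)
    (hb : IsUInvariant R ρ b) : centralElt F R ρ (a * b) =
      twistedMul F R ρ (centralElt F R ρ a) (centralElt F R ρ b) := by
  apply psi_injective F R ρ
  rw [psi_twistedMul, psi_centralElt F R ρ ha, psi_centralElt F R ρ hb,
    square_tmul_left F R ρ ha, psi_centralElt F R ρ (ha.mul R ρ hb)]
  simp

/-- `psi` recovers `a ⊗ 1`, and over a field 𝒦 embeds into 𝒦 ⊗ L as soon as `L` is nonzero. -/
theorem centralElt_injective [Nontrivial L] {a b : REAlgebra R ρ} (ha : IsUInvariant R ρ a)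
    (hb : IsUInvariant R ρ b) (h : centralElt F R ρ a = centralElt F R ρ b) : a = b := by
  have h2 := congrArg (psi (blackAct R ρ) (gaugeB F R : TwistedSquare R ⊗[k] L)) h
  rw [psi_centralElt F R ρ ha, psi_centralElt F R ρ hb] at h2
  exact Algebra.TensorProduct.includeLeft_injective (S := k)
    (FaithfulSMul.algebraMap_injective k L) h2

theorem centralElt_one : centralElt F R ρ 1 = 1 ⊗ₜ 1 := by
  have h1 : IsUInvariant R ρ 1 := by
    have := isUInvariant_algebraMap R ρ (1 : k)
    rwa [map_one] at this
  have : actL (blackAct R ρ) L (1 : REAlgebra R ρ) = eps := by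
    rw [actL, (modAlg_blackAct R ρ).act_one]
    ext; simp [eps_apply, Algebra.TensorProduct.algebraMap_apply]
  apply psi_injective F R ρ
  have e : (gaugeB F R : TwistedSquare R ⊗[k] L) * ((1 : TwistedSquare R) ⊗ₜ[k] (1 : L)) =
      gaugeB F R := mul_one _
  rw [psi_centralElt F R ρ h1, psi_tmul, e, act1, this, ev2_eps, gaugeB_counit]
  rfl

end Center
end DynRE
end

/-! ### The theorem -/

open DynRE
theorem mainTheorem9 {k H U L n : Type*} [Field k] [CharZero k]
    [Ring H] [HopfAlgebra k H]
    (hH : Function.Bijective (HopfAlgebra.antipode k : H →ₗ[k] H))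
    [Ring U] [HopfAlgebra k U] [Ring L] [Algebra k L] [Nontrivial L]
    [Fintype n] [DecidableEq n]
    (𝓛 : BaseAlgebra k H L) (R : UniversalRMatrix k U)
    (ι : H →ₐc[k] U) (hι : Function.Injective ι)
    (F : DynamicalTwist 𝓛 ι) (ρ : U →ₐ[k] Matrix n n k) :
    (∀ a : REAlgebra R ρ, IsUInvariant R ρ a → a ∈ Subalgebra.center k (REAlgebra R ρ)) ∧
    ∃ φ : DREAlgebra F R ρ ≃ₗ[k] REAlgebra R ρ ⊗[k] L,
      (∀ i j, φ (DREAlgebra.gen F R ρ i j) = REAlgebra.gen R ρ i j ⊗ₜ[k] (1 : L)) ∧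
      (∀ l : L, φ (DREAlgebra.base F R ρ l) = (1 : REAlgebra R ρ) ⊗ₜ[k] l) ∧
      (∀ u v, φ (u * v) = twistedMul F R ρ (φ u) (φ v)) ∧
      (∀ a : REAlgebra R ρ, IsUInvariant R ρ a →
        φ.symm (centralElt F R ρ a) ∈ Subalgebra.center k (DREAlgebra F R ρ)) ∧
      (∀ a b : REAlgebra R ρ, IsUInvariant R ρ a → IsUInvariant R ρ b →
        centralElt F R ρ a = centralElt F R ρ b → a = b) ∧
      φ.symm (centralElt F R ρ 1) = 1 ∧
      (∀ a b : REAlgebra R ρ, IsUInvariant R ρ a → IsUInvariant R ρ b →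
        φ.symm (centralElt F R ρ (a * b)) =
          φ.symm (centralElt F R ρ a) * φ.symm (centralElt F R ρ b)) := by
  -- The inverse antipode of `U` used in ζ and Γ̄ exists because `U` is quasitriangular.
  have := R.invertibleAntipode
  refine ⟨fun a ha => invariant_mem_center R ρ ha, dreEquiv F R ρ, dreEquiv_gen F R ρ,
    dreEquiv_base F R ρ, dreEquiv_mul F R ρ, fun a ha => ?_,
    fun a b ha hb h => centralElt_injective F R ρ ha hb h, ?_, fun a b ha hb => ?_⟩
  · rw [Subalgebra.mem_center_iff]
    intro d
    have h := centralElt_commute F R ρ ha (dreEquiv F R ρ d)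
    have h2 := congrArg (dreEquiv F R ρ).symm h
    rwa [dreEquiv_symm_mul, dreEquiv_symm_mul, LinearEquiv.symm_apply_apply] at h2
  · have h := dreEquiv_base F R ρ (1 : L)
    have h1 : DREAlgebra.base F R ρ 1 = 1 := map_one (DREAlgebra.baseHom F R ρ)
    rw [centralElt_one, ← h, LinearEquiv.symm_apply_apply, h1]
  · rw [centralElt_mul F R ρ ha hb, dreEquiv_symm_mul]
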